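/- Let $(M,\mathcal F)$ be a foliated manifold, let $G$ be a compact connected Lie group with Lie algebra $\mathfrak g$, and let $\pi:(P,\mathcal F_P)\to(M,\mathcal F)$ be a principal $G$-bundle (right action) that is foliated: $\mathcal F_P$ is a $G$-invariant foliation of $P$ and $T\pi$ maps $\mathcal F_P|_p$ isomorphically onto $\mathcal F|_{\pi(p)}$ for every $p\in P$. Write $\mathfrak X(\mathcal F)$ for the vector fields tangent to $\mathcal F$, $\mathfrak X(M,\mathcal F)$ for the vector fields $V$ with $[V,\mathfrak X(\mathcal F)]\subset\mathfrak X(\mathcal F)$, and $l(M,\mathcal F)=\mathfrak X(M,\mathcal F)/\mathfrak X(\mathcal F)$ (similarly on $P$). Let $\mathfrak h$ be a finite-dimensional real Lie algebra and let $\mathfrak h\to l(M,\mathcal F)$, $Y\mapsto Y_M$, and $\mathfrak h\to l(P,\mathcal F_P)^G$, $Y\mapsto Y_P$, be Lie algebra morphisms with $\pi_*Y_P=Y_M$ (that is, $P$ is $\mathfrak h$-equivariant). A connection form $\omega\in\mathcal A^1(P,\mathfrak g)^G$ is called basic if $i(Z)\omega=i(Z)d\omega=0$ for all $Z\in\mathfrak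 X(\mathcal F_P)$, and $\mathfrak h$-invariant if $\mathcal L_{Y_P}\omega=0$ for all $Y\in\mathfrak h$. Suppose that $P$ has an $\mathfrak h$-invariant basic connection. Let $\rho:G\to GL(V)$ be a finite-dimensional real or complex representation and let $E=P\times_\rho V$ be the associated vector bundle, whose sections are the maps $f:P\to V$ with $f(pg)=\rho(g)^{-1}f(p)$. For an $\mathfrak h$-invariant basic connection $\omega$ with curvature $\Omega=d\omega+\frac12[\omega,\omega]$, let $\nabla^E=d+d\rho(\omega)$ be the induced connection on $E$, $R^E=(\nabla^E)^2$ and $\mu^E(Y)=\mathcal L^E_Y-\nabla^E_{Y_M}$, where $\mathcal L^E_Y$ is the derivative of equivariant maps $f$ along $Y_P$, the term $\nabla^E_{Y_M}f$ is $(\nabla^E f)(Y_P)$, and the same representative of $Y_P$ is used in both terms. Let $C^\infty_{\mathfrak h}(M,\mathcal F)$ be the space of smooth maps $\alpha$ from $\mathfrak h$ to the complex $\mathcal F$-basic forms on $M$ (the forms $\beta$ with $i(Z)\beta=i(Z)d\beta=0$ for all $Z\in\mathfrak X(\mathcal F)$) that are $\mathfrak h$-invariant, i.e. $\mathcal L_{X_M}(\alpha(Y))=\frac{d}{dt}\big|_{t=0}\alpha(Y+t[X,Y])$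 for all $X,Y\in\mathfrak h$. Put $(d_{\mathfrak h}\alpha)(Y)=d(\alpha(Y))-i(Y_M)\alpha(Y)$ and let $H^\infty_{\mathfrak h}(M,\mathcal F)$ be the cohomology of $(C^\infty_{\mathfrak h}(M,\mathcal F),d_{\mathfrak h})$, i.e. the quotient of the $d_{\mathfrak h}$-closed elements by those of the form $d_{\mathfrak h}\beta$ with $\beta\in C^\infty_{\mathfrak h}(M,\mathcal F)$. Then, for every $\mathfrak h$-invariant basic connection $\omega$ on $P$: 1. the equivariant curvature $R^E+\mu^E(Y)$ is a well-defined form on $M$ with values in $\mathrm{End}(E)$, and it is the form induced by $d\rho(\Omega-\omega(Y_P))$; 2. $\mathrm{Ch}_{\mathfrak h}(E,\nabla^E,Y)=\mathrm{Tr}\,\exp\big(-(R^E+\mu^E(Y))\big)$ is an element of $C^\infty_{\mathfrak h}(M,\mathcal F)$ and it is $d_{\mathfrak h}$-closed; 3. its class in $H^\infty_{\mathfrak h}(M,\mathcal F)$ does not depend on the choice of $\omega$. Hence there is a unique class in $H^\infty_{\mathfrak h}(M,\mathcal F)$ that is the class of $\mathrm{Ch}_{\mathfrak h}(E,\nabla^E,\cdot)$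 for every such $\omega$, the $\mathfrak h$-equivariant basic Chern character of $E$. -/

import Mathlib

open scoped Manifold ContDiff

noncomputable section

namespace BasicChern

instance : ENat.LEInfty (minSmoothness ℝ 2) := ⟨by
  simp only [minSmoothness_of_isRCLikeNormedField]; exact ENat.LEInfty.out⟩

instance : ENat.LEInfty (minSmoothness ℝ 3) := ⟨by
  simp only [minSmoothness_of_isRCLikeNormedField]; exact ENat.LEInfty.out⟩

/-! ### The Lie algebra of vector fields, foliations, basic fields -/

section VectorFields

variable (E : Type*) [NormedAddCommGroup E] [NormedSpace ℝ E]
  (M : Type*) [TopologicalSpace M] [ChartedSpace E M] [IsManifold 𝓘(ℝ, E) ∞ M]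

/-- The space `𝔛(M)` of smooth vector fields on the manifold `M` (modelled on `E`). -/
abbrev VF : Type _ := ContMDiffSection 𝓘(ℝ, E) E ∞ (fun x : M ↦ TangentSpace 𝓘(ℝ, E) x)

variable {E M}

/-- The value of a vector field at `x`, as an element of the model space `E` (in Mathlib the tangent
space at `x` is a copy of `E`). -/
abbrev VF.vec (X : VF E M) (x : M) : E := X x

theorem VF.mdiff (X : VF E M) (x : M) : MDifferentiableAt 𝓘(ℝ, E) 𝓘(ℝ, E).tangent
    (fun x ↦ (⟨x, X x⟩ : TangentBundle 𝓘(ℝ, E) M)) x :=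
  X.contMDiff.mdifferentiable (by simp) x

variable [FiniteDimensional ℝ E]

/-- The Lie bracket of vector fields. -/
instance : Bracket (VF E M) (VF E M) where
  bracket X Y := ⟨VectorField.mlieBracket 𝓘(ℝ, E) X Y,
    haveI : IsManifold 𝓘(ℝ, E) (((⊤ : ℕ∞) : WithTop ℕ∞) + 1) M := by simpa
    ContDiff.mlieBracket_vectorField (m := ⊤) (n := ⊤) X.contMDiff Y.contMDiff (by simp)⟩

theorem bracket_apply (X Y : VF E M) (x : M) :
    ⁅X, Y⁆ x = VectorField.mlieBracket 𝓘(ℝ, E) X Y x := rfl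

instance : LieRing (VF E M) where
  add_lie X Y Z := by
    ext x
    exact VectorField.mlieBracket_add_left (X.mdiff x) (Y.mdiff x)
  lie_add X Y Z := by
    ext x
    exact VectorField.mlieBracket_add_right (Y.mdiff x) (Z.mdiff x)
  lie_self X := by
    ext x
    simp [bracket_apply]
  leibniz_lie X Y Z := by
    have h : ∀ X : VF E M, ContMDiff 𝓘(ℝ, E) 𝓘(ℝ, E).tangent (minSmoothness ℝ 2)
        (fun x ↦ (⟨x, X x⟩ : TangentBundle 𝓘(ℝ, E) M)) := fun X ↦
      X.contMDiff.of_le ENat.LEInfty.out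
    ext x
    exact VectorField.leibniz_identity_mlieBracket_apply (h X x) (h Y x) (h Z x)

instance : LieAlgebra ℝ (VF E M) where
  lie_smul c X Y := by
    ext x
    exact VectorField.mlieBracket_const_smul_right (Y.mdiff x)

variable (E M) in
/-- A foliation of `M`: a smooth integrable distribution of constant rank. -/
structure Foliation where
  /-- the tangent space of the foliation at each point -/
  dist : ∀ x : M, Submodule ℝ (TangentSpace 𝓘(ℝ, E) x)
  /-- the dimension of the foliation -/
  rank : ℕ
  exists_frame : ∀ x₀ : M, ∃ U : Set M, IsOpen U ∧ x₀ ∈ U ∧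
    ∃ X : Fin rank → ∀ x : M, TangentSpace 𝓘(ℝ, E) x,
      (∀ i, ContMDiffOn 𝓘(ℝ, E) 𝓘(ℝ, E).tangent ∞
        (fun x ↦ (⟨x, X i x⟩ : TangentBundle 𝓘(ℝ, E) M)) U) ∧
      ∀ x ∈ U, LinearIndependent ℝ (fun i ↦ X i x) ∧
        Submodule.span ℝ (Set.range fun i ↦ X i x) = dist x
  involutive : ∀ X Y : VF E M, (∀ x, X x ∈ dist x) → (∀ x, Y x ∈ dist x) →
    ∀ x, ⁅X, Y⁆ x ∈ dist x

namespace Foliation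

variable (F : Foliation E M)

/-- `𝔛(F)`: the vector fields tangent to `F`. -/
def tangent : LieSubalgebra ℝ (VF E M) where
  carrier := {Z | ∀ x, Z x ∈ F.dist x}
  add_mem' hX hY x := (F.dist x).add_mem (hX x) (hY x)
  zero_mem' x := (F.dist x).zero_mem
  smul_mem' c _ hX x := (F.dist x).smul_mem c (hX x)
  lie_mem' {X Y} hX hY := F.involutive X Y hX hY

/-- `𝔛(M, F)`: the foliated vector fields, i.e. the normalizer of `𝔛(F)` in `𝔛(M)`. -/
def foliated : LieSubalgebra ℝ (VF E M) := F.tangent.normalizer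

theorem mem_foliated (V : VF E M) : V ∈ F.foliated ↔ ∀ Z ∈ F.tangent, ⁅Z, V⁆ ∈ F.tangent :=
  F.tangent.mem_normalizer_iff' V

/-- `𝔛(F)` as an ideal of `𝔛(M, F)`. -/
def tangentIdeal : LieIdeal ℝ F.foliated where
  carrier := {V | (V : VF E M) ∈ F.tangent}
  add_mem' hX hY := F.tangent.add_mem hX hY
  zero_mem' := F.tangent.zero_mem
  smul_mem' c _ hX := F.tangent.smul_mem c hX
  lie_mem {V _} hZ := LieSubalgebra.ideal_in_normalizer V.2 hZ

/-- The Lie algebra `l(M, F) = 𝔛(M, F) / 𝔛(F)` of basic vector fields. A foliated action of a Lie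
algebra `𝔥` on `(M, F)` is a Lie algebra morphism `𝔥 →ₗ⁅ℝ⁆ F.BasicField`. -/
abbrev BasicField : Type _ := F.foliated ⧸ F.tangentIdeal

/-- The vector field `V` is foliated and represents the basic field `v`. -/
def Represents (V : VF E M) (v : F.BasicField) : Prop :=
  ∃ hV : V ∈ F.foliated, (LieSubmodule.Quotient.mk ⟨V, hV⟩ : F.BasicField) = v

theorem exists_represents (v : F.BasicField) : ∃ V : VF E M, F.Represents V v := by
  obtain ⟨⟨V, hV⟩, h⟩ := LieSubmodule.Quotient.surjective_mk' _ v
  exact ⟨V, hV, h⟩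

/-- A choice of a representative of a basic field. -/
def rep (v : F.BasicField) : VF E M := (F.exists_represents v).choose

theorem rep_spec (v : F.BasicField) : F.Represents (F.rep v) v := (F.exists_represents v).choose_spec

end Foliation

end VectorFields

/-! ### Differential forms -/

section Forms

/-- The tangent map of `f` at `x`. (In Mathlib the tangent space at `x` of a manifold modelled on
`E` is a copy of `E`.) -/
abbrev tmap (E E' : Type*) {M M' : Type*} [NormedAddCommGroup E] [NormedSpace ℝ E]
    [TopologicalSpace M] [ChartedSpace E M] [NormedAddCommGroup E'] [NormedSpace ℝ E']
    [TopologicalSpace M'] [ChartedSpace E' M'] (f : M → M') (x : M) : E →L[ℝ] E' :=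
  mfderiv 𝓘(ℝ, E) 𝓘(ℝ, E') f x

variable (E : Type*) [NormedAddCommGroup E] [NormedSpace ℝ E]
  (M : Type*) [TopologicalSpace M] [ChartedSpace E M]
  (W : Type*) [NormedAddCommGroup W] [NormedSpace ℝ W]

/-- A `k`-form on `M` with values in `W` (smoothness is the separate predicate `Form.IsSmooth`):
at each point `x` an alternating `k`-linear map on the tangent space `T_x M`, a copy of `E`. -/
abbrev Form (k : ℕ) : Type _ := M → E [⋀^Fin k]→L[ℝ] W

variable {E M W} {k : ℕ}

namespace Form

/-- The expression of a form in the chart at `x₀` (its pullback by the inverse chart). -/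
def inChart (α : Form E M W k) (x₀ : M) (y : E) : E [⋀^Fin k]→L[ℝ] W :=
  (α ((extChartAt 𝓘(ℝ, E) x₀).symm y)).compContinuousLinearMap
    (tmap E E (extChartAt 𝓘(ℝ, E) x₀).symm y)

/-- Smoothness of a form. -/
def IsSmooth (α : Form E M W k) : Prop :=
  ∀ x₀ : M, ContDiffOn ℝ ∞ (α.inChart x₀) (extChartAt 𝓘(ℝ, E) x₀).target

/-- The exterior derivative: at `x`, it is the pullback by the chart at `x` of the exterior
derivative of the expression of the form in this chart. -/
def d (α : Form E M W k) : Form E M W (k + 1) := fun x ↦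
  (extDeriv (α.inChart x) (extChartAt 𝓘(ℝ, E) x x)).compContinuousLinearMap
    (tmap E E (extChartAt 𝓘(ℝ, E) x) x)

variable [IsManifold 𝓘(ℝ, E) ∞ M]

/-- The contraction `i(V)α`. -/
def contract (V : VF E M) (α : Form E M W (k + 1)) : Form E M W k := fun x ↦
  (α x).curryLeft (V x)

/-- The Lie derivative `L_V = d ∘ i(V) + i(V) ∘ d`. -/
def lieDeriv (V : VF E M) : {k : ℕ} → Form E M W k → Form E M W k
  | 0, α => contract V (d α)
  | _ + 1, α => d (contract V α) + contract V (d α)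

end Form

theorem Form.IsSmooth.diffAt {α : Form E M W k} (h : α.IsSmooth) (x : M) :
    DifferentiableAt ℝ (α.inChart x) (extChartAt 𝓘(ℝ, E) x x) :=
  ((h x).contDiffAt ((isOpen_extChartAt_target x).mem_nhds
    (mem_extChartAt_target x))).differentiableAt (by simp)

theorem Form.d_add {α β : Form E M W k} {x : M}
    (hα : DifferentiableAt ℝ (α.inChart x) (extChartAt 𝓘(ℝ, E) x x))
    (hβ : DifferentiableAt ℝ (β.inChart x) (extChartAt 𝓘(ℝ, E) x x)) :
    (α + β).d x = α.d x + β.d x := by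
  have h : (α + β).inChart x = α.inChart x + β.inChart x := by ext y v; rfl
  rw [Form.d, h, extDeriv_add hα hβ]
  rfl

theorem Form.d_smul {α : Form E M ℂ k} {x : M} (c : ℂ)
    (hα : DifferentiableAt ℝ (α.inChart x) (extChartAt 𝓘(ℝ, E) x x)) :
    (c • α).d x = c • α.d x := by
  have h : (c • α).inChart x = c • α.inChart x := by ext y v; rfl
  have h2 : extDeriv (c • α.inChart x) (extChartAt 𝓘(ℝ, E) x x)
      = c • extDeriv (α.inChart x) (extChartAt 𝓘(ℝ, E) x x) := by
    ext v
    simp only [extDeriv, fderiv_const_smul hα c, ContinuousAlternatingMap.alternatizeUncurryFin_apply,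
      ContinuousAlternatingMap.smul_apply, Finset.smul_sum]
    exact Finset.sum_congr rfl fun i _ ↦ smul_comm _ _ _
  rw [Form.d, h, h2]
  rfl

variable [FiniteDimensional ℝ E] [IsManifold 𝓘(ℝ, E) ∞ M]

theorem Form.diffAt_contract (V : VF E M) (α : Form E M W (k + 1)) (h : α.IsSmooth) (x : M) :
    DifferentiableAt ℝ ((α.contract V).inChart x) (extChartAt 𝓘(ℝ, E) x x) := by
  let U : E → E := VectorField.mpullbackWithin 𝓘(ℝ, E) 𝓘(ℝ, E) (extChartAt 𝓘(ℝ, E) x).symm V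
    (Set.range 𝓘(ℝ, E))
  have hx := (isOpen_extChartAt_target (I := 𝓘(ℝ, E)) x).mem_nhds (mem_extChartAt_target x)
  have hU : DifferentiableAt ℝ U (extChartAt 𝓘(ℝ, E) x x) := by
    have h1 := VectorField.contMDiffWithinAt_mpullbackWithin_extChartAt_symm (n := ∞) (m := ∞)
      (x := x) (V := V) (s := Set.univ) (V.contMDiff.contMDiffAt).contMDiffWithinAt
      uniqueMDiffOn_univ trivial (by simp)
    have h2 := contMDiffWithinAt_vectorSpace_iff_contDiffWithinAt.1 h1
    refine (h2.differentiableWithinAt (by simp)).differentiableAt ?_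
    simpa only [Set.preimage_univ, Set.inter_univ] using hx
  have hc : (α.contract V).inChart x =ᶠ[nhds (extChartAt 𝓘(ℝ, E) x x)]
      fun y ↦ (α.inChart x y).curryLeft (U y) := by
    filter_upwards [hx] with y hy
    have hV : tmap E E (extChartAt 𝓘(ℝ, E) x).symm y (U y)
        = V ((extChartAt 𝓘(ℝ, E) x).symm y) := by
      have := (isInvertible_mfderivWithin_extChartAt_symm (I := 𝓘(ℝ, E)) hy).self_apply_inverse
        (V ((extChartAt 𝓘(ℝ, E) x).symm y))
      simp only [ModelWithCorners.range_eq_univ, mfderivWithin_univ] at this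
      simp only [U, VectorField.mpullbackWithin_apply, ModelWithCorners.range_eq_univ,
        mfderivWithin_univ]
      exact this
    simp only [Form.inChart]
    rw [ContinuousAlternatingMap.curryLeft_compContinuousLinearMap, hV]
    rfl
  refine DifferentiableAt.congr_of_eventuallyEq ?_ hc
  have hL : DifferentiableAt ℝ (fun y ↦ (α.inChart x y).curryLeft) (extChartAt 𝓘(ℝ, E) x x) :=
    DifferentiableAt.fun_comp' (g := fun f : E [⋀^Fin (k + 1)]→L[ℝ] W ↦ f.curryLeft) _
      (ContinuousAlternatingMap.curryLeftLI (𝕜 := ℝ) (E := E) (F := W)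
        (n := k)).toContinuousLinearMap.differentiableAt (h.diffAt x)
  exact DifferentiableAt.clm_apply hL hU

theorem Form.lieDeriv_add (V : VF E M) {α β : Form E M W k} (hα : α.IsSmooth) (hβ : β.IsSmooth) :
    (α + β).lieDeriv V = α.lieDeriv V + β.lieDeriv V := by
  have h : ((α + β).d).contract V = α.d.contract V + β.d.contract V := by
    funext x
    change ((α + β).d x).curryLeft (V x) = _
    rw [Form.d_add (hα.diffAt x) (hβ.diffAt x)]
    rfl
  cases k with
  | zero => exact h
  | succ k =>
    have h2 : ((α + β).contract V).d = (α.contract V).d + (β.contract V).d := by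
      funext x
      exact Form.d_add (α.diffAt_contract V hα x) (β.diffAt_contract V hβ x)
    change ((α + β).contract V).d + ((α + β).d).contract V = _
    rw [h, h2]
    exact add_add_add_comm _ _ _ _

theorem Form.contract_smul (V : VF E M) (c : ℂ) (β : Form E M ℂ (k + 1)) :
    (c • β).contract V = c • β.contract V := by
  funext x
  ext v
  rfl

theorem Form.lieDeriv_smul (V : VF E M) {α : Form E M ℂ k} (c : ℂ) (hα : α.IsSmooth) :
    (c • α).lieDeriv V = c • α.lieDeriv V := by
  have h : (c • α).d = c • α.d := funext fun x ↦ Form.d_smul c (hα.diffAt x)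
  cases k with
  | zero =>
    simp only [Form.lieDeriv]
    rw [h, Form.contract_smul]
  | succ k =>
    have h2 : (c • α.contract V).d = c • (α.contract V).d :=
      funext fun x ↦ Form.d_smul c (α.diffAt_contract V hα x)
    simp only [Form.lieDeriv]
    rw [h, Form.contract_smul, Form.contract_smul, h2, smul_add]

end Forms

/-! ### Equivariant basic forms and equivariant basic cohomology -/

section Equivariant

variable (E : Type*) [NormedAddCommGroup E] [NormedSpace ℝ E]
  (M : Type*) [TopologicalSpace M] [ChartedSpace E M]

/-- Complex differential forms of mixed degree. -/
abbrev Mixed : Type _ := ∀ k : ℕ, Form E M ℂ k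

variable {E M}

/-- The exterior derivative of a form of mixed degree. -/
def Mixed.d (α : Mixed E M) : Mixed E M
  | 0 => 0
  | k + 1 => (α k).d

variable [IsManifold 𝓘(ℝ, E) ∞ M]

/-- The contraction of a form of mixed degree. -/
def Mixed.contract (V : VF E M) (α : Mixed E M) : Mixed E M := fun k ↦ (α (k + 1)).contract V

variable (E M) in
/-- Families of forms of mixed degree on `M` parametrized by `h`. -/
def Family (h : Type*) : Type _ := h → Mixed E M

instance (h : Type*) : AddCommGroup (Family E M h) := inferInstanceAs (AddCommGroup (h → Mixed E M))

instance (h : Type*) : Module ℂ (Family E M h) := inferInstanceAs (Module ℂ (h → Mixed E M))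

variable {h : Type*} [LieRing h] [LieAlgebra ℝ h] [FiniteDimensional ℝ h]

/-- Smoothness of a map from the finite dimensional Lie algebra `h` to the forms on `M`: joint
smoothness in the linear coordinates of `h` and the coordinates of `M`. -/
def IsSmoothFamily (α : Family E M h) : Prop :=
  ∀ (k : ℕ) (x₀ : M), ContDiffOn ℝ ∞
    (fun q : (Fin (Module.finrank ℝ h) → ℝ) × E ↦
      (α ((Module.finBasis ℝ h).equivFun.symm q.1) k).inChart x₀ q.2)
    (Set.univ ×ˢ (extChartAt 𝓘(ℝ, E) x₀).target)

theorem IsSmoothFamily.isSmooth {α : h → Mixed E M} (hα : IsSmoothFamily α) (Y : h) (k : ℕ) :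
    (α Y k).IsSmooth := fun x₀ ↦ by
  have := (hα k x₀).comp (g := _) (f := fun y : E ↦ ((Module.finBasis ℝ h).equivFun Y, y))
    (s := (extChartAt 𝓘(ℝ, E) x₀).target) (by fun_prop) (fun y hy ↦ ⟨trivial, hy⟩)
  simpa [Function.comp_def] using this

theorem IsSmoothFamily.differentiableAt {α : h → Mixed E M} (hα : IsSmoothFamily α)
    (X Y : h) (k : ℕ) (x : M) (v : Fin k → E) :
    DifferentiableAt ℝ (fun t : ℝ ↦ α (Y + t • X) k x v) 0 := by
  let b := (Module.finBasis ℝ h).equivFun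
  have h1 : DifferentiableAt ℝ (fun q : (Fin (Module.finrank ℝ h) → ℝ) × E ↦
      (α ((Module.finBasis ℝ h).equivFun.symm q.1) k).inChart x q.2)
      (b Y, extChartAt 𝓘(ℝ, E) x x) :=
    ((hα k x).contDiffAt (prod_mem_nhds Filter.univ_mem
      ((isOpen_extChartAt_target x).mem_nhds (mem_extChartAt_target x)))).differentiableAt (by simp)
  have h2 : DifferentiableAt ℝ (fun t : ℝ ↦ (b Y + t • b X, extChartAt 𝓘(ℝ, E) x x)) 0 := by
    fun_prop
  have h3 : DifferentiableAt ℝ (fun t : ℝ ↦ (α (Y + t • X) k).inChart x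
      (extChartAt 𝓘(ℝ, E) x x)) 0 := by
    have := DifferentiableAt.comp (0 : ℝ) (g := fun q : (Fin (Module.finrank ℝ h) → ℝ) × E ↦
      (α ((Module.finBasis ℝ h).equivFun.symm q.1) k).inChart x q.2) (by simpa only [zero_smul, add_zero] using h1) h2
    have hb : ∀ t : ℝ, b.symm (b Y + t • b X) = Y + t • X := fun t ↦ by
      rw [← map_smul, ← map_add, b.symm_apply_apply]
    simpa only [Function.comp_def, hb, b] using this
  let w : Fin k → E := fun i ↦ tmap E E (extChartAt 𝓘(ℝ, E) x) x (v i)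
  have h4 : ∀ β : Form E M ℂ k, β x v = β.inChart x (extChartAt 𝓘(ℝ, E) x x) w := fun β ↦ by
    have : ∀ u : E, tmap E E (extChartAt 𝓘(ℝ, E) x).symm (extChartAt 𝓘(ℝ, E) x x)
        (tmap E E (extChartAt 𝓘(ℝ, E) x) x u) = u := fun u ↦ by
      have h := mfderivWithin_extChartAt_symm_comp_mfderiv_extChartAt (I := 𝓘(ℝ, E))
        (mem_extChartAt_target x)
      simp only [ModelWithCorners.range_eq_univ, mfderivWithin_univ] at h
      have : tmap E E (extChartAt 𝓘(ℝ, E) x).symm (extChartAt 𝓘(ℝ, E) x x)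
        (tmap E E (extChartAt 𝓘(ℝ, E) x)
          ((extChartAt 𝓘(ℝ, E) x).symm (extChartAt 𝓘(ℝ, E) x x)) u) = u := DFunLike.congr_fun h u
      rwa [extChartAt_to_inv] at this
    simp only [Form.inChart, ContinuousAlternatingMap.compContinuousLinearMap_apply, w,
      Function.comp_def, this, extChartAt_to_inv]
  simp only [h4]
  exact ((ContinuousAlternatingMap.apply ℝ E ℂ w).differentiableAt).comp _ h3

variable [FiniteDimensional ℝ E] (F : Foliation E M) (a : h →ₗ⁅ℝ⁆ F.BasicField)

/-- A form of mixed degree is `F`-basic when `i(Z)α = i(Z)dα = 0` for all `Z ∈ 𝔛(F)`. -/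
def IsBasic (α : Mixed E M) : Prop :=
  ∀ Z ∈ F.tangent, α.contract Z = 0 ∧ α.d.contract Z = 0

/-- Invariance of a smooth map `α` from `h` to the basic forms under the action of `h`, i.e.
`L_{X_M}(α(Y)) = d/dt|_{t = 0} α(Y + t[X, Y])` for all `X, Y`. (On basic forms the Lie derivative
does not depend on the vector field that represents `X_M`.) -/
def IsInvariant (α : Family E M h) : Prop :=
  ∀ (X Y : h) (V : VF E M), F.Represents V (a X) → ∀ (k : ℕ) (x : M) (v : Fin k → E),
    (α Y k).lieDeriv V x v = deriv (fun t : ℝ ↦ α (Y + t • ⁅X, Y⁆) k x v) 0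

theorem Mixed.d_add {α β : Mixed E M} (hα : ∀ k, (α k).IsSmooth) (hβ : ∀ k, (β k).IsSmooth) :
    (α + β).d = α.d + β.d := by
  funext k x
  cases k with
  | zero => exact (add_zero (0 : E [⋀^Fin 0]→L[ℝ] ℂ)).symm
  | succ k => exact Form.d_add ((hα k).diffAt x) ((hβ k).diffAt x)

theorem Mixed.d_smul {α : Mixed E M} (c : ℂ) (hα : ∀ k, (α k).IsSmooth) :
    (c • α).d = c • α.d := by
  funext k x
  cases k with
  | zero => exact (smul_zero (A := E [⋀^Fin 0]→L[ℝ] ℂ) c).symm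
  | succ k => exact Form.d_smul c ((hα k).diffAt x)

/-- The space `C^∞_h(M, F)` of `h`-equivariant `F`-basic forms: the `h`-invariant smooth maps from
`h` to the algebra of complex `F`-basic forms. -/
def EquivForms : Submodule ℂ (Family E M h) where
  carrier := {α | IsSmoothFamily α ∧ (∀ Y, IsBasic F (α Y)) ∧ IsInvariant F a α}
  zero_mem' := by
    have hz : ∀ k : ℕ, (0 : Form E M ℂ k).IsSmooth := fun k x₀ ↦ contDiffOn_const (c := 0)
    have hd : ∀ k : ℕ, (0 : Form E M ℂ k).d = 0 := fun k ↦ by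
      funext x
      simpa using Form.d_smul (α := (0 : Form E M ℂ k)) (x := x) 0 ((hz k).diffAt x)
    refine ⟨fun k x₀ ↦ contDiffOn_const (c := 0), fun Y Z _ ↦ ⟨rfl, ?_⟩, fun X Y V _ k x v ↦ ?_⟩
    · funext k x
      change ((0 : Form E M ℂ k).d x).curryLeft (Z x) = 0
      rw [hd]
      rfl
    · have := Form.lieDeriv_smul V (α := (0 : Form E M ℂ k)) 0 (hz k)
      rw [zero_smul ℂ (0 : Form E M ℂ k), zero_smul ℂ ((0 : Form E M ℂ k).lieDeriv V)] at this
      change (0 : Form E M ℂ k).lieDeriv V x v = deriv (fun _ : ℝ ↦ (0 : ℂ)) 0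
      rw [this, deriv_const]
      rfl
  add_mem' {α β} hα hβ := by
    refine ⟨fun k x₀ ↦ (hα.1 k x₀).add (hβ.1 k x₀), fun Y Z hZ ↦ ⟨?_, ?_⟩, fun X Y V hV k x v ↦ ?_⟩
    · have h1 := (hα.2.1 Y Z hZ).1
      have h2 := (hβ.2.1 Y Z hZ).1
      change (α Y).contract Z + (β Y).contract Z = 0
      rw [h1, h2, add_zero]
    · have h1 := (hα.2.1 Y Z hZ).2
      have h2 := (hβ.2.1 Y Z hZ).2
      change (α Y + β Y).d.contract Z = 0
      rw [Mixed.d_add (hα.1.isSmooth Y) (hβ.1.isSmooth Y)]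
      change (α Y).d.contract Z + (β Y).d.contract Z = 0
      rw [h1, h2, add_zero]
    · have h1 := hα.2.2 X Y V hV k x v
      have h2 := hβ.2.2 X Y V hV k x v
      have h3 := Form.lieDeriv_add V (hα.1.isSmooth Y k) (hβ.1.isSmooth Y k)
      have h4 := deriv_add (hα.1.differentiableAt ⁅X, Y⁆ Y k x v)
        (hβ.1.differentiableAt ⁅X, Y⁆ Y k x v)
      change (α Y k + β Y k).lieDeriv V x v = _
      rw [h3]
      exact (congrArg₂ (· + ·) h1 h2).trans h4.symm
  smul_mem' c {α} hα := by
    refine ⟨fun k x₀ ↦ (hα.1 k x₀).const_smul c, fun Y Z hZ ↦ ⟨?_, ?_⟩, fun X Y V hV k x v ↦ ?_⟩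
    · have h1 := (hα.2.1 Y Z hZ).1
      change c • (α Y).contract Z = 0
      rw [h1, smul_zero]
    · have h1 := (hα.2.1 Y Z hZ).2
      change (c • α Y).d.contract Z = 0
      rw [Mixed.d_smul c (hα.1.isSmooth Y)]
      change c • (α Y).d.contract Z = 0
      rw [h1, smul_zero]
    · have h1 := hα.2.2 X Y V hV k x v
      have h3 := Form.lieDeriv_smul V c (hα.1.isSmooth Y k)
      have h4 := deriv_const_smul c (hα.1.differentiableAt ⁅X, Y⁆ Y k x v)
      change (c • α Y k).lieDeriv V x v = _
      rw [h3]
      exact (congrArg (c • ·) h1).trans h4.symm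

/-- The equivariant differential `(d_h α)(Y) = d(α(Y)) - i(Y_M)(α(Y))`. (On basic forms the
contraction does not depend on the vector field that represents `Y_M`.) -/
def equivD : EquivForms F a →ₗ[ℂ] (Family E M h) where
  toFun α Y := (α.1 Y).d - (α.1 Y).contract (F.rep (a Y))
  map_add' α β := by
    funext Y
    have := Mixed.d_add (α.2.1.isSmooth Y) (β.2.1.isSmooth Y)
    change (α.1 Y + β.1 Y).d - ((α.1 Y).contract _ + (β.1 Y).contract _) = _
    rw [this, add_sub_add_comm]
    rfl
  map_smul' c α := by
    funext Y
    have := Mixed.d_smul c (α.2.1.isSmooth Y)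
    change (c • α.1 Y).d - c • (α.1 Y).contract _ = _
    rw [this, ← smul_sub]
    rfl

/-- The `d_h`-closed equivariant basic forms. -/
abbrev Cocycles : Submodule ℂ (EquivForms F a) := LinearMap.ker (equivD F a)

/-- The equivariant basic forms that are the differential of an equivariant basic form. -/
abbrev Coboundaries : Submodule ℂ (EquivForms F a) :=
  (LinearMap.range (equivD F a)).comap (EquivForms F a).subtype

/-- The equivariant basic cohomology `H^∞_h(M, F)`, the cohomology of `(C^∞_h(M, F), d_h)`. -/
abbrev Cohomology : Type _ :=
  Cocycles F a ⧸ (Coboundaries F a).comap (Cocycles F a).subtype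

end Equivariant

/-! ### Exterior algebra at a point -/

section Wedge

variable {T A B C : Type*} [AddCommGroup T] [Module ℝ T] [AddCommGroup A] [Module ℝ A]
  [AddCommGroup B] [Module ℝ B] [AddCommGroup C] [Module ℝ C]

/-- The exterior product of two vector valued alternating forms, with respect to a bilinear map `b`
between the spaces of values (sum over the shuffles). -/
def wedge {p q : ℕ} (b : A →ₗ[ℝ] B →ₗ[ℝ] C) (α : T [⋀^Fin p]→ₗ[ℝ] A) (β : T [⋀^Fin q]→ₗ[ℝ] B) :
    T [⋀^Fin (p + q)]→ₗ[ℝ] C :=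
  ((TensorProduct.lift b).compAlternatingMap (α.domCoprod β)).domDomCongr finSumFinEquiv

variable (T) in
/-- The alternating forms of mixed degree on `T` with values in `R`, i.e. `Λ T^* ⊗ R`. -/
abbrev AltForms (R : Type*) [Ring R] [Algebra ℝ R] : Type _ := ∀ k : ℕ, T [⋀^Fin k]→ₗ[ℝ] R

variable {R : Type*} [Ring R] [Algebra ℝ R]

/-- The product of the graded algebra `Λ T^* ⊗ R`. -/
def AltForms.mul (α β : AltForms T R) : AltForms T R := fun k ↦
  ∑ q ∈ (Finset.HasAntidiagonal.antidiagonal k).attach,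
    (wedge (LinearMap.mul ℝ R) (α q.1.1) (β q.1.2)).domDomCongr
      (finCongr (Finset.HasAntidiagonal.mem_antidiagonal.1 q.2))

/-- The unit of the algebra `Λ T^* ⊗ R`. -/
def AltForms.one : AltForms T R
  | 0 => AlternatingMap.constOfIsEmpty ℝ T (Fin 0) 1
  | _ + 1 => 0

/-- The powers in the algebra `Λ T^* ⊗ R`. -/
def AltForms.pow (α : AltForms T R) : ℕ → AltForms T R
  | 0 => AltForms.one
  | n + 1 => AltForms.mul (AltForms.pow α n) α

end Wedge

section Continuity

variable {E W : Type*} [NormedAddCommGroup E] [NormedSpace ℝ E] [FiniteDimensional ℝ E]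
  [NormedAddCommGroup W] [NormedSpace ℝ W]

theorem continuous_alternating {ι : Type*} [Fintype ι] (f : E [⋀^ι]→ₗ[ℝ] W) : Continuous f := by
  let b := Module.finBasis ℝ E
  have h : (f : (ι → E) → W) = fun v ↦ f fun i ↦ ∑ j, b.repr (v i) j • b j := by
    funext v
    conv_lhs => rw [← funext fun i ↦ b.sum_repr (v i)]
  rw [h]
  classical
  simp only [← AlternatingMap.coe_multilinearMap, MultilinearMap.map_sum]
  simp only [MultilinearMap.map_smul_univ]
  refine continuous_finsetSum _ fun r _ ↦ Continuous.smul (continuous_finsetProd _ fun i _ ↦ ?_)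
    continuous_const
  exact (LinearMap.continuous_of_finiteDimensional (b.coord (r i))).comp (continuous_apply i)

/-- On a finite dimensional space alternating forms are continuous. -/
def toCont {k : ℕ} (f : E [⋀^Fin k]→ₗ[ℝ] W) : E [⋀^Fin k]→L[ℝ] W :=
  { f with cont := continuous_alternating f }

/-- The component of degree `k` of `t(exp(-α))`, for an element `α` of the algebra `Λ T^* ⊗ R` and a
linear form `t` on `R` (the trace in the applications). The exponential is given by its power
series. -/
def AltForms.expTrace {R : Type*} [Ring R] [Algebra ℝ R] (t : R →ₗ[ℝ] ℂ) (α : AltForms E R)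
    (k : ℕ) : E [⋀^Fin k]→L[ℝ] ℂ :=
  ∑' n : ℕ, ((-1) ^ n / (n.factorial : ℝ)) • toCont (t.compAlternatingMap (α.pow n k))

end Continuity

/-! ### Principal bundles, connections -/

section Principal

variable (EM : Type*) [NormedAddCommGroup EM] [NormedSpace ℝ EM]
  (M : Type*) [TopologicalSpace M] [ChartedSpace EM M]
  (EP : Type*) [NormedAddCommGroup EP] [NormedSpace ℝ EP]
  (P : Type*) [TopologicalSpace P] [ChartedSpace EP P]
  (EG : Type*) [NormedAddCommGroup EG] [NormedSpace ℝ EG]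
  (G : Type*) [TopologicalSpace G] [ChartedSpace EG G] [Group G]

/-- A smooth principal bundle `P → M` with structure group `G` acting on the right. -/
structure PrincipalBundle where
  /-- the projection -/
  proj : P → M
  /-- the right action `p g` of the structure group -/
  act : P → G → P
  smooth_proj : ContMDiff 𝓘(ℝ, EP) 𝓘(ℝ, EM) ∞ proj
  smooth_act : ContMDiff (𝓘(ℝ, EP).prod 𝓘(ℝ, EG)) 𝓘(ℝ, EP) ∞ (fun q : P × G ↦ act q.1 q.2)
  act_one : ∀ p, act p 1 = p
  act_mul : ∀ p g g', act p (g * g') = act (act p g) g'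
  proj_act : ∀ p g, proj (act p g) = proj p
  /-- Local triviality: over an open neighbourhood `U` of each point there are a smooth section `σ`
  and a smooth map `φ` such that `(x, g) ↦ σ(x) g` and `p ↦ (proj p, φ(p))` are inverse to each
  other. -/
  locally_trivial : ∀ m : M, ∃ U : Set M, IsOpen U ∧ m ∈ U ∧ ∃ (σ : M → P) (φ : P → G),
    ContMDiffOn 𝓘(ℝ, EM) 𝓘(ℝ, EP) ∞ σ U ∧
    ContMDiffOn 𝓘(ℝ, EP) 𝓘(ℝ, EG) ∞ φ (proj ⁻¹' U) ∧
    (∀ x ∈ U, proj (σ x) = x ∧ ∀ g, φ (act (σ x) g) = g) ∧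
    ∀ p ∈ proj ⁻¹' U, act (σ (proj p)) (φ p) = p

variable {EM M EP P EG G}

namespace PrincipalBundle

variable (B : PrincipalBundle EM M EP P EG G)

theorem proj_surjective : Function.Surjective B.proj := fun m ↦ by
  obtain ⟨U, -, hm, σ, φ, -, -, h, -⟩ := B.locally_trivial m
  exact ⟨σ m, (h m hm).1⟩

theorem exists_act_eq {p q : P} (h : B.proj p = B.proj q) : ∃ g, B.act p g = q := by
  obtain ⟨U, -, hm, σ, φ, -, -, -, h2⟩ := B.locally_trivial (B.proj p)
  have hp := h2 p hm
  have hq := h2 q (show B.proj q ∈ U from h ▸ hm)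
  rw [← h] at hq
  refine ⟨(φ p)⁻¹ * φ q, ?_⟩
  calc B.act p ((φ p)⁻¹ * φ q)
      = B.act (B.act (σ (B.proj p)) (φ p)) ((φ p)⁻¹ * φ q) := by rw [hp]
    _ = q := by rw [← B.act_mul, mul_inv_cancel_left, hq]

theorem act_injective (p : P) : Function.Injective (B.act p) := fun g g' h ↦ by
  obtain ⟨U, -, hm, σ, φ, -, -, h1, h2⟩ := B.locally_trivial (B.proj p)
  have hp := h2 p hm
  rw [← hp, ← B.act_mul, ← B.act_mul] at h
  have := congrArg φ h
  rw [(h1 _ hm).2, (h1 _ hm).2] at this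
  exact mul_left_cancel this

/-- The value at `p` of the fundamental vector field `X_P`: the derivative at `t = 0` of
`p exp(tX)`. -/
def fundamental (p : P) (X : EG) : EP := tmap EG EP (fun g : G ↦ B.act p g) 1 X

end PrincipalBundle

variable (EG G) in
/-- The adjoint action of `g⁻¹` on the Lie algebra of `G`. -/
def adInv (g : G) : EG →L[ℝ] EG := tmap EG EG (fun x : G ↦ g⁻¹ * x * g) 1

/-- A connection form on a principal bundle: a smooth `G`-equivariant `1`-form `ω` on `P`, with
values in the Lie algebra of `G` (the tangent space of `G` at `1`), with `ω(X_P) = X`. -/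
structure Connection (B : PrincipalBundle EM M EP P EG G) where
  /-- the connection form -/
  form : Form EP P EG 1
  smooth : form.IsSmooth
  fundamental : ∀ p X, form p (fun _ ↦ B.fundamental p X) = X
  equivariant : ∀ p g v,
    form (B.act p g) (fun _ ↦ tmap EP EP (fun p' ↦ B.act p' g) p v) =
      adInv EG G g (form p (fun _ ↦ v))

section Curvature

variable [FiniteDimensional ℝ EG] [LieGroup 𝓘(ℝ, EG) ∞ G]

variable (EG G) in
/-- The bracket of the Lie algebra of `G`. -/
def lieBracket : EG →ₗ[ℝ] EG →ₗ[ℝ] EG :=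
  let b : GroupLieAlgebra 𝓘(ℝ, EG) G →ₗ[ℝ] GroupLieAlgebra 𝓘(ℝ, EG) G →ₗ[ℝ]
      GroupLieAlgebra 𝓘(ℝ, EG) G :=
    LinearMap.mk₂ ℝ (fun X X' ↦ ⁅X, X'⁆) add_lie smul_lie lie_add (fun c X X' ↦ lie_smul c X X')
  b

/-- The curvature `Ω = dω + ½[ω, ω]`. -/
def Connection.curvature {B : PrincipalBundle EM M EP P EG G} (θ : Connection B) (p : P) :
    EP [⋀^Fin 2]→ₗ[ℝ] EG :=
  (θ.form.d p).toAlternatingMap + (1 / 2 : ℝ) •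
    wedge (lieBracket EG G) (θ.form p).toAlternatingMap (θ.form p).toAlternatingMap

end Curvature

/-- The horizontal lift of tangent vectors to the point `p`: the inverse of `(Tπ, ω)` on
`T_{π(p)}M ⊕ 0`. -/
def Connection.horLift {B : PrincipalBundle EM M EP P EG G} (θ : Connection B) (p : P) :
    EM →L[ℝ] EP :=
  (((tmap EP EM B.proj p).prod
    ((ContinuousAlternatingMap.ofSubsingleton ℝ EP EG (0 : Fin 1)).symm (θ.form p))).inverse).comp
    (ContinuousLinearMap.inl ℝ EM EG)

/-! ### Foliated and equivariant principal bundles -/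

section Foliated

variable [FiniteDimensional ℝ EM] [IsManifold 𝓘(ℝ, EM) ∞ M]
  [FiniteDimensional ℝ EP] [IsManifold 𝓘(ℝ, EP) ∞ P]

/-- `(P, F_P) → (M, F)` is a foliated principal bundle: the foliation `F_P` of `P` is `G`-invariant
and the projection induces an isomorphism of `F_P` at `p` onto `F` at the image of `p`. -/
structure IsFoliatedBundle (B : PrincipalBundle EM M EP P EG G) (F : Foliation EM M)
    (FP : Foliation EP P) : Prop where
  invariant : ∀ p g, ∀ v ∈ FP.dist p, tmap EP EP (fun p' ↦ B.act p' g) p v ∈ FP.dist (B.act p g)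
  bijOn : ∀ p, Set.BijOn (tmap EP EM B.proj p)
    (FP.dist p : Set (TangentSpace 𝓘(ℝ, EP) p))
    (F.dist (B.proj p) : Set (TangentSpace 𝓘(ℝ, EM) (B.proj p)))

variable {h : Type*} [LieRing h] [LieAlgebra ℝ h]

/-- The foliated principal bundle `(P, F_P) → (M, F)` is `h`-equivariant with respect to the foliated
actions `aM` of `h` on `M` and `aP` of `h` on `P`: the basic fields `Y_P` of `P` are `G`-invariant
and `Y_P` projects to `Y_M`. -/
structure IsEquivariantBundle (B : PrincipalBundle EM M EP P EG G) (F : Foliation EM M)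
    (FP : Foliation EP P) (aM : h →ₗ⁅ℝ⁆ F.BasicField) (aP : h →ₗ⁅ℝ⁆ FP.BasicField) : Prop where
  invariant : ∀ (Y : h) (V : VF EP P), FP.Represents V (aP Y) → ∀ p g,
    tmap EP EP (fun p' ↦ B.act p' g) p (V.vec p) - V.vec (B.act p g) ∈ FP.dist (B.act p g)
  proj : ∀ (Y : h) (V : VF EP P) (W : VF EM M), FP.Represents V (aP Y) → F.Represents W (aM Y) →
    ∀ p, tmap EP EM B.proj p (V.vec p) - W.vec (B.proj p) ∈ F.dist (B.proj p)

/-- An `h`-invariant `F_P`-basic connection. -/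
structure InvariantBasicConnection (B : PrincipalBundle EM M EP P EG G) (FP : Foliation EP P)
    (aP : h →ₗ⁅ℝ⁆ FP.BasicField) extends Connection B where
  basic : ∀ Z ∈ FP.tangent, form.contract Z = 0 ∧ form.d.contract Z = 0
  invariant : ∀ (Y : h) (V : VF EP P), FP.Represents V (aP Y) → form.lieDeriv V = 0

end Foliated

/-! ### The associated vector bundle, its equivariant curvature and the Chern character form -/

section Associated

variable {𝕜 V : Type*} [RCLike 𝕜] [NormedAddCommGroup V] [NormedSpace 𝕜 V]
  (B : PrincipalBundle EM M EP P EG G) (ρ : G →* (V →L[𝕜] V))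

/-- The fibre at `m` of the associated vector bundle `E = P ×_ρ V`, described as the space of the
maps `f` from the fibre of `P` at `m` to `V` that satisfy `f(pg) = ρ(g)⁻¹ f(p)`. (The class of
`(p, v)` corresponds to the map `f` with `f(p) = v`.) -/
def fibre (m : M) : Submodule 𝕜 ({p : P // B.proj p = m} → V) where
  carrier := {f | ∀ p g, f ⟨B.act p.1 g, (B.proj_act p.1 g).trans p.2⟩ = ρ g⁻¹ (f p)}
  add_mem' {f f'} hf hf' p g := by
    simp only [Pi.add_apply, map_add]
    rw [hf p g, hf' p g]
  zero_mem' p g := (map_zero _).symm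
  smul_mem' c f hf p g := by
    simp only [Pi.smul_apply, map_smul]
    rw [hf p g]

/-- Evaluation at `p` of the elements of the fibre of the associated bundle. -/
def evalAt {m : M} (p : {p : P // B.proj p = m}) : fibre B ρ m →ₗ[𝕜] V :=
  (LinearMap.proj p).comp (fibre B ρ m).subtype

theorem evalAt_bijective {m : M} (p : {p : P // B.proj p = m}) :
    Function.Bijective (evalAt B ρ p) := by
  have hc : ∀ q : {p : P // B.proj p = m}, ∃ g, B.act p.1 g = q.1 := fun q ↦
    B.exists_act_eq (p.2.trans q.2.symm)
  choose γ hγ using hc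
  constructor
  · intro f f' h
    ext q
    have hq : q = ⟨B.act p.1 (γ q), (B.proj_act p.1 _).trans p.2⟩ := Subtype.ext (hγ q).symm
    rw [hq, f.2 p (γ q), f'.2 p (γ q)]
    exact congrArg _ h
  · intro v
    refine ⟨⟨fun q ↦ ρ (γ q)⁻¹ v, fun q g ↦ ?_⟩, ?_⟩
    · have : γ ⟨B.act q.1 g, (B.proj_act q.1 g).trans q.2⟩ = γ q * g :=
        B.act_injective p.1 (by rw [hγ, B.act_mul, hγ])
      simp only [this, mul_inv_rev, map_mul]
      rfl
    · have : γ p = 1 := B.act_injective p.1 (by rw [hγ, B.act_one])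
      change ρ (γ p)⁻¹ v = v
      rw [this, inv_one, map_one]
      rfl

/-- The isomorphism of `V` onto the fibre of `E` that is given by a point `p` of the fibre of `P`. -/
def frame {m : M} (p : {p : P // B.proj p = m}) : V ≃ₗ[𝕜] fibre B ρ m :=
  (LinearEquiv.ofBijective (evalAt B ρ p) (evalAt_bijective B ρ p)).symm

/-- The section of `E` that corresponds to an equivariant map `f : P → V`. -/
def toSection (f : P → V) (hf : ∀ p g, f (B.act p g) = ρ g⁻¹ (f p)) (m : M) : fibre B ρ m :=
  ⟨fun p ↦ f p.1, fun p g ↦ hf p.1 g⟩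

variable [NormedSpace ℝ V] [IsScalarTower ℝ 𝕜 V]

/-- The derivative `dρ` of the representation `ρ`. -/
def dRep : EG →ₗ[ℝ] Module.End 𝕜 V where
  toFun X := ((tmap EG (V →L[𝕜] V) (fun g : G ↦ ρ g) 1 X : V →L[𝕜] V) : V →ₗ[𝕜] V)
  map_add' X X' := by
    ext v
    simp
  map_smul' c X := by
    ext v
    simp

/-- `dρ(X)v` as a bilinear map. -/
def dRepApply : EG →ₗ[ℝ] V →ₗ[ℝ] V where
  toFun X := (dRep (EG := EG) ρ X).restrictScalars ℝ
  map_add' X X' := by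
    ext v
    simp
  map_smul' c X := by
    ext v
    simp

/-- `dρ`, transported to the fibre of `E` by the frame at `p`. -/
def fibreRep {m : M} (p : {p : P // B.proj p = m}) : EG →ₗ[ℝ] Module.End 𝕜 (fibre B ρ m) :=
  ((frame B ρ p).conjAlgEquiv ℝ).toLinearMap ∘ₗ dRep (EG := EG) ρ

variable [FiniteDimensional ℝ EP]

/-- The exterior covariant derivative `d + dρ(ω)` on forms on `P` with values in `V`. On the
`G`-equivariant functions `f : P → V`, i.e. on the sections of `E`, it is the covariant derivative
`∇^E` that is induced by `ω`, and its square is the curvature of `∇^E`. -/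
def Connection.covD {B : PrincipalBundle EM M EP P EG G} (θ : Connection B) {k : ℕ}
    (α : Form EP P V k) : Form EP P V (k + 1) := fun p ↦
  α.d p + toCont ((wedge (dRepApply (EG := EG) ρ) (θ.form p).toAlternatingMap
    (α p).toAlternatingMap).domDomCongr (finCongr (add_comm 1 k)))

/-- A function as a form of degree `0`. -/
def Form.ofFun {E M W : Type*} [NormedAddCommGroup E] [NormedSpace ℝ E] [NormedAddCommGroup W]
    [NormedSpace ℝ W] (f : M → W) : Form E M W 0 :=
  fun x ↦ ContinuousAlternatingMap.constOfIsEmpty ℝ E (Fin 0) (f x)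

variable [FiniteDimensional ℝ EG] [LieGroup 𝓘(ℝ, EG) ∞ G] [IsManifold 𝓘(ℝ, EP) ∞ P]
  {h : Type*} [LieRing h] [LieAlgebra ℝ h]
  {FP : Foliation EP P} (aP : h →ₗ⁅ℝ⁆ FP.BasicField)

/-- The equivariant curvature `R^E + μ^E(Y)` at `m`: the element of `Λ T_m^*M ⊗ End(E_m)` induced by
`Ω - ω(Y_P)` through `dρ`. Its part of degree `0` is the moment `μ^E(Y)` and its part of degree `2`
is the curvature `R^E`. -/
def Connection.equivCurv {B : PrincipalBundle EM M EP P EG G} (θ : Connection B) (Y : h) (m : M) :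
    AltForms EM (Module.End 𝕜 (fibre B ρ m)) :=
  let p : {p : P // B.proj p = m} := ⟨_, (B.proj_surjective m).choose_spec⟩
  fun
  | 0 => AlternatingMap.constOfIsEmpty ℝ EM (Fin 0)
      (fibreRep B ρ p (-(θ.form p.1 fun _ ↦ (FP.rep (aP Y)).vec p.1)))
  | 2 => (fibreRep B ρ p).compAlternatingMap ((θ.curvature p.1).compLinearMap (θ.horLift p.1))
  | _ => 0

/-- The trace of `End(E_m)`, with complex values. -/
def fibreTrace (m : M) : Module.End 𝕜 (fibre B ρ m) →ₗ[ℝ] ℂ :=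
  (RCLike.map 𝕜 ℂ).toLinearMap ∘ₗ (LinearMap.trace 𝕜 (fibre B ρ m)).restrictScalars ℝ

variable [FiniteDimensional ℝ EM]

/-- The form `Tr exp(-(R^E + μ^E(Y)))`, for each `Y`. -/
def Connection.chernForm {B : PrincipalBundle EM M EP P EG G} (θ : Connection B) :
    Family EM M h := fun Y k m ↦ (θ.equivCurv ρ aP Y m).expTrace (fibreTrace B ρ m) k

end Associated

end Principal

end BasicChern

end

/-! All computations take place on `P`, with forms of mixed degree whose values lie in an algebra
`R`, in the end `R = End(V)`; only scalar forms are moved down to `M`. Put `a = dρ(ω)`, `F = da +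
a²` and `α(Y) = F - a(Y_P)`. Since `dρ` respects brackets (`dRho_lieBracket`), `F` is `dρ(Ω)`
(`Connection.curv_toG_two`), so `α(Y)` is the equivariant curvature seen on `P`.

Closedness comes from the equivariant Bianchi identity `dα = i(Y_P)α - [a, α]`
(`IsBasicGauge.gd_eqCurv`), which combines `dF = Fa - aF` with `d(a(Y_P)) = -i(Y_P)da`, the
invariance of `ω`. The form `α` is even, so all three operations act on its powers as derivations
and the identity passes to `exp(-α)` (`dG_expNeg`). Inserting a factor `γ` and using graded
cyclicity of the trace gives `gd_trc_mul_expNeg`: the operator `d - i(Y_P)` sends `Tr(γ exp(-α))` to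
`Tr((dγ - i(Y_P)γ + [a, γ]) exp(-α))`, with a graded commutator. For `γ = 1` this is zero.

Independence of `ω` is a transgression. For two connections put `η = a' - a`, `a_s = a + sη`, and
let `α_s` be the equivariant curvature of `a_s`. Then `dα_s/ds = dη + [a_s, η] - i(Y_P)η` is exactly
the factor produced by `γ = η`. Hence `d - i(Y_P)` sends `Tr(η exp(-α_s))` to `-d/ds Tr exp(-α_s)`,
and integration over `[0, 1]` yields a primitive of the difference of the two Chern forms
(`IsBasicGauge.gd_sub_ι_transgression`).

Descent: in a local trivialization `p = s(p)φ(p)` the gauge form satisfies `a = φ⁻¹(s^*a)φ + φ⁻¹dφ`,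
so `α` and `η` are conjugated by `ρ(φ)` and the traces are pulled back from `M`
(`IsTensorial.isDescending_trc`). The tangent map of the projection is onto, so the form on `M` is
unique. Basicness, invariance and the value of `d_h` can therefore be checked on `P`
(`IsEquivariantBasic.mem_equivForms`, `IsEquivariantBasic.equivD_descend`).

Finally `R^E` and `μ^E` are recognized by embedding `V`-valued forms into `End(V)`-valued ones
through rank one operators, so that `∇^E` becomes `d + a` acting by left multiplication
(`toG_covD`). -/

noncomputable section
namespace BasicChern

/-! ### The exterior algebra of alternating forms with values in an algebra -/

section Shuffle

variable {T : Type*} [AddCommGroup T] [Module ℝ T]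

/-- The extension by zero of a finite sequence of vectors. -/
def seqOf {k : ℕ} (v : Fin k → T) (n : ℕ) : T := if h : n < k then v ⟨n, h⟩ else 0

/-- Insertion of a vector in a sequence. -/
def insSeq (j : ℕ) (x : T) (s : ℕ → T) (n : ℕ) : T :=
  if n < j then s n else if n = j then x else s (n - 1)

theorem seqOf_insertNth {k : ℕ} (j : Fin (k + 1)) (x : T) (u : Fin k → T) :
    seqOf (j.insertNth x u : Fin (k + 1) → T) = insSeq j x (seqOf u) := by
  funext n
  simp only [seqOf, insSeq]
  by_cases hn : n < k + 1
  · rw [dif_pos hn]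
    rcases lt_trichotomy n (j : ℕ) with h | h | h
    · have h1 : (⟨n, hn⟩ : Fin (k + 1)) = j.succAbove ⟨n, by omega⟩ := by
        rw [Fin.succAbove_of_castSucc_lt]
        · rfl
        · exact h
      rw [h1, Fin.insertNth_apply_succAbove, if_pos h, dif_pos (by omega)]
    · have h1 : (⟨n, hn⟩ : Fin (k + 1)) = j := Fin.ext h
      rw [h1, Fin.insertNth_apply_same, if_neg (by omega), if_pos h]
    · have h1 : (⟨n, hn⟩ : Fin (k + 1)) = j.succAbove ⟨n - 1, by omega⟩ := by
        rw [Fin.succAbove_of_le_castSucc]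
        · ext; simp; omega
        · simp [Fin.le_def]; omega
      rw [h1, Fin.insertNth_apply_succAbove, if_neg (by omega), if_neg (by omega),
        dif_pos (by omega)]
  · rw [dif_neg hn, if_neg (by omega), if_neg (by omega), dif_neg (by omega)]

/-- The antisymmetrization of a function of sequences. -/
def antisymm {N : Type*} [AddCommGroup N] (k : ℕ) (f : (ℕ → T) → N) (v : Fin k → T) : N :=
  ∑ σ : Equiv.Perm (Fin k), (Equiv.Perm.sign σ : ℤ) • f (seqOf (v ∘ σ))

variable {N : Type*} [AddCommGroup N]

/-- A permutation of `k + 1` letters amounts to the place `j` where `x` lands together with a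
permutation of the remaining letters; moving `x` to place `j` takes `j` transpositions. This
expansion is the source of the Leibniz rule for contractions. -/
theorem antisymm_cons (k : ℕ) (f : (ℕ → T) → N) (x : T) (v : Fin k → T) :
    antisymm (k + 1) f (Fin.cons x v : Fin (k + 1) → T) =
      ∑ j ∈ Finset.range (k + 1), (-1 : ℤ) ^ j • antisymm k (fun s ↦ f (insSeq j x s)) v := by
  -- `j.cycleRange` sends place `j` to `0` and shifts the earlier places up by one; the other factor
  -- fixes `0` and acts by `τ` on the rest. The place `j` is recovered as the preimage of `0`.
  let φ : Fin (k + 1) × Equiv.Perm (Fin k) → Equiv.Perm (Fin (k + 1)) := fun q ↦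
    Equiv.Perm.decomposeFin.symm (0, q.2) * q.1.cycleRange
  have hφ : Function.Bijective φ := by
    refine (Fintype.bijective_iff_injective_and_card φ).2 ⟨?_, ?_⟩
    · rintro ⟨j, τ⟩ ⟨j', τ'⟩ h
      have h0 : ∀ (j : Fin (k + 1)) (τ : Equiv.Perm (Fin k)), (φ (j, τ))⁻¹ 0 = j := by
        intro j τ
        rw [Equiv.Perm.inv_eq_iff_eq]
        simp [φ]
      have hj : j = j' := by rw [← h0 j τ, h, h0 j' τ']
      subst hj
      have := mul_right_cancel h
      have := (Equiv.Perm.decomposeFin.symm.injective this)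
      simp only [Prod.mk.injEq, true_and] at this
      rw [this]
    · simp [Fintype.card_perm, Nat.factorial_succ]
  rw [antisymm, ← hφ.sum_comp, Fintype.sum_prod_type, Finset.sum_range]
  refine Finset.sum_congr rfl fun j _ ↦ ?_
  rw [antisymm, Finset.smul_sum]
  refine Finset.sum_congr rfl fun τ _ ↦ ?_
  have h1 : (Fin.cons x v : Fin (k + 1) → T) ∘ φ (j, τ) = j.insertNth x (v ∘ τ) := by
    rw [← Fin.cons_comp_cycleRange]
    funext i
    simp only [φ, Function.comp_apply, Equiv.Perm.mul_apply]
    generalize j.cycleRange i = m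
    refine Fin.cases ?_ (fun m ↦ ?_) m <;> simp
  rw [h1, seqOf_insertNth, smul_smul]
  congr 1
  simp [φ, Equiv.Perm.sign_mul, Fin.sign_cycleRange, mul_comm]

theorem antisymm_smul (k : ℕ) (c : ℤ) (f : (ℕ → T) → N) (v : Fin k → T) :
    antisymm k (fun s ↦ c • f s) v = c • antisymm k f v := by
  simp only [antisymm, Finset.smul_sum]
  exact Finset.sum_congr rfl fun σ _ ↦ smul_comm _ _ _

variable {R : Type*} [Ring R] [Algebra ℝ R]

/-- The tensor product of two alternating forms, evaluated on a sequence. -/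
def tens {p q : ℕ} (a : T [⋀^Fin p]→ₗ[ℝ] R) (b : T [⋀^Fin q]→ₗ[ℝ] R) (s : ℕ → T) : R :=
  a (fun i ↦ s i) * b (fun j ↦ s (p + j))

theorem alternating_insSeq {p : ℕ} {W : Type*} [AddCommGroup W] [Module ℝ W]
    (a : T [⋀^Fin (p + 1)]→ₗ[ℝ] W) (j : ℕ) (hj : j < p + 1)
    (x : T) (s : ℕ → T) :
    a (fun i ↦ insSeq j x s i) = (-1 : ℤ) ^ j • a.curryLeft x (fun i ↦ s i) := by
  have h : (fun i : Fin (p + 1) ↦ insSeq j x s i) =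
      (⟨j, hj⟩ : Fin (p + 1)).insertNth x (fun i : Fin p ↦ s i) := by
    funext i
    have h1 := congrFun (seqOf_insertNth ⟨j, hj⟩ x (fun i : Fin p ↦ s i)) i
    rw [seqOf, dif_pos i.2] at h1
    rw [h1]
    simp only [insSeq, seqOf]
    have := i.2
    split_ifs <;> first | rfl | omega
  rw [h, AlternatingMap.map_insertNth]
  simp [AlternatingMap.curryLeft_apply_apply]

theorem tens_insSeq_left {p q : ℕ} (a : T [⋀^Fin (p + 1)]→ₗ[ℝ] R) (b : T [⋀^Fin q]→ₗ[ℝ] R)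
    (j : ℕ) (hj : j < p + 1) (x : T) (s : ℕ → T) :
    tens a b (insSeq j x s) = (-1 : ℤ) ^ j • tens (a.curryLeft x) b s := by
  have h : (fun i : Fin q ↦ insSeq j x s (p + 1 + i)) = fun i : Fin q ↦ s (p + i) := by
    funext i
    rw [insSeq, if_neg (by omega), if_neg (by omega)]
    congr 1
    omega
  rw [tens, alternating_insSeq a j hj, h, smul_mul_assoc]
  rfl

theorem tens_insSeq_right {p q : ℕ} (a : T [⋀^Fin p]→ₗ[ℝ] R) (b : T [⋀^Fin (q + 1)]→ₗ[ℝ] R)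
    (j : ℕ) (hj : j < q + 1) (x : T) (s : ℕ → T) :
    tens a b (insSeq (p + j) x s) = (-1 : ℤ) ^ j • tens a (b.curryLeft x) s := by
  have h : (fun i : Fin p ↦ insSeq (p + j) x s i) = fun i : Fin p ↦ s i := by
    funext i
    rw [insSeq, if_pos (by omega)]
  have h2 : (fun i : Fin (q + 1) ↦ insSeq (p + j) x s (p + i)) =
      fun i : Fin (q + 1) ↦ insSeq j x (fun n ↦ s (p + n)) i := by
    funext i
    simp only [insSeq]
    split_ifs <;> first | rfl | omega | (congr 1; omega)
  rw [tens, h, h2, alternating_insSeq b j hj, mul_smul_comm]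
  rfl

end Shuffle

/-! ### The wedge product as a sum over all permutations -/

section WedgeApply

variable {T A B C : Type*} [AddCommGroup T] [Module ℝ T] [AddCommGroup A] [Module ℝ A]
  [AddCommGroup B] [Module ℝ B] [AddCommGroup C] [Module ℝ C]

/-- Summing over all permutations instead of shuffles counts each shuffle `p! q!` times. In this
form the product can be contracted by `antisymm_cons`. -/
theorem wedge_apply {p q : ℕ} (b : A →ₗ[ℝ] B →ₗ[ℝ] C) (α : T [⋀^Fin p]→ₗ[ℝ] A)
    (β : T [⋀^Fin q]→ₗ[ℝ] B) (v : Fin (p + q) → T) :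
    (p.factorial * q.factorial : ℕ) • wedge b α β v =
      antisymm (p + q) (fun s ↦ b (α fun i ↦ s i) (β fun j ↦ s (p + j))) v := by
  have h := congrArg (fun f ↦ TensorProduct.lift b (f (v ∘ finSumFinEquiv)))
    (MultilinearMap.domCoprod_alternization_eq α β)
  simp only [Fintype.card_fin, AlternatingMap.smul_apply] at h
  rw [LinearMap.map_smul_of_tower] at h
  have h2 : TensorProduct.lift b ((α.domCoprod β) (v ∘ finSumFinEquiv)) = wedge b α β v := rfl
  rw [h2] at h
  rw [← h, MultilinearMap.alternatization_apply, map_sum, antisymm,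
    ← (Equiv.permCongr finSumFinEquiv).sum_comp]
  refine Finset.sum_congr rfl fun σ _ ↦ ?_
  rw [Equiv.Perm.sign_permCongr]
  simp only [Units.smul_def, map_zsmul, MultilinearMap.domDomCongr_apply, MultilinearMap.domCoprod_apply]
  congr 1
  simp only [TensorProduct.lift.tmul, AlternatingMap.coe_multilinearMap]
  congr 2
  · congr 1
    funext i
    have := i.2
    simp only [seqOf, Function.comp_apply]
    rw [dif_pos (by omega)]
    have h3 : (⟨i, by omega⟩ : Fin (p + q)) = finSumFinEquiv (Sum.inl i) := by
      ext; simp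
    rw [h3]
    simp
  · funext i
    have := i.2
    simp only [seqOf, Function.comp_apply]
    rw [dif_pos (by omega)]
    have h3 : (⟨p + i, by omega⟩ : Fin (p + q)) = finSumFinEquiv (Sum.inr i) := by
      ext; simp
    rw [h3]
    simp

end WedgeApply

end BasicChern
end

noncomputable section
namespace BasicChern

/-! ### The graded algebra of forms: product, contraction, antisymmetrization -/

section GradedForms

/-- The algebra `Λ T^* ⊗ R` of forms of mixed degree with values in an algebra. -/
def GForm (T R : Type*) [AddCommGroup T] [Module ℝ T] [Ring R] [Algebra ℝ R] : Type _ :=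
  AltForms T R

variable {T R : Type*} [AddCommGroup T] [Module ℝ T] [Ring R] [Algebra ℝ R]

theorem alternating_sum_apply {I W : Type*} [AddCommGroup W] [Module ℝ W] {k : ℕ} (s : Finset I)
    (f : I → T [⋀^Fin k]→ₗ[ℝ] W) (v : Fin k → T) : (∑ i ∈ s, f i) v = ∑ i ∈ s, f i v :=
  map_sum (⟨⟨fun g ↦ g v, rfl⟩, fun _ _ ↦ rfl⟩ : (T [⋀^Fin k]→ₗ[ℝ] W) →+ W) f s

namespace GForm

instance : AddCommGroup (GForm T R) := inferInstanceAs (AddCommGroup (∀ k : ℕ, T [⋀^Fin k]→ₗ[ℝ] R))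

instance : Module ℝ (GForm T R) := inferInstanceAs (Module ℝ (∀ k : ℕ, T [⋀^Fin k]→ₗ[ℝ] R))

instance : Mul (GForm T R) := ⟨AltForms.mul⟩

instance : One (GForm T R) := ⟨AltForms.one⟩

@[ext] theorem ext {a b : GForm T R} (h : ∀ k, a k = b k) : a = b := funext h

@[simp] theorem add_apply (a b : GForm T R) (k : ℕ) : (a + b) k = a k + b k := rfl
@[simp] theorem sub_apply (a b : GForm T R) (k : ℕ) : (a - b) k = a k - b k := rfl
@[simp] theorem neg_apply (a : GForm T R) (k : ℕ) : (-a) k = -a k := rfl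
@[simp] theorem zero_apply (k : ℕ) : (0 : GForm T R) k = 0 := rfl
@[simp] theorem smul_apply (c : ℝ) (a : GForm T R) (k : ℕ) : (c • a) k = c • a k := rfl

theorem mul_apply (a b : GForm T R) (k : ℕ) (v : Fin k → T) :
    (a * b) k v = ∑ q ∈ Finset.HasAntidiagonal.antidiagonal k,
      ((q.1.factorial * q.2.factorial : ℕ) : ℝ)⁻¹ • antisymm k (tens (a q.1) (b q.2)) v := by
  have key : ∀ (p q k : ℕ) (h : p + q = k) (v : Fin k → T),
      (wedge (LinearMap.mul ℝ R) (a p) (b q)).domDomCongr (finCongr h) v =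
        ((p.factorial * q.factorial : ℕ) : ℝ)⁻¹ • antisymm k (tens (a p) (b q)) v := by
    intro p q k h v
    subst h
    have h1 := wedge_apply (LinearMap.mul ℝ R) (a p) (b q) v
    have h2 : antisymm (p + q) (tens (a p) (b q)) v = (p.factorial * q.factorial : ℕ) •
        wedge (LinearMap.mul ℝ R) (a p) (b q) v := h1.symm
    rw [h2, ← Nat.cast_smul_eq_nsmul ℝ, smul_smul, inv_mul_cancel₀, one_smul]
    · rfl
    · positivity
  rw [← Finset.sum_attach (Finset.HasAntidiagonal.antidiagonal k)]
  change (∑ q ∈ (Finset.HasAntidiagonal.antidiagonal k).attach,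
    (wedge (LinearMap.mul ℝ R) (a q.1.1) (b q.1.2)).domDomCongr
      (finCongr (Finset.HasAntidiagonal.mem_antidiagonal.1 q.2))) v = _
  rw [alternating_sum_apply]
  exact Finset.sum_congr rfl fun q _ ↦ key _ _ _ _ _

theorem antisymm_tens_add_left {p q k : ℕ} (a a' : T [⋀^Fin p]→ₗ[ℝ] R) (b : T [⋀^Fin q]→ₗ[ℝ] R)
    (v : Fin k → T) :
    antisymm k (tens (a + a') b) v = antisymm k (tens a b) v + antisymm k (tens a' b) v := by
  simp only [antisymm, tens, ← Finset.sum_add_distrib, ← smul_add, AlternatingMap.add_apply,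
    add_mul]

theorem antisymm_tens_add_right {p q k : ℕ} (a : T [⋀^Fin p]→ₗ[ℝ] R) (b b' : T [⋀^Fin q]→ₗ[ℝ] R)
    (v : Fin k → T) :
    antisymm k (tens a (b + b')) v = antisymm k (tens a b) v + antisymm k (tens a b') v := by
  simp only [antisymm, tens, ← Finset.sum_add_distrib, ← smul_add, AlternatingMap.add_apply,
    mul_add]

theorem antisymm_tens_smul_left {p q k : ℕ} (c : ℝ) (a : T [⋀^Fin p]→ₗ[ℝ] R)
    (b : T [⋀^Fin q]→ₗ[ℝ] R) (v : Fin k → T) :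
    antisymm k (tens (c • a) b) v = c • antisymm k (tens a b) v := by
  simp only [antisymm, tens, Finset.smul_sum, AlternatingMap.smul_apply, smul_mul_assoc]
  exact Finset.sum_congr rfl fun σ _ ↦ smul_comm _ _ _

theorem antisymm_tens_smul_right {p q k : ℕ} (c : ℝ) (a : T [⋀^Fin p]→ₗ[ℝ] R)
    (b : T [⋀^Fin q]→ₗ[ℝ] R) (v : Fin k → T) :
    antisymm k (tens a (c • b)) v = c • antisymm k (tens a b) v := by
  simp only [antisymm, tens, Finset.smul_sum, AlternatingMap.smul_apply, mul_smul_comm]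
  exact Finset.sum_congr rfl fun σ _ ↦ smul_comm _ _ _

theorem smul_mul' (c : ℝ) (a b : GForm T R) : c • a * b = c • (a * b) := by
  ext k v
  simp only [smul_apply, mul_apply, AlternatingMap.smul_apply, antisymm_tens_smul_left,
    Finset.smul_sum]
  exact Finset.sum_congr rfl fun σ _ ↦ smul_comm _ _ _

theorem mul_smul' (c : ℝ) (a b : GForm T R) : a * c • b = c • (a * b) := by
  ext k v
  simp only [smul_apply, mul_apply, AlternatingMap.smul_apply, antisymm_tens_smul_right,
    Finset.smul_sum]
  exact Finset.sum_congr rfl fun σ _ ↦ smul_comm _ _ _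

instance instNonUnitalNonAssocRing : NonUnitalNonAssocRing (GForm T R) where
  left_distrib a b c := by
    ext k v
    simp only [add_apply, mul_apply, AlternatingMap.add_apply, antisymm_tens_add_right,
      smul_add, Finset.sum_add_distrib]
  right_distrib a b c := by
    ext k v
    simp only [add_apply, mul_apply, AlternatingMap.add_apply, antisymm_tens_add_left,
      smul_add, Finset.sum_add_distrib]
  zero_mul a := by
    have := smul_mul' 0 0 a
    rwa [zero_smul, zero_smul] at this
  mul_zero a := by
    have := mul_smul' 0 a 0
    rwa [zero_smul, zero_smul] at this

/-- The interior product. -/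
def ι : T →ₗ[ℝ] GForm T R →ₗ[ℝ] GForm T R :=
  LinearMap.mk₂ ℝ (fun x a k ↦ (a (k + 1)).curryLeft x)
    (fun x y a ↦ funext fun k ↦ map_add _ _ _)
    (fun c x a ↦ funext fun k ↦ map_smul _ _ _)
    (fun x a b ↦ funext fun k ↦ by
      change AlternatingMap.curryLeft (a (k + 1) + b (k + 1)) x = _
      rw [AlternatingMap.curryLeft_add]
      rfl)
    (fun c x a ↦ funext fun k ↦ by
      change AlternatingMap.curryLeft (c • a (k + 1)) x = _
      rw [AlternatingMap.curryLeft_smul]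
      rfl)

theorem ι_apply (x : T) (a : GForm T R) (k : ℕ) : ι x a k = (a (k + 1)).curryLeft x := rfl

theorem ι_apply_apply (x : T) (a : GForm T R) (k : ℕ) (v : Fin k → T) :
    ι x a k v = a (k + 1) (Fin.cons x v : Fin (k + 1) → T) := rfl

/-- The parity operator. -/
def ε : GForm T R →ₗ[ℝ] GForm T R where
  toFun a k := (-1 : ℝ) ^ k • a k
  map_add' a b := funext fun k ↦ smul_add _ _ _
  map_smul' c a := funext fun k ↦ smul_comm ((-1 : ℝ) ^ k) c (a k)

theorem ε_apply (a : GForm T R) (k : ℕ) : ε a k = (-1 : ℝ) ^ k • a k := rfl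

@[simp] theorem ε_ε (a : GForm T R) : ε (ε a) = a := by
  ext1 k
  rw [ε_apply, ε_apply, smul_smul, ← mul_pow]
  simp

theorem ι_ε (x : T) (a : GForm T R) : ι x (ε a) = -ε (ι x a) := by
  ext k v
  simp only [ι_apply, ε_apply, neg_apply, AlternatingMap.curryLeft_smul, LinearMap.smul_apply]
  rw [pow_succ, mul_neg_one, neg_smul]

theorem ε_mul (a b : GForm T R) : ε (a * b) = ε a * ε b := by
  ext k v
  rw [ε_apply, AlternatingMap.smul_apply, mul_apply, mul_apply, Finset.smul_sum]
  refine Finset.sum_congr rfl fun q hq ↦ ?_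
  have h : (-1 : ℝ) ^ k = (-1) ^ q.1 * (-1) ^ q.2 := by
    rw [← pow_add, Finset.HasAntidiagonal.mem_antidiagonal.1 hq]
  rw [ε_apply, ε_apply, antisymm_tens_smul_left, antisymm_tens_smul_right, h, smul_smul, smul_smul,
    smul_smul]
  congr 1
  ring

/-- In the product of degrees `p` and `q`, the vector `x` occupies one of `p` slots of the left
factor (`A`) or one of `q` slots of the right factor (`B`). The `p` equal terms turn the weight
`1/(p! q!)` into `1/((p-1)! q!)`, and likewise on the right, where crossing the left factor gives
the parity sign. -/
theorem ι_mul (x : T) (a b : GForm T R) : ι x (a * b) = ι x a * b + ε a * ι x b := by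
  ext k v
  let c : ℕ × ℕ → ℝ := fun q ↦ ((q.1.factorial * q.2.factorial : ℕ) : ℝ)⁻¹
  let A : ℕ × ℕ → R := fun q ↦ c q • ∑ j ∈ Finset.range q.1,
    (-1 : ℤ) ^ j • antisymm k (fun s ↦ tens (a q.1) (b q.2) (insSeq j x s)) v
  let B : ℕ × ℕ → R := fun q ↦ c q • ∑ j ∈ Finset.range q.2,
    (-1 : ℤ) ^ (q.1 + j) • antisymm k (fun s ↦ tens (a q.1) (b q.2) (insSeq (q.1 + j) x s)) v
  have h1 : ι x (a * b) k v = ∑ q ∈ Finset.HasAntidiagonal.antidiagonal (k + 1), (A q + B q) := by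
    rw [ι_apply_apply, mul_apply]
    refine Finset.sum_congr rfl fun q hq ↦ ?_
    rw [antisymm_cons, ← Finset.HasAntidiagonal.mem_antidiagonal.1 hq, Finset.sum_range_add, smul_add]
  have hA : ∀ p q, A (p + 1, q) = c (p, q) • antisymm k (tens (ι x a p) (b q)) v := by
    intro p q
    have : ∀ j ∈ Finset.range (p + 1),
        (-1 : ℤ) ^ j • antisymm k (fun s ↦ tens (a (p + 1)) (b q) (insSeq j x s)) v =
          antisymm k (tens (ι x a p) (b q)) v := by
      intro j hj
      have h2 : (fun s ↦ tens (a (p + 1)) (b q) (insSeq j x s)) =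
          fun s ↦ (-1 : ℤ) ^ j • tens (ι x a p) (b q) s := by
        funext s
        exact tens_insSeq_left _ _ j (Finset.mem_range.1 hj) x s
      rw [h2, antisymm_smul, smul_smul, ← mul_pow]
      simp
    simp only [A]
    rw [Finset.sum_congr rfl this, Finset.sum_const, Finset.card_range,
      ← Nat.cast_smul_eq_nsmul ℝ, smul_smul]
    congr 1
    simp only [c, Nat.factorial_succ]
    push_cast
    field_simp
  have hB : ∀ p q, B (p, q + 1) = c (p, q) • antisymm k (tens (ε a p) (ι x b q)) v := by
    intro p q
    have : ∀ j ∈ Finset.range (q + 1), (-1 : ℤ) ^ (p + j) •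
        antisymm k (fun s ↦ tens (a p) (b (q + 1)) (insSeq (p + j) x s)) v =
          antisymm k (tens (ε a p) (ι x b q)) v := by
      intro j hj
      have h2 : (fun s ↦ tens (a p) (b (q + 1)) (insSeq (p + j) x s)) =
          fun s ↦ (-1 : ℤ) ^ j • tens (a p) (ι x b q) s := by
        funext s
        exact tens_insSeq_right _ _ j (Finset.mem_range.1 hj) x s
      rw [h2, antisymm_smul, smul_smul, ε_apply, antisymm_tens_smul_left, pow_add, mul_assoc,
        ← mul_pow]
      have h3 : (-1 : ℝ) ^ p = (((-1 : ℤ) ^ p : ℤ) : ℝ) := by push_cast; rfl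
      rw [h3, Int.cast_smul_eq_zsmul]
      simp
    simp only [B]
    rw [Finset.sum_congr rfl this, Finset.sum_const, Finset.card_range,
      ← Nat.cast_smul_eq_nsmul ℝ, smul_smul]
    congr 1
    simp only [c, Nat.factorial_succ]
    push_cast
    field_simp
  rw [h1, Finset.sum_add_distrib, Finset.Nat.sum_antidiagonal_succ (f := A),
    Finset.Nat.sum_antidiagonal_succ' (f := B), add_apply, AlternatingMap.add_apply, mul_apply,
    mul_apply]
  -- A factor of degree zero has no slot for `x`. Without these end terms both sums run over the
  -- antidiagonal of `k`.
  have hA0 : A (0, k + 1) = 0 := by simp [A]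
  have hB0 : B (k + 1, 0) = 0 := by simp [B]
  rw [hA0, hB0, zero_add, zero_add]
  simp only [hA, hB]
  rfl

/-- A form of positive degree is determined by its contractions. Together with `ι_mul` this reduces
associativity, the unit laws, the rules for `alt` and the cyclicity of traces to degree zero, by
induction on the degree and without any further shuffle combinatorics. -/
theorem eq_succ {a b : GForm T R} {k : ℕ} (h : ∀ x, ι x a k = ι x b k) :
    a (k + 1) = b (k + 1) := by
  ext v
  have := congrArg (fun f ↦ f (Fin.tail v)) (h (v 0))
  simpa only [ι_apply_apply, Fin.cons_self_tail] using this

theorem mul_zero_apply (a b : GForm T R) (v : Fin 0 → T) : (a * b) 0 v = a 0 v * b 0 v := by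
  rw [mul_apply]
  simp only [Finset.HasAntidiagonal.antidiagonal_zero, Finset.sum_singleton, antisymm, tens]
  simp [Subsingleton.elim _ v]

theorem one_zero_apply (v : Fin 0 → T) : (1 : GForm T R) 0 v = 1 := rfl

@[simp] theorem ι_one (x : T) : ι x (1 : GForm T R) = 0 := by
  ext k v
  rfl

@[simp] theorem ε_one : ε (1 : GForm T R) = 1 := by
  ext k v
  rw [ε_apply]
  cases k with
  | zero => simp
  | succ k => exact smul_zero _

theorem mul_assoc_apply (k : ℕ) : ∀ a b c : GForm T R, (a * b * c) k = (a * (b * c)) k := by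
  induction k with
  | zero =>
    intro a b c
    ext v
    simp only [mul_zero_apply, mul_assoc]
  | succ k ih =>
    intro a b c
    refine eq_succ fun x ↦ ?_
    simp only [ι_mul, ε_mul, add_mul, mul_add, add_apply, ih, add_assoc]

theorem one_mul_apply (k : ℕ) : ∀ a : GForm T R, (1 * a) k = a k := by
  induction k with
  | zero =>
    intro a
    ext v
    rw [mul_zero_apply, one_zero_apply, one_mul]
  | succ k ih =>
    intro a
    refine eq_succ fun x ↦ ?_
    rw [ι_mul, ι_one, ε_one, zero_mul, zero_add, ih]

theorem mul_one_apply (k : ℕ) : ∀ a : GForm T R, (a * 1) k = a k := by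
  induction k with
  | zero =>
    intro a
    ext v
    rw [mul_zero_apply, one_zero_apply, mul_one]
  | succ k ih =>
    intro a
    refine eq_succ fun x ↦ ?_
    rw [ι_mul, ι_one, mul_zero, add_zero, ih]

instance : Ring (GForm T R) where
  __ := instNonUnitalNonAssocRing
  mul_assoc a b c := ext fun k ↦ mul_assoc_apply k a b c
  one_mul a := ext fun k ↦ one_mul_apply k a
  mul_one a := ext fun k ↦ mul_one_apply k a

instance : Algebra ℝ (GForm T R) := Algebra.ofModule smul_mul' (fun c a b ↦ mul_smul' c a b)

theorem pow_eq (a : GForm T R) (n : ℕ) : AltForms.pow a n = a ^ n := by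
  induction n with
  | zero => exact (pow_zero a).symm
  | succ n ih =>
    rw [pow_succ, ← ih]
    rfl

theorem ε_pow {a : GForm T R} (h : ε a = a) (n : ℕ) : ε (a ^ n) = a ^ n := by
  induction n with
  | zero => rw [pow_zero, ε_one]
  | succ n ih => rw [pow_succ, ε_mul, ih, h]

/-- The antisymmetrization of a linear map into the forms of mixed degree. -/
def alt : (T →ₗ[ℝ] GForm T R) →ₗ[ℝ] GForm T R where
  toFun φ
  | 0 => 0
  | k + 1 => AlternatingMap.alternatizeUncurryFin ((LinearMap.proj k).comp φ)
  map_add' φ ψ := by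
    ext1 k
    cases k with
    | zero => exact (add_zero _).symm
    | succ k =>
      exact AlternatingMap.alternatizeUncurryFin_add ((LinearMap.proj k).comp φ)
        ((LinearMap.proj k).comp ψ)
  map_smul' c φ := by
    ext1 k
    cases k with
    | zero => exact (smul_zero c).symm
    | succ k => exact AlternatingMap.alternatizeUncurryFin_smul c ((LinearMap.proj k).comp φ)

theorem alt_zero_apply (φ : T →ₗ[ℝ] GForm T R) : alt φ 0 = 0 := rfl

theorem alt_succ_apply (φ : T →ₗ[ℝ] GForm T R) (k : ℕ) (v : Fin (k + 1) → T) :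
    alt φ (k + 1) v = ∑ i : Fin (k + 1), (-1 : ℤ) ^ (i : ℕ) • φ (v i) k (i.removeNth v) :=
  AlternatingMap.alternatizeUncurryFin_apply _ _

/-- In a basis `alt φ` is `Σ eⁱ ∧ φ(eᵢ)`: the contraction either meets `eⁱ`, which leaves `φ x`, or
passes behind it with a minus sign. -/
theorem ι_alt (x : T) (φ : T →ₗ[ℝ] GForm T R) : ι x (alt φ) = φ x - alt (ι x ∘ₗ φ) := by
  ext k v
  rw [ι_apply_apply, alt_succ_apply, Fin.sum_univ_succ]
  simp only [Fin.val_zero, pow_zero, one_smul, Fin.cons_zero, Fin.val_succ, Fin.cons_succ,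
    sub_apply, AlternatingMap.sub_apply]
  have h0 : (0 : Fin (k + 1)).removeNth (Fin.cons x v : Fin (k + 1) → T) = v := by
    rw [Fin.removeNth_zero, Fin.tail_cons]
  rw [h0, sub_eq_add_neg]
  congr 1
  cases k with
  | zero =>
    rw [alt_zero_apply]
    simp
  | succ k =>
    rw [alt_succ_apply, ← Finset.sum_neg_distrib]
    refine Finset.sum_congr rfl fun i _ ↦ ?_
    rw [pow_succ, mul_neg_one, neg_smul, LinearMap.comp_apply, ι_apply_apply]
    congr 3
    funext j
    refine Fin.cases ?_ (fun j ↦ ?_) j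
    · simp [Fin.removeNth]
    · simp [Fin.removeNth]

theorem ε_alt (φ : T →ₗ[ℝ] GForm T R) : ε (alt φ) = -alt (ε ∘ₗ φ) := by
  ext k v
  cases k with
  | zero => simp [ε_apply, alt_zero_apply]
  | succ k =>
    rw [ε_apply, AlternatingMap.smul_apply, alt_succ_apply, neg_apply, AlternatingMap.neg_apply,
      alt_succ_apply, Finset.smul_sum, ← Finset.sum_neg_distrib]
    refine Finset.sum_congr rfl fun i _ ↦ ?_
    rw [LinearMap.comp_apply, ε_apply, AlternatingMap.smul_apply, pow_succ, mul_neg_one, neg_smul,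
      smul_comm]

theorem alt_mulRight_apply (k : ℕ) : ∀ (φ : T →ₗ[ℝ] GForm T R) (b : GForm T R),
    alt (LinearMap.mulRight ℝ b ∘ₗ φ) k = (alt φ * b) k := by
  induction k with
  | zero =>
    intro φ b
    ext v
    rw [mul_zero_apply, alt_zero_apply, alt_zero_apply]
    exact (zero_mul _).symm
  | succ k ih =>
    intro φ b
    refine eq_succ fun x ↦ ?_
    have h : ι x ∘ₗ LinearMap.mulRight ℝ b ∘ₗ φ =
        LinearMap.mulRight ℝ b ∘ₗ (ι x ∘ₗ φ) + LinearMap.mulRight ℝ (ι x b) ∘ₗ (ε ∘ₗ φ) := by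
      ext1 y
      simp [ι_mul]
    rw [ι_alt, h, map_add, sub_apply, add_apply, ih, ih, ι_mul, ι_alt, ε_alt]
    simp only [add_apply, LinearMap.comp_apply, LinearMap.mulRight_apply, sub_mul, neg_mul,
      sub_apply, neg_apply]
    abel

/-- `Σ eⁱ ∧ (φᵢ b) = (Σ eⁱ ∧ φᵢ) b`. -/
theorem alt_mulRight (φ : T →ₗ[ℝ] GForm T R) (b : GForm T R) :
    alt (LinearMap.mulRight ℝ b ∘ₗ φ) = alt φ * b := ext fun k ↦ alt_mulRight_apply k φ b

theorem alt_mulLeft_apply (k : ℕ) : ∀ (a : GForm T R) (φ : T →ₗ[ℝ] GForm T R),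
    alt (LinearMap.mulLeft ℝ a ∘ₗ φ) k = (ε a * alt φ) k := by
  induction k with
  | zero =>
    intro a φ
    ext v
    rw [mul_zero_apply, alt_zero_apply, alt_zero_apply]
    exact (mul_zero _).symm
  | succ k ih =>
    intro a φ
    refine eq_succ fun x ↦ ?_
    have h : ι x ∘ₗ LinearMap.mulLeft ℝ a ∘ₗ φ =
        LinearMap.mulLeft ℝ (ι x a) ∘ₗ φ + LinearMap.mulLeft ℝ (ε a) ∘ₗ (ι x ∘ₗ φ) := by
      ext1 y
      simp [ι_mul]
    rw [ι_alt, h, map_add, sub_apply, add_apply, ih, ih, ι_mul, ι_alt, ε_ε, ι_ε]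
    simp only [add_apply, LinearMap.comp_apply, LinearMap.mulLeft_apply, mul_sub, neg_mul,
      sub_apply, neg_apply]
    abel

/-- Carrying `a` across the one-forms `eⁱ` costs its parity; this is the sign in the Leibniz rule
for the exterior derivative. -/
theorem alt_mulLeft (a : GForm T R) (φ : T →ₗ[ℝ] GForm T R) :
    alt (LinearMap.mulLeft ℝ a ∘ₗ φ) = ε a * alt φ := ext fun k ↦ alt_mulLeft_apply k a φ

/-- The derivation of the algebra of forms that is induced by an endomorphism of `T`. -/
def der (B : T →ₗ[ℝ] T) (a : GForm T R) : GForm T R := alt ((ι.flip a) ∘ₗ B)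

/-- Contraction and antisymmetrization each contribute a parity sign on the left factor, and the two
cancel. In a chart `der` is the part of order zero of a Lie derivative. -/
theorem der_mul (B : T →ₗ[ℝ] T) (a b : GForm T R) : der B (a * b) = der B a * b + a * der B b := by
  have h : ι.flip (a * b) ∘ₗ B = LinearMap.mulRight ℝ b ∘ₗ (ι.flip a ∘ₗ B) +
      LinearMap.mulLeft ℝ (ε a) ∘ₗ (ι.flip b ∘ₗ B) := by
    ext1 y
    simp [ι_mul]
  rw [der, h, map_add, alt_mulRight, alt_mulLeft, ε_ε, der, der]

variable {W : Type*} [AddCommGroup W] [Module ℝ W]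

/-- Induction on the degree through contractions. Contracting exchanges even and odd forms, so both
parities have to be carried in one induction; in degree zero the claim is the cyclicity of `t`
itself. -/
theorem trace_mul_comm_apply (t : R →ₗ[ℝ] W) (ht : ∀ x y, t (x * y) = t (y * x)) (k : ℕ) :
    (∀ a b : GForm T R, ε a = a →
      t.compAlternatingMap ((a * b) k) = t.compAlternatingMap ((b * a) k)) ∧
    (∀ a b : GForm T R, ε a = -a →
      t.compAlternatingMap ((a * b) k) = t.compAlternatingMap ((ε b * a) k)) := by
  have key : ∀ (k : ℕ) (a b : GForm T R),
      (∀ x, t.compAlternatingMap (ι x a k) = t.compAlternatingMap (ι x b k)) →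
      t.compAlternatingMap (a (k + 1)) = t.compAlternatingMap (b (k + 1)) := by
    intro k a b h
    ext v
    have := congrArg (fun f ↦ f (Fin.tail v)) (h (v 0))
    simpa only [LinearMap.compAlternatingMap_apply, ι_apply_apply, Fin.cons_self_tail] using this
  have hneg : ∀ {k : ℕ} (f : T [⋀^Fin k]→ₗ[ℝ] R),
      t.compAlternatingMap (-f) = -t.compAlternatingMap f := by
    intro k f
    ext v
    simp
  induction k with
  | zero =>
    refine ⟨fun a b _ ↦ ?_, fun a b _ ↦ ?_⟩
    · ext v
      simp only [LinearMap.compAlternatingMap_apply, mul_zero_apply]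
      exact ht _ _
    · ext v
      simp only [LinearMap.compAlternatingMap_apply, mul_zero_apply, ε_apply, pow_zero, one_smul]
      exact ht _ _
  | succ k ih =>
    have hadd : ∀ f g : T [⋀^Fin k]→ₗ[ℝ] R,
        t.compAlternatingMap (f + g) = t.compAlternatingMap f + t.compAlternatingMap g := by
      intro f g
      ext v
      simp
    refine ⟨fun a b ha ↦ key _ _ _ fun x ↦ ?_, fun a b ha ↦ key _ _ _ fun x ↦ ?_⟩
    · have h1 : ε (ι x a) = -ι x a := by rw [← neg_eq_iff_eq_neg, ← ι_ε, ha]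
      rw [ι_mul, ι_mul, ha, add_apply, add_apply, hadd, hadd, ih.2 _ _ h1, ih.1 _ _ ha,
        add_comm]
    · have h1 : ε (ι x a) = ι x a := by
        have := ι_ε x a
        rw [ha, map_neg] at this
        exact (neg_injective this).symm
      rw [ι_mul, ι_mul, ha, add_apply, add_apply, hadd, hadd, ih.1 _ _ h1, ε_ε, neg_mul,
        neg_apply, hneg, ih.2 _ _ ha, ι_ε, neg_mul, neg_apply, hneg, add_comm]

section Naturality

variable {T' R' : Type*} [AddCommGroup T'] [Module ℝ T'] [Ring R'] [Algebra ℝ R']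

/-- Pullback by a linear map and composition with an algebra morphism. -/
def map (f : T' →ₗ[ℝ] T) (Φ : R →ₐ[ℝ] R') (a : GForm T R) : GForm T' R' := fun k ↦
  Φ.toLinearMap.compAlternatingMap ((a k).compLinearMap f)

theorem map_apply (f : T' →ₗ[ℝ] T) (Φ : R →ₐ[ℝ] R') (a : GForm T R) (k : ℕ) (v : Fin k → T') :
    map f Φ a k v = Φ (a k (f ∘ v)) := rfl

theorem map_mul (f : T' →ₗ[ℝ] T) (Φ : R →ₐ[ℝ] R') (a b : GForm T R) :
    map f Φ (a * b) = map f Φ a * map f Φ b := by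
  ext k v
  rw [map_apply, mul_apply, mul_apply, map_sum]
  refine Finset.sum_congr rfl fun q _ ↦ ?_
  rw [map_smul, antisymm, map_sum, antisymm]
  congr 1
  refine Finset.sum_congr rfl fun σ _ ↦ ?_
  rw [map_zsmul, tens, tens, map_apply, map_apply, _root_.map_mul]
  have h : ∀ n, f (seqOf (v ∘ σ) n) = seqOf ((f ∘ v) ∘ σ) n := by
    intro n
    simp only [seqOf]
    split_ifs
    · rfl
    · exact map_zero f
  simp only [Function.comp_def] at h ⊢
  simp only [h]

theorem map_one (f : T' →ₗ[ℝ] T) (Φ : R →ₐ[ℝ] R') : map f Φ (1 : GForm T R) = 1 := by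
  ext k v
  cases k with
  | zero => exact _root_.map_one Φ
  | succ k => exact map_zero Φ

theorem map_pow (f : T' →ₗ[ℝ] T) (Φ : R →ₐ[ℝ] R') (a : GForm T R) (n : ℕ) :
    map f Φ (a ^ n) = map f Φ a ^ n := by
  induction n with
  | zero => rw [pow_zero, pow_zero, map_one]
  | succ n ih => rw [pow_succ, pow_succ, map_mul, ih]

end Naturality

end GForm

end GradedForms

end BasicChern
end

noncomputable section
namespace BasicChern

/-! ### The derivative of the exponential series in a Banach algebra -/

section ExpSeries

variable {𝔸 : Type*} [NormedRing 𝔸] [NormedAlgebra ℝ 𝔸] [CompleteSpace 𝔸]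

/-- The derivative of `x ↦ x ^ n` at `x` in the direction `y`. -/
def powDeriv {A : Type*} [Ring A] (x y : A) : ℕ → A
  | 0 => 0
  | n + 1 => powDeriv x y n * x + x ^ n * y

omit [CompleteSpace 𝔸] in
theorem hasDerivAt_pow_curve {a : ℝ → 𝔸} {a' : 𝔸} {s : ℝ} (h : HasDerivAt a a' s) (n : ℕ) :
    HasDerivAt (fun s ↦ a s ^ n) (powDeriv (a s) a' n) s := by
  induction n with
  | zero =>
    simp only [pow_zero]
    exact hasDerivAt_const s (1 : 𝔸)
  | succ n ih =>
    simp only [pow_succ]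
    exact ih.mul h

omit [CompleteSpace 𝔸] in
theorem norm_powDeriv_le {x y : 𝔸} {C : ℝ} (hx : ‖x‖ ≤ C) (hy : ‖y‖ ≤ C) (n : ℕ) :
    ‖powDeriv x y n‖ ≤ n * C ^ n := by
  have hC : 0 ≤ C := (norm_nonneg x).trans hx
  -- Estimating `x ^ n * y` as a whole avoids `‖1‖`, which may exceed `1` in `𝔸`.
  have h1 : ∀ n : ℕ, ‖x ^ n * y‖ ≤ C ^ n * C := by
    intro n
    induction n with
    | zero => simpa using hy
    | succ n ih =>
      rw [pow_succ', mul_assoc]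
      calc ‖x * (x ^ n * y)‖ ≤ ‖x‖ * ‖x ^ n * y‖ := norm_mul_le _ _
        _ ≤ C * (C ^ n * C) := by gcongr
        _ = C ^ (n + 1) * C := by ring
  induction n with
  | zero => simp [powDeriv]
  | succ n ih =>
    calc ‖powDeriv x y (n + 1)‖ ≤ ‖powDeriv x y n * x‖ + ‖x ^ n * y‖ := norm_add_le _ _
      _ ≤ n * C ^ n * C + C ^ n * C := by
        gcongr
        · exact (norm_mul_le _ _).trans (by gcongr)
        · exact h1 n
      _ = ((n + 1 : ℕ) : ℝ) * C ^ (n + 1) := by push_cast; ring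

/-- Analyticity of `exp` gives the derivative along the curve by the chain rule. Its expression as a
series is found by differentiating term by term along the straight line `x + t a'`, which has the
same velocity. As `x` and `a'` need not commute, the terms stay in the form `powDeriv`. -/
theorem hasDerivAt_exp_curve {a : ℝ → 𝔸} {a' : 𝔸} {s : ℝ} (h : HasDerivAt a a' s) :
    ∃ D, HasSum (fun n : ℕ ↦ ((n.factorial : ℝ))⁻¹ • powDeriv (a s) a' n) D ∧
      HasDerivAt (fun s ↦ NormedSpace.exp (a s)) D s := by
  set x := a s
  have hL : HasFDerivAt (NormedSpace.exp : 𝔸 → 𝔸) (fderiv ℝ NormedSpace.exp x) x :=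
    (NormedSpace.exp_analytic (𝕂 := ℝ) x).differentiableAt.hasFDerivAt
  refine ⟨fderiv ℝ NormedSpace.exp x a', ?_, hL.comp_hasDerivAt s h⟩
  have hl : ∀ t : ℝ, HasDerivAt (fun t : ℝ ↦ x + t • a') a' t := by
    intro t
    simpa using ((hasDerivAt_id t).smul_const a').const_add x
  -- This constant bounds both `‖a'‖` and `‖x + t a'‖` for `|t| ≤ 1`, which makes the termwise bound
  -- uniform on the unit ball.
  set C := ‖x‖ + ‖a'‖
  let u : ℕ → ℝ := fun n ↦ ((n.factorial : ℝ))⁻¹ * (n * C ^ n)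
  have hu : Summable u := by
    rw [← summable_nat_add_iff 1]
    have := (Real.summable_pow_div_factorial C).mul_left C
    refine this.congr fun n ↦ ?_
    simp only [u, Nat.factorial_succ]
    push_cast
    field_simp
    ring
  have hb : ∀ (n : ℕ), ∀ t ∈ Metric.ball (0 : ℝ) 1,
      ‖((n.factorial : ℝ))⁻¹ • powDeriv (x + t • a') a' n‖ ≤ u n := by
    intro n t ht
    rw [norm_smul, norm_inv, Real.norm_natCast]
    have ht' : ‖t‖ ≤ 1 := by simpa using (mem_ball_zero_iff.1 ht).le
    have : ‖x + t • a'‖ ≤ C := by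
      refine (norm_add_le _ _).trans ?_
      rw [norm_smul]
      have : ‖t‖ * ‖a'‖ ≤ 1 * ‖a'‖ := by gcongr
      simp only [C]
      linarith
    have h2 : ‖a'‖ ≤ C := by simp [C]
    exact mul_le_mul_of_nonneg_left (norm_powDeriv_le this h2 n) (by positivity)
  have h0 : (0 : ℝ) ∈ Metric.ball (0 : ℝ) 1 := by simp
  have hsum : ∀ t : ℝ, HasSum (fun n : ℕ ↦ ((n.factorial : ℝ))⁻¹ • (x + t • a') ^ n)
      (NormedSpace.exp (x + t • a')) := fun t ↦ NormedSpace.exp_series_hasSum_exp' (𝕂 := ℝ) _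
  have h1 := hasDerivAt_tsum_of_isPreconnected hu Metric.isOpen_ball
    (convex_ball (0 : ℝ) 1).isPreconnected
    (fun n t _ ↦ (hasDerivAt_pow_curve (hl t) n).const_smul ((n.factorial : ℝ))⁻¹)
    hb h0 (hsum 0).summable h0
  have h2 : (fun t : ℝ ↦ ∑' n : ℕ, ((n.factorial : ℝ))⁻¹ • (x + t • a') ^ n) =
      fun t ↦ NormedSpace.exp (x + t • a') := funext fun t ↦ (hsum t).tsum_eq
  have h3 : HasDerivAt (fun t : ℝ ↦ NormedSpace.exp (x + t • a'))
      (fderiv ℝ NormedSpace.exp x a') 0 := by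
    have hL' : HasFDerivAt (NormedSpace.exp : 𝔸 → 𝔸) (fderiv ℝ NormedSpace.exp x)
      (x + (0 : ℝ) • a') := by simpa using hL
    exact hL'.comp_hasDerivAt 0 (hl 0)
  have h1' : HasDerivAt (fun t : ℝ ↦ NormedSpace.exp (x + t • a'))
      (∑' n : ℕ, ((n.factorial : ℝ))⁻¹ • powDeriv (x + (0 : ℝ) • a') a' n) 0 := by
    rw [← h2]
    exact h1
  rw [h3.unique h1']
  have h4 : Summable fun n : ℕ ↦ ((n.factorial : ℝ))⁻¹ • powDeriv (x + (0 : ℝ) • a') a' n :=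
    Summable.of_norm_bounded hu fun n ↦ hb n 0 h0
  simpa using h4.hasSum

end ExpSeries

/-! ### Functions with values in alternating forms -/

section EvalCriteria

variable {T W Q : Type*} [NormedAddCommGroup T] [NormedSpace ℝ T] [FiniteDimensional ℝ T]
  [NormedAddCommGroup W] [NormedSpace ℝ W] [FiniteDimensional ℝ W]
  [NormedAddCommGroup Q] [NormedSpace ℝ Q]

variable (T W) in
/-- The values of an alternating form on the vectors of a basis. -/
def basisValues (k : ℕ) :
    (T [⋀^Fin k]→L[ℝ] W) →ₗ[ℝ] ((Fin k → Fin (Module.finrank ℝ T)) → W) where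
  toFun f I := f fun i ↦ Module.finBasis ℝ T (I i)
  map_add' _ _ := rfl
  map_smul' _ _ := rfl

omit [FiniteDimensional ℝ W] in
theorem basisValues_injective (k : ℕ) : Function.Injective (basisValues T W k) := by
  intro f g h
  have : f.toMultilinearMap = g.toMultilinearMap :=
    Module.Basis.ext_multilinear (fun _ ↦ Module.finBasis ℝ T) fun I ↦ congrFun h I
  ext v
  exact congrArg (fun m ↦ m v) this

instance (k : ℕ) : FiniteDimensional ℝ (T [⋀^Fin k]→L[ℝ] W) :=
  FiniteDimensional.of_injective (basisValues T W k) (basisValues_injective k)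

/-- A form is recovered from its values on basis vectors by a continuous linear map. Hence
smoothness, derivatives and convergence of form-valued functions may be tested on fixed vectors. -/
theorem exists_basisValues_leftInverse (k : ℕ) :
    ∃ L : ((Fin k → Fin (Module.finrank ℝ T)) → W) →L[ℝ] (T [⋀^Fin k]→L[ℝ] W),
      ∀ f, L (basisValues T W k f) = f := by
  obtain ⟨L, hL⟩ := LinearMap.exists_leftInverse_of_injective (basisValues T W k)
    (LinearMap.ker_eq_bot.2 (basisValues_injective k))
  exact ⟨L.toContinuousLinearMap, fun f ↦ DFunLike.congr_fun hL f⟩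

theorem contDiffAt_alternating {k : ℕ} {n : WithTop ℕ∞} {f : Q → T [⋀^Fin k]→L[ℝ] W} {q : Q}
    (h : ∀ v, ContDiffAt ℝ n (fun q ↦ f q v) q) : ContDiffAt ℝ n f q := by
  obtain ⟨L, hL⟩ := exists_basisValues_leftInverse (T := T) (W := W) k
  have : f = L ∘ fun q ↦ basisValues T W k (f q) := funext fun q ↦ (hL _).symm
  rw [this]
  exact L.contDiff.contDiffAt.comp q (contDiffAt_pi.2 fun I ↦ h _)

theorem hasDerivAt_alternating {k : ℕ} {f : ℝ → T [⋀^Fin k]→L[ℝ] W} {f' : T [⋀^Fin k]→L[ℝ] W}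
    {s : ℝ} (h : ∀ v, HasDerivAt (fun s ↦ f s v) (f' v) s) : HasDerivAt f f' s := by
  obtain ⟨L, hL⟩ := exists_basisValues_leftInverse (T := T) (W := W) k
  have h1 : f = L ∘ fun q ↦ basisValues T W k (f q) := funext fun q ↦ (hL _).symm
  rw [h1, ← hL f']
  exact L.hasFDerivAt.comp_hasDerivAt s (hasDerivAt_pi.2 fun I ↦ h _)

end EvalCriteria

namespace GForm

/-! ### Componentwise series and derivatives, truncation, the exponential of a form -/

section Analysis

variable {T R : Type*} [NormedAddCommGroup T] [NormedSpace ℝ T]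
  [NormedRing R] [NormedAlgebra ℝ R]

/-- Sums of series of forms, componentwise on each family of vectors. -/
def HasGSum (f : ℕ → GForm T R) (S : GForm T R) : Prop :=
  ∀ k v, HasSum (fun n ↦ f n k v) (S k v)

/-- The derivative of a curve of forms, componentwise on each family of vectors. -/
def HasGDeriv (A : ℝ → GForm T R) (A' : GForm T R) (s : ℝ) : Prop :=
  ∀ k v, HasDerivAt (fun s ↦ A s k v) (A' k v) s

/-- Smoothness of a family of forms, componentwise on each family of vectors. -/
def GSmoothAt {Q : Type*} [NormedAddCommGroup Q] [NormedSpace ℝ Q] (A : Q → GForm T R) (q : Q) :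
    Prop := ∀ k v, ContDiffAt ℝ ∞ (fun q ↦ A q k v) q

theorem HasGSum.unique {f : ℕ → GForm T R} {S S' : GForm T R} (h : HasGSum f S)
    (h' : HasGSum f S') : S = S' := by
  ext k v
  exact (h k v).unique (h' k v)

theorem HasGSum.add {f g : ℕ → GForm T R} {S S' : GForm T R} (h : HasGSum f S)
    (h' : HasGSum g S') : HasGSum (fun n ↦ f n + g n) (S + S') := fun k v ↦ (h k v).add (h' k v)

theorem HasGSum.sub {f g : ℕ → GForm T R} {S S' : GForm T R} (h : HasGSum f S)
    (h' : HasGSum g S') : HasGSum (fun n ↦ f n - g n) (S - S') := fun k v ↦ (h k v).sub (h' k v)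

theorem HasGSum.ι {f : ℕ → GForm T R} {S : GForm T R} (h : HasGSum f S) (x : T) :
    HasGSum (fun n ↦ GForm.ι x (f n)) (GForm.ι x S) := fun _ _ ↦ h _ _

theorem HasGSum.mul_left {f : ℕ → GForm T R} {S : GForm T R} (h : HasGSum f S) (a : GForm T R) :
    HasGSum (fun n ↦ a * f n) (a * S) := by
  intro k v
  simp only [mul_apply]
  refine hasSum_sum fun q _ ↦ HasSum.const_smul _ (hasSum_sum fun σ _ ↦ HasSum.const_smul _ ?_)
  exact HasSum.mul_left _ (h _ _)

theorem HasGSum.mul_right {f : ℕ → GForm T R} {S : GForm T R} (h : HasGSum f S) (a : GForm T R) :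
    HasGSum (fun n ↦ f n * a) (S * a) := by
  intro k v
  simp only [mul_apply]
  refine hasSum_sum fun q _ ↦ HasSum.const_smul _ (hasSum_sum fun σ _ ↦ HasSum.const_smul _ ?_)
  exact HasSum.mul_right _ (h _ _)

theorem HasGSum.alt {φ : ℕ → T →ₗ[ℝ] GForm T R} {ψ : T →ₗ[ℝ] GForm T R}
    (h : ∀ u, HasGSum (fun n ↦ φ n u) (ψ u)) : HasGSum (fun n ↦ GForm.alt (φ n)) (GForm.alt ψ) := by
  intro k v
  cases k with
  | zero => exact hasSum_zero
  | succ k =>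
    simp only [alt_succ_apply]
    exact hasSum_sum fun i _ ↦ HasSum.const_smul _ (h _ _ _)

theorem HasGSum.der {f : ℕ → GForm T R} {S : GForm T R} (h : HasGSum f S) (B : T →ₗ[ℝ] T) :
    HasGSum (fun n ↦ GForm.der B (f n)) (GForm.der B S) := HasGSum.alt fun u ↦ h.ι (B u)

theorem HasGSum.ε {f : ℕ → GForm T R} {S : GForm T R} (h : HasGSum f S) :
    HasGSum (fun n ↦ GForm.ε (f n)) (GForm.ε S) := fun k v ↦ (h k v).const_smul _

theorem HasGDeriv.mul {A B : ℝ → GForm T R} {A' B' : GForm T R} {s : ℝ} (hA : HasGDeriv A A' s)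
    (hB : HasGDeriv B B' s) : HasGDeriv (fun s ↦ A s * B s) (A' * B s + A s * B') s := by
  intro k v
  simp only [mul_apply, add_apply, AlternatingMap.add_apply, ← Finset.sum_add_distrib, ← smul_add,
    antisymm]
  refine HasDerivAt.fun_sum fun q _ ↦ HasDerivAt.fun_const_smul _ ?_
  refine HasDerivAt.fun_sum fun σ _ ↦ HasDerivAt.fun_const_smul _ ?_
  exact (hA _ _).mul (hB _ _)

variable {Q : Type*} [NormedAddCommGroup Q] [NormedSpace ℝ Q]

theorem GSmoothAt.add {A B : Q → GForm T R} {q : Q} (hA : GSmoothAt A q) (hB : GSmoothAt B q) :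
    GSmoothAt (fun q ↦ A q + B q) q := fun k v ↦ (hA k v).add (hB k v)

theorem GSmoothAt.sub {A B : Q → GForm T R} {q : Q} (hA : GSmoothAt A q) (hB : GSmoothAt B q) :
    GSmoothAt (fun q ↦ A q - B q) q := fun k v ↦ (hA k v).sub (hB k v)

theorem GSmoothAt.mul {A B : Q → GForm T R} {q : Q} (hA : GSmoothAt A q) (hB : GSmoothAt B q) :
    GSmoothAt (fun q ↦ A q * B q) q := by
  intro k v
  simp only [mul_apply]
  refine ContDiffAt.sum fun p _ ↦ ContDiffAt.const_smul _
    (ContDiffAt.sum fun σ _ ↦ ContDiffAt.const_smul _ ?_)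
  exact (hA _ _).mul (hB _ _)

variable [FiniteDimensional ℝ T] [FiniteDimensional ℝ R]

variable (T R) in
/-- The forms of degree at most `N`. -/
def TForm (N : ℕ) : Type _ := ∀ j : Fin (N + 1), T [⋀^Fin (j : ℕ)]→L[ℝ] R

instance (N : ℕ) : NormedAddCommGroup (TForm T R N) :=
  inferInstanceAs (NormedAddCommGroup (∀ j : Fin (N + 1), T [⋀^Fin (j : ℕ)]→L[ℝ] R))

instance (N : ℕ) : NormedSpace ℝ (TForm T R N) :=
  inferInstanceAs (NormedSpace ℝ (∀ j : Fin (N + 1), T [⋀^Fin (j : ℕ)]→L[ℝ] R))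

instance (N : ℕ) : FiniteDimensional ℝ (TForm T R N) :=
  inferInstanceAs (FiniteDimensional ℝ (∀ j : Fin (N + 1), T [⋀^Fin (j : ℕ)]→L[ℝ] R))

instance (N : ℕ) : CompleteSpace (TForm T R N) := FiniteDimensional.complete ℝ _

variable (T R) in
/-- The component of degree `N`. -/
def topProj (N : ℕ) : TForm T R N →L[ℝ] (T [⋀^Fin N]→L[ℝ] R) :=
  ContinuousLinearMap.proj (R := ℝ) (φ := fun j : Fin (N + 1) ↦ T [⋀^Fin (j : ℕ)]→L[ℝ] R)
      (Fin.last N)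

/-- Truncation. -/
def trunc (N : ℕ) : GForm T R →ₗ[ℝ] TForm T R N where
  toFun a j := toCont (a j)
  map_add' _ _ := rfl
  map_smul' _ _ := rfl

/-- Extension by zero of truncated forms. -/
def extend (N : ℕ) : TForm T R N →ₗ[ℝ] GForm T R where
  toFun b k := if h : k < N + 1 then (b ⟨k, h⟩).toAlternatingMap else 0
  map_add' b b' := by
    funext k
    change (if h : k < N + 1 then ((b + b') ⟨k, h⟩).toAlternatingMap else 0 : T [⋀^Fin k]→ₗ[ℝ] R) =
      (if h : k < N + 1 then (b ⟨k, h⟩).toAlternatingMap else 0 : T [⋀^Fin k]→ₗ[ℝ] R) +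
        (if h : k < N + 1 then (b' ⟨k, h⟩).toAlternatingMap else 0 : T [⋀^Fin k]→ₗ[ℝ] R)
    split_ifs
    · rfl
    · exact (add_zero 0).symm
  map_smul' c b := by
    funext k
    change (if h : k < N + 1 then ((c • b) ⟨k, h⟩).toAlternatingMap else 0 : T [⋀^Fin k]→ₗ[ℝ] R) =
      c • (if h : k < N + 1 then (b ⟨k, h⟩).toAlternatingMap else 0 : T [⋀^Fin k]→ₗ[ℝ] R)
    split_ifs
    · rfl
    · exact (smul_zero c).symm

theorem extend_trunc_apply {N k : ℕ} (h : k < N + 1) (a : GForm T R) :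
    extend N (trunc N a) k = a k := by
  change (if h : k < N + 1 then (trunc N a ⟨k, h⟩).toAlternatingMap else 0) = a k
  rw [dif_pos h]
  rfl

/-- Right multiplication by a form on truncated forms. -/
def rmulAux (N : ℕ) (a : GForm T R) : TForm T R N →L[ℝ] TForm T R N :=
  LinearMap.toContinuousLinearMap (trunc N ∘ₗ LinearMap.mulRight ℝ a ∘ₗ extend N)

theorem rmulAux_apply (N : ℕ) (a : GForm T R) (b : TForm T R N) :
    rmulAux N a b = trunc N (extend N b * a) := rfl

variable (T R) in
/-- Right multiplication on truncated forms. -/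
def rmul (N : ℕ) : TForm T R N →L[ℝ] TForm T R N →L[ℝ] TForm T R N :=
  LinearMap.toContinuousLinearMap
    { toFun := fun a : TForm T R N ↦ rmulAux N (extend N a)
      map_add' := fun a a' ↦ by
        refine ContinuousLinearMap.ext fun b ↦ ?_
        rw [ContinuousLinearMap.add_apply]
        simp only [rmulAux_apply]
        rw [map_add, mul_add, map_add]
      map_smul' := fun c a ↦ by
        refine ContinuousLinearMap.ext fun b ↦ ?_
        rw [RingHom.id_apply, ContinuousLinearMap.smul_apply]
        simp only [rmulAux_apply]
        rw [map_smul, mul_smul_comm, map_smul] }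

theorem rmul_apply (N : ℕ) (a b : TForm T R N) :
    rmul T R N a b = trunc N (extend N b * extend N a) := rfl

/-- Components of degree at most `N` of a product depend only on components of degree at most `N` of
the factors. So products can be studied on a finite dimensional space, where right multiplication is
a bounded operator and has an exponential. -/
theorem rmul_trunc (N : ℕ) (a b : GForm T R) :
    rmul T R N (trunc N a) (trunc N b) = trunc N (b * a) := by
  rw [rmul_apply]
  funext j
  ext v
  change (extend N (trunc N b) * extend N (trunc N a)) j v = (b * a) j v
  rw [mul_apply, mul_apply]
  refine Finset.sum_congr rfl fun q hq ↦ ?_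
  have h := Finset.HasAntidiagonal.mem_antidiagonal.1 hq
  rw [extend_trunc_apply (by omega), extend_trunc_apply (by omega)]

theorem rmul_pow (N : ℕ) (a : GForm T R) (n : ℕ) :
    (rmul T R N (trunc N a) ^ n) (trunc N 1) = trunc N (a ^ n) := by
  induction n with
  | zero => rw [pow_zero, pow_zero]; rfl
  | succ n ih => rw [pow_succ', ContinuousLinearMap.mul_apply, ih, rmul_trunc, pow_succ]

/-- The exponential `exp(-a)` in the algebra of forms of mixed degree. -/
def expNeg (a : GForm T R) : GForm T R := fun k ↦
  (topProj T R k (NormedSpace.exp (-(rmul T R k (trunc k a))) (trunc k 1))).toAlternatingMap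

/-- Evaluation of truncated operators. -/
def evalOp (k : ℕ) (v : Fin k → T) : (TForm T R k →L[ℝ] TForm T R k) →L[ℝ] R :=
  (ContinuousAlternatingMap.apply ℝ T R v).comp
    ((topProj T R k).comp (ContinuousLinearMap.apply ℝ (TForm T R k) (trunc k 1)))

theorem evalOp_apply (k : ℕ) (v : Fin k → T) (A : TForm T R k →L[ℝ] TForm T R k) :
    evalOp k v A = topProj T R k (A (trunc k 1)) v := rfl

theorem expNeg_apply (a : GForm T R) (k : ℕ) (v : Fin k → T) :
    expNeg a k v = evalOp k v (NormedSpace.exp (-(rmul T R k (trunc k a)))) := rfl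

/-- The coefficients of the series of `exp(-x)`. -/
def expCoeff (n : ℕ) : ℝ := (-1) ^ n / n.factorial

theorem evalOp_neg_rmul_pow (k : ℕ) (v : Fin k → T) (a : GForm T R) (n : ℕ) :
    evalOp k v ((-(rmul T R k (trunc k a))) ^ n) = (-1 : ℝ) ^ n • (a ^ n) k v := by
  have h : (-(rmul T R k (trunc k a))) ^ n = (-1 : ℝ) ^ n • (rmul T R k (trunc k a)) ^ n := by
    rw [← neg_one_smul ℝ (rmul T R k (trunc k a)), smul_pow]
  rw [h, map_smul, evalOp_apply, rmul_pow]
  rfl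

/-- In degree `k`, the form `a ^ n` is the top component of the `n`-th power of right multiplication
applied to `1`, so the operator series becomes a series of forms. The algebraic properties of
`expNeg` are read off from it by uniqueness of sums. -/
theorem hasGSum_expNeg (a : GForm T R) : HasGSum (fun n ↦ expCoeff n • a ^ n) (expNeg a) := by
  intro k v
  have h := (evalOp (R := R) k v).hasSum (NormedSpace.exp_series_hasSum_exp' (𝕂 := ℝ)
    (-(rmul T R k (trunc k a))))
  rw [expNeg_apply]
  convert h using 2 with n
  change ((-1) ^ n / (n.factorial : ℝ)) • (a ^ n) k v = _
  rw [map_smul, evalOp_neg_rmul_pow, smul_smul, div_eq_inv_mul]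

theorem trunc_hasDerivAt {A : ℝ → GForm T R} {A' : GForm T R} {s : ℝ} (hA : HasGDeriv A A' s)
    (k : ℕ) : HasDerivAt (fun s ↦ trunc k (A s)) (trunc k A') s :=
  hasDerivAt_pi.2 fun j ↦ hasDerivAt_alternating fun v ↦ hA j v

theorem GSmoothAt.expNeg {A : Q → GForm T R} {q : Q} (hA : GSmoothAt A q) :
    GSmoothAt (fun q ↦ expNeg (A q)) q := by
  intro k v
  have h1 : ContDiffAt ℝ ∞ (fun q ↦ trunc k (A q)) q :=
    contDiffAt_pi.2 fun j ↦ contDiffAt_alternating fun v ↦ hA j v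
  have h2 : ContDiffAt ℝ ∞ (fun q ↦ -(rmul T R k (trunc k (A q)))) q :=
    ((rmul T R k).contDiff.contDiffAt.comp q h1).neg
  have h3 : ContDiffAt ℝ ∞ (NormedSpace.exp : (TForm T R k →L[ℝ] TForm T R k) → _)
      (-(rmul T R k (trunc k (A q)))) := (NormedSpace.exp_analytic (𝕂 := ℝ) _).contDiffAt
  exact (evalOp k v).contDiff.contDiffAt.comp q (h3.comp q h2)

theorem HasGDeriv.pow {A : ℝ → GForm T R} {A' : GForm T R} {s : ℝ} (hA : HasGDeriv A A' s)
    (n : ℕ) : HasGDeriv (fun s ↦ A s ^ n) (powDeriv (A s) A' n) s := by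
  induction n with
  | zero =>
    intro k v
    simp only [pow_zero]
    exact hasDerivAt_const _ _
  | succ n ih =>
    simp only [pow_succ]
    exact ih.mul hA

/-- The termwise derivative is supplied by `hasDerivAt_exp_curve` for the operators of right
multiplication; uniqueness of derivatives identifies its sum with the given `D`. -/
theorem HasGDeriv.hasGSum_expNeg {A : ℝ → GForm T R} {A' D : GForm T R} {s : ℝ}
    (hA : HasGDeriv A A' s) (hD : HasGDeriv (fun s ↦ GForm.expNeg (A s)) D s) :
    HasGSum (fun n ↦ expCoeff n • powDeriv (A s) A' n) D := by
  intro k v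
  have h1 : HasDerivAt (fun s ↦ -(rmul T R k (trunc k (A s)))) (-(rmul T R k (trunc k A'))) s :=
    ((rmul T R k).hasFDerivAt.comp_hasDerivAt s (trunc_hasDerivAt hA k)).neg
  obtain ⟨S, hS, hS'⟩ := hasDerivAt_exp_curve h1
  have h2 : HasDerivAt (fun s ↦ GForm.expNeg (A s) k v) (evalOp k v S) s :=
    (evalOp (R := R) k v).hasFDerivAt.comp_hasDerivAt s hS'
  rw [(hD k v).unique h2]
  have h3 := (evalOp (R := R) k v).hasSum hS
  convert h3 using 2 with n
  have h4 := ((evalOp (R := R) k v).hasFDerivAt.comp_hasDerivAt s (hasDerivAt_pow_curve h1 n))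
  have h5 : (fun s ↦ evalOp k v ((-(rmul T R k (trunc k (A s)))) ^ n)) =
      fun s ↦ (-1 : ℝ) ^ n • (A s ^ n) k v := by
    funext s
    rw [evalOp_neg_rmul_pow]
  have h6 := ((hA.pow n) k v).fun_const_smul ((-1 : ℝ) ^ n)
  rw [Function.comp_def, h5] at h4
  change ((-1) ^ n / (n.factorial : ℝ)) • powDeriv (A s) A' n k v = _
  rw [map_smul, ← h6.unique h4, smul_smul, div_eq_inv_mul]

end Analysis

end GForm
end BasicChern
end

noncomputable section
namespace BasicChern

namespace GForm

/-! ### Exterior calculus of families of forms of mixed degree on a vector space -/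

section Calculus

variable {T R : Type*} [NormedAddCommGroup T] [NormedSpace ℝ T] [FiniteDimensional ℝ T]
  [NormedRing R] [NormedAlgebra ℝ R] [FiniteDimensional ℝ R]
  {Q : Type*} [NormedAddCommGroup Q] [NormedSpace ℝ Q]

/-- The derivative of a map with values in the forms of mixed degree. -/
def gfderiv (A : Q → GForm T R) (q : Q) : Q →ₗ[ℝ] GForm T R where
  toFun u k := (fderiv ℝ (fun y ↦ toCont (A y k)) q u).toAlternatingMap
  map_add' u w := by
    funext k
    rw [map_add]
    rfl
  map_smul' c u := by
    funext k
    rw [map_smul]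
    rfl

theorem GSmoothAt.contDiffAt {A : Q → GForm T R} {q : Q} (hA : GSmoothAt A q) (k : ℕ) :
    ContDiffAt ℝ ∞ (fun y ↦ toCont (A y k)) q := contDiffAt_alternating fun v ↦ hA k v

theorem GSmoothAt.hasGDeriv {A : Q → GForm T R} {q : Q} (hA : GSmoothAt A q) {f : ℝ → Q} {u : Q}
    {s : ℝ} (hf : HasDerivAt f u s) (hs : f s = q) :
    HasGDeriv (fun s ↦ A (f s)) (gfderiv A q u) s := by
  intro k v
  subst hs
  have h1 : HasFDerivAt (fun y ↦ toCont (A y k)) _ (f s) :=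
    ((hA.contDiffAt k).differentiableAt (by simp)).hasFDerivAt
  have h2 := h1.comp_hasDerivAt s hf
  exact (ContinuousAlternatingMap.apply ℝ T R v).hasFDerivAt.comp_hasDerivAt s h2

theorem hasDerivAt_line (q u : Q) : HasDerivAt (fun s : ℝ ↦ q + s • u) u 0 := by
  simpa using ((hasDerivAt_id (0 : ℝ)).smul_const u).const_add q

theorem GSmoothAt.hasGDeriv_line {A : Q → GForm T R} {q : Q} (hA : GSmoothAt A q) (u : Q) :
    HasGDeriv (fun s : ℝ ↦ A (q + s • u)) (gfderiv A q u) 0 :=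
  hA.hasGDeriv (hasDerivAt_line q u) (by simp)

theorem GSmoothAt.gfderiv_eq {A : Q → GForm T R} {q u : Q} {D : GForm T R} (hA : GSmoothAt A q)
    (hD : HasGDeriv (fun s : ℝ ↦ A (q + s • u)) D 0) : gfderiv A q u = D := by
  ext k v
  exact (hA.hasGDeriv_line u k v).unique (hD k v)

theorem gfderiv_congr {A B : Q → GForm T R} {q : Q} (h : A =ᶠ[nhds q] B) :
    gfderiv A q = gfderiv B q := by
  ext u k v
  change fderiv ℝ (fun y ↦ toCont (A y k)) q u v = fderiv ℝ (fun y ↦ toCont (B y k)) q u v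
  have : (fun y ↦ toCont (A y k)) =ᶠ[nhds q] fun y ↦ toCont (B y k) := by
    filter_upwards [h] with y hy
    rw [hy]
  rw [this.fderiv_eq]

theorem gfderiv_mul {A B : Q → GForm T R} {q : Q} (hA : GSmoothAt A q) (hB : GSmoothAt B q)
    (u : Q) : gfderiv (fun q ↦ A q * B q) q u = gfderiv A q u * B q + A q * gfderiv B q u := by
  refine (hA.mul hB).gfderiv_eq ?_
  have := (hA.hasGDeriv_line u).mul (hB.hasGDeriv_line u)
  simpa using this

theorem gfderiv_add {A B : Q → GForm T R} {q : Q} (hA : GSmoothAt A q) (hB : GSmoothAt B q) :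
    gfderiv (fun q ↦ A q + B q) q = gfderiv A q + gfderiv B q := by
  ext1 u
  exact (hA.add hB).gfderiv_eq fun k v ↦
    (hA.hasGDeriv_line u k v).add (hB.hasGDeriv_line u k v)

theorem gfderiv_sub {A B : Q → GForm T R} {q : Q} (hA : GSmoothAt A q) (hB : GSmoothAt B q) :
    gfderiv (fun q ↦ A q - B q) q = gfderiv A q - gfderiv B q := by
  ext1 u
  exact (hA.sub hB).gfderiv_eq fun k v ↦
    (hA.hasGDeriv_line u k v).sub (hB.hasGDeriv_line u k v)

-- Expansion in a basis trades a varying contracting vector for scalar coefficients and fixed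
-- vectors, which is what componentwise calculus can handle.
omit [FiniteDimensional ℝ R] in
theorem ι_apply_eq_sum (x : T) (a : GForm T R) (k : ℕ) (v : Fin k → T) :
    ι x a k v = ∑ i, (Module.finBasis ℝ T).repr x i • ι (Module.finBasis ℝ T i) a k v := by
  let φ : T →ₗ[ℝ] R :=
    { toFun := fun x ↦ ι x a k v
      map_add' := fun x y ↦ by rw [map_add]; rfl
      map_smul' := fun c x ↦ by rw [map_smul]; rfl }
  change φ x = ∑ i, (Module.finBasis ℝ T).repr x i • φ (Module.finBasis ℝ T i)
  conv_lhs => rw [← (Module.finBasis ℝ T).sum_repr x, map_sum]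
  simp only [map_smul]

theorem contDiff_repr (i : Fin (Module.finrank ℝ T)) :
    ContDiff ℝ ∞ (fun x : T ↦ (Module.finBasis ℝ T).repr x i) :=
  (LinearMap.toContinuousLinearMap ((Module.finBasis ℝ T).coord i)).contDiff

theorem GSmoothAt.ι {A : Q → GForm T R} {X : Q → T} {q : Q} (hA : GSmoothAt A q)
    (hX : ContDiffAt ℝ ∞ X q) : GSmoothAt (fun q ↦ GForm.ι (X q) (A q)) q := fun k v ↦ by
  simp only [ι_apply_eq_sum (X _)]
  exact ContDiffAt.sum fun i _ ↦ ContDiffAt.smul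
    ((contDiff_repr (T := T) i).contDiffAt.comp q hX) (hA (k + 1) _)

theorem gfderiv_ι {A : Q → GForm T R} {X : Q → T} {q : Q} (hA : GSmoothAt A q)
    (hX : ContDiffAt ℝ ∞ X q) (u : Q) : gfderiv (fun q ↦ GForm.ι (X q) (A q)) q u =
      GForm.ι (X q) (gfderiv A q u) + GForm.ι (fderiv ℝ X q u) (A q) := by
  refine (hA.ι hX).gfderiv_eq fun k v ↦ ?_
  have h2 : HasDerivAt (fun s : ℝ ↦ X (q + s • u)) (fderiv ℝ X q u) 0 := by
    have h3 : HasFDerivAt X (fderiv ℝ X q) (q + (0 : ℝ) • u) := by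
      simpa using (hX.differentiableAt (by simp)).hasFDerivAt
    exact h3.comp_hasDerivAt 0 (hasDerivAt_line q u)
  change HasDerivAt _ (GForm.ι (X q) (gfderiv A q u) k v + GForm.ι (fderiv ℝ X q u) (A q) k v) 0
  simp only [ι_apply_eq_sum (X _), ι_apply_eq_sum (fderiv ℝ X q u), ← Finset.sum_add_distrib]
  refine HasDerivAt.fun_sum fun i _ ↦ ?_
  have h3 := ((LinearMap.toContinuousLinearMap
    ((Module.finBasis ℝ T).coord i)).hasFDerivAt.comp_hasDerivAt (0 : ℝ) h2).smul
    (hA.hasGDeriv_line u (k + 1) (Matrix.vecCons (Module.finBasis ℝ T i) v))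
  simp only [Function.comp_apply, zero_smul, add_zero] at h3
  exact h3

/-- The exterior derivative of a form of mixed degree. -/
def dG (A : T → GForm T R) (x : T) : GForm T R := alt (gfderiv A x)

theorem dG_zero_apply (A : T → GForm T R) (x : T) : dG A x 0 = 0 := rfl

theorem dG_succ_apply (A : T → GForm T R) (x : T) (k : ℕ) :
    dG A x (k + 1) = (extDeriv (fun y ↦ toCont (A y k)) x).toAlternatingMap := by
  ext v
  change alt (gfderiv A x) (k + 1) v = extDeriv (fun y ↦ toCont (A y k)) x v
  rw [alt_succ_apply, extDeriv, ContinuousAlternatingMap.alternatizeUncurryFin_apply]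
  rfl

theorem dG_congr {A B : T → GForm T R} {x : T} (h : A =ᶠ[nhds x] B) : dG A x = dG B x := by
  rw [dG, dG, gfderiv_congr h]

theorem dG_add {A B : T → GForm T R} {x : T} (hA : GSmoothAt A x) (hB : GSmoothAt B x) :
    dG (fun y ↦ A y + B y) x = dG A x + dG B x := by
  rw [dG, gfderiv_add hA hB, map_add, dG, dG]

theorem dG_sub {A B : T → GForm T R} {x : T} (hA : GSmoothAt A x) (hB : GSmoothAt B x) :
    dG (fun y ↦ A y - B y) x = dG A x - dG B x := by
  rw [dG, gfderiv_sub hA hB, map_sub, dG, dG]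

theorem dG_mul {A B : T → GForm T R} {x : T} (hA : GSmoothAt A x) (hB : GSmoothAt B x) :
    dG (fun y ↦ A y * B y) x = dG A x * B x + ε (A x) * dG B x := by
  have h : gfderiv (fun y ↦ A y * B y) x = LinearMap.mulRight ℝ (B x) ∘ₗ gfderiv A x +
      LinearMap.mulLeft ℝ (A x) ∘ₗ gfderiv B x := by
    ext1 u
    exact gfderiv_mul hA hB u
  rw [dG, h, map_add, alt_mulRight, alt_mulLeft, dG, dG]

/-- The Lie derivative, by Cartan's formula. -/
theorem dG_ι {A : T → GForm T R} {X : T → T} {x : T} (hA : GSmoothAt A x)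
    (hX : ContDiffAt ℝ ∞ X x) : dG (fun y ↦ GForm.ι (X y) (A y)) x + GForm.ι (X x) (dG A x) =
      gfderiv A x (X x) + der (fderiv ℝ X x) (A x) := by
  have h : gfderiv (fun y ↦ GForm.ι (X y) (A y)) x = GForm.ι (X x) ∘ₗ gfderiv A x +
      GForm.ι.flip (A x) ∘ₗ (fderiv ℝ X x : T →ₗ[ℝ] T) := by
    ext1 u
    exact gfderiv_ι hA hX u
  rw [dG, h, map_add, dG, ι_alt, der]
  abel

/-! ### Forms of a single degree -/

omit [FiniteDimensional ℝ T] [FiniteDimensional ℝ R] in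
variable (R) in
/-- A form of degree `k` as a form of mixed degree. -/
def single (k : ℕ) (a : T [⋀^Fin k]→L[ℝ] R) : GForm T R :=
  (Pi.single k a.toAlternatingMap : ∀ j : ℕ, T [⋀^Fin j]→ₗ[ℝ] R)

omit [FiniteDimensional ℝ T] [FiniteDimensional ℝ R] in
theorem single_same (k : ℕ) (a : T [⋀^Fin k]→L[ℝ] R) : single R k a k = a.toAlternatingMap :=
  Pi.single_eq_same k _

omit [FiniteDimensional ℝ T] [FiniteDimensional ℝ R] in
theorem single_ne {k j : ℕ} (h : j ≠ k) (a : T [⋀^Fin k]→L[ℝ] R) : single R k a j = 0 :=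
  Pi.single_eq_of_ne h _

omit [FiniteDimensional ℝ T] [FiniteDimensional ℝ R] in
theorem gSmoothAt_single {k : ℕ} {a : Q → T [⋀^Fin k]→L[ℝ] R} {q : Q}
    (h : ContDiffAt ℝ ∞ a q) : GSmoothAt (fun q ↦ single R k (a q)) q := by
  intro j v
  by_cases hj : j = k
  · subst hj
    simp only [single_same]
    exact (ContinuousAlternatingMap.apply ℝ T R v).contDiff.contDiffAt.comp q h
  · simp only [single_ne hj]
    exact contDiffAt_const

theorem dG_single {k : ℕ} (a : T → T [⋀^Fin k]→L[ℝ] R) (x : T) :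
    dG (fun y ↦ single R k (a y)) x = single R (k + 1) (extDeriv a x) := by
  ext1 j
  cases j with
  | zero => rw [dG_zero_apply, single_ne (by omega)]
  | succ j =>
    rw [dG_succ_apply]
    by_cases hj : j = k
    · subst hj
      rw [single_same]
      congr 2
      funext y
      rw [single_same]
      rfl
    · rw [single_ne (by omega)]
      have : (fun y ↦ toCont (single R k (a y) j)) = fun _ ↦ (0 : T [⋀^Fin j]→L[ℝ] R) := by
        funext y
        rw [single_ne hj]
        rfl
      rw [this]
      ext v
      simp [extDeriv, ContinuousAlternatingMap.alternatizeUncurryFin_apply]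

omit [FiniteDimensional ℝ T] [FiniteDimensional ℝ R] in
theorem ι_single_succ (k : ℕ) (a : T [⋀^Fin (k + 1)]→L[ℝ] R) (x : T) :
    ι x (single R (k + 1) a) = single R k (a.curryLeft x) := by
  ext1 j
  rw [ι_apply]
  by_cases h : j = k
  · subst h
    rw [single_same, single_same]
    rfl
  · rw [single_ne h, single_ne (by omega)]
    rfl

/-! ### Traces -/

section Trace

variable (t : R →ₗ[ℝ] ℂ)

omit [FiniteDimensional ℝ T] [FiniteDimensional ℝ R] in
/-- The composition of a form of mixed degree with a linear form on the algebra of values. -/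
def trc : GForm T R →ₗ[ℝ] GForm T ℂ where
  toFun a k := t.compAlternatingMap (a k)
  map_add' a b := by
    ext k v
    exact map_add t _ _
  map_smul' c a := by
    ext k v
    exact map_smul t c _

omit [FiniteDimensional ℝ T] [FiniteDimensional ℝ R] in
theorem trc_apply (a : GForm T R) (k : ℕ) (v : Fin k → T) : trc t a k v = t (a k v) := rfl

omit [FiniteDimensional ℝ T] [FiniteDimensional ℝ R] in
theorem trc_ι (x : T) (a : GForm T R) : trc t (ι x a) = ι x (trc t a) := rfl

omit [FiniteDimensional ℝ T] [FiniteDimensional ℝ R] in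
theorem trc_alt (φ : T →ₗ[ℝ] GForm T R) : trc t (alt φ) = alt (trc t ∘ₗ φ) := by
  ext k v
  cases k with
  | zero =>
    rw [trc_apply]
    exact map_zero t
  | succ k =>
    rw [trc_apply, alt_succ_apply, alt_succ_apply, map_sum]
    exact Finset.sum_congr rfl fun i _ ↦ map_zsmul t _ _

variable {t}

theorem HasGSum.trc {f : ℕ → GForm T R} {S : GForm T R} (h : HasGSum f S) :
    HasGSum (fun n ↦ GForm.trc t (f n)) (GForm.trc t S) := fun k v ↦
  (t.toContinuousLinearMap).hasSum (h k v)

theorem HasGDeriv.trc {A : ℝ → GForm T R} {A' : GForm T R} {s : ℝ} (h : HasGDeriv A A' s) :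
    HasGDeriv (fun s ↦ GForm.trc t (A s)) (GForm.trc t A') s := fun k v ↦
  (t.toContinuousLinearMap).hasFDerivAt.comp_hasDerivAt s (h k v)

theorem GSmoothAt.trc {A : Q → GForm T R} {q : Q} (h : GSmoothAt A q) :
    GSmoothAt (fun q ↦ GForm.trc t (A q)) q := fun k v ↦
  (t.toContinuousLinearMap).contDiff.contDiffAt.comp q (h k v)

theorem gfderiv_trc {A : Q → GForm T R} {q : Q} (h : GSmoothAt A q) :
    gfderiv (fun q ↦ GForm.trc t (A q)) q = GForm.trc t ∘ₗ gfderiv A q := by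
  ext1 u
  exact h.trc.gfderiv_eq (h.hasGDeriv_line u).trc

theorem dG_trc {A : T → GForm T R} {x : T} (h : GSmoothAt A x) :
    dG (fun q ↦ GForm.trc t (A q)) x = GForm.trc t (dG A x) := by
  rw [dG, gfderiv_trc h, dG, trc_alt]

omit [FiniteDimensional ℝ T] [FiniteDimensional ℝ R] in
theorem trc_mul_comm (ht : ∀ x y, t (x * y) = t (y * x)) {a : GForm T R} (ha : ε a = a)
    (b : GForm T R) : GForm.trc t (a * b) = GForm.trc t (b * a) :=
  GForm.ext fun k ↦ (trace_mul_comm_apply t ht k).1 a b ha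

omit [FiniteDimensional ℝ T] [FiniteDimensional ℝ R] in
theorem trc_mul_comm_odd (ht : ∀ x y, t (x * y) = t (y * x)) {a : GForm T R} (ha : ε a = -a)
    (b : GForm T R) : GForm.trc t (a * b) = GForm.trc t (ε b * a) :=
  GForm.ext fun k ↦ (trace_mul_comm_apply t ht k).2 a b ha

end Trace

/-! ### The exponential -/

theorem ε_expNeg {a : GForm T R} (ha : ε a = a) : ε (expNeg a) = expNeg a := by
  have h := (hasGSum_expNeg a).ε
  simp only [map_smul, ε_pow ha] at h
  exact h.unique (hasGSum_expNeg a)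

/-- Contraction has no sign to pay when it crosses an even form, so on its powers it behaves as an
ordinary derivation. -/
theorem ι_pow {a : GForm T R} (ha : ε a = a) (x : T) (n : ℕ) :
    ι x (a ^ n) = powDeriv a (ι x a) n := by
  induction n with
  | zero => rw [pow_zero, ι_one]; rfl
  | succ n ih => rw [pow_succ, ι_mul, ih, ε_pow ha, powDeriv]

theorem powDeriv_zero {A : Type*} [Ring A] (a : A) (n : ℕ) : powDeriv a 0 n = 0 := by
  induction n with
  | zero => rfl
  | succ n ih => rw [powDeriv, ih, zero_mul, mul_zero, add_zero]

theorem ι_expNeg_eq_zero {a : GForm T R} (ha : ε a = a) {x : T} (hx : ι x a = 0) :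
    ι x (expNeg a) = 0 := by
  have h := (hasGSum_expNeg a).ι x
  simp only [map_smul, ι_pow ha, hx, powDeriv_zero, smul_zero] at h
  exact h.unique fun k v ↦ hasSum_zero

theorem map_expNeg {T' R' : Type*} [NormedAddCommGroup T'] [NormedSpace ℝ T']
    [FiniteDimensional ℝ T'] [NormedRing R'] [NormedAlgebra ℝ R'] [FiniteDimensional ℝ R']
    (f : T' →ₗ[ℝ] T) (Φ : R →ₐ[ℝ] R') (a : GForm T R) :
    map f Φ (expNeg a) = expNeg (map f Φ a) := by
  refine HasGSum.unique (f := fun n ↦ expCoeff n • map f Φ a ^ n) (fun k v ↦ ?_)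
    (hasGSum_expNeg _)
  have h := (LinearMap.toContinuousLinearMap Φ.toLinearMap).hasSum (hasGSum_expNeg a k (f ∘ v))
  have h2 : (fun n ↦ (expCoeff n • map f Φ a ^ n) k v) =
      fun n ↦ Φ.toLinearMap ((expCoeff n • a ^ n) k (f ∘ v)) := by
    funext n
    rw [← map_pow]
    exact (map_smul Φ.toLinearMap (expCoeff n) _).symm
  rw [h2]
  exact h

/-- Commutation with `a` is a derivation, so the direction `aα - αa` contributes to the derivative
of `α ^ n` exactly the commutator of `a` with `α ^ n`. -/
theorem powDeriv_sub_comm (a α Y : GForm T R) (n : ℕ) :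
    powDeriv α (Y - (a * α - α * a)) n = powDeriv α Y n - (a * α ^ n - α ^ n * a) := by
  induction n with
  | zero => simp [powDeriv]
  | succ n ih =>
    rw [powDeriv, powDeriv, ih, pow_succ]
    noncomm_ring

/-- `dα = i(Y)α - [a, α]` implies the same formula for `exp(-α)`. -/
theorem dG_expNeg {α : T → GForm T R} {x : T} (hs : GSmoothAt α x) (hε : ε (α x) = α x)
    (a : GForm T R) (Y : T) (hα : dG α x = ι Y (α x) - (a * α x - α x * a)) :
    dG (fun y ↦ expNeg (α y)) x =
      ι Y (expNeg (α x)) - (a * expNeg (α x) - expNeg (α x) * a) := by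
  let P : ℕ → T →ₗ[ℝ] GForm T R := fun n ↦ gfderiv (fun y ↦ α y ^ n) x
  have hpow : ∀ n, GSmoothAt (fun y ↦ α y ^ n) x := by
    intro n
    induction n with
    | zero =>
      intro k v
      simp only [pow_zero]
      exact contDiffAt_const
    | succ n ih =>
      simp only [pow_succ]
      exact ih.mul hs
  have hP : ∀ n u, P n u = powDeriv (α x) (gfderiv α x u) n := by
    intro n u
    have := (hs.hasGDeriv_line u).pow n
    simp only [zero_smul, add_zero] at this
    exact (hpow n).gfderiv_eq this
  -- On powers of the even form `α`, the exterior derivative, the contraction and the commutator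
  -- with `a` are all given by `powDeriv`, so the identity for `α` passes to every power.
  have hd : ∀ n, dG (fun y ↦ α y ^ n) x = ι Y (α x ^ n) - (a * α x ^ n - α x ^ n * a) := by
    intro n
    rw [ι_pow hε, ← powDeriv_sub_comm, ← hα]
    induction n with
    | zero =>
      ext1 k
      cases k with
      | zero => rfl
      | succ k =>
        rw [dG_succ_apply]
        simp only [pow_zero]
        ext v
        simp [extDeriv, ContinuousAlternatingMap.alternatizeUncurryFin_apply, powDeriv]
    | succ n ih =>
      have h1 : (fun y ↦ α y ^ (n + 1)) = fun y ↦ α y ^ n * α y := by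
        funext y
        rw [pow_succ]
      rw [h1, dG_mul (hpow n) hs, ih, ε_pow hε, powDeriv]
  -- The exterior derivative is a finite antisymmetrization of directional derivatives, so it may be
  -- taken term by term in the exponential series.
  have h1 : HasGSum (fun n ↦ alt (expCoeff n • P n)) (dG (fun y ↦ expNeg (α y)) x) := by
    refine HasGSum.alt fun u ↦ ?_
    have h2 := (hs.hasGDeriv_line u).hasGSum_expNeg (hs.expNeg.hasGDeriv_line u)
    simp only [zero_smul, add_zero, ← hP] at h2
    exact h2
  have h2 := ((hasGSum_expNeg (α x)).ι Y).sub
    (((hasGSum_expNeg (α x)).mul_left a).sub ((hasGSum_expNeg (α x)).mul_right a))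
  refine h1.unique ?_
  convert h2 using 2 with n
  rw [map_smul]
  change expCoeff n • dG (fun y ↦ α y ^ n) x = _
  rw [hd, map_smul, mul_smul_comm, smul_mul_assoc, smul_sub, smul_sub]

/-- The equivariant differential of `t(γ exp(-α))`. -/
theorem dG_trc_mul_expNeg {t : R →ₗ[ℝ] ℂ} (ht : ∀ x y, t (x * y) = t (y * x))
    {α γ : T → GForm T R} {x : T} (hs : GSmoothAt α x) (hγ : GSmoothAt γ x)
    (hε : ε (α x) = α x) {a : GForm T R} (ha : ε a = -a) (Y : T)
    (hα : dG α x = ι Y (α x) - (a * α x - α x * a)) :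
    dG (fun y ↦ trc t (γ y * expNeg (α y))) x - ι Y (trc t (γ x * expNeg (α x))) =
      trc t ((dG γ x - ι Y (γ x) + (a * γ x - ε (γ x) * a)) * expNeg (α x)) := by
  rw [dG_trc (hγ.mul hs.expNeg), dG_mul hγ hs.expNeg, dG_expNeg hs hε a Y hα, ← trc_ι, ι_mul,
    ← map_sub]
  -- Graded cyclicity brings the odd form `a` from the right end to the left end, where it completes
  -- the graded commutator with `γ`. No parity of `γ` is needed.
  have h := trc_mul_comm_odd ht ha (γ x * expNeg (α x))
  rw [ε_mul, ε_expNeg hε] at h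
  have h2 : dG γ x * expNeg (α x) + ε (γ x) * (ι Y (expNeg (α x)) -
      (a * expNeg (α x) - expNeg (α x) * a)) - (ι Y (γ x) * expNeg (α x) +
      ε (γ x) * ι Y (expNeg (α x))) = (dG γ x - ι Y (γ x) - ε (γ x) * a) * expNeg (α x) +
      ε (γ x) * expNeg (α x) * a := by noncomm_ring
  rw [h2, map_add, ← h, ← map_add]
  congr 1
  noncomm_ring

/-- The Lie derivative of `γ exp(-α)`. -/
theorem lie_mul_expNeg {α γ : T → GForm T R} {x : T} (hs : GSmoothAt α x) (hγ : GSmoothAt γ x)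
    (X : T) (B : T →ₗ[ℝ] T) (α' D : GForm T R)
    (hα : gfderiv α x X + der B (α x) = α') (hγ' : gfderiv γ x X + der B (γ x) = 0)
    (hD : HasGDeriv (fun s : ℝ ↦ expNeg (α x + s • α')) D 0) :
    gfderiv (fun y ↦ γ y * expNeg (α y)) x X + der B (γ x * expNeg (α x)) = γ x * D := by
  -- In a chart the Lie derivative is `∂_X + der B`, a derivation; on powers of `α` it acts as
  -- `powDeriv` in the direction `α'`. Its series is then that of the derivative of `exp(-(α +
  -- sα'))` at `s = 0`.
  have hdpow : ∀ n, powDeriv (α x) (gfderiv α x X) n + der B (α x ^ n) =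
      powDeriv (α x) α' n := by
    intro n
    induction n with
    | zero =>
      have : GForm.ι.flip (1 : GForm T R) = 0 := by
        ext1 u
        exact ι_one u
      rw [pow_zero, der, this, LinearMap.zero_comp, map_zero]
      exact add_zero _
    | succ n ih =>
      rw [pow_succ, der_mul, powDeriv, powDeriv, ← ih, ← hα]
      noncomm_ring
  have h1 := (hs.hasGDeriv_line X).hasGSum_expNeg (hs.expNeg.hasGDeriv_line X)
  simp only [zero_smul, add_zero] at h1
  have h2 := h1.add ((hasGSum_expNeg (α x)).der B)
  have h3 : ∀ n, der B (expCoeff n • α x ^ n) = expCoeff n • der B (α x ^ n) := by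
    intro n
    rw [der, map_smul, LinearMap.smul_comp, map_smul, der]
  simp only [h3, ← smul_add, hdpow] at h2
  have h4 : HasGDeriv (fun s : ℝ ↦ α x + s • α') α' 0 := by
    intro k v
    simpa using ((hasDerivAt_id (0 : ℝ)).smul_const (α' k v)).const_add (α x k v)
  have h5 := h4.hasGSum_expNeg hD
  simp only [zero_smul, add_zero] at h5
  rw [gfderiv_mul hγ hs.expNeg, der_mul]
  have h6 := h2.unique h5
  have h7 : gfderiv γ x X * expNeg (α x) + γ x * gfderiv (fun y ↦ expNeg (α y)) x X +
      (der B (γ x) * expNeg (α x) + γ x * der B (expNeg (α x))) =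
      (gfderiv γ x X + der B (γ x)) * expNeg (α x) +
      γ x * (gfderiv (fun y ↦ expNeg (α y)) x X + der B (expNeg (α x))) := by noncomm_ring
  rw [h7, hγ', h6, zero_mul, zero_add]

/-- The derivative of `t(exp(-α))`. -/
theorem hasGDeriv_trc_expNeg {t : R →ₗ[ℝ] ℂ} (ht : ∀ x y, t (x * y) = t (y * x))
    {α : ℝ → GForm T R} {α' : GForm T R} {s : ℝ} (hα : HasGDeriv α α' s)
    (hs : GSmoothAt α s) (hε : ε (α s) = α s) :
    HasGDeriv (fun s ↦ trc t (expNeg (α s))) (-trc t (α' * expNeg (α s))) s := by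
  have hD : HasGDeriv (fun s ↦ expNeg (α s)) (gfderiv (fun s ↦ expNeg (α s)) s 1) s :=
    hs.expNeg.hasGDeriv (hasDerivAt_id s) rfl
  have key : ∀ n m : ℕ, trc t (powDeriv (α s) α' (n + 1) * α s ^ m) =
      ((n : ℝ) + 1) • trc t (α' * α s ^ (n + m)) := by
    intro n
    induction n with
    | zero =>
      intro m
      simp [powDeriv]
    | succ n ih =>
      intro m
      have h1 := ih (m + 1)
      rw [powDeriv, add_mul, map_add, mul_assoc, ← pow_succ', h1, mul_assoc,
        trc_mul_comm ht (ε_pow hε (n + 1)), mul_assoc, ← pow_add]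
      have h2 : n + (m + 1) = n + 1 + m := by omega
      have h3 : m + (n + 1) = n + 1 + m := by omega
      rw [h2, h3]
      push_cast
      simp only [add_smul, one_smul]
  have h1 := (hα.hasGSum_expNeg hD).trc (t := t)
  have h2 := ((hasGSum_expNeg (α s)).mul_left α').trc (t := t)
  have h3 : trc t (gfderiv (fun s ↦ expNeg (α s)) s 1) = -trc t (α' * expNeg (α s)) := by
    ext k v
    have h4 := (h2 k v).neg
    have h5 := h1 k v
    -- The constant term of the exponential has zero derivative. Dropping it shifts the index by
    -- one, and the factor `n + 1` cancels against the factorial, with a change of sign.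
    rw [← hasSum_nat_add_iff' 1] at h5
    simp only [Finset.range_one, Finset.sum_singleton] at h5
    have h6 : trc t (expCoeff 0 • powDeriv (α s) α' 0) k v = 0 := by
      simp [powDeriv]
    rw [h6, sub_zero] at h5
    refine h5.unique ?_
    refine (?_ : (fun n ↦ _) = fun n ↦ _) ▸ h4
    funext n
    symm
    refine (congrArg (fun f : GForm T ℂ ↦ f k v) (?_ : GForm.trc t (expCoeff (n + 1) •
      powDeriv (α s) α' (n + 1)) = -GForm.trc t (α' * expCoeff n • α s ^ n)))
    have h7 := key n 0
    rw [pow_zero, mul_one, add_zero] at h7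
    rw [map_smul, h7, mul_smul_comm, map_smul, smul_smul]
    have h8 : expCoeff (n + 1) * ((n : ℝ) + 1) = -expCoeff n := by
      simp only [expCoeff, Nat.factorial_succ]
      push_cast
      field_simp
      ring
    rw [h8, neg_smul]
  rw [← h3]
  exact hD.trc

end Calculus

end GForm
end BasicChern
end

noncomputable section
namespace BasicChern

/-! ### Integrals depending smoothly on parameters -/

section Parametric

variable {Q W : Type*} [NormedAddCommGroup Q] [NormedSpace ℝ Q] [FiniteDimensional ℝ Q]
  [NormedAddCommGroup W] [NormedSpace ℝ W]

theorem continuous_slice {Z : Type*} [TopologicalSpace Z] {f : ℝ × Q → Z} {U : Set Q}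
    (hU : IsOpen U) (hf : ContinuousOn f (Set.univ ×ˢ U)) {q : Q} (hq : q ∈ U) :
    Continuous (fun t ↦ f (t, q)) := by
  refine continuous_iff_continuousAt.2 fun t ↦ ?_
  have h1 : ContinuousAt f (t, q) := hf.continuousAt ((isOpen_univ.prod hU).mem_nhds ⟨trivial, hq⟩)
  exact ContinuousAt.comp (f := fun t : ℝ ↦ (t, q)) h1 (by fun_prop)

variable [CompleteSpace W]

/-- The partial derivative in `q` is continuous, hence bounded for `t` in `[0, 1]` and `q` in a
small closed ball, which is compact in finite dimension. This bound permits differentiation under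
the integral. -/
theorem hasFDerivAt_integral_of_contDiffOn {f : ℝ × Q → W} {U : Set Q} (hU : IsOpen U)
    (hf : ContDiffOn ℝ ∞ f (Set.univ ×ˢ U)) {q : Q} (hq : q ∈ U) :
    HasFDerivAt (fun q ↦ ∫ t in (0 : ℝ)..1, f (t, q))
      (∫ t in (0 : ℝ)..1, (fderiv ℝ f (t, q)).comp (ContinuousLinearMap.inr ℝ ℝ Q)) q := by
  have hO : IsOpen ((Set.univ : Set ℝ) ×ˢ U) := isOpen_univ.prod hU
  let F' : ℝ × Q → (Q →L[ℝ] W) := fun z ↦ (fderiv ℝ f z).comp (ContinuousLinearMap.inr ℝ ℝ Q)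
  have hF' : ContinuousOn F' (Set.univ ×ˢ U) :=
    ((contDiffOn_infty_iff_fderiv_of_isOpen hO).1 hf).2.continuousOn.clm_comp continuousOn_const
  obtain ⟨r, hr, hrU⟩ := Metric.isOpen_iff.1 hU q hq
  have hsub : Metric.closedBall q (r / 2) ⊆ U := (Metric.closedBall_subset_ball (by linarith)).trans hrU
  have hK : IsCompact (Set.Icc (0 : ℝ) 1 ×ˢ Metric.closedBall q (r / 2)) :=
    isCompact_Icc.prod (isCompact_closedBall q _)
  obtain ⟨C, hC⟩ := hK.exists_bound_of_continuousOn
    (hF'.mono (Set.prod_mono (Set.subset_univ _) hsub))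
  have hI : Set.uIoc (0 : ℝ) 1 ⊆ Set.Icc 0 1 := by
    rw [Set.uIoc_of_le zero_le_one]
    exact Set.Ioc_subset_Icc_self
  refine intervalIntegral.hasFDerivAt_integral_of_dominated_of_fderiv_le
    (F' := fun q t ↦ F' (t, q)) (bound := fun _ ↦ C)
    (Metric.closedBall_mem_nhds q (by linarith : 0 < r / 2)) ?_ ?_ ?_ ?_ ?_ ?_
  · filter_upwards [hU.mem_nhds hq] with x hx
    exact (continuous_slice hU hf.continuousOn hx).aestronglyMeasurable
  · exact (continuous_slice hU hf.continuousOn hq).intervalIntegrable _ _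
  · exact (continuous_slice hU hF' hq).aestronglyMeasurable
  · exact Filter.Eventually.of_forall fun t ht x hx ↦ hC (t, x) ⟨hI ht, hx⟩
  · exact intervalIntegrable_const
  · refine Filter.Eventually.of_forall fun t _ x hx ↦ ?_
    have h1 : HasFDerivAt f (fderiv ℝ f (t, x)) (t, x) :=
      ((hf.contDiffAt (hO.mem_nhds ⟨trivial, hsub hx⟩)).differentiableAt (by simp)).hasFDerivAt
    have h2 : HasFDerivAt (fun x : Q ↦ (t, x)) (ContinuousLinearMap.inr ℝ ℝ Q) x :=
      hasFDerivAt_prodMk_right t x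
    exact h1.comp x h2

theorem fderiv_integral_apply {f : ℝ × Q → W} {U : Set Q} (hU : IsOpen U)
    (hf : ContDiffOn ℝ ∞ f (Set.univ ×ˢ U)) {q : Q} (hq : q ∈ U) (u : Q) :
    fderiv ℝ (fun q ↦ ∫ t in (0 : ℝ)..1, f (t, q)) q u =
      ∫ t in (0 : ℝ)..1, fderiv ℝ f (t, q) (0, u) := by
  have hO : IsOpen ((Set.univ : Set ℝ) ×ˢ U) := isOpen_univ.prod hU
  have hF' : ContinuousOn (fun z ↦ (fderiv ℝ f z).comp (ContinuousLinearMap.inr ℝ ℝ Q))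
      (Set.univ ×ˢ U) :=
    ((contDiffOn_infty_iff_fderiv_of_isOpen hO).1 hf).2.continuousOn.clm_comp continuousOn_const
  rw [(hasFDerivAt_integral_of_contDiffOn hU hf hq).fderiv,
    ContinuousLinearMap.intervalIntegral_apply
      ((continuous_slice hU hF' hq).intervalIntegrable _ _)]
  rfl

/-- Each directional derivative of the integral is again an integral of this type, so the order of
differentiability increases by induction over all integrands simultaneously. -/
theorem contDiffOn_integral {f : ℝ × Q → W} {U : Set Q} (hU : IsOpen U)
    (hf : ContDiffOn ℝ ∞ f (Set.univ ×ˢ U)) :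
    ContDiffOn ℝ ∞ (fun q ↦ ∫ t in (0 : ℝ)..1, f (t, q)) U := by
  have hO : IsOpen ((Set.univ : Set ℝ) ×ˢ U) := isOpen_univ.prod hU
  refine contDiffOn_infty.2 fun n ↦ ?_
  induction n generalizing f with
  | zero =>
    exact contDiffOn_zero.2 fun q hq ↦
      (hasFDerivAt_integral_of_contDiffOn hU hf hq).continuousAt.continuousWithinAt
  | succ n ih =>
    push_cast
    rw [contDiffOn_succ_iff_fderiv_apply hU.uniqueDiffOn]
    refine ⟨fun q hq ↦ (hasFDerivAt_integral_of_contDiffOn hU hf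
      hq).differentiableAt.differentiableWithinAt, by simp, fun u ↦ ?_⟩
    have h1 : ContDiffOn ℝ ∞ (fun z : ℝ × Q ↦ fderiv ℝ f z (0, u)) (Set.univ ×ˢ U) :=
      ((contDiffOn_infty_iff_fderiv_of_isOpen hO).1 hf).2.clm_apply contDiffOn_const
    refine (ih h1).congr fun q hq ↦ ?_
    rw [fderivWithin_of_isOpen hU hq, fderiv_integral_apply hU hf hq]

end Parametric

end BasicChern
end

noncomputable section
namespace BasicChern

namespace GForm

/-! ### Pullback, multiplication by functions -/

section Pull

variable {T T' T'' R : Type*} [AddCommGroup T] [Module ℝ T] [AddCommGroup T'] [Module ℝ T']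
  [AddCommGroup T''] [Module ℝ T''] [Ring R] [Algebra ℝ R]

/-- The pullback by a linear map. -/
def pull (f : T' →ₗ[ℝ] T) : GForm T R →ₐ[ℝ] GForm T' R where
  toFun a := map f (AlgHom.id ℝ R) a
  map_one' := map_one _ _
  map_mul' := map_mul _ _
  map_zero' := by
    ext k v
    rfl
  map_add' a b := by
    ext k v
    rfl
  commutes' c := by
    rw [Algebra.algebraMap_eq_smul_one, Algebra.algebraMap_eq_smul_one]
    refine Eq.trans ?_ (congrArg (c • ·) (map_one f (AlgHom.id ℝ R)))
    ext k v
    rfl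

theorem pull_apply (f : T' →ₗ[ℝ] T) (a : GForm T R) (k : ℕ) (v : Fin k → T') :
    pull f a k v = a k (f ∘ v) := rfl

theorem pull_pull (f : T' →ₗ[ℝ] T) (g : T'' →ₗ[ℝ] T') (a : GForm T R) :
    pull g (pull f a) = pull (f ∘ₗ g) a := rfl

theorem pull_id (a : GForm T R) : pull LinearMap.id a = a := rfl

theorem ι_pull (f : T' →ₗ[ℝ] T) (x : T') (a : GForm T R) :
    ι x (pull f a) = pull f (ι (f x) a) := by
  ext k v
  rw [ι_apply_apply, pull_apply, pull_apply, ι_apply_apply]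
  congr 1
  funext i
  refine Fin.cases rfl (fun i ↦ rfl) i

theorem ε_pull (f : T' →ₗ[ℝ] T) (a : GForm T R) : ε (pull f a) = pull f (ε a) := by
  ext k v
  rfl

theorem pull_injective {f : T' →ₗ[ℝ] T} (hf : Function.Surjective f) :
    Function.Injective (pull (R := R) f) := by
  intro a b h
  ext k v
  choose g hg using hf
  have h1 := congrArg (fun c : GForm T' R ↦ c k (g ∘ v)) h
  simp only [pull_apply] at h1
  have h2 : f ∘ g ∘ v = v := funext fun i ↦ hg _
  rwa [h2] at h1

variable (T) in
/-- Functions as forms of degree `0`. -/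
def const (r : R) : GForm T R
  | 0 => AlternatingMap.constOfIsEmpty ℝ T (Fin 0) r
  | _ + 1 => 0

theorem const_zero_apply (r : R) (v : Fin 0 → T) : const T r 0 v = r := rfl

theorem ι_const (r : R) (x : T) : ι x (const T r) = 0 := by
  ext k v
  rfl

theorem ε_const (r : R) : ε (const T r) = const T r := by
  ext k v
  cases k with
  | zero =>
    change (-1 : ℝ) ^ 0 • r = r
    simp
  | succ k => exact smul_zero _

theorem pull_const (f : T' →ₗ[ℝ] T) (r : R) : pull f (const T r) = const T' r := by
  ext k v
  cases k with
  | zero => rfl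
  | succ k => rfl

theorem const_mul_apply (r : R) (a : GForm T R) (k : ℕ) (v : Fin k → T) :
    (const T r * a) k v = r * a k v := by
  induction k generalizing a with
  | zero => rw [mul_zero_apply, const_zero_apply]
  | succ k ih =>
    have h := ih (ι (v 0) a) (Fin.tail v)
    have h2 : ι (v 0) (const T r * a) = const T r * ι (v 0) a := by
      rw [ι_mul, ι_const, ε_const, zero_mul, zero_add]
    rw [← h2, ι_apply_apply, ι_apply_apply, Fin.cons_self_tail] at h
    exact h

theorem mul_const_apply (r : R) (a : GForm T R) (k : ℕ) (v : Fin k → T) :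
    (a * const T r) k v = a k v * r := by
  induction k generalizing a with
  | zero => rw [mul_zero_apply, const_zero_apply]
  | succ k ih =>
    have h := ih (ι (v 0) a) (Fin.tail v)
    have h2 : ι (v 0) (a * const T r) = ι (v 0) a * const T r := by
      rw [ι_mul, ι_const, mul_zero, add_zero]
    rw [← h2, ι_apply_apply, ι_apply_apply, Fin.cons_self_tail] at h
    exact h

theorem const_mul_const (r s : R) : const T r * const T s = const T (r * s) := by
  ext k v
  rw [const_mul_apply]
  cases k with
  | zero => rfl
  | succ k => exact mul_zero _

theorem const_one : const T (1 : R) = 1 := by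
  ext k v
  cases k with
  | zero => rfl
  | succ k => rfl

theorem ι_apply_zero_one (x : T) (a : GForm T R) (v : Fin 0 → T) :
    ι x a 0 v = a 1 (fun _ ↦ x) := by
  rw [ι_apply_apply]
  congr 1
  funext i
  exact Fin.cases rfl (fun i ↦ i.elim0) i

end Pull

section Calculus

variable {T T' R : Type*} [NormedAddCommGroup T] [NormedSpace ℝ T] [FiniteDimensional ℝ T]
  [NormedAddCommGroup T'] [NormedSpace ℝ T'] [FiniteDimensional ℝ T']
  [NormedRing R] [NormedAlgebra ℝ R] [FiniteDimensional ℝ R]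
  {Q : Type*} [NormedAddCommGroup Q] [NormedSpace ℝ Q]

theorem pull_expNeg (f : T' →ₗ[ℝ] T) (a : GForm T R) : pull f (expNeg a) = expNeg (pull f a) :=
  map_expNeg f (AlgHom.id ℝ R) a

omit [FiniteDimensional ℝ T] [FiniteDimensional ℝ T'] [FiniteDimensional ℝ R] in
theorem trc_pull (t : R →ₗ[ℝ] ℂ) (f : T' →ₗ[ℝ] T) (a : GForm T R) :
    trc t (pull f a) = pull f (trc t a) := rfl

omit [FiniteDimensional ℝ T] [FiniteDimensional ℝ T'] [FiniteDimensional ℝ R] in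
theorem pull_single (f : T' →L[ℝ] T) (k : ℕ) (a : T [⋀^Fin k]→L[ℝ] R) :
    pull (f : T' →ₗ[ℝ] T) (single R k a) = single R k (a.compContinuousLinearMap f) := by
  ext j v
  rw [pull_apply]
  by_cases h : j = k
  · subst h
    rw [single_same, single_same]
    rfl
  · rw [single_ne h, single_ne h]
    rfl

theorem conj_expNeg {r r' : R} (h : r * r' = 1) (h' : r' * r = 1) (a : GForm T R) :
    expNeg (const T r' * a * const T r) = const T r' * expNeg a * const T r := by
  have h1 := ((hasGSum_expNeg a).mul_left (const T r')).mul_right (const T r)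
  have hp : ∀ n : ℕ, const T r' * a ^ n * const T r = (const T r' * a * const T r) ^ n := by
    intro n
    induction n with
    | zero => rw [pow_zero, pow_zero, mul_one, const_mul_const, h', const_one]
    | succ n ih =>
      rw [pow_succ, pow_succ, ← ih]
      have : const T r * const T r' = 1 := by rw [const_mul_const, h, const_one]
      calc const T r' * (a ^ n * a) * const T r
          = const T r' * a ^ n * 1 * a * const T r := by noncomm_ring
        _ = _ := by rw [← this]; noncomm_ring
  simp only [mul_smul_comm, smul_mul_assoc, hp] at h1
  exact (hasGSum_expNeg _).unique h1

omit [FiniteDimensional ℝ T] [FiniteDimensional ℝ R] in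
theorem trc_conj {t : R →ₗ[ℝ] ℂ} (ht : ∀ x y, t (x * y) = t (y * x)) {r r' : R}
    (h : r * r' = 1) (a : GForm T R) : trc t (const T r' * a * const T r) = trc t a := by
  ext k v
  rw [trc_apply, mul_const_apply, const_mul_apply, ht, ← mul_assoc, h, one_mul, trc_apply]

/-- `GSmoothAt` concerns fixed vectors. Vectors that vary with the parameter are inserted one at a
time by `GSmoothAt.ι`. -/
theorem GSmoothAt.apply {A : Q → GForm T R} {q : Q} (hA : GSmoothAt A q) {k : ℕ}
    {w : Fin k → Q → T} (hw : ∀ i, ContDiffAt ℝ ∞ (w i) q) :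
    ContDiffAt ℝ ∞ (fun q ↦ A q k (fun i ↦ w i q)) q := by
  induction k generalizing A with
  | zero =>
    have : (fun q ↦ A q 0 (fun i ↦ w i q)) = fun q ↦ A q 0 ![] := by
      funext q
      congr 1
      exact Subsingleton.elim _ _
    rw [this]
    exact hA 0 _
  | succ k ih =>
    have h := ih (hA.ι (hw 0)) (w := fun i ↦ w i.succ) fun i ↦ hw i.succ
    refine h.congr_of_eventuallyEq (Filter.Eventually.of_forall fun q ↦ ?_)
    change A q (k + 1) _ = A q (k + 1) _
    congr 1
    funext i
    refine Fin.cases rfl (fun i ↦ rfl) i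

theorem GSmoothAt.pull {A : Q → GForm T R} {L : Q → T' →L[ℝ] T} {q : Q} (hA : GSmoothAt A q)
    (hL : ContDiffAt ℝ ∞ L q) :
    GSmoothAt (fun q ↦ GForm.pull (L q : T' →ₗ[ℝ] T) (A q)) q := fun _ v ↦
  hA.apply (w := fun i q ↦ L q (v i)) fun _ ↦ hL.clm_apply contDiffAt_const

theorem GSmoothAt.comp {Q' : Type*} [NormedAddCommGroup Q'] [NormedSpace ℝ Q']
    {A : Q → GForm T R} {f : Q' → Q} {q : Q'} (hA : GSmoothAt A (f q))
    (hf : ContDiffAt ℝ ∞ f q) : GSmoothAt (fun q ↦ A (f q)) q := fun k v ↦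
  (hA k v).comp q hf

theorem GSmoothAt.congr {A B : Q → GForm T R} {q : Q} (hA : GSmoothAt A q)
    (h : B =ᶠ[nhds q] A) : GSmoothAt B q := fun k v ↦ by
  refine (hA k v).congr_of_eventuallyEq ?_
  filter_upwards [h] with y hy
  rw [hy]

theorem GSmoothAt.const {r : Q → R} {q : Q} (h : ContDiffAt ℝ ∞ r q) :
    GSmoothAt (fun q ↦ GForm.const T (r q)) q := by
  intro k v
  cases k with
  | zero => exact h
  | succ k => exact contDiffAt_const

theorem GSmoothAt.dG {A : T → GForm T R} {x : T} (h : GSmoothAt A x) : GSmoothAt (dG A) x := by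
  intro k v
  cases k with
  | zero => exact contDiffAt_const
  | succ k =>
    simp only [dG_succ_apply]
    have h1 : ContDiffAt ℝ ∞ (extDeriv fun y ↦ toCont (A y k)) x := by
      have h2 : ContDiffAt ℝ ∞ (fderiv ℝ fun y ↦ toCont (A y k)) x :=
        (h.contDiffAt k).fderiv_right (by simp)
      exact (ContinuousAlternatingMap.alternatizeUncurryFinCLM ℝ T R).contDiff.contDiffAt.comp x h2
    exact (ContinuousAlternatingMap.apply ℝ T R v).contDiff.contDiffAt.comp x h1

theorem dG_dG {A : T → GForm T R} {x : T} (h : GSmoothAt A x) : GForm.dG (GForm.dG A) x = 0 := by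
  ext1 k
  cases k with
  | zero => rfl
  | succ k =>
    rw [dG_succ_apply]
    cases k with
    | zero =>
      ext v
      have h0 : (fun y ↦ toCont (GForm.dG A y 0)) = fun _ ↦ 0 := rfl
      rw [h0]
      simp [extDeriv, ContinuousAlternatingMap.alternatizeUncurryFin_apply]
    | succ k =>
      have h1 : (fun y ↦ toCont (GForm.dG A y (k + 1))) =
          extDeriv (fun y ↦ toCont (A y k)) := by
        funext y
        rw [dG_succ_apply]
        rfl
      rw [h1, extDeriv_extDeriv_apply (h.contDiffAt k) ENat.LEInfty.out]
      rfl

theorem dG_pull {A : T → GForm T R} {f : T' → T} {x : T'} (hA : GSmoothAt A (f x))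
    (hf : ContDiffAt ℝ ∞ f x) :
    GForm.dG (fun y ↦ GForm.pull (fderiv ℝ f y : T' →ₗ[ℝ] T) (A (f y))) x =
      GForm.pull (fderiv ℝ f x : T' →ₗ[ℝ] T) (GForm.dG A (f x)) := by
  ext1 k
  cases k with
  | zero => rfl
  | succ k =>
    rw [dG_succ_apply]
    have h : extDeriv (fun y ↦ (toCont (A (f y) k)).compContinuousLinearMap (fderiv ℝ f y)) x =
        (extDeriv (fun y ↦ toCont (A y k)) (f x)).compContinuousLinearMap (fderiv ℝ f x) :=
      extDeriv_pullback ((hA.contDiffAt k).differentiableAt (by simp)) hf ENat.LEInfty.out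
    ext v
    have h2 := congrArg (fun c ↦ c v) h
    change extDeriv _ x v = GForm.dG A (f x) (k + 1) _
    rw [dG_succ_apply]
    exact h2

end Calculus

end GForm

end BasicChern
end

noncomputable section
namespace BasicChern

/-! ### Charts -/

section Charts

variable {E : Type*} [NormedAddCommGroup E] [NormedSpace ℝ E]
  {M : Type*} [TopologicalSpace M] [ChartedSpace E M] [IsManifold 𝓘(ℝ, E) ∞ M]

theorem tmap_chart_symm (a : M) {y : E} (hy : y ∈ (extChartAt 𝓘(ℝ, E) a).target) :
    (tmap E E (extChartAt 𝓘(ℝ, E) a) ((extChartAt 𝓘(ℝ, E) a).symm y)).comp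
      (tmap E E (extChartAt 𝓘(ℝ, E) a).symm y) = ContinuousLinearMap.id ℝ E := by
  haveI : IsManifold 𝓘(ℝ, E) 1 M := IsManifold.of_le (n := ∞) (by simp)
  have h := mfderiv_extChartAt_comp_mfderivWithin_extChartAt_symm (I := 𝓘(ℝ, E)) hy
  simp only [ModelWithCorners.range_eq_univ, mfderivWithin_univ] at h
  exact h

theorem tmap_symm_chart (a : M) {y : E} (hy : y ∈ (extChartAt 𝓘(ℝ, E) a).target) :
    (tmap E E (extChartAt 𝓘(ℝ, E) a).symm y).comp
      (tmap E E (extChartAt 𝓘(ℝ, E) a) ((extChartAt 𝓘(ℝ, E) a).symm y)) =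
        ContinuousLinearMap.id ℝ E := by
  haveI : IsManifold 𝓘(ℝ, E) 1 M := IsManifold.of_le (n := ∞) (by simp)
  have h := mfderivWithin_extChartAt_symm_comp_mfderiv_extChartAt (I := 𝓘(ℝ, E)) hy
  simp only [ModelWithCorners.range_eq_univ, mfderivWithin_univ] at h
  exact h

theorem tmap_symm_chart' (a : M) {x : M} (hx : x ∈ (extChartAt 𝓘(ℝ, E) a).source) :
    (tmap E E (extChartAt 𝓘(ℝ, E) a).symm (extChartAt 𝓘(ℝ, E) a x)).comp
      (tmap E E (extChartAt 𝓘(ℝ, E) a) x) = ContinuousLinearMap.id ℝ E := by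
  have h := tmap_symm_chart a ((extChartAt 𝓘(ℝ, E) a).map_source hx)
  rwa [(extChartAt 𝓘(ℝ, E) a).left_inv hx] at h

theorem contMDiffAt_symm (a : M) {y : E} (hy : y ∈ (extChartAt 𝓘(ℝ, E) a).target) :
    ContMDiffAt 𝓘(ℝ, E) 𝓘(ℝ, E) ∞ (extChartAt 𝓘(ℝ, E) a).symm y :=
  (contMDiffOn_extChartAt_symm a).contMDiffAt ((isOpen_extChartAt_target a).mem_nhds hy)

theorem contMDiffAt_chart (a : M) {x : M} (hx : x ∈ (extChartAt 𝓘(ℝ, E) a).source) :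
    ContMDiffAt 𝓘(ℝ, E) 𝓘(ℝ, E) ∞ (extChartAt 𝓘(ℝ, E) a) x :=
  contMDiffAt_extChartAt' (by rwa [extChartAt_source] at hx)

theorem chart_tendsto_symm (a : M) {x : M} (hx : x ∈ (extChartAt 𝓘(ℝ, E) a).source) :
    Filter.Tendsto (extChartAt 𝓘(ℝ, E) a).symm (nhds (extChartAt 𝓘(ℝ, E) a x)) (nhds x) := by
  have h := (contMDiffAt_symm a ((extChartAt 𝓘(ℝ, E) a).map_source hx)).continuousAt
  rw [ContinuousAt, (extChartAt 𝓘(ℝ, E) a).left_inv hx] at h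
  exact h

variable {E' : Type*} [NormedAddCommGroup E'] [NormedSpace ℝ E']
  {M' : Type*} [TopologicalSpace M'] [ChartedSpace E' M'] [IsManifold 𝓘(ℝ, E') ∞ M']

theorem eventually_mdifferentiableAt {f : M' → M} {x : M'}
    (hf : ContMDiffAt 𝓘(ℝ, E') 𝓘(ℝ, E) ∞ f x) :
    ∀ᶠ y in nhds x, MDifferentiableAt 𝓘(ℝ, E') 𝓘(ℝ, E) f y := by
  haveI : IsManifold 𝓘(ℝ, E) 1 M := IsManifold.of_le (n := ∞) (by simp)
  haveI : IsManifold 𝓘(ℝ, E') 1 M' := IsManifold.of_le (n := ∞) (by simp)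
  have h1 : ContMDiffAt 𝓘(ℝ, E') 𝓘(ℝ, E) 1 f x := hf.of_le (by simp)
  filter_upwards [(contMDiffAt_iff_contMDiffAt_nhds (by simp)).1 h1] with y hy
  exact hy.mdifferentiableAt (by simp)

theorem tmap_comp {E'' : Type*} [NormedAddCommGroup E''] [NormedSpace ℝ E'']
    {M'' : Type*} [TopologicalSpace M''] [ChartedSpace E'' M''] {g : M → M''} {f : M' → M} {x : M'}
    (hg : MDifferentiableAt 𝓘(ℝ, E) 𝓘(ℝ, E'') g (f x))
    (hf : MDifferentiableAt 𝓘(ℝ, E') 𝓘(ℝ, E) f x) :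
    tmap E' E'' (g ∘ f) x = (tmap E E'' g (f x)).comp (tmap E' E f x) :=
  mfderiv_comp x hg hf

variable (E E') in
/-- The expression of a map in charts. -/
def inCharts (a : M) (a' : M') (f : M' → M) (y : E') : E :=
  extChartAt 𝓘(ℝ, E) a (f ((extChartAt 𝓘(ℝ, E') a').symm y))

theorem contDiffAt_inCharts {f : M' → M} {x : M'} (hf : ContMDiffAt 𝓘(ℝ, E') 𝓘(ℝ, E) ∞ f x)
    {a : M} {a' : M'} (h' : x ∈ (extChartAt 𝓘(ℝ, E') a').source)
    (h : f x ∈ (extChartAt 𝓘(ℝ, E) a).source) :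
    ContDiffAt ℝ ∞ (inCharts E E' a a' f) (extChartAt 𝓘(ℝ, E') a' x) := by
  rw [← contMDiffAt_iff_contDiffAt]
  have hx := (extChartAt 𝓘(ℝ, E') a').left_inv h'
  have h1 := contMDiffAt_symm a' ((extChartAt 𝓘(ℝ, E') a').map_source h')
  have h2 : ContMDiffAt 𝓘(ℝ, E') 𝓘(ℝ, E) ∞ (f ∘ (extChartAt 𝓘(ℝ, E') a').symm)
      (extChartAt 𝓘(ℝ, E') a' x) := ContMDiffAt.comp _ (by rwa [hx]) h1
  refine ContMDiffAt.comp (I' := 𝓘(ℝ, E)) _ (g := extChartAt 𝓘(ℝ, E) a) ?_ h2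
  refine contMDiffAt_chart a ?_
  simpa only [Function.comp_apply, hx] using h

theorem fderiv_inCharts {f : M' → M} {y : E'} {a : M} {a' : M'}
    (hy : y ∈ (extChartAt 𝓘(ℝ, E') a').target)
    (hf : MDifferentiableAt 𝓘(ℝ, E') 𝓘(ℝ, E) f ((extChartAt 𝓘(ℝ, E') a').symm y))
    (h : f ((extChartAt 𝓘(ℝ, E') a').symm y) ∈ (extChartAt 𝓘(ℝ, E) a).source) :
    fderiv ℝ (inCharts E E' a a' f) y = (tmap E E (extChartAt 𝓘(ℝ, E) a)
      (f ((extChartAt 𝓘(ℝ, E') a').symm y))).comp ((tmap E' E f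
        ((extChartAt 𝓘(ℝ, E') a').symm y)).comp (tmap E' E' (extChartAt 𝓘(ℝ, E') a').symm y)) := by
  have h1 := (contMDiffAt_symm a' hy).mdifferentiableAt (by simp)
  have h2 := (contMDiffAt_chart a h).mdifferentiableAt (by simp)
  rw [← tmap_comp hf h1, ← mfderiv_eq_fderiv]
  exact tmap_comp (f := f ∘ (extChartAt 𝓘(ℝ, E') a').symm) h2 (hf.comp y h1)

end Charts

/-! ### Forms of mixed degree on manifolds -/

section ManifoldForms

open GForm

variable {E : Type*} [NormedAddCommGroup E] [NormedSpace ℝ E] [FiniteDimensional ℝ E]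
  {M : Type*} [TopologicalSpace M] [ChartedSpace E M] [IsManifold 𝓘(ℝ, E) ∞ M]
  {E' : Type*} [NormedAddCommGroup E'] [NormedSpace ℝ E'] [FiniteDimensional ℝ E']
  {M' : Type*} [TopologicalSpace M'] [ChartedSpace E' M'] [IsManifold 𝓘(ℝ, E') ∞ M']
  {R : Type*} [NormedRing R] [NormedAlgebra ℝ R] [FiniteDimensional ℝ R]
  {Q : Type*} [NormedAddCommGroup Q] [NormedSpace ℝ Q]

/-- The expression in the chart at `a` of a form of mixed degree. -/
def chartRep (a : M) (A : M → GForm E R) (y : E) : GForm E R :=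
  pull (tmap E E (extChartAt 𝓘(ℝ, E) a).symm y : E →ₗ[ℝ] E) (A ((extChartAt 𝓘(ℝ, E) a).symm y))

variable (E') in
/-- The pullback of a form of mixed degree. -/
def pullM (f : M' → M) (A : M → GForm E R) (x : M') : GForm E' R :=
  pull (tmap E' E f x : E' →ₗ[ℝ] E) (A (f x))

/-- Joint smoothness at `(q, x)` of a family of forms on `M`. -/
def SmoothIn (A : Q → M → GForm E R) (q : Q) (x : M) : Prop :=
  GSmoothAt (fun z : Q × E ↦ chartRep x (A z.1) z.2) (q, extChartAt 𝓘(ℝ, E) x x)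

/-- Smoothness at `x` of a form on `M`. -/
def SmoothAt (A : M → GForm E R) (x : M) : Prop :=
  GSmoothAt (chartRep x A) (extChartAt 𝓘(ℝ, E) x x)

/-- The exterior derivative. -/
def gd (A : M → GForm E R) (x : M) : GForm E R :=
  pull (tmap E E (extChartAt 𝓘(ℝ, E) x) x : E →ₗ[ℝ] E) (dG (chartRep x A) (extChartAt 𝓘(ℝ, E) x x))

theorem chartRep_pullM {f : M' → M} {y : E'} {a : M} {a' : M'} (A : M → GForm E R)
    (hy : y ∈ (extChartAt 𝓘(ℝ, E') a').target)
    (hf : MDifferentiableAt 𝓘(ℝ, E') 𝓘(ℝ, E) f ((extChartAt 𝓘(ℝ, E') a').symm y))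
    (h : f ((extChartAt 𝓘(ℝ, E') a').symm y) ∈ (extChartAt 𝓘(ℝ, E) a).source) :
    chartRep a' (pullM E' f A) y = pull (fderiv ℝ (inCharts E E' a a' f) y : E' →ₗ[ℝ] E)
      (chartRep a A (inCharts E E' a a' f y)) := by
  have h1 : (extChartAt 𝓘(ℝ, E) a).symm (inCharts E E' a a' f y) =
      f ((extChartAt 𝓘(ℝ, E') a').symm y) := (extChartAt 𝓘(ℝ, E) a).left_inv h
  have h2 := tmap_symm_chart' a h
  rw [chartRep, pullM, pull_pull, chartRep, pull_pull, h1, fderiv_inCharts hy hf h]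
  congr 2
  ext1 u
  exact (DFunLike.congr_fun h2 _).symm

theorem eventually_charts {f : M' → M} {x : M'} (hf : ContMDiffAt 𝓘(ℝ, E') 𝓘(ℝ, E) ∞ f x)
    {a : M} {a' : M'} (h' : x ∈ (extChartAt 𝓘(ℝ, E') a').source)
    (h : f x ∈ (extChartAt 𝓘(ℝ, E) a).source) :
    ∀ᶠ y in nhds (extChartAt 𝓘(ℝ, E') a' x), ∀ A : M → GForm E R,
      chartRep a' (pullM E' f A) y = pull (fderiv ℝ (inCharts E E' a a' f) y : E' →ₗ[ℝ] E)
        (chartRep a A (inCharts E E' a a' f y)) := by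
  have h1 := (chart_tendsto_symm a' h').eventually (eventually_mdifferentiableAt hf)
  have h2 := (chart_tendsto_symm a' h').eventually
    (hf.continuousAt.eventually ((isOpen_extChartAt_source a).mem_nhds h))
  filter_upwards [h1, h2, (isOpen_extChartAt_target a').mem_nhds
    ((extChartAt 𝓘(ℝ, E') a').map_source h')] with y hy1 hy2 hy3 A
  exact chartRep_pullM A hy3 hy1 hy2

theorem SmoothIn.pullM_aux {f : M' → M} {A : Q → M → GForm E R} {q : Q} {x : M'}
    (hf : ContMDiffAt 𝓘(ℝ, E') 𝓘(ℝ, E) ∞ f x) {a : M} {a' : M'}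
    (h' : x ∈ (extChartAt 𝓘(ℝ, E') a').source) (h : f x ∈ (extChartAt 𝓘(ℝ, E) a).source)
    (hA : GSmoothAt (fun z : Q × E ↦ chartRep a (A z.1) z.2) (q, extChartAt 𝓘(ℝ, E) a (f x))) :
    GSmoothAt (fun z : Q × E' ↦ chartRep a' (pullM E' f (A z.1)) z.2)
      (q, extChartAt 𝓘(ℝ, E') a' x) := by
  have hF := contDiffAt_inCharts hf h' h
  have hF' : ContDiffAt ℝ ∞ (fderiv ℝ (inCharts E E' a a' f)) (extChartAt 𝓘(ℝ, E') a' x) :=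
    hF.fderiv_right (by simp)
  have hx : inCharts E E' a a' f (extChartAt 𝓘(ℝ, E') a' x) = extChartAt 𝓘(ℝ, E) a (f x) := by
    rw [inCharts, (extChartAt 𝓘(ℝ, E') a').left_inv h']
  have h1 : GSmoothAt (fun z : Q × E' ↦ chartRep a (A z.1) (inCharts E E' a a' f z.2))
      (q, extChartAt 𝓘(ℝ, E') a' x) := by
    refine GSmoothAt.comp (A := fun z : Q × E ↦ chartRep a (A z.1) z.2)
      (f := fun z : Q × E' ↦ (z.1, inCharts E E' a a' f z.2)) (by rwa [hx]) ?_
    exact contDiffAt_fst.prodMk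
      (ContDiffAt.comp (g := inCharts E E' a a' f) (q, extChartAt 𝓘(ℝ, E') a' x) hF contDiffAt_snd)
  have h2 := h1.pull (hF'.comp (q, extChartAt 𝓘(ℝ, E') a' x) contDiffAt_snd)
  refine h2.congr ?_
  have h3 : Filter.Tendsto (Prod.snd : Q × E' → E') (nhds (q, extChartAt 𝓘(ℝ, E') a' x))
      (nhds (extChartAt 𝓘(ℝ, E') a' x)) := continuous_snd.tendsto _
  filter_upwards [h3.eventually (eventually_charts (R := R) hf h' h)] with z hz
  exact hz _

theorem pullM_id (A : M → GForm E R) : pullM E id A = A := by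
  funext x
  have h : (tmap E E (id : M → M) x : E →ₗ[ℝ] E) = LinearMap.id := by
    rw [tmap, mfderiv_id]
    rfl
  rw [pullM, h]
  rfl

/-- A change of chart is the pullback by the identity map, read in two charts. So smoothness in the
chart centred at `x` implies smoothness in every chart around `x`. -/
theorem SmoothIn.chart {A : Q → M → GForm E R} {q : Q} {x a : M}
    (hx : x ∈ (extChartAt 𝓘(ℝ, E) a).source) (hA : SmoothIn A q x) :
    GSmoothAt (fun z : Q × E ↦ chartRep a (A z.1) z.2) (q, extChartAt 𝓘(ℝ, E) a x) := by
  have h := SmoothIn.pullM_aux (f := (id : M → M)) contMDiffAt_id hx (mem_extChartAt_source x) hA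
  simpa only [pullM_id] using h

theorem SmoothIn.pullM {f : M' → M} {A : Q → M → GForm E R} {q : Q} {x : M'}
    (hA : SmoothIn A q (f x)) (hf : ContMDiffAt 𝓘(ℝ, E') 𝓘(ℝ, E) ∞ f x) :
    SmoothIn (fun q ↦ BasicChern.pullM E' f (A q)) q x :=
  SmoothIn.pullM_aux hf (mem_extChartAt_source (I := 𝓘(ℝ, E')) x)
    (mem_extChartAt_source (I := 𝓘(ℝ, E)) (f x)) hA

theorem SmoothAt.smoothIn {A : M → GForm E R} {x : M} (h : SmoothAt A x) (q : Q) :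
    SmoothIn (fun _ : Q ↦ A) q x :=
  GSmoothAt.comp (A := chartRep x A) (f := Prod.snd) h contDiffAt_snd

theorem SmoothIn.comp {Q' : Type*} [NormedAddCommGroup Q'] [NormedSpace ℝ Q']
    {A : Q → M → GForm E R} {f : Q' → Q} {q : Q'} {x : M} (h : SmoothIn A (f q) x)
    (hf : ContDiffAt ℝ ∞ f q) : SmoothIn (fun q ↦ A (f q)) q x :=
  GSmoothAt.comp (A := fun z : Q × E ↦ chartRep x (A z.1) z.2) (f := fun z : Q' × E ↦ (f z.1, z.2))
    h ((hf.comp (q, extChartAt 𝓘(ℝ, E) x x) contDiffAt_fst).prodMk contDiffAt_snd)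

theorem SmoothIn.smoothAt {A : Q → M → GForm E R} {q : Q} {x : M} (h : SmoothIn A q x) :
    SmoothAt (A q) x :=
  GSmoothAt.comp (A := fun z : Q × E ↦ chartRep x (A z.1) z.2) (f := fun y ↦ (q, y)) h
    (contDiffAt_const.prodMk contDiffAt_id)

theorem SmoothAt.chart {A : M → GForm E R} {x a : M}
    (hx : x ∈ (extChartAt 𝓘(ℝ, E) a).source) (hA : SmoothAt A x) :
    GSmoothAt (chartRep a A) (extChartAt 𝓘(ℝ, E) a x) :=
  GSmoothAt.comp (A := fun z : ℝ × E ↦ chartRep a A z.2) (f := fun y ↦ ((0 : ℝ), y))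
    ((hA.smoothIn (0 : ℝ)).chart hx) (contDiffAt_const.prodMk contDiffAt_id)

theorem SmoothAt.pullM {f : M' → M} {A : M → GForm E R} {x : M'}
    (hA : SmoothAt A (f x)) (hf : ContMDiffAt 𝓘(ℝ, E') 𝓘(ℝ, E) ∞ f x) :
    SmoothAt (BasicChern.pullM E' f A) x :=
  ((hA.smoothIn (0 : ℝ)).pullM hf).smoothAt

theorem chartRep_congr {A A' : M → GForm E R} {x a : M}
    (hx : x ∈ (extChartAt 𝓘(ℝ, E) a).source) (h : A =ᶠ[nhds x] A') :
    chartRep a A =ᶠ[nhds (extChartAt 𝓘(ℝ, E) a x)] chartRep a A' := by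
  filter_upwards [(chart_tendsto_symm a hx).eventually h] with y hy
  rw [chartRep, hy, chartRep]

theorem gd_congr {A A' : M → GForm E R} {x : M} (h : A =ᶠ[nhds x] A') : gd A x = gd A' x := by
  rw [gd, gd, dG_congr (chartRep_congr (mem_extChartAt_source x) h)]

/-- The exterior derivative commutes with pullbacks. -/
theorem gd_pullM {f : M' → M} {A : M → GForm E R} {x : M'} (hA : SmoothAt A (f x))
    (hf : ContMDiffAt 𝓘(ℝ, E') 𝓘(ℝ, E) ∞ f x) : gd (pullM E' f A) x = pullM E' f (gd A) x := by
  have h' := mem_extChartAt_source (I := 𝓘(ℝ, E')) x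
  have h := mem_extChartAt_source (I := 𝓘(ℝ, E)) (f x)
  have hx : inCharts E E' (f x) x f (extChartAt 𝓘(ℝ, E') x x) = extChartAt 𝓘(ℝ, E) (f x) (f x) := by
    rw [inCharts, (extChartAt 𝓘(ℝ, E') x).left_inv h']
  have h1 : chartRep x (pullM E' f A) =ᶠ[nhds (extChartAt 𝓘(ℝ, E') x x)] fun y ↦
      pull (fderiv ℝ (inCharts E E' (f x) x f) y : E' →ₗ[ℝ] E)
        (chartRep (f x) A (inCharts E E' (f x) x f y)) := by
    filter_upwards [eventually_charts (R := R) hf h' h] with y hy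
    exact hy A
  have hxl := (extChartAt 𝓘(ℝ, E') x).left_inv h'
  rw [gd, dG_congr h1, dG_pull (by rwa [hx]) (contDiffAt_inCharts hf h' h), hx, pullM, gd,
    pull_pull, pull_pull, fderiv_inCharts ((extChartAt 𝓘(ℝ, E') x).map_source h')
      (by rw [hxl]; exact hf.mdifferentiableAt (by simp)) (by rwa [hxl]), hxl]
  congr 2
  have h3 := tmap_symm_chart' x h'
  ext1 u
  have h4 : tmap E' E' (extChartAt 𝓘(ℝ, E') x).symm (extChartAt 𝓘(ℝ, E') x x)
    (tmap E' E' (extChartAt 𝓘(ℝ, E') x) x u) = u := DFunLike.congr_fun h3 u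
  exact congrArg (fun w ↦ tmap E E (extChartAt 𝓘(ℝ, E) (f x)) (f x) (tmap E' E f x w)) h4

end ManifoldForms

end BasicChern
end

noncomputable section
namespace BasicChern

section ManifoldForms

open GForm

variable {E : Type*} [NormedAddCommGroup E] [NormedSpace ℝ E] [FiniteDimensional ℝ E]
  {M : Type*} [TopologicalSpace M] [ChartedSpace E M] [IsManifold 𝓘(ℝ, E) ∞ M]
  {R : Type*} [NormedRing R] [NormedAlgebra ℝ R] [FiniteDimensional ℝ R]
  {Q : Type*} [NormedAddCommGroup Q] [NormedSpace ℝ Q]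

/-! ### Algebraic operations and smoothness -/

section Closure

variable {A A' : Q → M → GForm E R} {q : Q} {x : M}

theorem SmoothIn.mul (h : SmoothIn A q x) (h' : SmoothIn A' q x) :
    SmoothIn (fun q x ↦ A q x * A' q x) q x := by
  refine (GSmoothAt.mul h h').congr (Filter.Eventually.of_forall fun z ↦ ?_)
  exact _root_.map_mul (pull _) _ _

theorem SmoothIn.add (h : SmoothIn A q x) (h' : SmoothIn A' q x) :
    SmoothIn (fun q x ↦ A q x + A' q x) q x := by
  refine (GSmoothAt.add h h').congr (Filter.Eventually.of_forall fun z ↦ ?_)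
  exact map_add (pull _) _ _

theorem SmoothIn.sub (h : SmoothIn A q x) (h' : SmoothIn A' q x) :
    SmoothIn (fun q x ↦ A q x - A' q x) q x := by
  refine (GSmoothAt.sub h h').congr (Filter.Eventually.of_forall fun z ↦ ?_)
  exact map_sub (pull _) _ _

theorem SmoothIn.smul {c : Q → ℝ} (hc : ContDiffAt ℝ ∞ c q) (h : SmoothIn A q x) :
    SmoothIn (fun q x ↦ c q • A q x) q x := fun k v ↦
  ContDiffAt.smul (hc.comp (q, extChartAt 𝓘(ℝ, E) x x) contDiffAt_fst) (h k v)

theorem SmoothIn.sum {I : Type*} {s : Finset I} {A : I → Q → M → GForm E R}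
    (h : ∀ i ∈ s, SmoothIn (A i) q x) : SmoothIn (fun q x ↦ ∑ i ∈ s, A i q x) q x := by
  classical
  induction s using Finset.induction_on with
  | empty =>
    intro k v
    exact contDiffAt_const (c := 0)
  | insert i s hi ih =>
    simp only [Finset.sum_insert hi]
    exact (h i (Finset.mem_insert_self i s)).add
      (ih fun j hj ↦ h j (Finset.mem_insert_of_mem hj))

theorem SmoothIn.expNeg (h : SmoothIn A q x) :
    SmoothIn (fun q x ↦ GForm.expNeg (A q x)) q x := by
  refine (GSmoothAt.expNeg h).congr (Filter.Eventually.of_forall fun z ↦ ?_)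
  exact pull_expNeg _ _

theorem SmoothIn.trc {t : R →ₗ[ℝ] ℂ} (h : SmoothIn A q x) :
    SmoothIn (fun q x ↦ GForm.trc t (A q x)) q x :=
  GSmoothAt.trc (t := t) h

variable {B B' : M → GForm E R}

theorem SmoothAt.mul (h : SmoothAt B x) (h' : SmoothAt B' x) :
    SmoothAt (fun x ↦ B x * B' x) x :=
  ((h.smoothIn (0 : ℝ)).mul (h'.smoothIn (0 : ℝ))).smoothAt

theorem SmoothAt.add (h : SmoothAt B x) (h' : SmoothAt B' x) :
    SmoothAt (fun x ↦ B x + B' x) x :=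
  ((h.smoothIn (0 : ℝ)).add (h'.smoothIn (0 : ℝ))).smoothAt

theorem SmoothAt.sub (h : SmoothAt B x) (h' : SmoothAt B' x) :
    SmoothAt (fun x ↦ B x - B' x) x :=
  ((h.smoothIn (0 : ℝ)).sub (h'.smoothIn (0 : ℝ))).smoothAt

theorem SmoothAt.smul (c : ℝ) (h : SmoothAt B x) : SmoothAt (fun x ↦ c • B x) x :=
  ((h.smoothIn (0 : ℝ)).smul (c := fun _ ↦ c) contDiffAt_const).smoothAt

theorem SmoothAt.expNeg (h : SmoothAt B x) : SmoothAt (fun x ↦ GForm.expNeg (B x)) x :=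
  ((h.smoothIn (0 : ℝ)).expNeg).smoothAt

theorem smoothAt_const {r : M → R} (hr : ContMDiffAt 𝓘(ℝ, E) 𝓘(ℝ, R) ∞ r x) :
    SmoothAt (fun x ↦ GForm.const E (r x)) x := by
  have h1 : ContDiffAt ℝ ∞ (fun y ↦ r ((extChartAt 𝓘(ℝ, E) x).symm y))
      (extChartAt 𝓘(ℝ, E) x x) := by
    rw [← contMDiffAt_iff_contDiffAt]
    refine ContMDiffAt.comp _ (g := r) ?_ (contMDiffAt_symm x (mem_extChartAt_target x))
    rwa [extChartAt_to_inv]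
  refine (GSmoothAt.const h1).congr (Filter.Eventually.of_forall fun y ↦ ?_)
  exact pull_const _ _

end Closure

/-! ### The exterior derivative -/

section Exterior

variable {A A' : M → GForm E R} {x : M}

theorem pull_chart_chartRep {a : M} (hx : x ∈ (extChartAt 𝓘(ℝ, E) a).source) (A : M → GForm E R) :
    pull (tmap E E (extChartAt 𝓘(ℝ, E) a) x : E →ₗ[ℝ] E)
      (chartRep a A (extChartAt 𝓘(ℝ, E) a x)) = A x := by
  have h := tmap_symm_chart' a hx
  rw [chartRep, pull_pull, (extChartAt 𝓘(ℝ, E) a).left_inv hx]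
  have h2 : ((tmap E E (extChartAt 𝓘(ℝ, E) a).symm (extChartAt 𝓘(ℝ, E) a x) : E →ₗ[ℝ] E) ∘ₗ
      (tmap E E (extChartAt 𝓘(ℝ, E) a) x : E →ₗ[ℝ] E)) = LinearMap.id := by
    ext1 u
    exact DFunLike.congr_fun h u
  rw [h2]
  rfl

theorem pull_symm_pull_chart (a : M) {y : E} (hy : y ∈ (extChartAt 𝓘(ℝ, E) a).target)
    (B : GForm E R) :
    pull (tmap E E (extChartAt 𝓘(ℝ, E) a).symm y : E →ₗ[ℝ] E)
      (pull (tmap E E (extChartAt 𝓘(ℝ, E) a) ((extChartAt 𝓘(ℝ, E) a).symm y) : E →ₗ[ℝ] E) B) =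
        B := by
  have h := tmap_chart_symm a hy
  rw [pull_pull]
  have h2 : ((tmap E E (extChartAt 𝓘(ℝ, E) a) ((extChartAt 𝓘(ℝ, E) a).symm y) : E →ₗ[ℝ] E) ∘ₗ
      (tmap E E (extChartAt 𝓘(ℝ, E) a).symm y : E →ₗ[ℝ] E)) = LinearMap.id := by
    ext1 u
    exact DFunLike.congr_fun h u
  rw [h2]
  rfl

/-- `gd` uses at each point the chart centred there. As `d` commutes with the transition maps, one
fixed chart can serve for a whole neighbourhood, which is required before `gd A` can be
differentiated again. -/
theorem gd_chart {a : M} (hx : x ∈ (extChartAt 𝓘(ℝ, E) a).source) (hA : SmoothAt A x) :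
    gd A x = pull (tmap E E (extChartAt 𝓘(ℝ, E) a) x : E →ₗ[ℝ] E)
      (dG (chartRep a A) (extChartAt 𝓘(ℝ, E) a x)) := by
  have hid : ContMDiffAt 𝓘(ℝ, E) 𝓘(ℝ, E) ∞ (id : M → M) x := contMDiffAt_id
  have h' := mem_extChartAt_source (I := 𝓘(ℝ, E)) x
  have hxl := (extChartAt 𝓘(ℝ, E) x).left_inv h'
  have hF : inCharts E E a x id (extChartAt 𝓘(ℝ, E) x x) = extChartAt 𝓘(ℝ, E) a x := by
    rw [inCharts, hxl, id]
  have h1 : chartRep x A =ᶠ[nhds (extChartAt 𝓘(ℝ, E) x x)] fun y ↦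
      pull (fderiv ℝ (inCharts E E a x id) y : E →ₗ[ℝ] E)
        (chartRep a A (inCharts E E a x id y)) := by
    filter_upwards [eventually_charts (R := R) hid h' hx] with y hy
    have := hy A
    rwa [pullM_id] at this
  rw [gd, dG_congr h1, dG_pull (by rw [hF]; exact hA.chart hx) (contDiffAt_inCharts hid h' hx), hF,
    pull_pull, fderiv_inCharts ((extChartAt 𝓘(ℝ, E) x).map_source h')
      mdifferentiableAt_id (by rwa [hxl]), hxl]
  congr 2
  have h3 := tmap_symm_chart' x h'
  ext1 u
  have h4 : tmap E E (extChartAt 𝓘(ℝ, E) x).symm (extChartAt 𝓘(ℝ, E) x x)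
    (tmap E E (extChartAt 𝓘(ℝ, E) x) x u) = u := DFunLike.congr_fun h3 u
  have h5 : tmap E E (id : M → M) x = ContinuousLinearMap.id ℝ E := mfderiv_id
  change tmap E E (extChartAt 𝓘(ℝ, E) a) x (tmap E E (id : M → M) x
    (tmap E E (extChartAt 𝓘(ℝ, E) x).symm (extChartAt 𝓘(ℝ, E) x x)
    (tmap E E (extChartAt 𝓘(ℝ, E) x) x u))) = _
  rw [h4, h5]
  rfl

theorem chartRep_gd (a : M) {y : E} (hy : y ∈ (extChartAt 𝓘(ℝ, E) a).target)
    (hA : SmoothAt A ((extChartAt 𝓘(ℝ, E) a).symm y)) :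
    chartRep a (gd A) y = dG (chartRep a A) y := by
  rw [chartRep, gd_chart ((extChartAt 𝓘(ℝ, E) a).map_target hy) hA, pull_symm_pull_chart a hy,
    (extChartAt 𝓘(ℝ, E) a).right_inv hy]

theorem eventually_chartRep_gd (hA : ∀ᶠ z in nhds x, SmoothAt A z) :
    chartRep x (gd A) =ᶠ[nhds (extChartAt 𝓘(ℝ, E) x x)] dG (chartRep x A) := by
  filter_upwards [(chart_tendsto_symm x (mem_extChartAt_source x)).eventually hA,
    (isOpen_extChartAt_target x).mem_nhds (mem_extChartAt_target x)] with y hy hy2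
  exact chartRep_gd x hy2 hy

theorem SmoothAt.gd (hA : ∀ᶠ z in nhds x, SmoothAt A z) : SmoothAt (gd A) x :=
  GSmoothAt.congr (GSmoothAt.dG hA.self_of_nhds) (eventually_chartRep_gd hA)

theorem gd_gd (hA : ∀ᶠ z in nhds x, SmoothAt A z) : gd (gd A) x = 0 := by
  rw [BasicChern.gd, dG_congr (eventually_chartRep_gd hA), dG_dG hA.self_of_nhds, map_zero]

theorem gd_mul (hA : SmoothAt A x) (hA' : SmoothAt A' x) :
    gd (fun x ↦ A x * A' x) x = gd A x * A' x + ε (A x) * gd A' x := by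
  have h : chartRep x (fun x ↦ A x * A' x) = fun y ↦ chartRep x A y * chartRep x A' y := by
    funext y
    exact _root_.map_mul (pull _) _ _
  rw [gd, h, dG_mul hA hA', map_add, _root_.map_mul, _root_.map_mul, ← ε_pull,
    pull_chart_chartRep (mem_extChartAt_source x), pull_chart_chartRep (mem_extChartAt_source x),
    gd, gd]

theorem gd_add (hA : SmoothAt A x) (hA' : SmoothAt A' x) :
    gd (fun x ↦ A x + A' x) x = gd A x + gd A' x := by
  have h : chartRep x (fun x ↦ A x + A' x) = fun y ↦ chartRep x A y + chartRep x A' y := by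
    funext y
    exact map_add (pull _) _ _
  rw [gd, h, dG_add hA hA', map_add, gd, gd]

theorem gd_sub (hA : SmoothAt A x) (hA' : SmoothAt A' x) :
    gd (fun x ↦ A x - A' x) x = gd A x - gd A' x := by
  have h : chartRep x (fun x ↦ A x - A' x) = fun y ↦ chartRep x A y - chartRep x A' y := by
    funext y
    exact map_sub (pull _) _ _
  rw [gd, h, dG_sub hA hA', map_sub, gd, gd]

theorem gd_trc (t : R →ₗ[ℝ] ℂ) (hA : SmoothAt A x) :
    gd (fun x ↦ trc t (A x)) x = trc t (gd A x) := by
  have h : chartRep x (fun x ↦ trc t (A x)) = fun y ↦ trc t (chartRep x A y) := rfl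
  rw [gd, h, dG_trc hA, gd, trc_pull]

end Exterior

/-! ### Vector fields -/

/-- The expression of a vector field in the chart at `a`. -/
def chartVF (a : M) (V : M → E) : E → E :=
  VectorField.mpullbackWithin 𝓘(ℝ, E) 𝓘(ℝ, E) (extChartAt 𝓘(ℝ, E) a).symm V (Set.range 𝓘(ℝ, E))

theorem tmap_symm_chartVF {a : M} (V : M → E) {y : E} (hy : y ∈ (extChartAt 𝓘(ℝ, E) a).target) :
    tmap E E (extChartAt 𝓘(ℝ, E) a).symm y (chartVF a V y) =
      V ((extChartAt 𝓘(ℝ, E) a).symm y) := by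
  haveI : IsManifold 𝓘(ℝ, E) 1 M := IsManifold.of_le (n := ∞) (by simp)
  have := (isInvertible_mfderivWithin_extChartAt_symm (I := 𝓘(ℝ, E)) hy).self_apply_inverse
    (V ((extChartAt 𝓘(ℝ, E) a).symm y))
  have hc : chartVF a V y = (mfderivWithin 𝓘(ℝ, E) 𝓘(ℝ, E) (extChartAt 𝓘(ℝ, E) a).symm
    (Set.range 𝓘(ℝ, E)) y).inverse (V ((extChartAt 𝓘(ℝ, E) a).symm y)) := rfl
  have ht : tmap E E (extChartAt 𝓘(ℝ, E) a).symm y = mfderivWithin 𝓘(ℝ, E) 𝓘(ℝ, E)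
      (extChartAt 𝓘(ℝ, E) a).symm (Set.range 𝓘(ℝ, E)) y := by
    rw [ModelWithCorners.range_eq_univ, mfderivWithin_univ]
  rw [hc, ht]
  exact this

theorem chartVF_apply {a : M} (V : M → E) {y : E} (hy : y ∈ (extChartAt 𝓘(ℝ, E) a).target) :
    chartVF a V y = tmap E E (extChartAt 𝓘(ℝ, E) a) ((extChartAt 𝓘(ℝ, E) a).symm y)
      (V ((extChartAt 𝓘(ℝ, E) a).symm y)) := by
  rw [← tmap_symm_chartVF V hy]
  exact (DFunLike.congr_fun (tmap_chart_symm a hy) _).symm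

theorem contDiffAt_chartVF {x : M} {V : M → E} (hV : ContMDiffAt 𝓘(ℝ, E) 𝓘(ℝ, E).tangent ∞
    (fun x ↦ (⟨x, V x⟩ : TangentBundle 𝓘(ℝ, E) M)) x) :
    ContDiffAt ℝ ∞ (chartVF x V) (extChartAt 𝓘(ℝ, E) x x) := by
  have h1 := VectorField.contMDiffWithinAt_mpullbackWithin_extChartAt_symm (n := ∞) (m := ∞)
    (x := x) (V := V) (s := Set.univ) hV.contMDiffWithinAt
    uniqueMDiffOn_univ trivial (by simp)
  have h2 := contMDiffWithinAt_vectorSpace_iff_contDiffWithinAt.1 h1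
  refine h2.contDiffAt ?_
  simpa only [Set.preimage_univ, Set.inter_univ] using
    (isOpen_extChartAt_target (I := 𝓘(ℝ, E)) x).mem_nhds (mem_extChartAt_target x)

theorem tmap_chart_mlieBracket (V W : M → E) (x : M) :
    tmap E E (extChartAt 𝓘(ℝ, E) x) x (VectorField.mlieBracket 𝓘(ℝ, E) V W x : E) =
      VectorField.lieBracket ℝ (chartVF x V) (chartVF x W) (extChartAt 𝓘(ℝ, E) x x) := by
  haveI : IsManifold 𝓘(ℝ, E) 1 M := IsManifold.of_le (n := ∞) (by simp)
  have h0 := (congrFun (VectorField.mlieBracketWithin_univ (I := 𝓘(ℝ, E)) (V := V)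
    (W := W)).symm x).trans VectorField.mlieBracketWithin_apply
  have h := fun w : E ↦ (isInvertible_mfderiv_extChartAt (I := 𝓘(ℝ, E))
    (mem_extChartAt_source x)).self_apply_inverse w
  refine (congrArg (tmap E E (extChartAt 𝓘(ℝ, E) x) x) h0).trans ((h _).trans ?_)
  rw [Set.preimage_univ, ModelWithCorners.range_eq_univ, Set.univ_inter]
  have h3 := VectorField.lieBracketWithin_univ (𝕜 := ℝ) (V := chartVF x V) (W := chartVF x W)
  rw [← h3]
  have h4 : chartVF x V = VectorField.mpullbackWithin 𝓘(ℝ, E) 𝓘(ℝ, E)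
    (extChartAt 𝓘(ℝ, E) x).symm V (Set.range 𝓘(ℝ, E)) := rfl
  have h5 : chartVF x W = VectorField.mpullbackWithin 𝓘(ℝ, E) 𝓘(ℝ, E)
    (extChartAt 𝓘(ℝ, E) x).symm W (Set.range 𝓘(ℝ, E)) := rfl
  rw [ModelWithCorners.range_eq_univ] at h4 h5
  rw [h4, h5]

theorem chartRep_ι {a : M} (V : M → E) (A : M → GForm E R) {y : E}
    (hy : y ∈ (extChartAt 𝓘(ℝ, E) a).target) :
    chartRep a (fun x ↦ ι (V x) (A x)) y = ι (chartVF a V y) (chartRep a A y) := by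
  rw [chartRep, chartRep, ι_pull]
  congr 2
  exact congrArg ι (tmap_symm_chartVF V hy).symm

theorem eventually_chartRep_ι (V : M → E) (A : M → GForm E R) (x : M) :
    chartRep x (fun x ↦ ι (V x) (A x)) =ᶠ[nhds (extChartAt 𝓘(ℝ, E) x x)]
      fun y ↦ ι (chartVF x V y) (chartRep x A y) := by
  filter_upwards [(isOpen_extChartAt_target x).mem_nhds (mem_extChartAt_target x)] with y hy
  exact chartRep_ι V A hy

theorem SmoothAt.ι {x : M} {A : M → GForm E R} (V : VF E M) (hA : SmoothAt A x) :
    SmoothAt (fun x ↦ GForm.ι (V.vec x) (A x)) x :=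
  GSmoothAt.congr (GSmoothAt.ι hA (contDiffAt_chartVF (V.contMDiff x)))
    (eventually_chartRep_ι _ _ _)

/-- The Lie derivative, defined by Cartan's formula. -/
def lieM (V : VF E M) (A : M → GForm E R) (x : M) : GForm E R :=
  gd (fun x ↦ ι (V.vec x) (A x)) x + ι (V.vec x) (gd A x)

section Lie

variable {A A' : M → GForm E R} {x : M} (V : VF E M)

/-- The exterior derivative and the contraction are antiderivations that anticommute with the parity
operator `ε`; the mixed terms of their anticommutator cancel. -/
theorem lieM_mul (hA : SmoothAt A x) (hA' : SmoothAt A' x) :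
    lieM V (fun x ↦ A x * A' x) x = lieM V A x * A' x + A x * lieM V A' x := by
  have h : (fun x ↦ ι (V.vec x) (A x * A' x)) = fun x ↦
      ι (V.vec x) (A x) * A' x + ε (A x) * ι (V.vec x) (A' x) := by
    funext x
    exact ι_mul _ _ _
  have hε : SmoothAt (fun x ↦ ε (A x)) x := fun k v ↦ contDiffAt_const.smul (hA k v)
  have hdε : gd (fun x ↦ ε (A x)) x = -ε (gd A x) := by
    have h1 : chartRep x (fun x ↦ ε (A x)) = fun y ↦ ε (chartRep x A y) := rfl
    have h2 : gfderiv (fun y ↦ ε (chartRep x A y)) (extChartAt 𝓘(ℝ, E) x x) =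
        ε ∘ₗ gfderiv (chartRep x A) (extChartAt 𝓘(ℝ, E) x x) := by
      ext1 u
      refine GSmoothAt.gfderiv_eq (fun k v ↦ contDiffAt_const.smul (hA k v)) fun k v ↦ ?_
      exact (hA.hasGDeriv_line u k v).const_smul ((-1 : ℝ) ^ k)
    rw [gd, h1, dG, h2, gd, dG, ε_pull, ε_alt, map_neg, neg_neg]
  rw [lieM, h, gd_add ((hA.ι V).mul hA') (hε.mul (hA'.ι V)), gd_mul (hA.ι V) hA',
    gd_mul hε (hA'.ι V), gd_mul hA hA', map_add, ι_mul, ι_mul, hdε, ι_ε, ε_ε, lieM, lieM]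
  noncomm_ring

/-- Cartan's formula `dG_ι` splits the Lie derivative in a chart into a directional derivative and a
term algebraic in the values of the form, the shape in which it is applied to contractions and
exponentials. -/
theorem lieM_chart (hA : SmoothAt A x) : lieM V A x =
    pull (tmap E E (extChartAt 𝓘(ℝ, E) x) x : E →ₗ[ℝ] E)
      (gfderiv (chartRep x A) (extChartAt 𝓘(ℝ, E) x x)
        (chartVF x V.vec (extChartAt 𝓘(ℝ, E) x x)) +
        der (fderiv ℝ (chartVF x V.vec) (extChartAt 𝓘(ℝ, E) x x))
          (chartRep x A (extChartAt 𝓘(ℝ, E) x x))) := by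
  have hV := chartVF_apply (a := x) V.vec (mem_extChartAt_target x)
  rw [extChartAt_to_inv] at hV
  rw [lieM, gd, dG_congr (eventually_chartRep_ι _ _ _), gd, ι_pull, ← map_add,
    ← dG_ι hA (contDiffAt_chartVF (V.contMDiff x)), hV]
  rfl

omit [FiniteDimensional ℝ E] [FiniteDimensional ℝ R] in
theorem ι_ι_self (u : E) (a : GForm E R) : ι u (ι u a) = 0 := by
  ext k v
  rw [ι_apply_apply, ι_apply_apply]
  exact (a (k + 1 + 1)).map_eq_zero_of_eq (i := 0) (j := 1) _ rfl (by simp)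

omit [FiniteDimensional ℝ E] [FiniteDimensional ℝ R] in
theorem ι_ι_add (u w : E) (a : GForm E R) : ι u (ι w a) + ι w (ι u a) = 0 := by
  have h := ι_ι_self (u + w) a
  simp only [map_add, LinearMap.add_apply, ι_ι_self, add_zero, zero_add] at h
  rw [add_comm]
  exact h

theorem der_ι (B : E →ₗ[ℝ] E) (u : E) (a : GForm E R) :
    der B (ι u a) = ι u (der B a) - ι (B u) a := by
  have h : ι.flip (ι u a) ∘ₗ B = -(ι u ∘ₗ (ι.flip a ∘ₗ B)) := by
    ext1 y
    change ι (B y) (ι u a) = -(ι u (ι (B y) a))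
    exact eq_neg_of_add_eq_zero_left (ι_ι_add _ _ _)
  rw [der, h, map_neg, der, ι_alt]
  change _ = ι (B u) a - _ - ι (B u) a
  abel

/-- In a chart the directional derivative contributes the contraction with `DW(V)` and `der`
contributes minus that with `DV(W)`; their difference is the coordinate formula of the bracket. -/
theorem lieM_ι (W : VF E M) (hA : SmoothAt A x) :
    lieM V (fun x ↦ ι (W.vec x) (A x)) x =
      ι ((⁅V, W⁆ : VF E M).vec x) (A x) + ι (W.vec x) (lieM V A x) := by
  have hsW := contDiffAt_chartVF (V := W.vec) (W.contMDiff x)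
  have hW := chartVF_apply (a := x) W.vec (mem_extChartAt_target x)
  rw [extChartAt_to_inv] at hW
  have hb := tmap_chart_mlieBracket V.vec W.vec x
  have hb' : tmap E E (extChartAt 𝓘(ℝ, E) x) x ((⁅V, W⁆ : VF E M).vec x) =
    fderiv ℝ (chartVF x W.vec) (extChartAt 𝓘(ℝ, E) x x)
      (chartVF x V.vec (extChartAt 𝓘(ℝ, E) x x)) -
    fderiv ℝ (chartVF x V.vec) (extChartAt 𝓘(ℝ, E) x x)
      (chartVF x W.vec (extChartAt 𝓘(ℝ, E) x x)) := hb
  have hA' := pull_chart_chartRep (mem_extChartAt_source (I := 𝓘(ℝ, E)) x) A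
  have h1 := (eventually_chartRep_ι W.vec A x).self_of_nhds
  rw [lieM_chart V (hA.ι W), gfderiv_congr (eventually_chartRep_ι _ _ _), h1, gfderiv_ι hA hsW,
    der_ι, lieM_chart V hA, ι_pull]
  have h2 : ι ((⁅V, W⁆ : VF E M).vec x) (A x) = pull (tmap E E (extChartAt 𝓘(ℝ, E) x) x : E →ₗ[ℝ] E)
      (ι (tmap E E (extChartAt 𝓘(ℝ, E) x) x ((⁅V, W⁆ : VF E M).vec x))
        (chartRep x A (extChartAt 𝓘(ℝ, E) x x))) := by
    conv_lhs => rw [← hA']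
    exact ι_pull _ _ _
  rw [h2, ← map_add]
  congr 1
  change _ = ι (tmap E E (extChartAt 𝓘(ℝ, E) x) x ((⁅V, W⁆ : VF E M).vec x)) _ +
    ι (tmap E E (extChartAt 𝓘(ℝ, E) x) x (W.vec x)) _
  rw [hb', ← hW, map_sub, LinearMap.sub_apply, map_add]
  change _ + (_ - ι (fderiv ℝ (chartVF x V.vec) (extChartAt 𝓘(ℝ, E) x x)
    (chartVF x W.vec (extChartAt 𝓘(ℝ, E) x x))) _) = _
  abel

end Lie

end ManifoldForms

end BasicChern
end

noncomputable section
namespace BasicChern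

/-! ### Exponentials and traces of forms on a manifold -/

section ManifoldExp

open GForm

variable {E : Type*} [NormedAddCommGroup E] [NormedSpace ℝ E] [FiniteDimensional ℝ E]
  {M : Type*} [TopologicalSpace M] [ChartedSpace E M] [IsManifold 𝓘(ℝ, E) ∞ M]
  {R : Type*} [NormedRing R] [NormedAlgebra ℝ R] [FiniteDimensional ℝ R]

theorem pull_symm_pull_chart' (x : M) (B : GForm E R) :
    pull (tmap E E (extChartAt 𝓘(ℝ, E) x).symm (extChartAt 𝓘(ℝ, E) x x) : E →ₗ[ℝ] E)
      (pull (tmap E E (extChartAt 𝓘(ℝ, E) x) x : E →ₗ[ℝ] E) B) = B := by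
  have h := pull_symm_pull_chart x (mem_extChartAt_target x) B
  rwa [extChartAt_to_inv] at h

theorem pull_chart_pull_symm (x : M) (B : GForm E R) :
    pull (tmap E E (extChartAt 𝓘(ℝ, E) x) x : E →ₗ[ℝ] E)
      (pull (tmap E E (extChartAt 𝓘(ℝ, E) x).symm (extChartAt 𝓘(ℝ, E) x x) : E →ₗ[ℝ] E) B) =
        B := by
  have h := pull_chart_chartRep (mem_extChartAt_source (I := 𝓘(ℝ, E)) x) (fun _ ↦ B)
  exact h

theorem chartRep_center (A : M → GForm E R) (x : M) :
    chartRep x A (extChartAt 𝓘(ℝ, E) x x) =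
      pull (tmap E E (extChartAt 𝓘(ℝ, E) x).symm (extChartAt 𝓘(ℝ, E) x x) : E →ₗ[ℝ] E) (A x) := by
  rw [chartRep, extChartAt_to_inv]

theorem dG_chartRep_center (A : M → GForm E R) (x : M) :
    dG (chartRep x A) (extChartAt 𝓘(ℝ, E) x x) =
      pull (tmap E E (extChartAt 𝓘(ℝ, E) x).symm (extChartAt 𝓘(ℝ, E) x x) : E →ₗ[ℝ] E)
        (gd A x) := by
  rw [gd, pull_symm_pull_chart']

theorem chartRep_trc_mul_expNeg (t : R →ₗ[ℝ] ℂ) (α γ : M → GForm E R) (a : M) :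
    chartRep a (fun x ↦ trc t (γ x * expNeg (α x))) =
      fun y ↦ trc t (chartRep a γ y * expNeg (chartRep a α y)) := by
  funext y
  rw [chartRep, ← trc_pull, _root_.map_mul, pull_expNeg]
  rfl

/-- The equivariant differential of `t(γ exp(-α))`. -/
theorem gd_trc_mul_expNeg {t : R →ₗ[ℝ] ℂ} (ht : ∀ x y, t (x * y) = t (y * x))
    {α γ : M → GForm E R} {x : M} (hs : SmoothAt α x) (hγ : SmoothAt γ x)
    (hε : ε (α x) = α x) {a : GForm E R} (ha : ε a = -a) (Y : E)
    (hα : gd α x = ι Y (α x) - (a * α x - α x * a)) :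
    gd (fun x ↦ trc t (γ x * expNeg (α x))) x - ι Y (trc t (γ x * expNeg (α x))) =
      trc t ((gd γ x - ι Y (γ x) + (a * γ x - ε (γ x) * a)) * expNeg (α x)) := by
  -- `L` and `L'` are the mutually inverse tangent maps of the chart and of its inverse. The
  -- hypotheses are carried into the chart by `pull L'`, the formula on the vector space is applied,
  -- and the result returns by `pull L`.
  let L : E →ₗ[ℝ] E := (tmap E E (extChartAt 𝓘(ℝ, E) x) x : E →ₗ[ℝ] E)
  let L' : E →ₗ[ℝ] E :=
    (tmap E E (extChartAt 𝓘(ℝ, E) x).symm (extChartAt 𝓘(ℝ, E) x x) : E →ₗ[ℝ] E)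
  have hLL : ∀ B : GForm E R, pull L (pull L' B) = B := pull_chart_pull_symm x
  have hLi : ∀ B : GForm E R, pull L' (ι Y B) = ι (L Y) (pull L' B) := by
    intro B
    rw [← pull_symm_pull_chart' x (ι (L Y) (pull L' B))]
    change _ = pull L' (pull L (ι (L Y) (pull L' B)))
    rw [← ι_pull, hLL]
  have ha' : ε (pull L' a) = -pull L' a := by rw [ε_pull, ha, map_neg]
  have hε' : ε (chartRep x α (extChartAt 𝓘(ℝ, E) x x)) =
      chartRep x α (extChartAt 𝓘(ℝ, E) x x) := by rw [chartRep_center, ε_pull, hε]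
  have hα' : dG (chartRep x α) (extChartAt 𝓘(ℝ, E) x x) =
      ι (L Y) (chartRep x α (extChartAt 𝓘(ℝ, E) x x)) -
        (pull L' a * chartRep x α (extChartAt 𝓘(ℝ, E) x x) -
          chartRep x α (extChartAt 𝓘(ℝ, E) x x) * pull L' a) := by
    rw [dG_chartRep_center, hα, map_sub, map_sub, _root_.map_mul, _root_.map_mul, chartRep_center]
    change pull L' (ι Y (α x)) - _ = _
    rw [hLi]
  have key := dG_trc_mul_expNeg ht hs hγ hε' ha' (L Y) hα'
  have h1 := congrArg (pull L) key
  rw [map_sub, ← trc_pull, ← chartRep_trc_mul_expNeg] at h1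
  have h2 : pull L (ι (L Y) (trc t (chartRep x γ (extChartAt 𝓘(ℝ, E) x x) *
      expNeg (chartRep x α (extChartAt 𝓘(ℝ, E) x x))))) =
      ι Y (trc t (γ x * expNeg (α x))) := by
    rw [← ι_pull, ← trc_pull, _root_.map_mul, pull_expNeg]
    have e1 := pull_chart_chartRep (mem_extChartAt_source (I := 𝓘(ℝ, E)) x) γ
    have e2 := pull_chart_chartRep (mem_extChartAt_source (I := 𝓘(ℝ, E)) x) α
    change ι Y (trc t (pull L _ * expNeg (pull L _))) = _
    rw [e1, e2]
  rw [h2] at h1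
  refine h1.trans ?_
  rw [dG_chartRep_center, chartRep_center, chartRep_center]
  change trc t (pull L ((pull L' (gd γ x) - ι (L Y) (pull L' (γ x)) + (pull L' a * pull L' (γ x) -
    ε (pull L' (γ x)) * pull L' a)) * expNeg (pull L' (α x)))) = _
  have h3 : ∀ B : GForm E R, pull L (ι (L Y) (pull L' B)) = ι Y B := by
    intro B
    rw [← ι_pull, hLL]
  congr 1
  rw [_root_.map_mul (pull L), map_add, map_sub, map_sub, _root_.map_mul (pull L),
    _root_.map_mul (pull L), pull_expNeg, ← ε_pull]
  simp only [hLL, h3]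

theorem _root_.BasicChern.GForm.HasGDeriv.pull {T T' : Type*} [NormedAddCommGroup T]
    [NormedSpace ℝ T] [NormedAddCommGroup T'] [NormedSpace ℝ T'] {A : ℝ → GForm T R}
    {A' : GForm T R} {s : ℝ} (h : HasGDeriv A A' s) (f : T' →ₗ[ℝ] T) :
    HasGDeriv (fun s ↦ GForm.pull f (A s)) (GForm.pull f A') s := fun k v ↦ h k (f ∘ v)

/-- The Lie derivative of `exp(-α)`. -/
theorem lieM_expNeg {α : M → GForm E R} {x : M} (hs : SmoothAt α x) (V : VF E M)
    {D : GForm E R} (hD : HasGDeriv (fun s : ℝ ↦ expNeg (α x + s • lieM V α x)) D 0) :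
    lieM V (fun x ↦ expNeg (α x)) x = D := by
  have h1 : chartRep x (fun x ↦ expNeg (α x)) = fun y ↦ expNeg (chartRep x α y) := by
    funext y
    exact pull_expNeg _ _
  let L' : E →ₗ[ℝ] E :=
    (tmap E E (extChartAt 𝓘(ℝ, E) x).symm (extChartAt 𝓘(ℝ, E) x x) : E →ₗ[ℝ] E)
  have hone : GSmoothAt (fun _ : E ↦ (1 : GForm E R)) (extChartAt 𝓘(ℝ, E) x x) :=
    fun _ _ ↦ contDiffAt_const
  have hD' : HasGDeriv (fun s : ℝ ↦ expNeg (chartRep x α (extChartAt 𝓘(ℝ, E) x x) +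
      s • pull L' (lieM V α x))) (pull L' D) 0 := by
    have h := hD.pull L'
    simp only [pull_expNeg, map_add, map_smul] at h
    rw [chartRep_center]
    exact h
  have h2 := lie_mul_expNeg hs hone (chartVF x V.vec (extChartAt 𝓘(ℝ, E) x x))
    (fderiv ℝ (chartVF x V.vec) (extChartAt 𝓘(ℝ, E) x x)) (pull L' (lieM V α x)) (pull L' D)
    (by rw [lieM_chart V hs, pull_symm_pull_chart']) ?_ hD'
  · simp only [one_mul] at h2
    rw [lieM_chart V hs.expNeg, h1, h2]
    exact pull_chart_pull_symm x D
  · have h3 : gfderiv (fun _ : E ↦ (1 : GForm E R)) (extChartAt 𝓘(ℝ, E) x x) = 0 := by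
      ext1 u
      exact hone.gfderiv_eq fun k v ↦ hasDerivAt_const _ _
    have h4 : ι.flip (1 : GForm E R) = 0 := by
      ext1 u
      exact ι_one u
    rw [h3, der, h4, LinearMap.zero_comp, map_zero]
    exact add_zero _

theorem lieM_trc (t : R →ₗ[ℝ] ℂ) {A : M → GForm E R} {x : M} (hA : SmoothAt A x) (V : VF E M) :
    lieM V (fun x ↦ trc t (A x)) x = trc t (lieM V A x) := by
  rw [lieM, lieM, gd_trc t hA, map_add, trc_ι, ← gd_trc t (hA.ι V)]
  rfl

end ManifoldExp

/-! ### Forms of a fixed degree, forms of mixed degree -/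

section Bridge

open GForm

variable {E : Type*} [NormedAddCommGroup E] [NormedSpace ℝ E]
  {M : Type*} [TopologicalSpace M] [ChartedSpace E M]
  {R : Type*} [NormedRing R] [NormedAlgebra ℝ R]
  {W : Type*} [NormedAddCommGroup W] [NormedSpace ℝ W]

theorem extDeriv_clm_comp (l : W →L[ℝ] R) {k : ℕ} {β : E → E [⋀^Fin k]→L[ℝ] W} {x : E}
    (hβ : DifferentiableAt ℝ β x) :
    extDeriv (fun y ↦ l.compContinuousAlternatingMap (β y)) x =
      l.compContinuousAlternatingMap (extDeriv β x) := by
  have h : fderiv ℝ (fun y ↦ l.compContinuousAlternatingMap (β y)) x =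
      (ContinuousLinearMap.compContinuousAlternatingMapCLM ℝ E W R (Fin k) l).comp
        (fderiv ℝ β x) :=
    ((ContinuousLinearMap.compContinuousAlternatingMapCLM ℝ E W R (Fin k) l).hasFDerivAt.comp x
      hβ.hasFDerivAt).fderiv
  ext v
  rw [extDeriv, h, ContinuousLinearMap.compContinuousAlternatingMap_coe, Function.comp_apply,
    extDeriv, ContinuousAlternatingMap.alternatizeUncurryFin_apply,
    ContinuousAlternatingMap.alternatizeUncurryFin_apply, map_sum]
  exact Finset.sum_congr rfl fun i _ ↦ (map_zsmul l _ _).symm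

/-- The composition of a form with a linear map into an algebra, as a form of mixed degree. -/
def toG (l : W →L[ℝ] R) {k : ℕ} (α : Form E M W k) (x : M) : GForm E R :=
  single R k (l.compContinuousAlternatingMap (α x))

theorem chartRep_toG (l : W →L[ℝ] R) {k : ℕ} (α : Form E M W k) (a : M) (y : E) :
    chartRep a (toG l α) y = single R k (l.compContinuousAlternatingMap (α.inChart a y)) :=
  pull_single _ _ _

/-- The form of mixed degree that corresponds to a family of forms of fixed degrees. -/
def mixG (α : Mixed E M) (x : M) : GForm E ℂ := fun k ↦ (α k x).toAlternatingMap

theorem mixG_contract [IsManifold 𝓘(ℝ, E) ∞ M] (V : VF E M) (α : Mixed E M) (x : M) :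
    mixG (α.contract V) x = ι (V.vec x) (mixG α x) := rfl

variable [FiniteDimensional ℝ E] [FiniteDimensional ℝ R]

theorem gd_toG (l : W →L[ℝ] R) {k : ℕ} (α : Form E M W k) {x : M}
    (hα : DifferentiableAt ℝ (α.inChart x) (extChartAt 𝓘(ℝ, E) x x)) :
    gd (toG l α) x = toG l α.d x := by
  have h : chartRep x (toG l α) =
      fun y ↦ single R k (l.compContinuousAlternatingMap (α.inChart x y)) :=
    funext fun y ↦ chartRep_toG l α x y
  rw [gd, h, dG_single, extDeriv_clm_comp l hα, pull_single]
  rfl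

theorem smoothAt_toG (l : W →L[ℝ] R) {k : ℕ} {α : Form E M W k} (hα : α.IsSmooth) (x : M) :
    SmoothAt (toG l α) x := by
  have h : chartRep x (toG l α) =
      fun y ↦ single R k (l.compContinuousAlternatingMap (α.inChart x y)) :=
    funext fun y ↦ chartRep_toG l α x y
  have h1 := ((hα x).contDiffAt ((isOpen_extChartAt_target x).mem_nhds (mem_extChartAt_target x)))
  rw [SmoothAt, h]
  exact gSmoothAt_single ((ContinuousLinearMap.compContinuousAlternatingMapCLM ℝ E W R
    (Fin k) l).contDiff.contDiffAt.comp _ h1)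

theorem ι_toG [IsManifold 𝓘(ℝ, E) ∞ M] (l : W →L[ℝ] R) {k : ℕ} (α : Form E M W (k + 1))
    (V : VF E M) (x : M) : ι (V.vec x) (toG l α x) = toG l (α.contract V) x :=
  ι_single_succ _ _ _

theorem lieM_toG [IsManifold 𝓘(ℝ, E) ∞ M] (l : W →L[ℝ] R) {k : ℕ} {α : Form E M W (k + 1)}
    (hα : α.IsSmooth) (V : VF E M) (x : M) :
    lieM V (toG l α) x = toG l (α.lieDeriv V) x := by
  have h : (fun x ↦ ι (V.vec x) (toG l α x)) = toG l (α.contract V) :=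
    funext fun x ↦ ι_toG l α V x
  rw [lieM, h, gd_toG l _ (α.diffAt_contract V hα x), gd_toG l α (hα.diffAt x), ι_toG]
  ext j v
  rw [Form.lieDeriv]
  change single R (k + 1) _ j v + single R (k + 1) _ j v = single R (k + 1) _ j v
  by_cases hj : j = k + 1
  · subst hj
    simp only [single_same]
    exact (map_add l _ _).symm
  · simp only [single_ne hj]
    exact add_zero 0

theorem gd_mixG (α : Mixed E M) : gd (mixG α) = mixG α.d := by
  funext x
  ext k v
  cases k with
  | zero => rfl
  | succ k =>
    change dG (chartRep x (mixG α)) _ (k + 1) _ = _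
    rw [dG_succ_apply]
    rfl

theorem lieM_mixG [IsManifold 𝓘(ℝ, E) ∞ M] (V : VF E M) (α : Mixed E M) (x : M) (k : ℕ)
    (v : Fin k → E) : (α k).lieDeriv V x v = lieM V (mixG α) x k v := by
  have h : lieM V (mixG α) x = mixG (α.contract V).d x + ι (V.vec x) (mixG α.d x) := by
    rw [lieM, gd_mixG, ← gd_mixG (α.contract V)]
    rfl
  rw [h]
  cases k with
  | zero =>
    change _ = (0 : E [⋀^Fin 0]→L[ℝ] ℂ) v + _
    exact (zero_add _).symm
  | succ k => rfl

/-- The family of forms of fixed degrees that corresponds to a form of mixed degree. -/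
def unmix (A : M → GForm E ℂ) : Mixed E M := fun k x ↦ toCont (A x k)

theorem mixG_unmix (A : M → GForm E ℂ) : mixG (unmix A) = A := rfl

theorem isSmoothFamily_of_smoothIn [IsManifold 𝓘(ℝ, E) ∞ M] {h : Type*} [LieRing h]
    [LieAlgebra ℝ h] [FiniteDimensional ℝ h] {α : Family E M h}
    (hα : ∀ q x, SmoothIn (fun q ↦ mixG (α ((Module.finBasis ℝ h).equivFun.symm q))) q x) :
    IsSmoothFamily α := by
  intro k a z hz
  have hs := (extChartAt 𝓘(ℝ, E) a).map_target hz.2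
  have h1 := ((hα z.1 ((extChartAt 𝓘(ℝ, E) a).symm z.2)).chart hs).contDiffAt k
  rw [(extChartAt 𝓘(ℝ, E) a).right_inv hz.2] at h1
  exact h1.contDiffWithinAt

/-- The series in `AltForms.expTrace` is summed in a normed space of forms, whereas `expNeg` is
known componentwise; the left inverse of `basisValues` links the two. The morphism `Φ` allows the
analysis to take place in a normed algebra, the endomorphisms of a fibre being only an algebra. -/
theorem expTrace_map {R₀ : Type*} [Ring R₀] [Algebra ℝ R₀] (t₀ : R₀ →ₗ[ℝ] ℂ) (Φ : R →ₐ[ℝ] R₀)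
    (a : GForm E R) (k : ℕ) : AltForms.expTrace t₀ (map LinearMap.id Φ a) k =
      toCont (trc (t₀ ∘ₗ Φ.toLinearMap) (expNeg a) k) := by
  have h := (hasGSum_expNeg a).trc (t := t₀ ∘ₗ Φ.toLinearMap)
  refine HasSum.tsum_eq ?_
  obtain ⟨L, hL⟩ := exists_basisValues_leftInverse (T := E) (W := ℂ) k
  have h1 : ∀ n : ℕ, ((-1) ^ n / (n.factorial : ℝ)) • toCont (t₀.compAlternatingMap
      (AltForms.pow (map LinearMap.id Φ a) n k)) =
      toCont (trc (t₀ ∘ₗ Φ.toLinearMap) (expCoeff n • a ^ n) k) := by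
    intro n
    have h2 : AltForms.pow (map LinearMap.id Φ a) n = map LinearMap.id Φ (a ^ n) := by
      rw [GForm.map_pow, ← pow_eq]
    ext v
    rw [h2, map_smul]
    rfl
  have h2 : HasSum (fun n ↦ L (basisValues E ℂ k
      (toCont (trc (t₀ ∘ₗ Φ.toLinearMap) (expCoeff n • a ^ n) k))))
      (L (basisValues E ℂ k (toCont (trc (t₀ ∘ₗ Φ.toLinearMap) (expNeg a) k)))) :=
    L.hasSum (Pi.hasSum.2 fun I ↦ h k _)
  simp only [hL] at h2
  simp only [h1]
  exact h2

end Bridge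

end BasicChern
end

noncomputable section
namespace BasicChern

namespace GForm

/-! ### Forms of degree one -/

section DegreeOne

variable {T T' R : Type*} [AddCommGroup T] [Module ℝ T] [AddCommGroup T'] [Module ℝ T']
  [Ring R] [Algebra ℝ R]

/-- The form is homogeneous of degree one. -/
def IsOneForm (a : GForm T R) : Prop := ∀ k, k ≠ 1 → a k = 0

theorem IsOneForm.ext {a b : GForm T R} (ha : IsOneForm a) (hb : IsOneForm b)
    (h : ∀ v, a 1 (fun _ ↦ v) = b 1 (fun _ ↦ v)) : a = b := by
  funext k
  by_cases hk : k = 1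
  · subst hk
    ext v
    have hv : v = fun _ ↦ v 0 := funext fun i ↦ congrArg v (Subsingleton.elim _ _)
    rw [hv]
    exact h _
  · rw [ha k hk, hb k hk]

theorem IsOneForm.ι_eq {a : GForm T R} (ha : IsOneForm a) (x : T) :
    ι x a = const T (a 1 fun _ ↦ x) := by
  ext k v
  cases k with
  | zero => rw [ι_apply_zero_one, const_zero_apply]
  | succ k =>
    rw [ι_apply_apply, ha _ (by omega)]
    rfl

theorem IsOneForm.ε_eq {a : GForm T R} (ha : IsOneForm a) : ε a = -a := by
  funext k
  rw [ε_apply]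
  by_cases hk : k = 1
  · subst hk
    rw [pow_one]
    exact neg_one_smul ℝ (a 1)
  · change _ = -(a k)
    rw [ha k hk, smul_zero, neg_zero]

theorem IsOneForm.pull {a : GForm T R} (ha : IsOneForm a) (f : T' →ₗ[ℝ] T) :
    IsOneForm (pull f a) := fun k hk ↦ by
  ext v
  rw [pull_apply, ha k hk]
  rfl

theorem IsOneForm.add {a b : GForm T R} (ha : IsOneForm a) (hb : IsOneForm b) :
    IsOneForm (a + b) := fun k hk ↦ by
  change a k + b k = 0
  rw [ha k hk, hb k hk, add_zero]

theorem IsOneForm.sub {a b : GForm T R} (ha : IsOneForm a) (hb : IsOneForm b) :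
    IsOneForm (a - b) := fun k hk ↦ by
  change a k - b k = 0
  rw [ha k hk, hb k hk, sub_zero]

theorem IsOneForm.smul {a : GForm T R} (ha : IsOneForm a) (c : ℝ) :
    IsOneForm (c • a) := fun k hk ↦ by
  change c • a k = 0
  rw [ha k hk, smul_zero]

theorem IsOneForm.const_mul {a : GForm T R} (ha : IsOneForm a) (r : R) :
    IsOneForm (const T r * a) := fun k hk ↦ by
  ext v
  rw [const_mul_apply, ha k hk]
  exact mul_zero r

theorem IsOneForm.mul_const {a : GForm T R} (ha : IsOneForm a) (r : R) :
    IsOneForm (a * const T r) := fun k hk ↦ by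
  ext v
  rw [mul_const_apply, ha k hk]
  exact zero_mul r

theorem const_add (r s : R) : const T (r + s) = const T r + const T s := by
  ext k v
  cases k with
  | zero => rfl
  | succ k => exact (add_zero _).symm

theorem const_smul (c : ℝ) (r : R) : const T (c • r) = c • const T r := by
  ext k v
  cases k with
  | zero => rfl
  | succ k => exact (smul_zero _).symm

theorem const_injective : Function.Injective (const T : R → GForm T R) := fun r s h ↦
  congrArg (fun a : GForm T R ↦ a 0 Fin.elim0) h

end DegreeOne

end GForm

/-! ### The exterior derivative of algebra-valued functions -/

section GdConst

open GForm

variable {E : Type*} [NormedAddCommGroup E] [NormedSpace ℝ E] [FiniteDimensional ℝ E]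
  {M : Type*} [TopologicalSpace M] [ChartedSpace E M] [IsManifold 𝓘(ℝ, E) ∞ M]
  {R : Type*} [NormedRing R] [NormedAlgebra ℝ R] [FiniteDimensional ℝ R]

omit [FiniteDimensional ℝ E] [FiniteDimensional ℝ R] in
theorem const_eq_single (r : R) :
    const E r = single R 0 (ContinuousAlternatingMap.constOfIsEmpty ℝ E (Fin 0) r) := by
  funext k
  cases k with
  | zero =>
    rw [single_same]
    rfl
  | succ k =>
    rw [single_ne (Nat.succ_ne_zero k)]
    rfl

theorem gd_const {r : M → R} {x : M} (hr : MDifferentiableAt 𝓘(ℝ, E) 𝓘(ℝ, R) r x) :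
    gd (fun x ↦ const E (r x)) x =
      single R 1 (ContinuousAlternatingMap.ofSubsingleton ℝ E R (0 : Fin 1) (tmap E R r x)) := by
  let ψ := (extChartAt 𝓘(ℝ, E) x).symm
  have hψ := (contMDiffAt_symm x (mem_extChartAt_target (I := 𝓘(ℝ, E)) x)).mdifferentiableAt
    (by simp)
  have hxl : ψ (extChartAt 𝓘(ℝ, E) x x) = x := extChartAt_to_inv (I := 𝓘(ℝ, E)) x
  have h1 : chartRep x (fun x ↦ const E (r x)) = fun y ↦ single R 0
      (ContinuousAlternatingMap.constOfIsEmpty ℝ E (Fin 0) (r (ψ y))) := by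
    funext y
    exact (pull_const _ _).trans (const_eq_single _)
  rw [gd, h1, dG_single, extDeriv_constOfIsEmpty, pull_single]
  refine congrArg (single R 1) ?_
  have h2 : tmap E R (r ∘ ψ) (extChartAt 𝓘(ℝ, E) x x) = (tmap E R r x).comp
      (tmap E E ψ (extChartAt 𝓘(ℝ, E) x x)) := by
    rw [tmap_comp (by rwa [hxl]) hψ, hxl]
  have h3 := tmap_symm_chart' x (mem_extChartAt_source (I := 𝓘(ℝ, E)) x)
  ext v
  change fderiv ℝ (r ∘ ψ) _ (tmap E E (extChartAt 𝓘(ℝ, E) x) x (v 0)) = tmap E R r x (v 0)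
  rw [← mfderiv_eq_fderiv]
  refine (DFunLike.congr_fun h2 _).trans ?_
  exact congrArg (tmap E R r x) (DFunLike.congr_fun h3 (v 0))

theorem isOneForm_gd_const {r : M → R} {x : M} (hr : MDifferentiableAt 𝓘(ℝ, E) 𝓘(ℝ, R) r x) :
    IsOneForm (gd (fun x ↦ const E (r x)) x) := fun k hk ↦ by
  rw [gd_const hr, single_ne hk]

theorem gd_const_apply {r : M → R} {x : M} (hr : MDifferentiableAt 𝓘(ℝ, E) 𝓘(ℝ, R) r x) (v : E) :
    gd (fun x ↦ const E (r x)) x 1 (fun _ ↦ v) = tmap E R r x v := by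
  rw [gd_const hr, single_same]
  rfl

theorem ι_gd_const {r : M → R} {x : M} (hr : MDifferentiableAt 𝓘(ℝ, E) 𝓘(ℝ, R) r x) (v : E) :
    ι v (gd (fun x ↦ const E (r x)) x) = const E (tmap E R r x v) := by
  rw [(isOneForm_gd_const hr).ι_eq, gd_const_apply hr]

theorem gd_const_const (r : R) (x : M) : gd (fun _ : M ↦ const E r) x = 0 := by
  have hr : MDifferentiableAt 𝓘(ℝ, E) 𝓘(ℝ, R) (fun _ : M ↦ r) x := mdifferentiableAt_const
  refine (isOneForm_gd_const hr).ext (fun _ _ ↦ rfl) (fun v ↦ ?_)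
  rw [gd_const_apply hr]
  simp only [tmap]
  rw [mfderiv_const]
  rfl

end GdConst

end BasicChern
end

noncomputable section
namespace BasicChern

/-! ### The derivative of a representation of the structure group -/

section Group

open GForm

variable {EG : Type*} [NormedAddCommGroup EG] [NormedSpace ℝ EG]
  {G : Type*} [TopologicalSpace G] [ChartedSpace EG G] [Group G]
  {R : Type*} [NormedRing R] [NormedAlgebra ℝ R]

theorem tmap_clm_comp {E : Type*} [NormedAddCommGroup E] [NormedSpace ℝ E]
    {M : Type*} [TopologicalSpace M] [ChartedSpace E M] [IsManifold 𝓘(ℝ, E) ∞ M] {W W' : Type*} [NormedAddCommGroup W]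
    [NormedSpace ℝ W] [NormedAddCommGroup W'] [NormedSpace ℝ W'] (L : W →L[ℝ] W') {f : M → W} {x : M}
    (hf : MDifferentiableAt 𝓘(ℝ, E) 𝓘(ℝ, W) f x) (v : E) :
    tmap E W' (fun x ↦ L (f x)) x v = L (tmap E W f x v) := by
  have h := tmap_comp (g := L) L.differentiableAt.mdifferentiableAt hf
  have h2 : tmap W W' L (f x) = L := by
    rw [tmap, mfderiv_eq_fderiv, L.fderiv]
  rw [h2] at h
  exact DFunLike.congr_fun h v

/-- The derivative at `1` of a representation in the units of an algebra. -/
def dRho (ρ : G →* R) : EG →L[ℝ] R := tmap EG R (fun g : G ↦ ρ g) 1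

variable [LieGroup 𝓘(ℝ, EG) ∞ G] {ρ : G →* R} (hρ : ContMDiff 𝓘(ℝ, EG) 𝓘(ℝ, R) ∞ ρ)

include hρ in
theorem mdiff_rho (g : G) : MDifferentiableAt 𝓘(ℝ, EG) 𝓘(ℝ, R) ρ g :=
  hρ.mdifferentiable (by simp) g

omit [Group G] [LieGroup 𝓘(ℝ, EG) ∞ G] in
theorem mdiff_mul_left [Group G] [LieGroup 𝓘(ℝ, EG) ∞ G] (g x : G) :
    MDifferentiableAt 𝓘(ℝ, EG) 𝓘(ℝ, EG) (fun x : G ↦ g * x) x :=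
  (contMDiff_mul_left (I := 𝓘(ℝ, EG)) (n := ∞) (a := g)).mdifferentiable (by simp) x

/-- From `ρ(x) = ρ(g) ρ(g⁻¹x)`: left translation moves the derivative at `g` to the identity. -/
theorem tmap_rho (hρ : ContMDiff 𝓘(ℝ, EG) 𝓘(ℝ, R) ∞ ρ) (g : G) (w : EG) :
    tmap EG R ρ g w = ρ g * dRho ρ (tmap EG EG (fun x : G ↦ g⁻¹ * x) g w) := by
  have h1 : (ρ : G → R) = fun x ↦ ContinuousLinearMap.mul ℝ R (ρ g) ((ρ ∘ fun x ↦ g⁻¹ * x) x) := by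
    funext x
    simp only [ContinuousLinearMap.mul_apply', Function.comp_apply]
    rw [← _root_.map_mul, mul_inv_cancel_left]
  have h2 : MDifferentiableAt 𝓘(ℝ, EG) 𝓘(ℝ, R) (ρ ∘ fun x ↦ g⁻¹ * x) g :=
    (mdiff_rho hρ _).comp g (mdiff_mul_left g⁻¹ g)
  conv_lhs => rw [h1]
  rw [tmap_clm_comp _ h2, tmap_comp (mdiff_rho hρ _) (mdiff_mul_left g⁻¹ g)]
  simp only [ContinuousLinearMap.mul_apply', ContinuousLinearMap.comp_apply, inv_mul_cancel]
  rfl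

theorem tmap_rho_inv_mul (hρ : ContMDiff 𝓘(ℝ, EG) 𝓘(ℝ, R) ∞ ρ) (g : G) (w : EG) :
    dRho ρ (tmap EG EG (fun x : G ↦ g⁻¹ * x) g w) = ρ g⁻¹ * tmap EG R ρ g w := by
  rw [tmap_rho hρ, ← mul_assoc, ← _root_.map_mul, inv_mul_cancel, _root_.map_one, one_mul]

theorem dRho_adInv (hρ : ContMDiff 𝓘(ℝ, EG) 𝓘(ℝ, R) ∞ ρ) (g : G) (X : EG) :
    dRho ρ (adInv EG G g X) = ρ g⁻¹ * dRho ρ X * ρ g := by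
  have hm : MDifferentiableAt 𝓘(ℝ, EG) 𝓘(ℝ, EG) (fun x : G ↦ g⁻¹ * x * g) 1 :=
    (((contMDiff_mul_right (I := 𝓘(ℝ, EG)) (n := ∞) (a := g)).comp
      (contMDiff_mul_left (I := 𝓘(ℝ, EG)) (n := ∞) (a := g⁻¹))).mdifferentiable (by simp)) 1
  have h1 : g⁻¹ * 1 * g = 1 := by group
  have h2 : tmap EG R (ρ ∘ fun x : G ↦ g⁻¹ * x * g) 1 = (dRho ρ).comp (adInv EG G g) := by
    rw [tmap_comp (mdiff_rho hρ _) hm, h1]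
    rfl
  have h3 : (ρ ∘ fun x : G ↦ g⁻¹ * x * g) = fun x ↦
      ((ContinuousLinearMap.mul ℝ R).flip (ρ g) ∘L ContinuousLinearMap.mul ℝ R (ρ g⁻¹)) (ρ x) := by
    funext x
    simp [_root_.map_mul]
  have h4 := tmap_clm_comp
    ((ContinuousLinearMap.mul ℝ R).flip (ρ g) ∘L ContinuousLinearMap.mul ℝ R (ρ g⁻¹))
    (mdiff_rho hρ 1) X
  rw [← h3, h2] at h4
  exact h4

variable [FiniteDimensional ℝ EG] [FiniteDimensional ℝ R]

variable (G) in
/-- The left invariant vector field with value `X` at `1`. -/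
def leftField (X : EG) : VF EG G :=
  ⟨mulInvariantVectorField (I := 𝓘(ℝ, EG)) (G := G) X, by
    haveI : IsManifold 𝓘(ℝ, EG) (∞ + 1) G := inferInstanceAs (IsManifold 𝓘(ℝ, EG) ∞ G)
    haveI : IsManifold 𝓘(ℝ, EG) 1 G := IsManifold.of_le (n := ∞) (by simp)
    -- The field is the differential of the multiplication applied to the zero vector at `g` and to
    -- `X` at `1`, a composition of smooth maps of tangent bundles.
    let fg : G → TangentBundle 𝓘(ℝ, EG) G := fun g ↦ ⟨g, 0⟩
    have sfg : ContMDiff 𝓘(ℝ, EG) 𝓘(ℝ, EG).tangent ∞ fg :=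
      Bundle.contMDiff_zeroSection ℝ (TangentSpace 𝓘(ℝ, EG) (M := G))
    let fv : G → TangentBundle 𝓘(ℝ, EG) G := fun _ ↦ ⟨1, X⟩
    have sfv : ContMDiff 𝓘(ℝ, EG) 𝓘(ℝ, EG).tangent ∞ fv := contMDiff_const
    have hmul := contMDiff_mul (G := G) 𝓘(ℝ, EG) ∞
    have S₂ : ContMDiff (𝓘(ℝ, EG).tangent.prod 𝓘(ℝ, EG).tangent)
      (𝓘(ℝ, EG).prod 𝓘(ℝ, EG)).tangent ∞
      (equivTangentBundleProd 𝓘(ℝ, EG) G 𝓘(ℝ, EG) G).symm := contMDiff_equivTangentBundleProd_symm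
    have S₃ : ContMDiff (𝓘(ℝ, EG).prod 𝓘(ℝ, EG)).tangent 𝓘(ℝ, EG).tangent ∞
        (tangentMap (𝓘(ℝ, EG).prod 𝓘(ℝ, EG)) 𝓘(ℝ, EG) (fun p : G × G ↦ p.1 * p.2)) :=
      ContMDiff.contMDiff_tangentMap hmul (m := ∞) le_rfl
    have S := (S₃.comp S₂).comp (sfg.prodMk sfv)
    convert S using 1
    funext g
    have h := mfderiv_prod_eq_add_apply (p := ((g, 1) : G × G)) (v := ((0 : EG), X))
      (hmul.mdifferentiableAt (by simp))
    refine Bundle.TotalSpace.ext (mul_one g).symm ?_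
    refine heq_of_eq ?_
    refine Eq.trans ?_ h.symm
    exact ((congrArg (· + _) (map_zero (mfderiv 𝓘(ℝ, EG) 𝓘(ℝ, EG) (fun z : G ↦ z * 1) g))).trans
      (zero_add _)).symm⟩

theorem leftField_vec (X : EG) (g : G) :
    (leftField G X).vec g = tmap EG EG (fun x : G ↦ g * x) 1 X := rfl

theorem lieBracket_eq (X X' : EG) : lieBracket EG G X X' =
    (⁅leftField G X, leftField G X'⁆ : VF EG G).vec (1 : G) :=
  rfl

theorem tmap_rho_leftField (hρ : ContMDiff 𝓘(ℝ, EG) 𝓘(ℝ, R) ∞ ρ) (X : EG) (g : G) :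
    tmap EG R ρ g ((leftField G X).vec g) = ρ g * dRho ρ X := by
  rw [tmap_rho hρ, leftField_vec]
  congr 2
  have h := tmap_comp (mdiff_mul_left (EG := EG) g⁻¹ (g * 1)) (mdiff_mul_left g 1)
  have h2 : ((fun x : G ↦ g⁻¹ * x) ∘ fun x ↦ g * x) = id := by
    funext x
    simp
  rw [h2, mul_one] at h
  have h3 := DFunLike.congr_fun h X
  simp only [tmap, mfderiv_id] at h3
  exact h3.symm

/-- Regard `ρ` as an algebra-valued function on `G`. For left invariant fields `i(X)dρ = ρ·dρ(X)`
and `L_X(dρ) = dρ·dρ(X)`, the last factor being constant in both. Applying `[L_X, i(X')] = i([X,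
X'])` to the form `dρ` and evaluating at `1` gives the commutator. -/
theorem dRho_lieBracket (hρ : ContMDiff 𝓘(ℝ, EG) 𝓘(ℝ, R) ∞ ρ) (X X' : EG) :
    dRho ρ (lieBracket EG G X X') = dRho ρ X * dRho ρ X' - dRho ρ X' * dRho ρ X := by
  let C : G → GForm EG R := fun g ↦ const EG (ρ g)
  have hC : ∀ g, SmoothAt C g := fun g ↦ smoothAt_const (hρ g)
  have hdC : ∀ g, SmoothAt (gd C) g := fun g ↦ SmoothAt.gd (Filter.Eventually.of_forall hC)
  have hc : ∀ r : R, ∀ g : G, SmoothAt (fun _ : G ↦ const EG r) g := fun r g ↦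
    smoothAt_const contMDiffAt_const
  have hι : ∀ X : EG, (fun g : G ↦ ι ((leftField G X).vec g) (gd C g)) =
      fun g ↦ C g * const EG (dRho ρ X) := fun X ↦ by
    funext g
    rw [ι_gd_const (mdiff_rho hρ g), tmap_rho_leftField hρ, const_mul_const]
  have hgd : ∀ (r : R) (g : G), gd (fun g ↦ C g * const EG r) g = gd C g * const EG r := by
    intro r g
    rw [gd_mul (hC g) (hc r g), gd_const_const, mul_zero, add_zero]
  have h1 : ∀ (X : EG) (r : R) (g : G), lieM (leftField G X) (fun g ↦ C g * const EG r) g =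
      C g * const EG (dRho ρ X * r) := by
    intro X r g
    rw [lieM, hgd, ι_mul, ι_const, mul_zero, add_zero, congrFun (hι X) g]
    have : (fun g ↦ ι ((leftField G X).vec g) (C g * const EG r)) =
        fun _ ↦ const EG (0 : R) := by
      funext g
      rw [ι_mul, ι_const, ι_const, zero_mul, mul_zero, add_zero]
      ext k v
      cases k <;> rfl
    rw [this, gd_const_const, zero_add, mul_assoc, const_mul_const]
  have h2 : ∀ (X : EG) (g : G), lieM (leftField G X) (gd C) g = gd C g * const EG (dRho ρ X) := by
    intro X g
    rw [lieM, hι, hgd, gd_gd (Filter.Eventually.of_forall hC), map_zero, add_zero]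
  have h3 := lieM_ι (V := leftField G X) (leftField G X') (hdC 1)
  rw [hι, h1, h2, ι_mul, ι_const, mul_zero, add_zero, congrFun (hι X') 1,
    ι_gd_const (mdiff_rho hρ 1), ← lieBracket_eq] at h3
  simp only [C, _root_.map_one, const_mul_const, one_mul, ← const_add] at h3
  have h4 := const_injective h3
  rw [h4, add_sub_cancel_right]
  rfl

end Group

end BasicChern
end

noncomputable section
namespace BasicChern

/-! ### Local trivializations, vertical vectors and horizontal lifts -/

section Bundle

open GForm

variable {EM : Type*} [NormedAddCommGroup EM] [NormedSpace ℝ EM]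
  {M : Type*} [TopologicalSpace M] [ChartedSpace EM M]
  {EP : Type*} [NormedAddCommGroup EP] [NormedSpace ℝ EP]
  {P : Type*} [TopologicalSpace P] [ChartedSpace EP P]
  {EG : Type*} [NormedAddCommGroup EG] [NormedSpace ℝ EG]
  {G : Type*} [TopologicalSpace G] [ChartedSpace EG G] [Group G]

/-- A local trivialization of a principal bundle. -/
structure LocalTriv (B : PrincipalBundle EM M EP P EG G) where
  /-- the base -/
  U : Set M
  isOpen : IsOpen U
  /-- the local section -/
  σ : M → P
  /-- the component in the structure group -/
  φ : P → G
  smooth_σ : ContMDiffOn 𝓘(ℝ, EM) 𝓘(ℝ, EP) ∞ σ U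
  smooth_φ : ContMDiffOn 𝓘(ℝ, EP) 𝓘(ℝ, EG) ∞ φ (B.proj ⁻¹' U)
  proj_σ : ∀ x ∈ U, B.proj (σ x) = x
  φ_act : ∀ x ∈ U, ∀ g, φ (B.act (σ x) g) = g
  act_φ : ∀ p, B.proj p ∈ U → B.act (σ (B.proj p)) (φ p) = p

variable (B : PrincipalBundle EM M EP P EG G)

theorem PrincipalBundle.exists_localTriv (m : M) : ∃ T : LocalTriv B, m ∈ T.U := by
  obtain ⟨U, hU, hm, σ, φ, h1, h2, h3, h4⟩ := B.locally_trivial m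
  exact ⟨⟨U, hU, σ, φ, h1, h2, fun x hx ↦ (h3 x hx).1, fun x hx ↦ (h3 x hx).2,
    fun p hp ↦ h4 p hp⟩, hm⟩

theorem PrincipalBundle.contMDiff_actRight (g : G) :
    ContMDiff 𝓘(ℝ, EP) 𝓘(ℝ, EP) ∞ (fun p ↦ B.act p g) :=
  B.smooth_act.comp (contMDiff_id.prodMk contMDiff_const)

theorem PrincipalBundle.mdiff_actRight (g : G) (p : P) :
    MDifferentiableAt 𝓘(ℝ, EP) 𝓘(ℝ, EP) (fun p ↦ B.act p g) p :=
  (B.contMDiff_actRight g).mdifferentiable (by simp) p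

theorem PrincipalBundle.contMDiff_actLeft (p : P) :
    ContMDiff 𝓘(ℝ, EG) 𝓘(ℝ, EP) ∞ (fun g ↦ B.act p g) :=
  B.smooth_act.comp (contMDiff_const.prodMk contMDiff_id)

theorem PrincipalBundle.mdiff_actLeft (p : P) (g : G) :
    MDifferentiableAt 𝓘(ℝ, EG) 𝓘(ℝ, EP) (fun g ↦ B.act p g) g :=
  (B.contMDiff_actLeft p).mdifferentiable (by simp) g

theorem PrincipalBundle.mdiff_proj (p : P) :
    MDifferentiableAt 𝓘(ℝ, EP) 𝓘(ℝ, EM) B.proj p :=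
  B.smooth_proj.mdifferentiable (by simp) p

variable [IsManifold 𝓘(ℝ, EM) ∞ M] [IsManifold 𝓘(ℝ, EP) ∞ P] [LieGroup 𝓘(ℝ, EG) ∞ G]

theorem PrincipalBundle.tmap_proj_fundamental (p : P) (X : EG) :
    tmap EP EM B.proj p (B.fundamental p X) = 0 := by
  have h := tmap_comp (B.mdiff_proj (B.act p 1)) (B.mdiff_actLeft p 1)
  have h2 : B.proj ∘ (fun g ↦ B.act p g) = fun _ ↦ B.proj p := funext fun g ↦ B.proj_act p g
  rw [h2, B.act_one] at h
  have h3 := DFunLike.congr_fun h X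
  simp only [tmap, mfderiv_const] at h3
  exact h3.symm

theorem PrincipalBundle.tmap_proj_actRight (p : P) (g : G) (v : EP) :
    tmap EP EM B.proj (B.act p g) (tmap EP EP (fun p ↦ B.act p g) p v) = tmap EP EM B.proj p v := by
  have h := tmap_comp (f := fun p ↦ B.act p g) (B.mdiff_proj (B.act p g)) (B.mdiff_actRight g p)
  have h2 : B.proj ∘ (fun p ↦ B.act p g) = B.proj := funext fun p ↦ B.proj_act p g
  rw [h2] at h
  exact (DFunLike.congr_fun h v).symm

variable {B}

namespace LocalTriv

variable (T : LocalTriv B)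

/-- The local section composed with the projection. -/
def s (p : P) : P := T.σ (B.proj p)

variable {T} {p : P} (hp : B.proj p ∈ T.U)

include hp

omit [IsManifold 𝓘(ℝ, EM) ∞ M] [IsManifold 𝓘(ℝ, EP) ∞ P] [LieGroup 𝓘(ℝ, EG) ∞ G] in
theorem eventually_mem : ∀ᶠ q in nhds p, B.proj q ∈ T.U :=
  (B.smooth_proj.continuous.isOpen_preimage _ T.isOpen).mem_nhds hp

omit [IsManifold 𝓘(ℝ, EM) ∞ M] [IsManifold 𝓘(ℝ, EP) ∞ P] [LieGroup 𝓘(ℝ, EG) ∞ G] in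
theorem contMDiffAt_φ : ContMDiffAt 𝓘(ℝ, EP) 𝓘(ℝ, EG) ∞ T.φ p :=
  T.smooth_φ.contMDiffAt (eventually_mem hp)

omit [IsManifold 𝓘(ℝ, EM) ∞ M] [IsManifold 𝓘(ℝ, EP) ∞ P] [LieGroup 𝓘(ℝ, EG) ∞ G] in
theorem contMDiffAt_σ : ContMDiffAt 𝓘(ℝ, EM) 𝓘(ℝ, EP) ∞ T.σ (B.proj p) :=
  T.smooth_σ.contMDiffAt (T.isOpen.mem_nhds hp)

omit [IsManifold 𝓘(ℝ, EM) ∞ M] [IsManifold 𝓘(ℝ, EP) ∞ P] [LieGroup 𝓘(ℝ, EG) ∞ G] in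
theorem contMDiffAt_s : ContMDiffAt 𝓘(ℝ, EP) 𝓘(ℝ, EP) ∞ T.s p :=
  (contMDiffAt_σ hp).comp p B.smooth_proj.contMDiffAt

omit [IsManifold 𝓘(ℝ, EM) ∞ M] [IsManifold 𝓘(ℝ, EP) ∞ P] [LieGroup 𝓘(ℝ, EG) ∞ G] in
theorem act_s_φ : B.act (T.s p) (T.φ p) = p := T.act_φ p hp

theorem tmap_s (v : EP) :
    tmap EP EP T.s p v = tmap EM EP T.σ (B.proj p) (tmap EP EM B.proj p v) :=
  DFunLike.congr_fun (tmap_comp (g := T.σ) ((contMDiffAt_σ hp).mdifferentiableAt (by simp))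
    (B.mdiff_proj p)) v

theorem tmap_proj_σ (u : EM) :
    tmap EP EM B.proj (T.σ (B.proj p)) (tmap EM EP T.σ (B.proj p) u) = u := by
  have h := tmap_comp (B.mdiff_proj (T.σ (B.proj p)))
    ((contMDiffAt_σ hp).mdifferentiableAt (by simp))
  have h2 : B.proj ∘ T.σ =ᶠ[nhds (B.proj p)] id := by
    filter_upwards [T.isOpen.mem_nhds hp] with x hx using T.proj_σ x hx
  have h3 := DFunLike.congr_fun h u
  simp only [tmap] at h3
  rw [h2.mfderiv_eq, mfderiv_id] at h3
  exact h3.symm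

/-- The decomposition of a tangent vector of `P` in a local trivialization. -/
theorem tmap_decomp (v : EP) : v = tmap EP EP (fun q ↦ B.act q (T.φ p)) (T.s p) (tmap EP EP T.s p v) +
    B.fundamental p (tmap EG EG (fun x ↦ (T.φ p)⁻¹ * x) (T.φ p) (tmap EP EG T.φ p v)) := by
  have hs := (contMDiffAt_s hp).mdifferentiableAt (n := ∞) (by simp)
  have hφ := (contMDiffAt_φ hp).mdifferentiableAt (n := ∞) (by simp)
  have ha := B.smooth_act.mdifferentiableAt (x := (T.s p, T.φ p)) (by simp)
  -- Differentiate `q = s(q) φ(q)`: varying `s` gives the translated summand, and varying `φ` gives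
  -- the fundamental one.
  have h1 : (fun q : P × G ↦ B.act q.1 q.2) ∘ (fun q ↦ (T.s q, T.φ q)) =ᶠ[nhds p] id := by
    filter_upwards [eventually_mem hp] with q hq using act_s_φ hq
  have h2 := mfderiv_comp (x := p) (f := fun q ↦ (T.s q, T.φ q)) (g := fun q : P × G ↦ B.act q.1 q.2)
    ha (hs.prodMk hφ)
  rw [h1.mfderiv_eq, mfderiv_id] at h2
  have h3 : v = mfderiv (𝓘(ℝ, EP).prod 𝓘(ℝ, EG)) 𝓘(ℝ, EP) (fun q : P × G ↦ B.act q.1 q.2)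
      (T.s p, T.φ p) (tmap EP EP T.s p v, tmap EP EG T.φ p v) := by
    refine (DFunLike.congr_fun h2 v).trans ?_
    have h4 := DFunLike.congr_fun (hs.mfderiv_prod hφ) v
    exact congrArg (mfderiv (𝓘(ℝ, EP).prod 𝓘(ℝ, EG)) 𝓘(ℝ, EP) (fun q : P × G ↦ B.act q.1 q.2)
      (T.s p, T.φ p)) h4
  refine h3.trans ((mfderiv_prod_eq_add_apply ha).trans ?_)
  refine congrArg₂ (· + ·) rfl ?_
  have h5 : (fun g ↦ B.act (T.s p) g) = (fun g ↦ B.act p g) ∘ fun g ↦ (T.φ p)⁻¹ * g := by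
    funext g
    have := B.act_mul (T.s p) (T.φ p) ((T.φ p)⁻¹ * g)
    rwa [mul_inv_cancel_left, act_s_φ hp] at this
  have h6 := tmap_comp (B.mdiff_actLeft p ((T.φ p)⁻¹ * T.φ p)) (mdiff_mul_left (EG := EG) (T.φ p)⁻¹ (T.φ p))
  rw [← h5, inv_mul_cancel] at h6
  exact DFunLike.congr_fun h6 (tmap EP EG T.φ p v)

theorem tmap_proj_surjective_aux (u : EM) : tmap EP EM B.proj p
    (tmap EP EP (fun q ↦ B.act q (T.φ p)) (T.s p) (tmap EM EP T.σ (B.proj p) u)) = u := by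
  have h := B.tmap_proj_actRight (T.s p) (T.φ p) (tmap EM EP T.σ (B.proj p) u)
  rw [act_s_φ hp] at h
  exact h.trans (tmap_proj_σ hp u)

end LocalTriv

theorem PrincipalBundle.tmap_proj_surjective (B : PrincipalBundle EM M EP P EG G) (p : P) :
    Function.Surjective (tmap EP EM B.proj p) := fun u ↦ by
  obtain ⟨T, hT⟩ := B.exists_localTriv (B.proj p)
  exact ⟨_, LocalTriv.tmap_proj_surjective_aux hT u⟩

/-- The first summand of `LocalTriv.tmap_decomp` factors through the tangent map of the projection,
so a vertical vector consists of the second summand alone. -/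
theorem PrincipalBundle.exists_fundamental (B : PrincipalBundle EM M EP P EG G) {p : P} {v : EP}
    (hv : tmap EP EM B.proj p v = 0) : ∃ X, v = B.fundamental p X := by
  obtain ⟨T, hT⟩ := B.exists_localTriv (B.proj p)
  have h := LocalTriv.tmap_decomp hT v
  rw [LocalTriv.tmap_s hT, hv, map_zero, map_zero, zero_add] at h
  exact ⟨_, h⟩

variable [FiniteDimensional ℝ EM] [FiniteDimensional ℝ EP] [FiniteDimensional ℝ EG]

/-- `ContinuousLinearMap.inverse` is zero on a map that is not invertible, so `(Tπ, ω)` must be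
shown to be bijective. A vertical vector is fundamental and `ω` returns its generator; any lift of a
vector of `M` can be corrected by a fundamental vector to reach a prescribed value of `ω`. -/
theorem Connection.tmap_proj_horLift (θ : Connection B) (p : P) (u : EM) :
    tmap EP EM B.proj p (θ.horLift p u) = u := by
  let f : EP →L[ℝ] EM × EG := (tmap EP EM B.proj p).prod
    ((ContinuousAlternatingMap.ofSubsingleton ℝ EP EG (0 : Fin 1)).symm (θ.form p))
  have hf : ∀ v, f v = (tmap EP EM B.proj p v, θ.form p fun _ ↦ v) := fun v ↦ rfl
  have hbij : Function.Bijective (f : EP →ₗ[ℝ] EM × EG) := by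
    constructor
    · rw [← LinearMap.ker_eq_bot, LinearMap.ker_eq_bot']
      intro v hv
      have h1 := (hf v).symm.trans hv
      rw [Prod.mk_eq_zero] at h1
      obtain ⟨X, rfl⟩ := B.exists_fundamental h1.1
      rw [θ.fundamental p X] at h1
      rw [h1.2]
      exact map_zero (tmap EG EP (fun g : G ↦ B.act p g) 1)
    · rintro ⟨u, X⟩
      obtain ⟨w, rfl⟩ := B.tmap_proj_surjective p u
      refine ⟨w + B.fundamental p (X - θ.form p fun _ ↦ w), ?_⟩
      rw [map_add]
      refine (congrArg₂ (· + ·) (hf _) (hf _)).trans ?_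
      rw [B.tmap_proj_fundamental, θ.fundamental, Prod.mk_add_mk, add_zero, add_sub_cancel]
  let e : EP ≃L[ℝ] EM × EG := (LinearEquiv.ofBijective (f : EP →ₗ[ℝ] EM × EG)
    hbij).toContinuousLinearEquiv
  have he : (e : EP →L[ℝ] EM × EG) = f := rfl
  have h2 : θ.horLift p u = e.symm (u, 0) := by
    change f.inverse (u, 0) = _
    rw [← he, ContinuousLinearMap.inverse_equiv]
    rfl
  have h3 : f (e.symm (u, 0)) = (u, 0) := e.apply_symm_apply (u, 0)
  rw [h2]
  exact congrArg Prod.fst h3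

end Bundle

end BasicChern
end

noncomputable section
namespace BasicChern

/-! ### Representatives of basic fields -/

section Represent

variable {E : Type*} [NormedAddCommGroup E] [NormedSpace ℝ E] [FiniteDimensional ℝ E]
  {M : Type*} [TopologicalSpace M] [ChartedSpace E M] [IsManifold 𝓘(ℝ, E) ∞ M]

namespace Foliation

variable (F : Foliation E M)

/-- A local frame field times a bump function equal to `1` at `x` is a global tangent field.
Conditions imposed on all tangent fields thus hold for every vector of the distribution. -/
theorem exists_tangent_eq [T2Space M] {x : M} {z : E} (hz : z ∈ F.dist x) :
    ∃ Z ∈ F.tangent, Z.vec x = z := by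
  let ev : VF E M →ₗ[ℝ] TangentSpace 𝓘(ℝ, E) x :=
    { toFun := fun V ↦ V.vec x
      map_add' := fun _ _ ↦ rfl
      map_smul' := fun _ _ ↦ rfl }
  suffices h : F.dist x ≤ (F.tangent.toSubmodule).map ev from h hz
  obtain ⟨U, hU, hx, X, hX, hs⟩ := F.exists_frame x
  rw [← (hs x hx).2, Submodule.span_le]
  rintro _ ⟨i, rfl⟩
  obtain ⟨f, -, hf⟩ := (SmoothBumpFunction.nhds_basis_tsupport (I := 𝓘(ℝ, E)) x).mem_iff.1
    (hU.mem_nhds hx)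
  refine ⟨⟨(f : M → ℝ) • X i, ?_⟩, ?_, ?_⟩
  · exact ContMDiffOn.smul_section_of_tsupport f.contMDiff.contMDiffOn hU hf (hX i)
  · intro y
    change f y • X i y ∈ F.dist y
    by_cases hy : y ∈ U
    · refine Submodule.smul_mem _ _ ?_
      rw [← (hs y hy).2]
      exact Submodule.subset_span ⟨i, rfl⟩
    · have : f y = 0 := image_eq_zero_of_notMem_tsupport fun h ↦ hy (hf h)
      rw [this, zero_smul]
      exact Submodule.zero_mem _
  · change f x • X i x = X i x
    rw [f.eq_one, one_smul]

variable {F}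

theorem Represents.add {V W : VF E M} {v w : F.BasicField} (hV : F.Represents V v)
    (hW : F.Represents W w) : F.Represents (V + W) (v + w) := by
  obtain ⟨h1, rfl⟩ := hV
  obtain ⟨h2, rfl⟩ := hW
  exact ⟨add_mem h1 h2, rfl⟩

theorem Represents.smul {V : VF E M} {v : F.BasicField} (hV : F.Represents V v) (c : ℝ) :
    F.Represents (c • V) (c • v) := by
  obtain ⟨h1, rfl⟩ := hV
  exact ⟨F.foliated.smul_mem c h1, rfl⟩

theorem Represents.lie {V W : VF E M} {v w : F.BasicField} (hV : F.Represents V v)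
    (hW : F.Represents W w) : F.Represents ⁅V, W⁆ ⁅v, w⁆ := by
  obtain ⟨h1, rfl⟩ := hV
  obtain ⟨h2, rfl⟩ := hW
  exact ⟨F.foliated.lie_mem h1 h2, rfl⟩

theorem Represents.sub_mem {V W : VF E M} {v : F.BasicField} (hV : F.Represents V v)
    (hW : F.Represents W v) : V - W ∈ F.tangent := by
  obtain ⟨h1, rfl⟩ := hV
  obtain ⟨h2, h3⟩ := hW
  exact (LieSubmodule.Quotient.mk_eq_zero'.1 (sub_eq_zero.2 h3.symm) :)

theorem represents_zero {Z : VF E M} (hZ : Z ∈ F.tangent) : F.Represents Z 0 :=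
  ⟨LieSubalgebra.le_normalizer _ hZ, LieSubmodule.Quotient.mk_eq_zero'.2 hZ⟩

end Foliation

end Represent

/-! ### Gauge forms, their curvature and tensorial forms -/

section Gauge

open GForm

variable {EM : Type*} [NormedAddCommGroup EM] [NormedSpace ℝ EM]
  {M : Type*} [TopologicalSpace M] [ChartedSpace EM M]
  {EP : Type*} [NormedAddCommGroup EP] [NormedSpace ℝ EP] [FiniteDimensional ℝ EP]
  {P : Type*} [TopologicalSpace P] [ChartedSpace EP P] [IsManifold 𝓘(ℝ, EP) ∞ P]
  {EG : Type*} [NormedAddCommGroup EG] [NormedSpace ℝ EG]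
  {G : Type*} [TopologicalSpace G] [ChartedSpace EG G] [Group G]
  {R : Type*} [NormedRing R] [NormedAlgebra ℝ R] [FiniteDimensional ℝ R]

/-- A `1`-form on `P` with values in an algebra that behaves like the image of a connection form by
the derivative of a representation of the structure group in the algebra. -/
structure IsGauge (B : PrincipalBundle EM M EP P EG G) (ρ : G →* R) (a : P → GForm EP R) :
    Prop where
  smooth : ∀ p, SmoothAt a p
  oneForm : ∀ p, IsOneForm (a p)
  localForm : ∀ (T : LocalTriv B) (p : P), B.proj p ∈ T.U →
    a p = const EP (ρ (T.φ p)⁻¹) * pullM EP T.s a p * const EP (ρ (T.φ p)) +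
      const EP (ρ (T.φ p)⁻¹) * gd (fun q ↦ const EP (ρ (T.φ q))) p
  equivariant : ∀ p g, pullM EP (fun q ↦ B.act q g) a p = const EP (ρ g⁻¹) * a p * const EP (ρ g)

/-- The form `γ` on `P` is induced by a form on `M` with values in the bundle associated to the
conjugation action. -/
def IsTensorial (B : PrincipalBundle EM M EP P EG G) (ρ : G →* R) (γ : P → GForm EP R) : Prop :=
  ∀ (T : LocalTriv B) (p : P), B.proj p ∈ T.U →
    γ p = const EP (ρ (T.φ p)⁻¹) * pullM EP T.s γ p * const EP (ρ (T.φ p))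

/-- The curvature of a gauge form. -/
def curv (a : P → GForm EP R) (p : P) : GForm EP R := gd a p + a p * a p

variable {B : PrincipalBundle EM M EP P EG G} {ρ : G →* R}

omit [FiniteDimensional ℝ EP] [FiniteDimensional ℝ R] [IsManifold 𝓘(ℝ, EP) ∞ P] in
theorem const_rho_mul (g : G) : const EP (ρ g) * const EP (ρ g⁻¹) = 1 := by
  rw [const_mul_const, ← _root_.map_mul, mul_inv_cancel, _root_.map_one, const_one]

omit [FiniteDimensional ℝ EP] [FiniteDimensional ℝ R] [IsManifold 𝓘(ℝ, EP) ∞ P] in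
theorem const_rho_inv_mul (g : G) : const EP (ρ g⁻¹) * const EP (ρ g) = 1 := by
  rw [const_mul_const, ← _root_.map_mul, inv_mul_cancel, _root_.map_one, const_one]

section

variable {a a' : P → GForm EP R} (ha : IsGauge B ρ a) (ha' : IsGauge B ρ a')

include ha

theorem IsGauge.smoothAt_gd (p : P) : SmoothAt (gd a) p :=
  SmoothAt.gd (Filter.Eventually.of_forall ha.smooth)

theorem IsGauge.smoothAt_curv (p : P) : SmoothAt (curv a) p :=
  (ha.smoothAt_gd p).add ((ha.smooth p).mul (ha.smooth p))

/-- Bianchi identity: `a` is odd, so `d(a²) = da·a - a·da`, and the cubic terms of the commutator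
with `da + a²` cancel. -/
theorem IsGauge.gd_curv (p : P) : gd (curv a) p = curv a p * a p - a p * curv a p := by
  have h := gd_add (ha.smoothAt_gd p) ((ha.smooth p).mul (ha.smooth p))
  rw [gd_gd (Filter.Eventually.of_forall ha.smooth), gd_mul (ha.smooth p) (ha.smooth p),
    (ha.oneForm p).ε_eq, zero_add] at h
  refine h.trans ?_
  rw [curv]
  noncomm_ring

/-- With `c = ρ(φ)`, `c' = c⁻¹` and `b = s^*a`, one has `a = c'bc + c'dc` near `p`. All terms of `da
+ a²` that contain `dc` or `dc'` cancel, by the relation `dc·c' = -c·dc'` obtained from `cc' = 1`;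
what remains is `c'(db + b²)c`. -/
theorem IsGauge.tensorial_curv [LieGroup 𝓘(ℝ, EG) ∞ G]
    (hρ : ContMDiff 𝓘(ℝ, EG) 𝓘(ℝ, R) ∞ ρ) : IsTensorial B ρ (curv a) := by
  intro T p hp
  let c : P → GForm EP R := fun q ↦ const EP (ρ (T.φ q))
  let c' : P → GForm EP R := fun q ↦ const EP (ρ (T.φ q)⁻¹)
  let b : P → GForm EP R := pullM EP T.s a
  have hφ := LocalTriv.contMDiffAt_φ hp
  have hc : SmoothAt c p := smoothAt_const (hρ.contMDiffAt.comp p hφ)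
  have hc' : SmoothAt c' p := smoothAt_const (hρ.contMDiffAt.comp p hφ.inv)
  have hdc : SmoothAt (gd c) p := SmoothAt.gd <| by
    filter_upwards [LocalTriv.eventually_mem hp] with q hq
    exact smoothAt_const (hρ.contMDiffAt.comp q (LocalTriv.contMDiffAt_φ hq))
  have hb : SmoothAt b p := (ha.smooth (T.s p)).pullM (LocalTriv.contMDiffAt_s hp)
  have hgb : gd b p = pullM EP T.s (gd a) p :=
    gd_pullM (ha.smooth (T.s p)) (LocalTriv.contMDiffAt_s hp)
  have hcc' : c p * c' p = 1 := const_rho_mul _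
  have hc'c : c' p * c p = 1 := const_rho_inv_mul _
  have hεb : ε (b p) = -b p := ((ha.oneForm _).pull _).ε_eq
  have hεc : ε (c p) = c p := ε_const _
  have hεc' : ε (c' p) = c' p := ε_const _
  have hggc : gd (gd c) p = 0 := gd_gd <| by
    filter_upwards [LocalTriv.eventually_mem hp] with q hq
    exact smoothAt_const (hρ.contMDiffAt.comp q (LocalTriv.contMDiffAt_φ hq))
  have hdcc' : gd c p * c' p = -(c p * gd c' p) := by
    have h := gd_mul hc hc'
    have h1 : (fun q ↦ c q * c' q) = fun _ ↦ const EP (1 : R) := by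
      funext q
      rw [const_one]
      exact const_rho_mul _
    rw [h1, gd_const_const, hεc] at h
    exact eq_neg_of_add_eq_zero_left h.symm
  have hloc : ∀ᶠ q in nhds p, a q = c' q * b q * c q + c' q * gd c q := by
    filter_upwards [LocalTriv.eventually_mem hp] with q hq using ha.localForm T q hq
  have h1 : gd a p = gd c' p * b p * c p + c' p * gd b p * c p - c' p * b p * gd c p +
      gd c' p * gd c p := by
    rw [gd_congr hloc, gd_add ((hc'.mul hb).mul hc) (hc'.mul hdc), gd_mul (hc'.mul hb) hc,
      gd_mul hc' hb, gd_mul hc' hdc, hggc, hεc', mul_zero, add_zero]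
    have : ε (c' p * b p) = -(c' p * b p) := by
      have : ε (c' p * b p) = c' p * ε (b p) := by
        rw [ε_mul, hεc']
      rw [this, hεb, mul_neg]
    rw [this]
    noncomm_ring
  have h2 := hloc.self_of_nhds
  have h3 : c' p * gd c p * c' p = - gd c' p := by
    rw [mul_assoc, hdcc', mul_neg, ← mul_assoc, hc'c, one_mul]
  have h4 : a p * a p = c' p * (b p * b p) * c p + c' p * b p * gd c p - gd c' p * b p * c p -
      gd c' p * gd c p := by
    rw [h2]
    have e1 : c' p * b p * c p * (c' p * b p * c p) = c' p * (b p * b p) * c p := by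
      calc _ = c' p * b p * (c p * c' p) * b p * c p := by noncomm_ring
        _ = _ := by rw [hcc']; noncomm_ring
    have e2 : c' p * b p * c p * (c' p * gd c p) = c' p * b p * gd c p := by
      calc _ = c' p * b p * (c p * c' p) * gd c p := by noncomm_ring
        _ = _ := by rw [hcc']; noncomm_ring
    have e3 : c' p * gd c p * (c' p * b p * c p) = - (gd c' p * b p * c p) := by
      calc _ = (c' p * gd c p * c' p) * b p * c p := by noncomm_ring
        _ = _ := by rw [h3]; noncomm_ring
    have e4 : c' p * gd c p * (c' p * gd c p) = - (gd c' p * gd c p) := by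
      calc _ = (c' p * gd c p * c' p) * gd c p := by noncomm_ring
        _ = _ := by rw [h3]; noncomm_ring
    rw [add_mul, mul_add, mul_add, e1, e2, e3, e4]
    noncomm_ring
  have h5 : pullM EP T.s (curv a) p = gd b p + b p * b p := by
    rw [hgb]
    change pull _ (gd a _ + a _ * a _) = _
    rw [map_add, _root_.map_mul]
    rfl
  rw [h5, curv, h1, h4]
  change _ = c' p * _ * c p
  noncomm_ring

include ha'

/-- The inhomogeneous term `φ⁻¹dφ` is the same for every gauge form and drops out of the difference.
-/
theorem IsGauge.tensorial_sub : IsTensorial B ρ (fun p ↦ a' p - a p) := by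
  intro T p hp
  have h1 := ha.localForm T p hp
  have h2 := ha'.localForm T p hp
  have h3 : pullM EP T.s (fun p ↦ a' p - a p) p = pullM EP T.s a' p - pullM EP T.s a p :=
    map_sub _ _ _
  change a' p - a p = _
  rw [h3, h1, h2]
  noncomm_ring

theorem IsGauge.add_smul (t : ℝ) : IsGauge B ρ (fun p ↦ a p + t • (a' p - a p)) where
  smooth p := (ha.smooth p).add (((ha'.smooth p).sub (ha.smooth p)).smul t)
  oneForm p := (ha.oneForm p).add (((ha'.oneForm p).sub (ha.oneForm p)).smul t)
  localForm T p hp := by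
    have h1 := ha.localForm T p hp
    have h2 : a' p - a p = _ := ha.tensorial_sub ha' T p hp
    have h3 : pullM EP T.s (fun p ↦ a p + t • (a' p - a p)) p =
      pullM EP T.s a p + t • pullM EP T.s (fun p ↦ a' p - a p) p := by
      change pull _ (_ + t • _) = _
      rw [map_add, map_smul]
      rfl
    change a p + t • (a' p - a p) = _
    rw [h3, h2]
    nth_rewrite 1 [h1]
    simp only [mul_add, add_mul, mul_smul_comm, smul_mul_assoc]
    abel
  equivariant p g := by
    have h1 := ha.equivariant p g
    have h2 := ha'.equivariant p g
    have h3 : pullM EP (fun q ↦ B.act q g) (fun p ↦ a p + t • (a' p - a p)) p =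
      pullM EP (fun q ↦ B.act q g) a p + t • (pullM EP (fun q ↦ B.act q g) a' p -
        pullM EP (fun q ↦ B.act q g) a p) := by
      change pull _ (_ + t • (_ - _)) = _
      rw [map_add, map_smul, map_sub]
      rfl
    rw [h3, h1, h2]
    simp only [mul_add, add_mul, mul_smul_comm, smul_mul_assoc, mul_sub, sub_mul]

end

end Gauge

end BasicChern
end

noncomputable section
namespace BasicChern

/-! ### Linearity of the exterior and Lie derivatives -/

section LinearOps

open GForm

variable {E : Type*} [NormedAddCommGroup E] [NormedSpace ℝ E] [FiniteDimensional ℝ E]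
  {M : Type*} [TopologicalSpace M] [ChartedSpace E M] [IsManifold 𝓘(ℝ, E) ∞ M]
  {R : Type*} [NormedRing R] [NormedAlgebra ℝ R] [FiniteDimensional ℝ R]
  {A A' : M → GForm E R} {x : M}

theorem gd_smul (c : ℝ) (hA : SmoothAt A x) : gd (fun x ↦ c • A x) x = c • gd A x := by
  -- A scalar acts as multiplication by a constant function, so the Leibniz rule applies.
  have h1 : ∀ a : GForm E R, c • a = const E (c • (1 : R)) * a := fun a ↦ by
    rw [GForm.const_smul, const_one, smul_one_mul]
  have h2 : (fun x ↦ c • A x) = fun x ↦ const E (c • (1 : R)) * A x := funext fun x ↦ h1 _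
  rw [h2, gd_mul (smoothAt_const contMDiffAt_const) hA, gd_const_const, zero_mul, zero_add, ε_const,
    ← h1]

theorem lieM_add (V : VF E M) (hA : SmoothAt A x) (hA' : SmoothAt A' x) :
    lieM V (fun x ↦ A x + A' x) x = lieM V A x + lieM V A' x := by
  have h : (fun x ↦ ι (V.vec x) (A x + A' x)) = fun x ↦ ι (V.vec x) (A x) + ι (V.vec x) (A' x) :=
    funext fun x ↦ map_add _ _ _
  rw [lieM, h, gd_add (hA.ι V) (hA'.ι V), gd_add hA hA', map_add, lieM, lieM]
  abel

theorem lieM_sub (V : VF E M) (hA : SmoothAt A x) (hA' : SmoothAt A' x) :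
    lieM V (fun x ↦ A x - A' x) x = lieM V A x - lieM V A' x := by
  have h : (fun x ↦ ι (V.vec x) (A x - A' x)) = fun x ↦ ι (V.vec x) (A x) - ι (V.vec x) (A' x) :=
    funext fun x ↦ map_sub _ _ _
  rw [lieM, h, gd_sub (hA.ι V) (hA'.ι V), gd_sub hA hA', map_sub, lieM, lieM]
  abel

theorem lieM_smul (V : VF E M) (c : ℝ) (hA : SmoothAt A x) :
    lieM V (fun x ↦ c • A x) x = c • lieM V A x := by
  have h : (fun x ↦ ι (V.vec x) (c • A x)) = fun x ↦ c • ι (V.vec x) (A x) :=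
    funext fun x ↦ map_smul _ _ _
  rw [lieM, h, gd_smul c (hA.ι V), gd_smul c hA, map_smul, lieM, smul_add]

end LinearOps

/-! ### Basic invariant gauge forms and the equivariant Bianchi identity -/

section BasicGauge

open GForm

variable {EM : Type*} [NormedAddCommGroup EM] [NormedSpace ℝ EM] [FiniteDimensional ℝ EM]
  {M : Type*} [TopologicalSpace M] [ChartedSpace EM M] [IsManifold 𝓘(ℝ, EM) ∞ M]
  {EP : Type*} [NormedAddCommGroup EP] [NormedSpace ℝ EP] [FiniteDimensional ℝ EP]
  {P : Type*} [TopologicalSpace P] [ChartedSpace EP P] [IsManifold 𝓘(ℝ, EP) ∞ P]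
  {EG : Type*} [NormedAddCommGroup EG] [NormedSpace ℝ EG]
  {G : Type*} [TopologicalSpace G] [ChartedSpace EG G] [Group G]
  {R : Type*} [NormedRing R] [NormedAlgebra ℝ R] [FiniteDimensional ℝ R]
  {h : Type*} [LieRing h] [LieAlgebra ℝ h]

omit [FiniteDimensional ℝ EP] [IsManifold 𝓘(ℝ, EP) ∞ P] [FiniteDimensional ℝ R]  in
theorem gd_eq_zero_of_oneForm [FiniteDimensional ℝ EP] [FiniteDimensional ℝ R] {a : P → GForm EP R}
    (ha : ∀ p, IsOneForm (a p)) (p : P) {k : ℕ} (hk : k ≠ 2) : gd a p k = 0 := by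
  ext v
  change dG (chartRep p a) _ k _ = 0
  cases k with
  | zero => rfl
  | succ j =>
    have hj : (fun y ↦ toCont (chartRep p a y j)) = fun _ ↦ (0 : EP [⋀^Fin j]→L[ℝ] R) := by
      funext y
      have h1 : chartRep p a y j = 0 := ((ha _).pull _ : IsOneForm (chartRep p a y)) j (by omega)
      rw [h1]
      rfl
    rw [dG_succ_apply, hj, extDeriv, fderiv_const_apply]
    exact DFunLike.congr_fun (map_zero (ContinuousAlternatingMap.alternatizeUncurryFinCLM ℝ EP R)) _

variable (B : PrincipalBundle EM M EP P EG G) (ρ : G →* R)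
  {FP : Foliation EP P} (aP : h →ₗ⁅ℝ⁆ FP.BasicField)

/-- A gauge form that is basic and invariant. -/
structure IsBasicGauge (a : P → GForm EP R) : Prop extends IsGauge B ρ a where
  horizontal : ∀ p, ∀ z ∈ FP.dist p, ι (show EP from z) (a p) = 0
  horizontal_gd : ∀ p, ∀ z ∈ FP.dist p, ι (show EP from z) (gd a p) = 0
  invariant : ∀ (Y : h) (V : VF EP P), FP.Represents V (aP Y) → ∀ p, lieM V a p = 0

/-- The value of a gauge form on the basic field `Y_P`. -/
def moment (a : P → GForm EP R) (Y : h) (p : P) : R := a p 1 fun _ ↦ (FP.rep (aP Y)).vec p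

/-- The equivariant curvature of a gauge form. -/
def eqCurv (a : P → GForm EP R) (Y : h) (p : P) : GForm EP R :=
  curv a p - const EP (moment aP a Y p)

variable {B ρ aP} {a a' : P → GForm EP R} (ha : IsBasicGauge B ρ aP a)

namespace IsBasicGauge

include ha

/-- Two representatives of `Y_P` differ by a field tangent to the foliation, which `a` annihilates.
So `moment`, although defined through a choice, is linear in `Y` and compatible with brackets. -/
theorem ι_rep {Y : h} {V : VF EP P} (hV : FP.Represents V (aP Y)) (p : P) :
    ι (V.vec p) (a p) = const EP (moment aP a Y p) := by
  have h1 : ι ((V - FP.rep (aP Y)).vec p) (a p) = 0 :=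
    ha.horizontal p _ (hV.sub_mem (FP.rep_spec _) p)
  have h2 : (V - FP.rep (aP Y)).vec p = V.vec p - (FP.rep (aP Y)).vec p := rfl
  rw [h2, map_sub, LinearMap.sub_apply, sub_eq_zero, (ha.oneForm p).ι_eq ((FP.rep (aP Y)).vec p)] at h1
  exact h1

theorem moment_add_smul (Y Y' : h) (s : ℝ) (p : P) :
    moment aP a (Y + s • Y') p = moment aP a Y p + s • moment aP a Y' p := by
  have hV : FP.Represents (FP.rep (aP Y) + s • FP.rep (aP Y')) (aP (Y + s • Y')) := by
    rw [map_add, map_smul]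
    exact (FP.rep_spec _).add ((FP.rep_spec _).smul s)
  have h1 := ha.ι_rep hV p
  have h2 : (FP.rep (aP Y) + s • FP.rep (aP Y')).vec p =
    (FP.rep (aP Y)).vec p + s • (FP.rep (aP Y')).vec p := rfl
  rw [h2, map_add, map_smul, LinearMap.add_apply, LinearMap.smul_apply,
    ha.ι_rep (FP.rep_spec _), ha.ι_rep (FP.rep_spec _), ← GForm.const_smul, ← const_add] at h1
  exact (const_injective h1).symm

theorem smoothAt_moment (Y : h) (p : P) : SmoothAt (fun p ↦ const EP (moment aP a Y p)) p := by
  have h1 := SmoothAt.ι (FP.rep (aP Y)) (ha.smooth p)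
  have h2 : (fun p ↦ ι ((FP.rep (aP Y)).vec p) (a p)) = fun p ↦ const EP (moment aP a Y p) :=
    funext fun p ↦ ha.ι_rep (FP.rep_spec _) p
  rwa [h2] at h1

theorem smoothAt_eqCurv (Y : h) (p : P) : SmoothAt (eqCurv aP a Y) p :=
  (ha.smoothAt_curv p).sub (ha.smoothAt_moment Y p)

theorem ε_eqCurv (Y : h) (p : P) : ε (eqCurv aP a Y p) = eqCurv aP a Y p := by
  have h1 : ε (gd a p) = gd a p := by
    funext k
    rw [ε_apply]
    by_cases hk : k = 2
    · subst hk
      rw [neg_one_sq]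
      exact one_smul ℝ (gd a p 2)
    · rw [gd_eq_zero_of_oneForm ha.oneForm p hk, smul_zero]
  rw [eqCurv, curv, map_sub, map_add, ε_mul, (ha.oneForm p).ε_eq, neg_mul_neg, h1, ε_const]

/-- Apply `[L_V, i(W)] = i([V, W])` to `a`, with `L_V a = 0`; the field `[V, W]` represents the
basic field of `[X, Y]`. -/
theorem lieM_moment {X : h} {V : VF EP P} (hV : FP.Represents V (aP X)) (Y : h) (p : P) :
    lieM V (fun p ↦ const EP (moment aP a Y p)) p = const EP (moment aP a ⁅X, Y⁆ p) := by
  have h2 : (fun p ↦ ι ((FP.rep (aP Y)).vec p) (a p)) = fun p ↦ const EP (moment aP a Y p) :=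
    funext fun p ↦ ha.ι_rep (FP.rep_spec _) p
  rw [← h2, lieM_ι _ _ (ha.smooth p), ha.invariant X V hV, map_zero, add_zero]
  refine ha.ι_rep ?_ p
  rw [LieHom.map_lie]
  exact hV.lie (FP.rep_spec _)

/-- Differentiating Cartan's formula for `L_V a = 0` gives `d(i(V)da) = 0`, which is `L_V(da)`; the
quadratic term follows from the derivation property. -/
theorem lieM_curv {X : h} {V : VF EP P} (hV : FP.Represents V (aP X)) (p : P) :
    lieM V (curv a) p = 0 := by
  have hι : ∀ p, SmoothAt (fun p ↦ ι (V.vec p) (a p)) p := fun p ↦ (ha.smooth p).ι V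
  have h1 : lieM V (gd a) p = 0 := by
    have h2 : (fun p ↦ gd (fun p ↦ ι (V.vec p) (a p)) p + ι (V.vec p) (gd a p)) =
        fun _ ↦ const EP (0 : R) := by
      funext p
      refine (ha.invariant X V hV p).trans ?_
      ext k v
      cases k <;> rfl
    have h3 := gd_add (SmoothAt.gd (Filter.Eventually.of_forall hι)) ((ha.smoothAt_gd p).ι V)
    rw [h2, gd_const_const, gd_gd (Filter.Eventually.of_forall hι), zero_add] at h3
    rw [lieM, ← h3, gd_gd (Filter.Eventually.of_forall ha.smooth), map_zero, add_zero]
  have h4 : lieM V (curv a) p = lieM V (gd a) p + lieM V (fun p ↦ a p * a p) p :=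
    lieM_add V (ha.smoothAt_gd p) ((ha.smooth p).mul (ha.smooth p))
  rw [h4, h1, lieM_mul V (ha.smooth p) (ha.smooth p), ha.invariant X V hV, mul_zero, zero_mul]
  simp

theorem lieM_eqCurv {X : h} {V : VF EP P} (hV : FP.Represents V (aP X)) (Y : h) (p : P) :
    lieM V (eqCurv aP a Y) p = -const EP (moment aP a ⁅X, Y⁆ p) := by
  have h4 : lieM V (eqCurv aP a Y) p =
      lieM V (curv a) p - lieM V (fun p ↦ const EP (moment aP a Y p)) p :=
    lieM_sub V (ha.smoothAt_curv p) (ha.smoothAt_moment Y p)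
  rw [h4, ha.lieM_curv hV, ha.lieM_moment hV, zero_sub]

theorem eqCurv_add_smul (Y Y' : h) (s : ℝ) (p : P) :
    eqCurv aP a (Y + s • Y') p = eqCurv aP a Y p - s • const EP (moment aP a Y' p) := by
  rw [eqCurv, eqCurv, ha.moment_add_smul, const_add, GForm.const_smul, sub_sub]

/-- Invariance reads `d(a(Y_P)) = -i(Y_P)da`, and `IsGauge.gd_curv` treats the curvature. The
commutator of `a` with `a(Y_P)` on the right is matched by the contraction of `a²`. -/
theorem gd_eqCurv {Y : h} {V : VF EP P} (hV : FP.Represents V (aP Y)) (p : P) :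
    gd (eqCurv aP a Y) p = ι (V.vec p) (eqCurv aP a Y p) -
      (a p * eqCurv aP a Y p - eqCurv aP a Y p * a p) := by
  have h6 : gd (eqCurv aP a Y) p = gd (curv a) p - gd (fun p ↦ const EP (moment aP a Y p)) p :=
    gd_sub (ha.smoothAt_curv p) (ha.smoothAt_moment Y p)
  have h2 : (fun p ↦ ι (V.vec p) (a p)) = fun p ↦ const EP (moment aP a Y p) :=
    funext fun p ↦ ha.ι_rep hV p
  have h3 := ha.invariant Y V hV p
  rw [lieM, h2] at h3
  rw [h6, ha.gd_curv, eq_neg_of_add_eq_zero_left h3, eqCurv, curv, map_sub, ι_const, sub_zero,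
    map_add, ι_mul, (ha.oneForm p).ε_eq, ha.ι_rep hV]
  noncomm_ring

theorem ι_curv (p : P) {z : EP} (hz : z ∈ FP.dist p) : ι z (curv a p) = 0 := by
  rw [curv, map_add, ι_mul, ha.horizontal p z hz, ha.horizontal_gd p z hz, zero_mul, mul_zero,
    add_zero, add_zero]

theorem ι_eqCurv (Y : h) (p : P) {z : EP} (hz : z ∈ FP.dist p) : ι z (eqCurv aP a Y p) = 0 := by
  rw [eqCurv, map_sub, ha.ι_curv p hz, ι_const, sub_zero]

theorem apply_eq {p : P} {v w : EP} (hvw : v - w ∈ FP.dist p) :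
    a p 1 (fun _ ↦ v) = a p 1 (fun _ ↦ w) := by
  have h1 := ha.horizontal p _ hvw
  rw [map_sub, LinearMap.sub_apply, sub_eq_zero, (ha.oneForm p).ι_eq, (ha.oneForm p).ι_eq] at h1
  exact const_injective h1

/-- The field `Y_P` is `G`-invariant only modulo the foliation; this suffices because `a` vanishes
along it. -/
theorem tensorial_moment {F : Foliation EM M} {aM : h →ₗ⁅ℝ⁆ F.BasicField}
    (hE : IsEquivariantBundle B F FP aM aP) (Y : h) :
    IsTensorial B ρ (fun p ↦ const EP (moment aP a Y p)) := by
  intro T p hp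
  have h1 := hE.invariant Y _ (FP.rep_spec _) (T.s p) (T.φ p)
  have h2 := ha.equivariant (T.s p) (T.φ p)
  rw [LocalTriv.act_s_φ hp] at h1
  have h3 := congrArg (fun b : GForm EP R ↦ b 1 fun _ ↦ (FP.rep (aP Y)).vec (T.s p)) h2
  simp only [mul_const_apply, const_mul_apply, pullM, pull_apply] at h3
  rw [LocalTriv.act_s_φ hp] at h3
  have h4 := ha.apply_eq h1
  have h5 : moment aP a Y p = ρ (T.φ p)⁻¹ * moment aP a Y (T.s p) * ρ (T.φ p) := h4.symm.trans h3
  change const EP (moment aP a Y p) = _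
  rw [h5, pullM, pull_const, const_mul_const, const_mul_const]

theorem tensorial_eqCurv [LieGroup 𝓘(ℝ, EG) ∞ G] (hρ : ContMDiff 𝓘(ℝ, EG) 𝓘(ℝ, R) ∞ ρ)
    {F : Foliation EM M} {aM : h →ₗ⁅ℝ⁆ F.BasicField}
    (hE : IsEquivariantBundle B F FP aM aP) (Y : h) : IsTensorial B ρ (eqCurv aP a Y) := by
  intro T p hp
  have h1 := ha.tensorial_curv hρ T p hp
  have h2 : const EP (moment aP a Y p) = _ := ha.tensorial_moment hE Y T p hp
  have h3 : pullM EP T.s (eqCurv aP a Y) p =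
    pullM EP T.s (curv a) p - pullM EP T.s (fun p ↦ const EP (moment aP a Y p)) p := map_sub _ _ _
  rw [h3, eqCurv, h1, h2]
  noncomm_ring

/-- Each defining condition is affine in the form, so the segment joining two such forms consists of
such forms. It is the path of the transgression. -/
theorem add_smul (ha' : IsBasicGauge B ρ aP a') (t : ℝ) :
    IsBasicGauge B ρ aP (fun p ↦ a p + t • (a' p - a p)) where
  toIsGauge := ha.toIsGauge.add_smul ha'.toIsGauge t
  horizontal p z hz := by
    rw [map_add, map_smul, map_sub, ha.horizontal p z hz, ha'.horizontal p z hz, sub_zero,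
      smul_zero, add_zero]
  horizontal_gd p z hz := by
    have h1 : gd (fun p ↦ a p + t • (a' p - a p)) p = gd a p + t • (gd a' p - gd a p) := by
      rw [gd_add (ha.smooth p) (((ha'.smooth p).sub (ha.smooth p)).smul t),
        gd_smul t ((ha'.smooth p).sub (ha.smooth p)), gd_sub (ha'.smooth p) (ha.smooth p)]
    rw [h1, map_add, map_smul, map_sub, ha.horizontal_gd p z hz, ha'.horizontal_gd p z hz, sub_zero,
      smul_zero, add_zero]
  invariant Y V hV p := by
    rw [lieM_add V (ha.smooth p) (((ha'.smooth p).sub (ha.smooth p)).smul t),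
      lieM_smul V t ((ha'.smooth p).sub (ha.smooth p)), lieM_sub V (ha'.smooth p) (ha.smooth p),
      ha.invariant Y V hV, ha'.invariant Y V hV, sub_zero, smul_zero, add_zero]

end IsBasicGauge

end BasicGauge

end BasicChern
end

noncomputable section
namespace BasicChern

/-! ### Products of two one-forms -/

section Products

variable {T : Type*} [AddCommGroup T] [Module ℝ T] {N : Type*} [AddCommGroup N]

theorem antisymm_zero_apply (f : (ℕ → T) → N) (v : Fin 0 → T) : antisymm 0 f v = f (seqOf v) := by
  simp [antisymm, Subsingleton.elim _ v]

theorem antisymm_two_apply (f : T → T → N) (v : Fin 2 → T) :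
    antisymm 2 (fun s ↦ f (s 0) (s 1)) v = f (v 0) (v 1) - f (v 1) (v 0) := by
  have hv : v = (Fin.cons (v 0) (Fin.cons (v 1) (Fin.elim0 : Fin 0 → T) : Fin 1 → T) : Fin 2 → T) := by
    funext i
    fin_cases i <;> rfl
  rw [hv]
  simp only [antisymm_cons, antisymm_zero_apply, Finset.sum_range_succ, Finset.sum_range_zero, insSeq]
  simp
  abel

namespace GForm

variable {R : Type*} [Ring R] [Algebra ℝ R]

theorem IsOneForm.mul_apply_two {a b : GForm T R} (ha : IsOneForm a) (hb : IsOneForm b)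
    (v : Fin 2 → T) : (a * b) 2 v =
      a 1 (fun _ ↦ v 0) * b 1 (fun _ ↦ v 1) - a 1 (fun _ ↦ v 1) * b 1 (fun _ ↦ v 0) := by
  have h1 : (a * b) 2 v = ι (v 0) (a * b) 1 (Fin.tail v) := by
    rw [ι_apply_apply, Fin.cons_self_tail]
  have h2 : Fin.tail v = fun _ ↦ v 1 := by
    funext i
    fin_cases i
    rfl
  have h3 : ι (v 0) (a * b) 1 (Fin.tail v) = (const T (a 1 fun _ ↦ v 0) * b) 1 (Fin.tail v) -
      (a * const T (b 1 fun _ ↦ v 0)) 1 (Fin.tail v) := by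
    rw [ι_mul, ha.ε_eq, ha.ι_eq, hb.ι_eq, neg_mul, ← sub_eq_add_neg]
    rfl
  rw [h1, h3, const_mul_apply, mul_const_apply, h2]

theorem IsOneForm.mul_eq_zero {a b : GForm T R} (ha : IsOneForm a) (hb : IsOneForm b) {k : ℕ}
    (hk : k ≠ 2) : (a * b) k = 0 := by
  ext v
  rw [mul_apply]
  refine Finset.sum_eq_zero fun q hq ↦ ?_
  have hq' := Finset.HasAntidiagonal.mem_antidiagonal.1 hq
  have h : tens (a q.1) (b q.2) = fun _ ↦ 0 := by
    funext s
    by_cases h1 : q.1 = 1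
    · have h2 : q.2 ≠ 1 := by omega
      rw [tens, hb _ h2]
      exact mul_zero _
    · rw [tens, ha _ h1]
      exact zero_mul _
  rw [h]
  simp [antisymm]

end GForm

end Products

/-! ### From connections to gauge forms -/

section FromConnection

open GForm

variable {EM : Type*} [NormedAddCommGroup EM] [NormedSpace ℝ EM] [FiniteDimensional ℝ EM]
  {M : Type*} [TopologicalSpace M] [ChartedSpace EM M] [IsManifold 𝓘(ℝ, EM) ∞ M]
  {EP : Type*} [NormedAddCommGroup EP] [NormedSpace ℝ EP] [FiniteDimensional ℝ EP]
  {P : Type*} [TopologicalSpace P] [ChartedSpace EP P] [IsManifold 𝓘(ℝ, EP) ∞ P]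
  {EG : Type*} [NormedAddCommGroup EG] [NormedSpace ℝ EG] [FiniteDimensional ℝ EG]
  {G : Type*} [TopologicalSpace G] [ChartedSpace EG G] [Group G] [LieGroup 𝓘(ℝ, EG) ∞ G]
  {R : Type*} [NormedRing R] [NormedAlgebra ℝ R] [FiniteDimensional ℝ R]
  {h : Type*} [LieRing h] [LieAlgebra ℝ h]
  {B : PrincipalBundle EM M EP P EG G} {ρ : G →* R}
  {FP : Foliation EP P} {aP : h →ₗ⁅ℝ⁆ FP.BasicField}

theorem toG_zero {W : Type*} [NormedAddCommGroup W] [NormedSpace ℝ W] (l : W →L[ℝ] R) {k : ℕ}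
    (p : P) : toG l (0 : Form EP P W k) p = 0 := by
  funext j
  rw [toG]
  by_cases hj : j = k
  · subst hj
    rw [single_same]
    ext v
    exact map_zero l
  · exact single_ne hj _

omit [FiniteDimensional ℝ EM] [IsManifold 𝓘(ℝ, EM) ∞ M] [FiniteDimensional ℝ EP]
  [IsManifold 𝓘(ℝ, EP) ∞ P] [FiniteDimensional ℝ EG] [LieGroup 𝓘(ℝ, EG) ∞ G]
  [FiniteDimensional ℝ R] in
theorem Connection.toG_apply (θ : Connection B) (p : P) (v : EP) :
    toG (dRho ρ) θ.form p 1 (fun _ ↦ v) = dRho ρ (θ.form p fun _ ↦ v) := by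
  rw [toG, single_same]
  rfl

omit [FiniteDimensional ℝ EM] [IsManifold 𝓘(ℝ, EM) ∞ M] [FiniteDimensional ℝ EP]
  [IsManifold 𝓘(ℝ, EP) ∞ P] [FiniteDimensional ℝ EG] [LieGroup 𝓘(ℝ, EG) ∞ G]
  [FiniteDimensional ℝ R] in
theorem Connection.isOneForm_toG (θ : Connection B) (p : P) :
    IsOneForm (toG (dRho (EG := EG) ρ) θ.form p) := fun _ hk ↦ single_ne hk _

/-- For the local formula a tangent vector is split by `LocalTriv.tmap_decomp`: equivariance of the
connection gives the conjugated term, and its value on fundamental vectors gives `φ⁻¹dφ`. -/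
theorem Connection.isGauge (θ : Connection B) (hρ : ContMDiff 𝓘(ℝ, EG) 𝓘(ℝ, R) ∞ ρ) :
    IsGauge B ρ (toG (dRho ρ) θ.form) where
  smooth p := smoothAt_toG _ θ.smooth p
  oneForm p := θ.isOneForm_toG p
  equivariant p g := by
    refine ((θ.isOneForm_toG _).pull _).ext (((θ.isOneForm_toG p).const_mul _).mul_const _)
      fun v ↦ ?_
    rw [mul_const_apply, const_mul_apply, θ.toG_apply, ← dRho_adInv hρ, ← θ.equivariant,
      ← θ.toG_apply]
    rfl
  localForm T p hp := by
    have hφ := LocalTriv.contMDiffAt_φ hp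
    have hφd := hφ.mdifferentiableAt (n := ∞) (by simp)
    have hr : MDifferentiableAt 𝓘(ℝ, EP) 𝓘(ℝ, R) (ρ ∘ T.φ) p := (mdiff_rho hρ _).comp p hφd
    refine (θ.isOneForm_toG p).ext (((((θ.isOneForm_toG _).pull _).const_mul _).mul_const _).add
      ((isOneForm_gd_const hr).const_mul _)) fun v ↦ ?_
    have hadd : ∀ v w : EP, θ.form p (fun _ ↦ v + w) = θ.form p (fun _ ↦ v) + θ.form p (fun _ ↦ w) :=
      fun v w ↦ map_add ((ContinuousAlternatingMap.ofSubsingleton ℝ EP EG (0 : Fin 1)).symm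
        (θ.form p)) v w
    have h1 := θ.equivariant (T.s p) (T.φ p) (tmap EP EP T.s p v)
    rw [LocalTriv.act_s_φ hp] at h1
    rw [θ.toG_apply, LocalTriv.tmap_decomp hp v, hadd, h1, θ.fundamental, map_add, dRho_adInv hρ,
      tmap_rho_inv_mul hρ, ← θ.toG_apply, ← LocalTriv.tmap_decomp hp v]
    refine congrArg₂ (· + ·) ?_ ?_
    · exact ((mul_const_apply _ _ _ _).trans (congrArg (· * _) (const_mul_apply _ _ _ _))).symm
    · refine Eq.trans (congrArg _ ?_) (const_mul_apply _ _ _ _).symm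
      have h2 := gd_const_apply hr v
      rw [tmap_comp (mdiff_rho hρ _) hφd] at h2
      exact h2.symm

theorem InvariantBasicConnection.isBasicGauge [T2Space P]
    (θ : InvariantBasicConnection B FP aP) (hρ : ContMDiff 𝓘(ℝ, EG) 𝓘(ℝ, R) ∞ ρ) :
    IsBasicGauge B ρ aP (toG (dRho ρ) θ.form) where
  toIsGauge := θ.toConnection.isGauge hρ
  horizontal p z hz := by
    obtain ⟨Z, hZ, rfl⟩ := FP.exists_tangent_eq hz
    refine (ι_toG (dRho ρ) θ.form Z p).trans ?_
    rw [(θ.basic Z hZ).1]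
    exact toG_zero _ p
  horizontal_gd p z hz := by
    obtain ⟨Z, hZ, rfl⟩ := FP.exists_tangent_eq hz
    rw [gd_toG _ _ (θ.smooth.diffAt p)]
    refine (ι_toG (dRho ρ) θ.form.d Z p).trans ?_
    rw [(θ.basic Z hZ).2]
    exact toG_zero _ p
  invariant Y V hV p := by
    rw [lieM_toG _ θ.smooth, θ.invariant Y V hV]
    exact toG_zero _ p

/-- On a pair of vectors `[ω, ω]` has two summands whose images under `dρ` agree, which accounts for
the factor one half. By `dRho_lieBracket` that common image is a commutator, the value of `a²`. -/
theorem Connection.curv_toG_two (θ : Connection B) (hρ : ContMDiff 𝓘(ℝ, EG) 𝓘(ℝ, R) ∞ ρ) (p : P)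
    (v : Fin 2 → EP) : curv (toG (dRho ρ) θ.form) p 2 v = dRho ρ (θ.curvature p v) := by
  have h1 := wedge_apply (lieBracket EG G) (θ.form p).toAlternatingMap (θ.form p).toAlternatingMap v
  have h2 := antisymm_two_apply (fun u w ↦ lieBracket EG G (θ.form p fun _ ↦ u)
    (θ.form p fun _ ↦ w)) v
  have h3 : wedge (lieBracket EG G) (θ.form p).toAlternatingMap (θ.form p).toAlternatingMap v =
      lieBracket EG G (θ.form p fun _ ↦ v 0) (θ.form p fun _ ↦ v 1) -
        lieBracket EG G (θ.form p fun _ ↦ v 1) (θ.form p fun _ ↦ v 0) := by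
    rw [← h2]
    simp only [Nat.factorial_one, mul_one, one_smul] at h1
    rw [h1]
    congr 1
    funext s
    refine congrArg₂ (fun x y ↦ lieBracket EG G x y) (congrArg (θ.form p) (funext fun i ↦ ?_))
      (congrArg (θ.form p) (funext fun i ↦ ?_))
    · simp
    · simp
  have h4 : θ.curvature p v = θ.form.d p v + (1 / 2 : ℝ) •
      wedge (lieBracket EG G) (θ.form p).toAlternatingMap (θ.form p).toAlternatingMap v := rfl
  have h5 : curv (toG (dRho ρ) θ.form) p 2 v =
      gd (toG (dRho ρ) θ.form) p 2 v + (toG (dRho ρ) θ.form p * toG (dRho ρ) θ.form p) 2 v := rfl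
  rw [h4, h3, h5, gd_toG _ _ (θ.smooth.diffAt p), (θ.isOneForm_toG p).mul_apply_two
    (θ.isOneForm_toG p), map_add, map_smul, map_sub, dRho_lieBracket hρ, dRho_lieBracket hρ,
    toG, single_same]
  have h6 : ∀ x y z : R, x + (1 / 2 : ℝ) • (y - z - (z - y)) = x + (y - z) := fun x y z ↦ by
    have : y - z - (z - y) = (2 : ℝ) • (y - z) := by
      rw [two_smul]
      abel
    rw [this, smul_smul]
    norm_num
  rw [h6]
  simp only [θ.toG_apply]
  rfl

end FromConnection

end BasicChern
end

noncomputable section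
namespace BasicChern

/-! ### Descent of scalar forms from the bundle to the base -/

section Descent

open GForm

variable {EM : Type*} [NormedAddCommGroup EM] [NormedSpace ℝ EM] [FiniteDimensional ℝ EM]
  {M : Type*} [TopologicalSpace M] [ChartedSpace EM M] [IsManifold 𝓘(ℝ, EM) ∞ M]
  {EP : Type*} [NormedAddCommGroup EP] [NormedSpace ℝ EP] [FiniteDimensional ℝ EP]
  {P : Type*} [TopologicalSpace P] [ChartedSpace EP P] [IsManifold 𝓘(ℝ, EP) ∞ P]
  {EG : Type*} [NormedAddCommGroup EG] [NormedSpace ℝ EG]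
  {G : Type*} [TopologicalSpace G] [ChartedSpace EG G] [Group G] [LieGroup 𝓘(ℝ, EG) ∞ G]
  {R : Type*} [NormedRing R] [NormedAlgebra ℝ R] [FiniteDimensional ℝ R]
  {Q : Type*} [NormedAddCommGroup Q] [NormedSpace ℝ Q]
  (B : PrincipalBundle EM M EP P EG G)

theorem SmoothIn.congr {A A' : Q → M → GForm EM R} {q : Q} {x : M} (hA : SmoothIn A q x) {U : Set M}
    (hU : U ∈ nhds x) (h : ∀ q, ∀ y ∈ U, A' q y = A q y) : SmoothIn A' q x := by
  refine GSmoothAt.congr hA ?_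
  have h1 := chart_tendsto_symm x (mem_extChartAt_source (I := 𝓘(ℝ, EM)) x)
  have h2 := (continuous_snd (X := Q)).tendsto (q, extChartAt 𝓘(ℝ, EM) x x)
  filter_upwards [(h1.comp h2).eventually hU] with z hz
  exact congrArg (pull _) (h _ _ hz)

/-- The form on `P` is the pullback of a form on `M`. -/
def IsDescending (Ψ : P → GForm EP ℂ) : Prop :=
  ∀ (T : LocalTriv B) (p : P), B.proj p ∈ T.U → Ψ p = pullM EP T.s Ψ p

/-- The form on `M` whose pullback to `P` is a given form. -/
def descend (Ψ : P → GForm EP ℂ) (m : M) : GForm EM ℂ :=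
  pullM EM (B.exists_localTriv m).choose.σ Ψ m

variable {B} {ρ : G →* R}

-- Both factors are conjugated by the same `ρ(φ)`, hence so is their product with the exponential,
-- and the trace does not see the conjugation.
omit [FiniteDimensional ℝ EM] [IsManifold 𝓘(ℝ, EM) ∞ M] [IsManifold 𝓘(ℝ, EP) ∞ P]
  [LieGroup 𝓘(ℝ, EG) ∞ G] in
theorem IsTensorial.isDescending_trc {γ α : P → GForm EP R} (hγ : IsTensorial B ρ γ)
    (hα : IsTensorial B ρ α) {t : R →ₗ[ℝ] ℂ} (ht : ∀ x y, t (x * y) = t (y * x)) :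
    IsDescending B (fun p ↦ trc t (γ p * expNeg (α p))) := by
  intro T p hp
  have h1 := hγ T p hp
  have h2 := hα T p hp
  have hr : ρ (T.φ p) * ρ (T.φ p)⁻¹ = 1 := by
    rw [← _root_.map_mul, mul_inv_cancel, _root_.map_one]
  have hr' : ρ (T.φ p)⁻¹ * ρ (T.φ p) = 1 := by
    rw [← _root_.map_mul, inv_mul_cancel, _root_.map_one]
  have h3 : pullM EP T.s (fun p ↦ trc t (γ p * expNeg (α p))) p =
      trc t (pullM EP T.s γ p * expNeg (pullM EP T.s α p)) := by
    rw [pullM, pullM, pullM, ← pull_expNeg, ← _root_.map_mul, trc_pull]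
  change trc t (γ p * expNeg (α p)) = _
  rw [h3, h1, h2, conj_expNeg hr hr']
  have h4 : ∀ x y : GForm EP R, const EP (ρ (T.φ p)⁻¹) * x * const EP (ρ (T.φ p)) *
      (const EP (ρ (T.φ p)⁻¹) * y * const EP (ρ (T.φ p))) =
      const EP (ρ (T.φ p)⁻¹) * (x * y) * const EP (ρ (T.φ p)) := fun x y ↦ by
    calc _ = const EP (ρ (T.φ p)⁻¹) * x * (const EP (ρ (T.φ p)) * const EP (ρ (T.φ p)⁻¹)) * y *
          const EP (ρ (T.φ p)) := by noncomm_ring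
      _ = _ := by rw [const_rho_mul]; noncomm_ring
  rw [h4]
  exact trc_conj ht hr _

omit [FiniteDimensional ℝ EM] [FiniteDimensional ℝ EP] in
theorem pullM_descend {Ψ : P → GForm EP ℂ} (hΨ : IsDescending B Ψ) (p : P) :
    pullM EP B.proj (descend B Ψ) p = Ψ p := by
  have hT := (B.exists_localTriv (B.proj p)).choose_spec
  rw [hΨ _ p hT]
  have h1 : tmap EP EP (LocalTriv.s _) p = (tmap EM EP (B.exists_localTriv (B.proj p)).choose.σ
    (B.proj p)).comp (tmap EP EM B.proj p) := ContinuousLinearMap.ext (LocalTriv.tmap_s hT)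
  conv_rhs => rw [pullM, h1]
  rfl

omit [FiniteDimensional ℝ EM] [FiniteDimensional ℝ EP] in
theorem pull_proj_injective (p : P) :
    Function.Injective (pull (R := R) (tmap EP EM B.proj p : EP →ₗ[ℝ] EM)) :=
  pull_injective (B.tmap_proj_surjective p)

-- The tangent map of the projection is onto, so the pullback at a single point of the fibre
-- determines the form on the base.
omit [FiniteDimensional ℝ EM] [FiniteDimensional ℝ EP] in
theorem descend_unique {Ψ : P → GForm EP ℂ} (hΨ : IsDescending B Ψ) {p : P} {b : GForm EM ℂ}
    (hb : pull (tmap EP EM B.proj p : EP →ₗ[ℝ] EM) b = Ψ p) : descend B Ψ (B.proj p) = b :=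
  pull_proj_injective p ((pullM_descend hΨ p).trans hb.symm)

-- `descend` picks a trivialization separately at each point. Being free to use one fixed section
-- near `m` is what makes smoothness accessible.
omit [FiniteDimensional ℝ EM] [FiniteDimensional ℝ EP] in
theorem descend_eq {Ψ : P → GForm EP ℂ} (hΨ : IsDescending B Ψ) (T : LocalTriv B) {m : M}
    (hm : m ∈ T.U) : descend B Ψ m = pullM EM T.σ Ψ m := by
  obtain ⟨p, rfl⟩ := B.proj_surjective m
  refine descend_unique hΨ ?_
  rw [hΨ T p hm]
  have h1 : tmap EP EP T.s p = (tmap EM EP T.σ (B.proj p)).comp (tmap EP EM B.proj p) :=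
    ContinuousLinearMap.ext (LocalTriv.tmap_s hm)
  conv_rhs => rw [pullM, h1]
  rfl

theorem smoothIn_descend {Ψ : Q → P → GForm EP ℂ} (hΨ : ∀ q, IsDescending B (Ψ q)) {q : Q}
    (hs : ∀ p, SmoothIn Ψ q p) (m : M) : SmoothIn (fun q ↦ descend B (Ψ q)) q m := by
  obtain ⟨T, hT⟩ := B.exists_localTriv m
  obtain ⟨p, rfl⟩ := B.proj_surjective m
  exact ((hs _).pullM (LocalTriv.contMDiffAt_σ hT)).congr (T.isOpen.mem_nhds hT)
    fun q y hy ↦ descend_eq (hΨ q) T hy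

theorem smoothAt_descend {Ψ : P → GForm EP ℂ} (hΨ : IsDescending B Ψ) (hs : ∀ p, SmoothAt Ψ p)
    (m : M) : SmoothAt (descend B Ψ) m :=
  (smoothIn_descend (Q := ℝ) (Ψ := fun _ ↦ Ψ) (q := 0) (fun _ ↦ hΨ)
    (fun p ↦ (hs p).smoothIn 0) m).smoothAt

theorem pullM_gd_descend {Ψ : P → GForm EP ℂ} (hΨ : IsDescending B Ψ) (hs : ∀ p, SmoothAt Ψ p)
    (p : P) : pullM EP B.proj (gd (descend B Ψ)) p = gd Ψ p := by
  rw [← gd_pullM (smoothAt_descend hΨ hs _) B.smooth_proj.contMDiffAt]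
  congr 1
  exact funext (pullM_descend hΨ)

variable {F : Foliation EM M} {FP : Foliation EP P} (hB : IsFoliatedBundle B F FP)
  {h : Type*} [LieRing h] [LieAlgebra ℝ h] [FiniteDimensional ℝ h]
  {aM : h →ₗ⁅ℝ⁆ F.BasicField} {aP : h →ₗ⁅ℝ⁆ FP.BasicField}
  (hE : IsEquivariantBundle B F FP aM aP)

/-- The families of forms on `P` that descend to equivariant basic forms on `M`. -/
structure IsEquivariantBasic (B : PrincipalBundle EM M EP P EG G) (aP : h →ₗ⁅ℝ⁆ FP.BasicField)
    (Ψ : h → P → GForm EP ℂ) : Prop where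
  smooth : ∀ q p, SmoothIn (fun q ↦ Ψ ((Module.finBasis ℝ h).equivFun.symm q)) q p
  descending : ∀ Y, IsDescending B (Ψ Y)
  horizontal : ∀ Y p, ∀ z ∈ FP.dist p, ι (show EP from z) (Ψ Y p) = 0
  invariant : ∀ (X Y : h) (V : VF EP P), FP.Represents V (aP X) → ∀ p,
    HasGDeriv (fun s : ℝ ↦ Ψ (Y + s • ⁅X, Y⁆) p) (lieM V (Ψ Y) p) 0

variable [T2Space P] {Ψ : h → P → GForm EP ℂ} (hΨ : IsEquivariantBasic B aP Ψ)

include hΨ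

omit [T2Space P] in
theorem IsEquivariantBasic.smoothAt (Y : h) (p : P) : SmoothAt (Ψ Y) p := by
  have h1 := (hΨ.smooth ((Module.finBasis ℝ h).equivFun Y) p).smoothAt
  rwa [LinearEquiv.symm_apply_apply] at h1

include hB in
theorem IsEquivariantBasic.ι_descend (Y : h) {m : M} {u : EM} (hu : u ∈ F.dist m) :
    ι u (descend B (Ψ Y) m) = 0 := by
  obtain ⟨p, rfl⟩ := B.proj_surjective m
  obtain ⟨z, hz, rfl⟩ := (hB.bijOn p).surjOn hu
  apply pull_proj_injective (B := B) p
  rw [map_zero]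
  refine (ι_pull _ _ _).symm.trans ?_
  refine Eq.trans ?_ (hΨ.horizontal Y p z hz)
  exact congrArg _ (pullM_descend (hΨ.descending Y) p)

/-- A field `Z` tangent to the foliation represents the zero basic field. Invariance for `X = 0`
then says that the Lie derivative along `Z` is the derivative of a constant curve, and Cartan's
formula with `i(Z)Ψ = 0` leaves `i(Z)dΨ = 0`. -/
theorem IsEquivariantBasic.ι_gd (Y : h) {p : P} {z : EP} (hz : z ∈ FP.dist p) :
    ι z (gd (Ψ Y) p) = 0 := by
  obtain ⟨Z, hZ, rfl⟩ := FP.exists_tangent_eq hz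
  have hZ0 : FP.Represents Z (aP 0) := by
    rw [map_zero]
    exact Foliation.represents_zero hZ
  have h1 := hΨ.invariant 0 Y Z hZ0 p
  have h2 : lieM Z (Ψ Y) p = 0 := by
    ext k v
    have h3 := h1 k v
    simp only [zero_lie, smul_zero, add_zero] at h3
    exact h3.unique (hasDerivAt_const 0 _)
  have h4 : (fun p ↦ ι (Z.vec p) (Ψ Y p)) = fun _ ↦ const EP (0 : ℂ) := by
    funext q
    refine (hΨ.horizontal Y q _ (hZ q)).trans ?_
    ext k v
    cases k <;> rfl
  rwa [lieM, h4, gd_const_const, zero_add] at h2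

include hB in
theorem IsEquivariantBasic.ι_gd_descend (Y : h) {m : M} {u : EM} (hu : u ∈ F.dist m) :
    ι u (gd (descend B (Ψ Y)) m) = 0 := by
  obtain ⟨p, rfl⟩ := B.proj_surjective m
  obtain ⟨z, hz, rfl⟩ := (hB.bijOn p).surjOn hu
  apply pull_proj_injective (B := B) p
  rw [map_zero]
  refine (ι_pull _ _ _).symm.trans ?_
  refine Eq.trans ?_ (hΨ.ι_gd Y hz)
  exact congrArg _ (pullM_gd_descend (hΨ.descending Y) (hΨ.smoothAt Y) p)

-- The field `V` projects to `W` only modulo the foliation of `M`, but the descended form vanishes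
-- on the difference.
include hB hE in
theorem IsEquivariantBasic.ι_pullM {Y : h} {V : VF EP P} {W : VF EM M} {X : h}
    (hV : FP.Represents V (aP X)) (hW : F.Represents W (aM X)) (p : P) :
    ι (V.vec p) (Ψ Y p) = pullM EP B.proj (fun m ↦ ι (W.vec m) (descend B (Ψ Y) m)) p := by
  rw [← pullM_descend (hΨ.descending Y) p]
  refine (ι_pull _ _ _).trans ?_
  refine congrArg _ ?_
  have h1 := hΨ.ι_descend hB Y (hE.proj X V W hV hW p)
  rw [map_sub, LinearMap.sub_apply, sub_eq_zero] at h1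
  exact h1

include hB hE in
theorem IsEquivariantBasic.lieM_pullM {Y : h} {V : VF EP P} {W : VF EM M} {X : h}
    (hV : FP.Represents V (aP X)) (hW : F.Represents W (aM X)) (p : P) :
    lieM V (Ψ Y) p = pullM EP B.proj (lieM W (descend B (Ψ Y))) p := by
  have hs := smoothAt_descend (hΨ.descending Y) (hΨ.smoothAt Y)
  have h1 : (fun p ↦ ι (V.vec p) (Ψ Y p)) =
      pullM EP B.proj (fun m ↦ ι (W.vec m) (descend B (Ψ Y) m)) :=
    funext (hΨ.ι_pullM hB hE hV hW)
  rw [lieM, h1, gd_pullM ((hs _).ι W) B.smooth_proj.contMDiffAt]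
  have h2 : ι (V.vec p) (gd (Ψ Y) p) =
      pullM EP B.proj (fun m ↦ ι (W.vec m) (gd (descend B (Ψ Y)) m)) p := by
    rw [← pullM_gd_descend (hΨ.descending Y) (hΨ.smoothAt Y)]
    refine (ι_pull _ _ _).trans (congrArg _ ?_)
    have h3 := hΨ.ι_gd_descend hB Y (hE.proj X V W hV hW p)
    rw [map_sub, LinearMap.sub_apply, sub_eq_zero] at h3
    exact h3
  rw [h2]
  exact (map_add (pull (tmap EP EM B.proj p : EP →ₗ[ℝ] EM)) _ _).symm

include hB hE in
theorem IsEquivariantBasic.mem_equivForms :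
    (fun Y ↦ unmix (descend B (Ψ Y)) : Family EM M h) ∈ EquivForms F aM := by
  refine ⟨isSmoothFamily_of_smoothIn fun q m ↦ smoothIn_descend (fun q ↦ hΨ.descending _)
    (hΨ.smooth q) m, fun Y Z hZ ↦ ⟨?_, ?_⟩, fun X Y W hW k m v ↦ ?_⟩
  · funext k m
    ext v
    exact DFunLike.congr_fun (congrFun (hΨ.ι_descend hB Y (hZ m)) k) v
  · funext k m
    have h1 : mixG (unmix (descend B (Ψ Y))).d m = gd (descend B (Ψ Y)) m :=
      (congrFun (gd_mixG _) m).symm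
    have h2 : mixG ((unmix (descend B (Ψ Y))).d.contract Z) m = 0 := by
      rw [mixG_contract, h1]
      exact hΨ.ι_gd_descend hB Y (hZ m)
    ext v
    exact DFunLike.congr_fun (congrFun h2 k) v
  · rw [lieM_mixG, mixG_unmix]
    obtain ⟨p, rfl⟩ := B.proj_surjective m
    obtain ⟨T, hT⟩ := B.exists_localTriv (B.proj p)
    -- Invariance on `P` is used at the single point `σ(m)` and pulled back to `M` by the section.
    have h1 := (hΨ.invariant X Y _ (FP.rep_spec _) (T.σ (B.proj p))).pull
      (tmap EM EP T.σ (B.proj p) : EM →ₗ[ℝ] EP) k v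
    have h2 : pull (tmap EM EP T.σ (B.proj p) : EM →ₗ[ℝ] EP)
        (lieM (FP.rep (aP X)) (Ψ Y) (T.σ (B.proj p))) = lieM W (descend B (Ψ Y)) (B.proj p) := by
      rw [hΨ.lieM_pullM hB hE (FP.rep_spec _) hW, pullM, pull_pull, T.proj_σ _ hT]
      have h3 : (tmap EP EM B.proj (T.σ (B.proj p)) : EP →ₗ[ℝ] EM) ∘ₗ
          (tmap EM EP T.σ (B.proj p) : EM →ₗ[ℝ] EP) = LinearMap.id :=
        LinearMap.ext fun u ↦ LocalTriv.tmap_proj_σ hT u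
      rw [h3, pull_id]
    rw [h2] at h1
    refine (h1.deriv.symm.trans ?_)
    congr 1
    funext s
    have h4 := descend_eq (hΨ.descending (Y + s • ⁅X, Y⁆)) T hT
    exact (DFunLike.congr_fun (congrFun h4 k) v).symm

-- By injectivity of the pullback, `d_h` may be computed on `P`, with the representative of `Y_P` in
-- place of that of `Y_M`.
include hB hE in
theorem IsEquivariantBasic.equivD_descend {Ψ' : h → P → GForm EP ℂ}
    (h' : ∀ Y p, gd (Ψ Y) p - ι ((FP.rep (aP Y)).vec p) (Ψ Y p) = Ψ' Y p)
    (hd : ∀ Y, IsDescending B (Ψ' Y)) :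
    equivD F aM ⟨_, hΨ.mem_equivForms hB hE⟩ = fun Y ↦ unmix (descend B (Ψ' Y)) := by
  funext Y
  have h1 : (unmix (descend B (Ψ Y))).d - (unmix (descend B (Ψ Y))).contract (F.rep (aM Y)) =
      unmix (descend B (Ψ' Y)) := by
    funext k m
    obtain ⟨p, rfl⟩ := B.proj_surjective m
    have h2 : descend B (Ψ' Y) (B.proj p) = gd (descend B (Ψ Y)) (B.proj p) -
        ι ((F.rep (aM Y)).vec (B.proj p)) (descend B (Ψ Y) (B.proj p)) := by
      refine descend_unique (hd Y) ?_
      rw [← h', map_sub, ← pullM_gd_descend (hΨ.descending Y) (hΨ.smoothAt Y),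
        hΨ.ι_pullM hB hE (FP.rep_spec _) (F.rep_spec _)]
      rfl
    have h3 : mixG (unmix (descend B (Ψ Y))).d (B.proj p) = gd (descend B (Ψ Y)) (B.proj p) :=
      (congrFun (gd_mixG _) _).symm
    rw [← h3] at h2
    ext v
    exact (DFunLike.congr_fun (congrFun h2 k) v).symm
  exact h1

end Descent

end BasicChern
end

noncomputable section
namespace BasicChern

/-! ### Integrals of families of forms -/

theorem clm_fderiv_integral {Q W W' : Type*} [NormedAddCommGroup Q] [NormedSpace ℝ Q]
    [FiniteDimensional ℝ Q] [NormedAddCommGroup W] [NormedSpace ℝ W] [CompleteSpace W]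
    [NormedAddCommGroup W'] [NormedSpace ℝ W'] [CompleteSpace W'] {f : ℝ × Q → W} {U : Set Q}
    (hU : IsOpen U) (hf : ContDiffOn ℝ ∞ f (Set.univ ×ˢ U)) {q : Q} (hq : q ∈ U)
    (L : (Q →L[ℝ] W) →L[ℝ] W') :
    L (fderiv ℝ (fun q ↦ ∫ t in (0 : ℝ)..1, f (t, q)) q) =
      ∫ t in (0 : ℝ)..1, L ((fderiv ℝ f (t, q)).comp (ContinuousLinearMap.inr ℝ ℝ Q)) := by
  have hF' : ContinuousOn (fun z ↦ (fderiv ℝ f z).comp (ContinuousLinearMap.inr ℝ ℝ Q))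
      (Set.univ ×ˢ U) :=
    ((contDiffOn_infty_iff_fderiv_of_isOpen (isOpen_univ.prod hU)).1 hf).2.continuousOn.clm_comp
      continuousOn_const
  rw [(hasFDerivAt_integral_of_contDiffOn hU hf hq).fderiv]
  exact (L.intervalIntegral_comp_comm ((continuous_slice hU hF' hq).intervalIntegrable _ _)).symm

namespace GForm

section Integral

variable {T T' R : Type*} [NormedAddCommGroup T] [NormedSpace ℝ T] [FiniteDimensional ℝ T]
  [NormedAddCommGroup T'] [NormedSpace ℝ T'] [FiniteDimensional ℝ T']
  [NormedRing R] [NormedAlgebra ℝ R] [FiniteDimensional ℝ R]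

/-- Continuity of a curve of forms. -/
def GCont (A : ℝ → GForm T R) : Prop := ∀ k v, Continuous fun t ↦ A t k v

/-- The integral from `0` to `1` of a curve of forms. -/
def gint (A : ℝ → GForm T R) : GForm T R := fun k ↦
  (∫ t in (0 : ℝ)..1, toCont (A t k)).toAlternatingMap

theorem GCont.toCont {A : ℝ → GForm T R} (hA : GCont A) (k : ℕ) :
    Continuous fun t ↦ toCont (A t k) := by
  obtain ⟨L, hL⟩ := exists_basisValues_leftInverse (T := T) (W := R) k
  have : (fun t ↦ BasicChern.toCont (A t k)) =
      L ∘ fun t ↦ basisValues T R k (BasicChern.toCont (A t k)) := funext fun q ↦ (hL _).symm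
  rw [this]
  exact L.continuous.comp (continuous_pi fun I ↦ hA k _)

theorem gint_apply {A : ℝ → GForm T R} (hA : GCont A) (k : ℕ) (v : Fin k → T) :
    gint A k v = ∫ t in (0 : ℝ)..1, A t k v := by
  haveI : CompleteSpace R := FiniteDimensional.complete ℝ R
  have h := (ContinuousAlternatingMap.apply ℝ T R v).intervalIntegral_comp_comm
    ((hA.toCont k).intervalIntegrable (μ := MeasureTheory.volume) 0 1)
  exact h.symm

omit [FiniteDimensional ℝ T] [FiniteDimensional ℝ T'] [FiniteDimensional ℝ R] in
theorem GCont.pull {A : ℝ → GForm T R} (hA : GCont A) (f : T' →ₗ[ℝ] T) :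
    GCont (fun t ↦ GForm.pull f (A t)) := fun k _ ↦ hA k _

omit [FiniteDimensional ℝ T] [FiniteDimensional ℝ R] in
theorem GCont.ι {A : ℝ → GForm T R} (hA : GCont A) (x : T) :
    GCont (fun t ↦ GForm.ι x (A t)) := fun k _ ↦ hA (k + 1) _

omit [FiniteDimensional ℝ T] [FiniteDimensional ℝ R] in
theorem GCont.add {A B : ℝ → GForm T R} (hA : GCont A) (hB : GCont B) :
    GCont (fun t ↦ A t + B t) := fun k v ↦ (hA k v).add (hB k v)

omit [FiniteDimensional ℝ T] [FiniteDimensional ℝ R] in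
theorem GCont.sub {A B : ℝ → GForm T R} (hA : GCont A) (hB : GCont B) :
    GCont (fun t ↦ A t - B t) := fun k v ↦ (hA k v).sub (hB k v)

theorem gint_pull {A : ℝ → GForm T R} (hA : GCont A) (f : T' →ₗ[ℝ] T) :
    gint (fun t ↦ pull f (A t)) = pull f (gint A) := by
  ext k v
  rw [gint_apply (hA.pull f), pull_apply, gint_apply hA]
  rfl

theorem gint_ι {A : ℝ → GForm T R} (hA : GCont A) (x : T) :
    gint (fun t ↦ ι x (A t)) = ι x (gint A) := by
  ext k v
  rw [gint_apply (hA.ι x), ι_apply_apply, gint_apply hA]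
  rfl

theorem gint_add {A B : ℝ → GForm T R} (hA : GCont A) (hB : GCont B) :
    gint (fun t ↦ A t + B t) = gint A + gint B := by
  ext k v
  rw [gint_apply (hA.add hB)]
  refine Eq.trans (intervalIntegral.integral_add ((hA k v).intervalIntegrable 0 1)
    ((hB k v).intervalIntegrable 0 1)) ?_
  exact (congrArg₂ (· + ·) (gint_apply hA k v) (gint_apply hB k v)).symm

theorem gint_sub {A B : ℝ → GForm T R} (hA : GCont A) (hB : GCont B) :
    gint (fun t ↦ A t - B t) = gint A - gint B := by
  ext k v
  rw [gint_apply (hA.sub hB)]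
  refine Eq.trans (intervalIntegral.integral_sub ((hA k v).intervalIntegrable 0 1)
    ((hB k v).intervalIntegrable 0 1)) ?_
  exact (congrArg₂ (· - ·) (gint_apply hA k v) (gint_apply hB k v)).symm

omit [FiniteDimensional ℝ R] in
theorem gint_zero : gint (fun _ ↦ (0 : GForm T R)) = 0 := by
  funext k
  have h : toCont ((0 : GForm T R) k) = 0 := rfl
  rw [gint, h, intervalIntegral.integral_zero]
  rfl

/-- The fundamental theorem of calculus. -/
theorem gint_deriv {A A' : ℝ → GForm T R} (h : ∀ t, HasGDeriv A (A' t) t) (hA' : GCont A') :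
    gint A' = A 1 - A 0 := by
  haveI : CompleteSpace R := FiniteDimensional.complete ℝ R
  ext k v
  rw [gint_apply hA']
  exact intervalIntegral.integral_eq_sub_of_hasDerivAt (fun t _ ↦ h t k v)
    ((hA' k v).intervalIntegrable 0 1)

variable {Q : Type*} [NormedAddCommGroup Q] [NormedSpace ℝ Q]

section Smooth

variable {A : ℝ → Q → GForm T R} {U : Set Q} (hU : IsOpen U)
  (hA : ∀ t, ∀ q ∈ U, GSmoothAt (fun z : ℝ × Q ↦ A z.1 z.2) (t, q))

include hA

omit [FiniteDimensional ℝ T] [FiniteDimensional ℝ R] in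
theorem gCont_of_gSmoothAt {q : Q} (hq : q ∈ U) : GCont (fun t ↦ A t q) := fun k v ↦
  continuous_iff_continuousAt.2 fun t ↦ ((hA t q hq k v).comp t
    (f := fun t : ℝ ↦ (t, q)) (by fun_prop)).continuousAt

theorem contDiffOn_toCont (k : ℕ) :
    ContDiffOn ℝ ∞ (fun z : ℝ × Q ↦ toCont (A z.1 z.2 k)) (Set.univ ×ˢ U) := fun z hz ↦
  ((hA z.1 z.2 hz.2).contDiffAt k).contDiffWithinAt

include hU

theorem gSmoothAt_gint [FiniteDimensional ℝ Q] {q : Q} (hq : q ∈ U) :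
    GSmoothAt (fun q ↦ gint fun t ↦ A t q) q := by
  haveI : CompleteSpace R := FiniteDimensional.complete ℝ R
  intro k v
  have h1 := (contDiffOn_integral hU (contDiffOn_toCont hA k)).contDiffAt (hU.mem_nhds hq)
  exact (ContinuousAlternatingMap.apply ℝ T R v).contDiff.contDiffAt.comp q h1

end Smooth

/-- The exterior derivative at a point is a continuous linear function of the derivative, hence
commutes with the integral. Continuity of the integrand is recorded along with the formula because
further linear operations under the integral require it. -/
theorem dG_gint_aux {A : ℝ → T → GForm T R} {U : Set T} (hU : IsOpen U)
    (hA : ∀ t, ∀ q ∈ U, GSmoothAt (fun z : ℝ × T ↦ A z.1 z.2) (t, q)) {q : T} (hq : q ∈ U) :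
    GCont (fun t ↦ dG (A t) q) ∧ dG (fun q ↦ gint fun t ↦ A t q) q = gint fun t ↦ dG (A t) q := by
  haveI : CompleteSpace R := FiniteDimensional.complete ℝ R
  have h1 : ∀ k t, extDeriv (fun y ↦ toCont (A t y k)) q =
      ContinuousAlternatingMap.alternatizeUncurryFinCLM ℝ T R
        ((fderiv ℝ (fun z : ℝ × T ↦ toCont (A z.1 z.2 k)) (t, q)).comp
          (ContinuousLinearMap.inr ℝ ℝ T)) := fun k t ↦ by
    have h2 : HasFDerivAt (fun x : T ↦ (t, x)) (ContinuousLinearMap.inr ℝ ℝ T) q :=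
      hasFDerivAt_prodMk_right t q
    have h3 := (((hA t q hq).contDiffAt k).differentiableAt (by simp)).hasFDerivAt.comp q h2
    exact congrArg (ContinuousAlternatingMap.alternatizeUncurryFinCLM ℝ T R) h3.fderiv
  have hc : ∀ k, Continuous fun t ↦ (fderiv ℝ (fun z : ℝ × T ↦ toCont (A z.1 z.2 k)) (t, q)).comp
      (ContinuousLinearMap.inr ℝ ℝ T) := fun k ↦ by
    have h4 := ((contDiffOn_infty_iff_fderiv_of_isOpen (isOpen_univ.prod hU)).1
      (contDiffOn_toCont hA k)).2.continuousOn.clm_comp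
        (continuousOn_const (c := ContinuousLinearMap.inr ℝ ℝ T))
    exact continuous_slice hU h4 hq
  have hc' : ∀ k, Continuous fun t ↦ extDeriv (fun y ↦ toCont (A t y k)) q := fun k ↦ by
    simp only [h1]
    exact (ContinuousLinearMap.continuous _).comp (hc k)
  refine ⟨fun k v ↦ ?_, funext fun k ↦ ?_⟩
  · cases k with
    | zero => exact continuous_const
    | succ k =>
      simp only [dG_succ_apply]
      exact (ContinuousAlternatingMap.apply ℝ T R v).continuous.comp (hc' k)
  · cases k with
    | zero =>
      have : (fun t ↦ toCont (dG (A t) q 0)) = fun _ ↦ 0 := rfl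
      rw [dG_zero_apply, gint, this, intervalIntegral.integral_zero]
      rfl
    | succ k =>
      rw [dG_succ_apply, gint]
      congr 1
      have h5 : (fun t ↦ toCont (dG (A t) q (k + 1))) =
          fun t ↦ extDeriv (fun y ↦ toCont (A t y k)) q := by
        funext t
        rw [dG_succ_apply]
        rfl
      rw [h5]
      simp only [h1]
      exact clm_fderiv_integral hU (contDiffOn_toCont hA k) hq
        (ContinuousAlternatingMap.alternatizeUncurryFinCLM ℝ T R)

end Integral

end GForm

/-! ### Integrals of families of forms on a manifold -/

section ManifoldIntegral

open GForm

variable {E : Type*} [NormedAddCommGroup E] [NormedSpace ℝ E] [FiniteDimensional ℝ E]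
  {M : Type*} [TopologicalSpace M] [ChartedSpace E M] [IsManifold 𝓘(ℝ, E) ∞ M]
  {R : Type*} [NormedRing R] [NormedAlgebra ℝ R] [FiniteDimensional ℝ R]
  {Q : Type*} [NormedAddCommGroup Q] [NormedSpace ℝ Q]

theorem SmoothIn.ι {A : Q → M → GForm E R} {q : Q} {x : M} (V : VF E M) (hA : SmoothIn A q x) :
    SmoothIn (fun q x ↦ GForm.ι (V.vec x) (A q x)) q x := by
  have hV : ContDiffAt ℝ ∞ (fun z : Q × E ↦ chartVF x V.vec z.2) (q, extChartAt 𝓘(ℝ, E) x x) :=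
    (contDiffAt_chartVF (V := V.vec) (V.contMDiff x)).comp (q, extChartAt 𝓘(ℝ, E) x x)
      contDiffAt_snd
  refine (GSmoothAt.ι hA hV).congr ?_
  have h2 := (continuous_snd (X := Q)).tendsto (q, extChartAt 𝓘(ℝ, E) x x)
  filter_upwards [h2.eventually ((isOpen_extChartAt_target x).mem_nhds
    (mem_extChartAt_target (I := 𝓘(ℝ, E)) x))] with z hz
  exact chartRep_ι _ _ hz

theorem SmoothIn.gSmoothAt {A : Q → M → GForm E R} {q : Q} {x : M} (hA : SmoothIn A q x) :
    GSmoothAt (fun q ↦ A q x) q := by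
  have h1 : GSmoothAt (fun q ↦ chartRep x (A q) (extChartAt 𝓘(ℝ, E) x x)) q :=
    GSmoothAt.comp (f := fun q : Q ↦ (q, extChartAt 𝓘(ℝ, E) x x)) hA (by fun_prop)
  have h2 : GSmoothAt (fun q ↦ pull (tmap E E (extChartAt 𝓘(ℝ, E) x) x : E →ₗ[ℝ] E)
      (chartRep x (A q) (extChartAt 𝓘(ℝ, E) x x))) q := fun k v ↦ h1 k _
  refine h2.congr (Filter.Eventually.of_forall fun q ↦ ?_)
  exact (pull_chart_chartRep (mem_extChartAt_source (I := 𝓘(ℝ, E)) x) (A q)).symm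

theorem SmoothIn.gCont {A : ℝ → M → GForm E R} {x : M} (hA : ∀ t, SmoothIn A t x) :
    GCont (fun t ↦ A t x) := fun k v ↦
  continuous_iff_continuousAt.2 fun t ↦ ((hA t).gSmoothAt k v).continuousAt

theorem smoothIn_gint [FiniteDimensional ℝ Q] {A : ℝ → Q → M → GForm E R}
    (hA : ∀ t q x, SmoothIn (fun z : ℝ × Q ↦ A z.1 z.2) (t, q) x) (q : Q) (x : M) :
    SmoothIn (fun q x ↦ gint fun t ↦ A t q x) q x := by
  have hU : IsOpen ((Set.univ : Set Q) ×ˢ (extChartAt 𝓘(ℝ, E) x).target) :=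
    isOpen_univ.prod (isOpen_extChartAt_target x)
  have h1 := gSmoothAt_gint (A := fun t (z : Q × E) ↦ chartRep x (A t z.1) z.2) hU
    (fun t z hz ↦ by
      have hs := (extChartAt 𝓘(ℝ, E) x).map_target hz.2
      have h2 := (hA t z.1 _).chart hs
      rw [(extChartAt 𝓘(ℝ, E) x).right_inv hz.2] at h2
      have h3 : ContDiffAt ℝ ∞ (fun w : ℝ × Q × E ↦ ((w.1, w.2.1), w.2.2)) (t, z) := by fun_prop
      exact GSmoothAt.comp (f := fun w : ℝ × Q × E ↦ ((w.1, w.2.1), w.2.2)) h2 h3)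
    (q := (q, extChartAt 𝓘(ℝ, E) x x)) ⟨trivial, mem_extChartAt_target x⟩
  refine h1.congr (Filter.Eventually.of_forall fun z ↦ ?_)
  refine (gint_pull ?_ _).symm
  refine SmoothIn.gCont (A := fun t ↦ A t z.1) fun t ↦ ?_
  exact SmoothIn.comp (f := fun t : ℝ ↦ (t, z.1)) (hA t z.1 _) (by fun_prop)

theorem gd_gint {A : ℝ → M → GForm E R} (hA : ∀ t x, SmoothIn A t x) (x : M) :
    gd (fun x ↦ gint fun t ↦ A t x) x = gint fun t ↦ gd (A t) x := by
  have h1 : chartRep x (fun x ↦ gint fun t ↦ A t x) = fun y ↦ gint fun t ↦ chartRep x (A t) y :=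
    funext fun y ↦ (gint_pull (SmoothIn.gCont fun t ↦ hA t _) _).symm
  have h2 := dG_gint_aux (A := fun t y ↦ chartRep x (A t) y)
    (isOpen_extChartAt_target (I := 𝓘(ℝ, E)) x) (fun t y hy ↦ by
      have hs := (extChartAt 𝓘(ℝ, E) x).map_target hy
      have h2 := (hA t _).chart hs
      rwa [(extChartAt 𝓘(ℝ, E) x).right_inv hy] at h2) (mem_extChartAt_target x)
  rw [gd, h1, h2.2]
  exact (gint_pull h2.1 _).symm

theorem gCont_gd {A : ℝ → M → GForm E R} (hA : ∀ t x, SmoothIn A t x) (x : M) :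
    GCont fun t ↦ gd (A t) x := by
  have h2 := dG_gint_aux (A := fun t y ↦ chartRep x (A t) y)
    (isOpen_extChartAt_target (I := 𝓘(ℝ, E)) x) (fun t y hy ↦ by
      have hs := (extChartAt 𝓘(ℝ, E) x).map_target hy
      have h2 := (hA t _).chart hs
      rwa [(extChartAt 𝓘(ℝ, E) x).right_inv hy] at h2) (mem_extChartAt_target x)
  exact h2.1.pull _

theorem lieM_gint {A : ℝ → M → GForm E R} (hA : ∀ t x, SmoothIn A t x) (V : VF E M) (x : M) :
    lieM V (fun x ↦ gint fun t ↦ A t x) x = gint fun t ↦ lieM V (A t) x := by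
  have h1 : (fun x ↦ ι (V.vec x) (gint fun t ↦ A t x)) =
      fun x ↦ gint fun t ↦ ι (V.vec x) (A t x) :=
    funext fun x ↦ (gint_ι (SmoothIn.gCont fun t ↦ hA t x) _).symm
  have h2 : ∀ t x, SmoothIn (fun t x ↦ ι (V.vec x) (A t x)) t x := fun t x ↦ (hA t x).ι V
  rw [lieM, h1, gd_gint h2, gd_gint hA, ← gint_ι (gCont_gd hA x),
    ← gint_add (gCont_gd h2 x) ((gCont_gd hA x).ι _)]
  rfl

end ManifoldIntegral

end BasicChern
end

noncomputable section
namespace BasicChern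

namespace GForm

variable {T R : Type*} [NormedAddCommGroup T] [NormedSpace ℝ T] [FiniteDimensional ℝ T]
  [NormedRing R] [NormedAlgebra ℝ R] [FiniteDimensional ℝ R]

/-- Differentiation under the integral sign. -/
theorem hasGDeriv_gint {A : ℝ → ℝ → GForm T R} {A' : ℝ → GForm T R} {s : ℝ}
    (hA : ∀ t s, GSmoothAt (fun z : ℝ × ℝ ↦ A z.1 z.2) (t, s))
    (h : ∀ t, HasGDeriv (A t) (A' t) s) :
    HasGDeriv (fun s ↦ gint fun t ↦ A t s) (gint A') s := by
  haveI : CompleteSpace R := FiniteDimensional.complete ℝ R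
  have hf : ∀ k v, ContDiffOn ℝ ∞ (fun z : ℝ × ℝ ↦ A z.1 z.2 k v) (Set.univ ×ˢ Set.univ) :=
    fun k v z _ ↦ (hA z.1 z.2 k v).contDiffWithinAt
  have hO : IsOpen ((Set.univ : Set ℝ) ×ˢ (Set.univ : Set ℝ)) := isOpen_univ.prod isOpen_univ
  have hd : ∀ k v t, fderiv ℝ (fun z : ℝ × ℝ ↦ A z.1 z.2 k v) (t, s) (0, 1) = A' t k v :=
    fun k v t ↦ by
      have h1 : HasFDerivAt (fun x : ℝ ↦ (t, x)) (ContinuousLinearMap.inr ℝ ℝ ℝ) s :=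
        hasFDerivAt_prodMk_right t s
      have h2 := (((hA t s k v).differentiableAt (by simp)).hasFDerivAt.comp s h1).hasDerivAt
      exact h2.unique (h t k v)
  have hc : GCont A' := fun k v ↦ by
    have h1 := ((contDiffOn_infty_iff_fderiv_of_isOpen hO).1 (hf k v)).2.continuousOn.clm_apply
      (continuousOn_const (c := ((0 : ℝ), (1 : ℝ))))
    have h2 := continuous_slice isOpen_univ h1 (Set.mem_univ s)
    simpa only [hd] using h2
  have hc' : ∀ s, GCont fun t ↦ A t s := fun s ↦
    gCont_of_gSmoothAt (U := Set.univ) (fun t q _ ↦ hA t q) (Set.mem_univ s)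
  intro k v
  have h3 := (hasFDerivAt_integral_of_contDiffOn isOpen_univ (hf k v)
    (Set.mem_univ s)).differentiableAt.hasFDerivAt.hasDerivAt
  rw [fderiv_integral_apply isOpen_univ (hf k v) (Set.mem_univ s)] at h3
  simp only [hd] at h3
  rw [gint_apply hc]
  simpa only [gint_apply (hc' _)] using h3

omit [FiniteDimensional ℝ T] [FiniteDimensional ℝ R] in
theorem hasGDeriv_affine (a b : GForm T R) (s : ℝ) : HasGDeriv (fun s : ℝ ↦ a + s • b) b s :=
  fun k v ↦ by
    have h := ((hasDerivAt_id s).smul_const (b k v)).const_add (a k v)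
    rw [one_smul] at h
    exact h

end GForm

/-! ### The transgression form -/

section Transgression

open GForm

variable {EM : Type*} [NormedAddCommGroup EM] [NormedSpace ℝ EM] [FiniteDimensional ℝ EM]
  {M : Type*} [TopologicalSpace M] [ChartedSpace EM M] [IsManifold 𝓘(ℝ, EM) ∞ M]
  {EP : Type*} [NormedAddCommGroup EP] [NormedSpace ℝ EP] [FiniteDimensional ℝ EP]
  {P : Type*} [TopologicalSpace P] [ChartedSpace EP P] [IsManifold 𝓘(ℝ, EP) ∞ P]
  {EG : Type*} [NormedAddCommGroup EG] [NormedSpace ℝ EG]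
  {G : Type*} [TopologicalSpace G] [ChartedSpace EG G] [Group G]
  {R : Type*} [NormedRing R] [NormedAlgebra ℝ R] [FiniteDimensional ℝ R]
  {B : PrincipalBundle EM M EP P EG G} {ρ : G →* R}
  {FP : Foliation EP P} {h : Type*} [LieRing h] [LieAlgebra ℝ h] [FiniteDimensional ℝ h]
  {aP : h →ₗ⁅ℝ⁆ FP.BasicField}

/-- The segment between two forms. -/
def segment (a a' : P → GForm EP R) (t : ℝ) (p : P) : GForm EP R := a p + t • (a' p - a p)

omit [FiniteDimensional ℝ EP] [IsManifold 𝓘(ℝ, EP) ∞ P] [FiniteDimensional ℝ R] in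
theorem segment_zero (a a' : P → GForm EP R) : segment a a' 0 = a :=
  funext fun p ↦ by rw [segment, zero_smul, add_zero]

omit [FiniteDimensional ℝ EP] [IsManifold 𝓘(ℝ, EP) ∞ P] [FiniteDimensional ℝ R] in
theorem segment_one (a a' : P → GForm EP R) : segment a a' 1 = a' :=
  funext fun p ↦ by rw [segment, one_smul, add_sub_cancel]

variable {a a' : P → GForm EP R}

namespace IsBasicGauge

omit [FiniteDimensional ℝ h] in
theorem moment_sum (ha : IsBasicGauge B ρ aP a) {I : Type*} (s : Finset I) (c : I → ℝ) (Y : I → h)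
    (p : P) : moment aP a (∑ i ∈ s, c i • Y i) p = ∑ i ∈ s, c i • moment aP a (Y i) p := by
  have h0 : moment aP a 0 p = 0 := by
    have h1 := ha.moment_add_smul 0 0 1 p
    rw [one_smul, one_smul, add_zero] at h1
    exact left_eq_add.1 h1
  classical
  induction s using Finset.induction_on with
  | empty => rw [Finset.sum_empty, Finset.sum_empty, h0]
  | insert i s hi ih =>
    rw [Finset.sum_insert hi, Finset.sum_insert hi, add_comm, ha.moment_add_smul, ih, add_comm]

variable (ha : IsBasicGauge B ρ aP a) (ha' : IsBasicGauge B ρ aP a')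

include ha ha'

omit [FiniteDimensional ℝ h] in
theorem isBasicGauge_segment (t : ℝ) : IsBasicGauge B ρ aP (segment a a' t) := ha.add_smul ha' t

omit [FiniteDimensional ℝ h] in
theorem gd_segment (t : ℝ) (p : P) :
    gd (segment a a' t) p = gd a p + t • gd (fun p ↦ a' p - a p) p :=
  (gd_add (ha.smooth p) (((ha'.smooth p).sub (ha.smooth p)).smul t)).trans
    (congrArg _ (gd_smul t ((ha'.smooth p).sub (ha.smooth p))))

/-- The curvature of the segment is polynomial in its parameter. The choice `FP.rep` is not linear
in `Y`, but the moment is: in a basis of `h` it is a sum of coordinates times contractions with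
fixed fields, which is jointly smooth. -/
theorem smoothIn_eqCurv_segment (t : ℝ) (q : Fin (Module.finrank ℝ h) → ℝ) (p : P) :
    SmoothIn (fun z : ℝ × (Fin (Module.finrank ℝ h) → ℝ) ↦
      eqCurv aP (segment a a' z.1) ((Module.finBasis ℝ h).equivFun.symm z.2)) (t, q) p := by
  have hη : ∀ p, SmoothAt (fun p ↦ a' p - a p) p := fun p ↦ (ha'.smooth p).sub (ha.smooth p)
  have hs : SmoothIn (fun z : ℝ × (Fin (Module.finrank ℝ h) → ℝ) ↦ segment a a' z.1) (t, q) p :=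
    ((ha.smooth p).smoothIn _).add (((hη p).smoothIn _).smul contDiffAt_fst)
  have hd : SmoothIn (fun z : ℝ × (Fin (Module.finrank ℝ h) → ℝ) ↦ gd (segment a a' z.1)) (t, q) p := by
    have h1 : SmoothIn (fun (z : ℝ × (Fin (Module.finrank ℝ h) → ℝ)) p ↦ gd a p + z.1 • gd (fun p ↦ a' p - a p) p) (t, q) p :=
      ((SmoothAt.gd (Filter.Eventually.of_forall ha.smooth)).smoothIn _).add
        (((SmoothAt.gd (Filter.Eventually.of_forall hη)).smoothIn _).smul contDiffAt_fst)
    exact h1.congr Filter.univ_mem fun z p _ ↦ ha.gd_segment ha' z.1 p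
  have hm : SmoothIn (fun (z : ℝ × (Fin (Module.finrank ℝ h) → ℝ)) p ↦ ∑ i, z.2 i •
      GForm.ι ((FP.rep (aP (Module.finBasis ℝ h i))).vec p) (segment a a' z.1 p)) (t, q) p :=
    SmoothIn.sum fun i _ ↦ (hs.ι _).smul (by fun_prop)
  refine ((hd.add (hs.mul hs)).sub hm).congr Filter.univ_mem fun z p _ ↦ ?_
  have hz := ha.isBasicGauge_segment ha' z.1
  rw [eqCurv, curv, Module.Basis.equivFun_symm_apply, hz.moment_sum]
  refine congrArg _ ?_
  simp only [hz.ι_rep (FP.rep_spec _), ← GForm.const_smul]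
  exact map_sum (AddMonoidHom.mk' (const EP) const_add) _ _

omit ha' in
theorem smoothIn_eqCurv (q : Fin (Module.finrank ℝ h) → ℝ) (p : P) :
    SmoothIn (fun q ↦ eqCurv aP a ((Module.finBasis ℝ h).equivFun.symm q)) q p := by
  have h1 := SmoothIn.comp (f := fun q : Fin (Module.finrank ℝ h) → ℝ ↦ ((0 : ℝ), q))
    (ha.smoothIn_eqCurv_segment ha 0 q p) (by fun_prop)
  simpa only [segment_zero] using h1

omit ha' in
/-- The forms `t(γ exp(-α))` for the equivariant curvature `α`. -/
theorem isEquivariantBasic_trc [LieGroup 𝓘(ℝ, EG) ∞ G] (hρ : ContMDiff 𝓘(ℝ, EG) 𝓘(ℝ, R) ∞ ρ)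
    {F : Foliation EM M} {aM : h →ₗ⁅ℝ⁆ F.BasicField} (hE : IsEquivariantBundle B F FP aM aP)
    {t : R →ₗ[ℝ] ℂ} (ht : ∀ x y, t (x * y) = t (y * x)) {γ : P → GForm EP R}
    (hγ : ∀ p, SmoothAt γ p) (hγT : IsTensorial B ρ γ)
    (hγh : ∀ p, ∀ z ∈ FP.dist p, ι (show EP from z) (γ p) = 0)
    (hγi : ∀ (Y : h) (V : VF EP P), FP.Represents V (aP Y) → ∀ p, lieM V γ p = 0) :
    IsEquivariantBasic B aP (fun Y p ↦ trc t (γ p * expNeg (eqCurv aP a Y p))) where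
  smooth q p := (((hγ p).smoothIn _).mul (ha.smoothIn_eqCurv q p).expNeg).trc
  descending Y := hγT.isDescending_trc (ha.tensorial_eqCurv hρ hE Y) ht
  horizontal Y p z hz := by
    rw [← trc_ι, ι_mul, hγh p z hz, ι_expNeg_eq_zero (ha.ε_eqCurv Y p) (ha.ι_eqCurv Y p hz),
      zero_mul, mul_zero, add_zero, map_zero]
  invariant X Y V hV p := by
    have hs : GSmoothAt (fun s : ℝ ↦ expNeg (eqCurv aP a Y p + s • lieM V (eqCurv aP a Y) p)) 0 :=
      GSmoothAt.expNeg fun k v ↦ by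
        change ContDiffAt ℝ ∞ (fun s : ℝ ↦ eqCurv aP a Y p k v +
          s • lieM V (eqCurv aP a Y) p k v) 0
        fun_prop
    have hD := hs.hasGDeriv_line 1
    simp only [zero_add, smul_eq_mul, mul_one] at hD
    have h1 := lieM_expNeg (ha.smoothAt_eqCurv Y p) V hD
    have h2 : lieM V (fun p ↦ trc t (γ p * expNeg (eqCurv aP a Y p))) p =
        trc t (γ p * lieM V (fun p ↦ expNeg (eqCurv aP a Y p)) p) := by
      rw [lieM_trc t ((hγ p).mul (ha.smoothAt_eqCurv Y p).expNeg) V,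
        lieM_mul V (hγ p) (ha.smoothAt_eqCurv Y p).expNeg, hγi X V hV, zero_mul, zero_add]
    rw [h2, h1]
    have h3 : HasGDeriv (fun _ : ℝ ↦ γ p) 0 0 := fun k v ↦ hasDerivAt_const _ _
    have h4 := (h3.mul hD).trc (t := t)
    rw [zero_mul, zero_add] at h4
    -- The Lie derivative of `α(Y)` is `-a([X, Y]_P)`, so the line from `α(Y)` in this direction is
    -- the curve `s ↦ α(Y + s[X, Y])`. The derivative of the exponential along it is precisely what
    -- invariance demands.
    have h5 : ∀ s : ℝ, eqCurv aP a Y p + s • lieM V (eqCurv aP a Y) p =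
        eqCurv aP a (Y + s • ⁅X, Y⁆) p := fun s ↦ by
      rw [ha.lieM_eqCurv hV, ha.eqCurv_add_smul, smul_neg, sub_eq_add_neg]
    simpa only [h5] using h4

end IsBasicGauge

variable {Ψ : ℝ → h → P → GForm EP ℂ}

/-- Descent and horizontality are linear and pass under the integral; so do the Lie derivative and,
by differentiation under the integral, the derivative in `Y`. -/
theorem IsEquivariantBasic.gint [LieGroup 𝓘(ℝ, EG) ∞ G]
    (hs : ∀ t q p, SmoothIn (fun z : ℝ × (Fin (Module.finrank ℝ h) → ℝ) ↦
      Ψ z.1 ((Module.finBasis ℝ h).equivFun.symm z.2)) (t, q) p)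
    (hΨ : ∀ t, IsEquivariantBasic B aP (Ψ t)) :
    IsEquivariantBasic B aP (fun Y p ↦ GForm.gint fun t ↦ Ψ t Y p) := by
  have hs' : ∀ Y t p, SmoothIn (fun t ↦ Ψ t Y) t p := fun Y t p ↦ by
    have h1 := SmoothIn.comp (f := fun t : ℝ ↦ (t, (Module.finBasis ℝ h).equivFun Y))
      (hs t _ p) (by fun_prop)
    simpa only [LinearEquiv.symm_apply_apply] using h1
  have hc : ∀ Y p, GCont fun t ↦ Ψ t Y p := fun Y p ↦ SmoothIn.gCont fun t ↦ hs' Y t p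
  refine ⟨smoothIn_gint hs, fun Y T p hp ↦ ?_, fun Y p z hz ↦ ?_, fun X Y V hV p ↦ ?_⟩
  · refine Eq.trans ?_ (gint_pull (hc Y _) _)
    exact congrArg _ (funext fun t ↦ (hΨ t).descending Y T p hp)
  · rw [← gint_ι (hc Y p)]
    refine Eq.trans ?_ gint_zero
    exact congrArg _ (funext fun t ↦ (hΨ t).horizontal Y p z hz)
  · rw [lieM_gint (hs' Y)]
    refine hasGDeriv_gint (fun t s ↦ ?_) fun t ↦ (hΨ t).invariant X Y V hV p
    have h1 := SmoothIn.gSmoothAt (SmoothIn.comp (f := fun z : ℝ × ℝ ↦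
      (z.1, (Module.finBasis ℝ h).equivFun Y + z.2 • (Module.finBasis ℝ h).equivFun ⁅X, Y⁆))
      (q := (t, s)) (hs t _ p) (by fun_prop))
    simpa only [map_add, map_smul, LinearEquiv.symm_apply_apply] using h1

namespace IsBasicGauge

variable (ha : IsBasicGauge B ρ aP a) (ha' : IsBasicGauge B ρ aP a')

include ha

omit [FiniteDimensional ℝ h] in
-- The case `γ = 1` of `gd_trc_mul_expNeg`: the graded commutator of `a` with `1` vanishes, and
-- nothing is left.
theorem gd_sub_ι_trc {t : R →ₗ[ℝ] ℂ} (ht : ∀ x y, t (x * y) = t (y * x)) (Y : h) (p : P) :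
    gd (fun p ↦ trc t (expNeg (eqCurv aP a Y p))) p -
      ι ((FP.rep (aP Y)).vec p) (trc t (expNeg (eqCurv aP a Y p))) = 0 := by
  have hone : SmoothAt (fun _ : P ↦ (1 : GForm EP R)) p := by
    have := smoothAt_const (E := EP) (M := P) (r := fun _ ↦ (1 : R)) (x := p) contMDiffAt_const
    simpa only [const_one] using this
  have hgd : gd (fun _ : P ↦ (1 : GForm EP R)) p = 0 := by
    have := gd_const_const (E := EP) (1 : R) p
    simpa only [const_one] using this
  have h1 := gd_trc_mul_expNeg ht (ha.smoothAt_eqCurv Y p) hone (ha.ε_eqCurv Y p)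
    (ha.oneForm p).ε_eq _ (ha.gd_eqCurv (FP.rep_spec _) p)
  simp only [one_mul] at h1
  rw [h1, hgd, ι_one, ε_one, mul_one, one_mul, sub_self, sub_self, zero_add, zero_mul, map_zero]

include ha'

omit [FiniteDimensional ℝ h] in
theorem eqCurv_segment (s : ℝ) (Y : h) (p : P) : eqCurv aP (segment a a' s) Y p =
    gd a p + s • gd (fun p ↦ a' p - a p) p + segment a a' s p * segment a a' s p -
      (ι ((FP.rep (aP Y)).vec p) (a p) + s • ι ((FP.rep (aP Y)).vec p) (a' p - a p)) := by
  rw [eqCurv, curv, ha.gd_segment ha',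
    ← (ha.isBasicGauge_segment ha' s).ι_rep (FP.rep_spec _), segment, map_add, map_smul]

/-- The integrand of the transgression form. -/
def transgressionIntegrand (aP : h →ₗ⁅ℝ⁆ FP.BasicField) (t : R →ₗ[ℝ] ℂ) (a a' : P → GForm EP R)
    (s : ℝ) (Y : h) (p : P) : GForm EP ℂ :=
  trc t ((a' p - a p) * expNeg (eqCurv aP (segment a a' s) Y p))

theorem smoothIn_transgressionIntegrand (t : R →ₗ[ℝ] ℂ) (s : ℝ)
    (q : Fin (Module.finrank ℝ h) → ℝ) (p : P) :
    SmoothIn (fun z : ℝ × (Fin (Module.finrank ℝ h) → ℝ) ↦ transgressionIntegrand aP t a a' z.1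
      ((Module.finBasis ℝ h).equivFun.symm z.2)) (s, q) p :=
  ((((ha'.smooth p).sub (ha.smooth p)).smoothIn _).mul
    (ha.smoothIn_eqCurv_segment ha' s q p).expNeg).trc

theorem isEquivariantBasic_transgression [LieGroup 𝓘(ℝ, EG) ∞ G]
    (hρ : ContMDiff 𝓘(ℝ, EG) 𝓘(ℝ, R) ∞ ρ)
    {F : Foliation EM M} {aM : h →ₗ⁅ℝ⁆ F.BasicField} (hE : IsEquivariantBundle B F FP aM aP)
    {t : R →ₗ[ℝ] ℂ} (ht : ∀ x y, t (x * y) = t (y * x)) :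
    IsEquivariantBasic B aP (fun Y p ↦ gint fun s ↦ transgressionIntegrand aP t a a' s Y p) := by
  refine IsEquivariantBasic.gint (ha.smoothIn_transgressionIntegrand ha' t) fun s ↦ ?_
  refine (ha.isBasicGauge_segment ha' s).isEquivariantBasic_trc hρ hE ht
    (fun p ↦ (ha'.smooth p).sub (ha.smooth p)) (ha.toIsGauge.tensorial_sub ha'.toIsGauge)
    (fun p z hz ↦ ?_) (fun Y V hV p ↦ ?_)
  · rw [map_sub, ha.horizontal p z hz, ha'.horizontal p z hz, sub_zero]
  · rw [lieM_sub V (ha'.smooth p) (ha.smooth p), ha.invariant Y V hV, ha'.invariant Y V hV,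
      sub_zero]

/-- The transgression formula. -/
theorem gd_sub_ι_transgression {t : R →ₗ[ℝ] ℂ} (ht : ∀ x y, t (x * y) = t (y * x)) (Y : h) (p : P) :
    gd (fun p ↦ gint fun s ↦ transgressionIntegrand aP t a a' s Y p) p -
      ι ((FP.rep (aP Y)).vec p) (gint fun s ↦ transgressionIntegrand aP t a a' s Y p) =
      trc t (expNeg (eqCurv aP a Y p)) - trc t (expNeg (eqCurv aP a' Y p)) := by
  have hs : ∀ s p, SmoothIn (fun s ↦ transgressionIntegrand aP t a a' s Y) s p := fun s p ↦ by
    have h1 := SmoothIn.comp (f := fun t : ℝ ↦ (t, (Module.finBasis ℝ h).equivFun Y))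
      (ha.smoothIn_transgressionIntegrand ha' t s _ p) (by fun_prop)
    simpa only [LinearEquiv.symm_apply_apply] using h1
  have hα : ∀ s p, SmoothIn (fun s ↦ eqCurv aP (segment a a' s) Y) s p := fun s p ↦ by
    have h1 := SmoothIn.comp (f := fun t : ℝ ↦ (t, (Module.finBasis ℝ h).equivFun Y))
      (ha.smoothIn_eqCurv_segment ha' s _ p) (by fun_prop)
    simpa only [LinearEquiv.symm_apply_apply] using h1
  have hc : GCont fun s ↦ transgressionIntegrand aP t a a' s Y p := SmoothIn.gCont fun s ↦ hs s p
  have hc' := gCont_gd hs p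
  rw [gd_gint hs, ← gint_ι hc, ← gint_sub hc' (hc.ι _)]
  have hη : SmoothAt (fun p ↦ a' p - a p) p := (ha'.smooth p).sub (ha.smooth p)
  -- The derivative of the curvature along the segment is `dη + ηa_s + a_sη - i(Y_P)η`. Both `a_s`
  -- and `η` are odd, so the graded commutator in `gd_trc_mul_expNeg` for `γ = η` is this
  -- anticommutator, and the integrand is an exact derivative in `s`.
  have key : ∀ s, HasGDeriv (fun s ↦ -trc t (expNeg (eqCurv aP (segment a a' s) Y p)))
      (gd (transgressionIntegrand aP t a a' s Y) p - ι ((FP.rep (aP Y)).vec p)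
        (transgressionIntegrand aP t a a' s Y p)) s := fun s ↦ by
    have hb := ha.isBasicGauge_segment ha' s
    have h1 := gd_trc_mul_expNeg ht (hb.smoothAt_eqCurv Y p) hη (hb.ε_eqCurv Y p)
      (hb.oneForm p).ε_eq _ (hb.gd_eqCurv (FP.rep_spec _) p)
    have hd1 := hasGDeriv_affine (gd a p) (gd (fun p ↦ a' p - a p) p) s
    have hd2 : HasGDeriv (fun s ↦ segment a a' s p) (a' p - a p) s :=
      hasGDeriv_affine (a p) (a' p - a p) s
    have hd3 := hasGDeriv_affine (ι ((FP.rep (aP Y)).vec p) (a p))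
      (ι ((FP.rep (aP Y)).vec p) (a' p - a p)) s
    have hd4 := hd2.mul hd2
    have hd : HasGDeriv (fun s ↦ eqCurv aP (segment a a' s) Y p)
        (gd (fun p ↦ a' p - a p) p + ((a' p - a p) * segment a a' s p +
          segment a a' s p * (a' p - a p)) - ι ((FP.rep (aP Y)).vec p) (a' p - a p)) s := by
      simp only [ha.eqCurv_segment ha']
      exact fun k v ↦ ((hd1 k v).add (hd4 k v)).sub (hd3 k v)
    have h2 := hasGDeriv_trc_expNeg ht hd (hα s p).gSmoothAt (hb.ε_eqCurv Y p)
    have h3 : gd (transgressionIntegrand aP t a a' s Y) p - ι ((FP.rep (aP Y)).vec p)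
        (transgressionIntegrand aP t a a' s Y p) = - -trc t ((gd (fun p ↦ a' p - a p) p +
          ((a' p - a p) * segment a a' s p + segment a a' s p * (a' p - a p)) -
          ι ((FP.rep (aP Y)).vec p) (a' p - a p)) * expNeg (eqCurv aP (segment a a' s) Y p)) := by
      rw [neg_neg]
      refine h1.trans ?_
      have h4 : ε (a' p - a p) = -(a' p - a p) := ((ha'.oneForm p).sub (ha.oneForm p)).ε_eq
      rw [h4]
      congr 2
      noncomm_ring
    rw [h3]
    exact fun k v ↦ (h2 k v).neg
  rw [gint_deriv key (hc'.sub (hc.ι _)), segment_zero, segment_one]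
  abel

end IsBasicGauge

end Transgression

end BasicChern
end

noncomputable section
namespace BasicChern

/-! ### Endomorphisms of `V` as a real normed algebra -/

section EndAlgebra

variable (𝕜 V : Type*) [RCLike 𝕜] [NormedAddCommGroup V] [NormedSpace 𝕜 V]
  [NormedSpace ℝ V] [IsScalarTower ℝ 𝕜 V]

/-- The endomorphisms of a `𝕜`-vector space, as a normed algebra over `ℝ`. -/
@[reducible] def endNormedAlgebra : NormedAlgebra ℝ (V →L[𝕜] V) :=
  { ContinuousLinearMap.algebra with
    norm_smul_le := fun c f ↦ norm_smul_le c f }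

theorem finiteDimensional_end [FiniteDimensional 𝕜 V] : FiniteDimensional ℝ (V →L[𝕜] V) := by
  haveI : IsScalarTower ℝ 𝕜 (V →L[𝕜] V) :=
    ⟨fun c z f ↦ ContinuousLinearMap.ext fun v ↦ smul_assoc c z (f v)⟩
  exact FiniteDimensional.trans ℝ 𝕜 (V →L[𝕜] V)

attribute [local instance] endNormedAlgebra

/-- The continuous endomorphisms as an algebra of linear maps. -/
def endHom : (V →L[𝕜] V) →ₐ[ℝ] Module.End 𝕜 V :=
  AlgHom.ofLinearMap
    { toFun := fun f ↦ (f : V →ₗ[𝕜] V)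
      map_add' := fun _ _ ↦ rfl
      map_smul' := fun _ _ ↦ rfl } rfl (fun _ _ ↦ rfl)

/-- The trace of the endomorphisms, with complex values. -/
def endTrace : (V →L[𝕜] V) →ₗ[ℝ] ℂ :=
  (RCLike.map 𝕜 ℂ).toLinearMap ∘ₗ (LinearMap.trace 𝕜 V).restrictScalars ℝ ∘ₗ
    (endHom 𝕜 V).toLinearMap

theorem endTrace_mul_comm (f g : V →L[𝕜] V) : endTrace 𝕜 V (f * g) = endTrace 𝕜 V (g * f) :=
  congrArg (RCLike.map 𝕜 ℂ) (LinearMap.trace_mul_comm 𝕜 (f : V →ₗ[𝕜] V) (g : V →ₗ[𝕜] V))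

end EndAlgebra

attribute [local instance] endNormedAlgebra finiteDimensional_end

/-! ### The equivariant curvature in a frame of the fibre -/

section Specialization

open GForm

variable {EM : Type*} [NormedAddCommGroup EM] [NormedSpace ℝ EM] [FiniteDimensional ℝ EM]
  {M : Type*} [TopologicalSpace M] [ChartedSpace EM M] [IsManifold 𝓘(ℝ, EM) ∞ M]
  {EP : Type*} [NormedAddCommGroup EP] [NormedSpace ℝ EP] [FiniteDimensional ℝ EP]
  {P : Type*} [TopologicalSpace P] [ChartedSpace EP P] [IsManifold 𝓘(ℝ, EP) ∞ P] [T2Space P]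
  {EG : Type*} [NormedAddCommGroup EG] [NormedSpace ℝ EG] [FiniteDimensional ℝ EG]
  {G : Type*} [TopologicalSpace G] [ChartedSpace EG G] [Group G] [LieGroup 𝓘(ℝ, EG) ∞ G]
  {B : PrincipalBundle EM M EP P EG G}
  {F : Foliation EM M} {FP : Foliation EP P} {h : Type*} [LieRing h] [LieAlgebra ℝ h]
  {aM : h →ₗ⁅ℝ⁆ F.BasicField} {aP : h →ₗ⁅ℝ⁆ FP.BasicField}
  {𝕜 V : Type*} [RCLike 𝕜] [NormedAddCommGroup V] [NormedSpace 𝕜 V] [FiniteDimensional 𝕜 V]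
  [NormedSpace ℝ V] [IsScalarTower ℝ 𝕜 V] {ρ : G →* (V →L[𝕜] V)}

variable (B ρ) in
/-- The action of the endomorphisms of `V` on the fibre of the associated bundle, in the frame given
by a point of the principal bundle. -/
def frameHom {m : M} (p : {p : P // B.proj p = m}) :
    (V →L[𝕜] V) →ₐ[ℝ] Module.End 𝕜 (fibre B ρ m) :=
  (((frame B ρ p).conjAlgEquiv ℝ : Module.End 𝕜 V ≃ₐ[ℝ] Module.End 𝕜 (fibre B ρ m)) :
    Module.End 𝕜 V →ₐ[ℝ] Module.End 𝕜 (fibre B ρ m)).comp (endHom 𝕜 V)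

theorem evalAt_frameHom {m : M} (p : {p : P // B.proj p = m}) (A : V →L[𝕜] V)
    (f : fibre B ρ m) : evalAt B ρ p (frameHom B ρ p A f) = A (evalAt B ρ p f) :=
  (LinearEquiv.ofBijective (evalAt B ρ p) (evalAt_bijective B ρ p)).apply_symm_apply
    (A (evalAt B ρ p f))

/-- Traces are unchanged by the conjugation with a frame, so the trace on the fibre can be computed
on `V` in any frame. -/
theorem fibreTrace_comp_frameHom {m : M} (p : {p : P // B.proj p = m}) :
    fibreTrace B ρ m ∘ₗ (frameHom B ρ p).toLinearMap = endTrace 𝕜 V :=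
  LinearMap.ext fun A ↦ congrArg (RCLike.map 𝕜 ℂ)
    (LinearMap.trace_conj' (endHom 𝕜 V A) (frame B ρ p))

variable (B) in
/-- A point of the principal bundle over `m`. -/
def basePoint (m : M) : {p : P // B.proj p = m} := ⟨_, (B.proj_surjective m).choose_spec⟩

variable (ρ) in
/-- The `1`-form `dρ(θ)`. -/
abbrev Connection.gauge (θ : Connection B) : P → GForm EP (V →L[𝕜] V) := toG (dRho ρ) θ.form

/-- The equivariant curvature at the image of `p`, in the frame `p`. -/
def frameCurv (aP : h →ₗ⁅ℝ⁆ FP.BasicField) (ρ : G →* (V →L[𝕜] V)) (θ : Connection B) (Y : h)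
    (p : P) : GForm EM (V →L[𝕜] V) :=
  pull (θ.horLift p : EM →ₗ[ℝ] EP) (eqCurv aP (θ.gauge ρ) Y p)

variable (hρ : ContMDiff 𝓘(ℝ, EG) 𝓘(ℝ, V →L[𝕜] V) ∞ ρ)

include hρ

theorem curv_gauge_eq_zero (θ : Connection B) (p : P) {k : ℕ} (hk : k ≠ 2) :
    curv (θ.gauge ρ) p k = 0 := by
  have h1 := gd_eq_zero_of_oneForm (a := θ.gauge ρ) θ.isOneForm_toG p hk
  have h2 := (θ.isOneForm_toG (ρ := ρ) p).mul_eq_zero (θ.isOneForm_toG (ρ := ρ) p) hk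
  exact (congrArg₂ (· + ·) h1 h2).trans (add_zero _)

theorem eqCurv_gauge_zero (θ : Connection B) (Y : h) (p : P) (v : Fin 0 → EP) :
    eqCurv aP (θ.gauge ρ) Y p 0 v = -dRho ρ (θ.form p fun _ ↦ (FP.rep (aP Y)).vec p) := by
  have h1 := DFunLike.congr_fun (curv_gauge_eq_zero hρ θ p (k := 0) (by simp)) v
  have h2 : eqCurv aP (θ.gauge ρ) Y p 0 v =
    curv (θ.gauge ρ) p 0 v - moment aP (θ.gauge ρ) Y p := rfl
  rw [h2, moment, θ.toG_apply]
  exact (congrArg (· - _) h1).trans (zero_sub _)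

theorem eqCurv_gauge_two (θ : Connection B) (Y : h) (p : P) (v : Fin 2 → EP) :
    eqCurv aP (θ.gauge ρ) Y p 2 v = dRho ρ (θ.curvature p v) :=
  (sub_zero _).trans (θ.curv_toG_two hρ p v)

/-- Apart from degrees zero and two, `eqCurv` has no components: `da` and `a²` have degree two and
the moment has degree zero. This identifies the fibrewise definition with the form studied on `P`.
-/
theorem equivCurv_eq (θ : Connection B) (Y : h) (m : M) :
    θ.equivCurv ρ aP Y m = GForm.map (R' := Module.End 𝕜 (fibre B ρ m)) LinearMap.id (frameHom B ρ (basePoint B m))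
      (frameCurv aP ρ θ Y (basePoint B m).1) := by
  have h1 : ∀ k : ℕ, k ≠ 0 → k ≠ 2 → GForm.map (R' := Module.End 𝕜 (fibre B ρ m)) LinearMap.id (frameHom B ρ (basePoint B m))
      (frameCurv aP ρ θ Y (basePoint B m).1) k = 0 := fun k hk0 hk2 ↦ by
    ext1 v
    have h2 : eqCurv aP (θ.gauge ρ) Y (basePoint B m).1 k = 0 := by
      obtain ⟨k, rfl⟩ := Nat.exists_eq_succ_of_ne_zero hk0
      exact (sub_zero _).trans (curv_gauge_eq_zero hρ θ (basePoint B m).1 hk2)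
    exact (congrArg (frameHom B ρ (basePoint B m)) (DFunLike.congr_fun h2 _)).trans (map_zero _)
  funext k
  match k with
  | 0 =>
    ext1 v
    refine Eq.trans ?_ (congrArg (frameHom B ρ (basePoint B m))
      (eqCurv_gauge_zero hρ θ Y (basePoint B m).1 _)).symm
    rw [← map_neg]
    rfl
  | 1 => exact (h1 1 (by simp) (by simp)).symm
  | 2 =>
    ext1 v
    exact (congrArg (frameHom B ρ (basePoint B m))
      (eqCurv_gauge_two hρ θ Y (basePoint B m).1 _)).symm
  | k + 3 => exact (h1 (k + 3) (by simp) (by simp)).symm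

theorem chernForm_eq (θ : Connection B) (Y : h) (k : ℕ) (m : M) :
    θ.chernForm ρ aP Y k m =
      toCont (trc (endTrace 𝕜 V) (expNeg (frameCurv aP ρ θ Y (basePoint B m).1)) k) := by
  rw [Connection.chernForm, equivCurv_eq hρ, expTrace_map, fibreTrace_comp_frameHom]

end Specialization

end BasicChern
end

noncomputable section
namespace BasicChern

/-! ### Horizontal lifts of tensorial forms and change of frame -/

section FramedCurvature

open GForm

variable {EM : Type*} [NormedAddCommGroup EM] [NormedSpace ℝ EM] [FiniteDimensional ℝ EM]
  {M : Type*} [TopologicalSpace M] [ChartedSpace EM M] [IsManifold 𝓘(ℝ, EM) ∞ M]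
  {EP : Type*} [NormedAddCommGroup EP] [NormedSpace ℝ EP] [FiniteDimensional ℝ EP]
  {P : Type*} [TopologicalSpace P] [ChartedSpace EP P] [IsManifold 𝓘(ℝ, EP) ∞ P]
  {EG : Type*} [NormedAddCommGroup EG] [NormedSpace ℝ EG] [FiniteDimensional ℝ EG]
  {G : Type*} [TopologicalSpace G] [ChartedSpace EG G] [Group G] [LieGroup 𝓘(ℝ, EG) ∞ G]
  {B : PrincipalBundle EM M EP P EG G}

theorem LocalTriv.φ_act_eq (T : LocalTriv B) {p : P} (hp : B.proj p ∈ T.U) (g : G) :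
    T.φ (B.act p g) = T.φ p * g := by
  conv_lhs => rw [← T.act_φ p hp, ← B.act_mul, T.φ_act _ hp]

section Tensorial

variable {R : Type*} [NormedRing R] [NormedAlgebra ℝ R] {ρ : G →* R} {γ : P → GForm EP R}

/-- The tangent map of `s = σ ∘ π` factors through that of the projection, so it sends a horizontal
lift to the image under `σ`. The result does not depend on the connection. -/
theorem IsTensorial.pull_horLift_eq (hγ : IsTensorial B ρ γ) (θ : Connection B) (T : LocalTriv B)
    {p : P} (hp : B.proj p ∈ T.U) : pull (θ.horLift p : EM →ₗ[ℝ] EP) (γ p) =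
      const EM (ρ (T.φ p)⁻¹) * pull (tmap EM EP T.σ (B.proj p) : EM →ₗ[ℝ] EP) (γ (T.s p)) *
        const EM (ρ (T.φ p)) := by
  have h1 : (tmap EP EP T.s p : EP →ₗ[ℝ] EP) ∘ₗ (θ.horLift p : EM →ₗ[ℝ] EP) =
      (tmap EM EP T.σ (B.proj p) : EM →ₗ[ℝ] EP) := LinearMap.ext fun u ↦
    (LocalTriv.tmap_s hp (θ.horLift p u)).trans
      (congrArg (tmap EM EP T.σ (B.proj p)) (θ.tmap_proj_horLift p u))
  rw [hγ T p hp, _root_.map_mul, _root_.map_mul, pull_const, pull_const, pullM, pull_pull, h1]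

/-- A tensorial form vanishes on vertical vectors, so replacing each vector by the horizontal lift
of its projection changes nothing. -/
theorem IsTensorial.pull_proj_pull_horLift (hγ : IsTensorial B ρ γ) (θ : Connection B) (p : P) :
    pull (tmap EP EM B.proj p : EP →ₗ[ℝ] EM) (pull (θ.horLift p : EM →ₗ[ℝ] EP) (γ p)) = γ p := by
  obtain ⟨T, hT⟩ := B.exists_localTriv (B.proj p)
  have h1 : (tmap EM EP T.σ (B.proj p) : EM →ₗ[ℝ] EP) ∘ₗ (tmap EP EM B.proj p : EP →ₗ[ℝ] EM) =
      (tmap EP EP T.s p : EP →ₗ[ℝ] EP) := LinearMap.ext fun u ↦ (LocalTriv.tmap_s hT u).symm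
  rw [hγ.pull_horLift_eq θ T hT, _root_.map_mul, _root_.map_mul, pull_const, pull_const, pull_pull,
    h1]
  exact (hγ T p hT).symm

theorem IsTensorial.pull_horLift_act (hγ : IsTensorial B ρ γ) (θ : Connection B) (p : P) (g : G) :
    pull (θ.horLift (B.act p g) : EM →ₗ[ℝ] EP) (γ (B.act p g)) =
      const EM (ρ g⁻¹) * pull (θ.horLift p : EM →ₗ[ℝ] EP) (γ p) * const EM (ρ g) := by
  obtain ⟨T, hT⟩ := B.exists_localTriv (B.proj p)
  have hT' : B.proj (B.act p g) ∈ T.U := by rwa [B.proj_act]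
  have hs : T.s (B.act p g) = T.s p := congrArg T.σ (B.proj_act p g)
  rw [hγ.pull_horLift_eq θ T hT, hγ.pull_horLift_eq θ T hT', hs, B.proj_act, T.φ_act_eq hT,
    mul_inv_rev, _root_.map_mul, _root_.map_mul, ← const_mul_const, ← const_mul_const]
  noncomm_ring

end Tensorial

end FramedCurvature

attribute [local instance] endNormedAlgebra finiteDimensional_end

/-! ### The Chern character form and its class -/

section ChernForm

open GForm

variable {EM : Type*} [NormedAddCommGroup EM] [NormedSpace ℝ EM] [FiniteDimensional ℝ EM]
  {M : Type*} [TopologicalSpace M] [ChartedSpace EM M] [IsManifold 𝓘(ℝ, EM) ∞ M]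
  {EP : Type*} [NormedAddCommGroup EP] [NormedSpace ℝ EP] [FiniteDimensional ℝ EP]
  {P : Type*} [TopologicalSpace P] [ChartedSpace EP P] [IsManifold 𝓘(ℝ, EP) ∞ P] [T2Space P]
  {EG : Type*} [NormedAddCommGroup EG] [NormedSpace ℝ EG] [FiniteDimensional ℝ EG]
  {G : Type*} [TopologicalSpace G] [ChartedSpace EG G] [Group G] [LieGroup 𝓘(ℝ, EG) ∞ G]
  {B : PrincipalBundle EM M EP P EG G}
  {F : Foliation EM M} {FP : Foliation EP P} {h : Type*} [LieRing h] [LieAlgebra ℝ h]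
  {aM : h →ₗ⁅ℝ⁆ F.BasicField} {aP : h →ₗ⁅ℝ⁆ FP.BasicField}
  {𝕜 V : Type*} [RCLike 𝕜] [NormedAddCommGroup V] [NormedSpace 𝕜 V] [FiniteDimensional 𝕜 V]
  [NormedSpace ℝ V] [IsScalarTower ℝ 𝕜 V] {ρ : G →* (V →L[𝕜] V)}
  (hρ : ContMDiff 𝓘(ℝ, EG) 𝓘(ℝ, V →L[𝕜] V) ∞ ρ)
  (hE : IsEquivariantBundle B F FP aM aP) (θ : InvariantBasicConnection B FP aP)

include hρ hE

theorem tensorial_eqCurv_gauge (Y : h) : IsTensorial B ρ (eqCurv aP (θ.gauge ρ) Y) :=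
  (θ.isBasicGauge hρ).tensorial_eqCurv hρ hE Y

theorem pull_proj_frameCurv (Y : h) (p : P) :
    pull (tmap EP EM B.proj p : EP →ₗ[ℝ] EM) (frameCurv aP ρ θ.toConnection Y p) =
      eqCurv aP (θ.gauge ρ) Y p :=
  (tensorial_eqCurv_gauge hρ hE θ Y).pull_proj_pull_horLift θ.toConnection p

theorem frameCurv_act (Y : h) (p : P) (g : G) :
    frameCurv aP ρ θ.toConnection Y (B.act p g) =
      const EM (ρ g⁻¹) * frameCurv aP ρ θ.toConnection Y p * const EM (ρ g) :=
  (tensorial_eqCurv_gauge hρ hE θ Y).pull_horLift_act θ.toConnection p g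

/-- The equivariant curvature in an arbitrary frame. -/
theorem evalAt_equivCurv (Y : h) {m : M} (p : {p : P // B.proj p = m}) (k : ℕ) (v : Fin k → EM)
    (f : fibre B ρ m) : evalAt B ρ p (θ.equivCurv ρ aP Y m k v f) =
      frameCurv aP ρ θ.toConnection Y p.1 k v (evalAt B ρ p f) := by
  -- The frame at `p` and the frame at the chosen base point differ by some `g`. Evaluation changes
  -- by `ρ(g)⁻¹` and the curvature by conjugation, and the two changes compensate.
  obtain ⟨g, hg⟩ := B.exists_act_eq ((basePoint B m).2.trans p.2.symm)
  have hp : p = ⟨B.act (basePoint B m).1 g, (B.proj_act _ g).trans (basePoint B m).2⟩ :=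
    Subtype.ext hg.symm
  have h1 : ∀ x : fibre B ρ m, evalAt B ρ p x = ρ g⁻¹ (evalAt B ρ (basePoint B m) x) := fun x ↦ by
    rw [hp]
    exact x.2 (basePoint B m) g
  have h2 : ρ g (evalAt B ρ p f) = evalAt B ρ (basePoint B m) f := by
    rw [h1, ← ContinuousLinearMap.mul_apply, ← _root_.map_mul, mul_inv_cancel, _root_.map_one]
    rfl
  have h3 : θ.equivCurv ρ aP Y m k v f = frameHom B ρ (basePoint B m)
      (frameCurv aP ρ θ.toConnection Y (basePoint B m).1 k v) f := by
    rw [equivCurv_eq hρ]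
    rfl
  have h4 : frameCurv aP ρ θ.toConnection Y p.1 k v = ρ g⁻¹ *
      frameCurv aP ρ θ.toConnection Y (basePoint B m).1 k v * ρ g := by
    rw [← hg, frameCurv_act hρ hE θ]
    exact (mul_const_apply _ _ _ _).trans (congrArg (· * _) (const_mul_apply _ _ _ _))
  rw [h1, h3, evalAt_frameHom, h4, ← h2]
  rfl

/-- The Chern character form, on the principal bundle. -/
def chernP (aP : h →ₗ⁅ℝ⁆ FP.BasicField) (ρ : G →* (V →L[𝕜] V)) (θ : Connection B) (Y : h) (p : P) :
    GForm EP ℂ := trc (endTrace 𝕜 V) (expNeg (eqCurv aP (θ.gauge ρ) Y p))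

omit [FiniteDimensional ℝ EM] [T2Space P] [FiniteDimensional ℝ EG] hE hρ in
theorem chernP_eq (Y : h) : chernP aP ρ θ.toConnection Y = fun p ↦ trc (endTrace 𝕜 V)
    ((1 : GForm EP (V →L[𝕜] V)) * expNeg (eqCurv aP (θ.gauge ρ) Y p)) :=
  funext fun p ↦ by rw [one_mul, chernP]

omit [T2Space P] [FiniteDimensional ℝ EP] [IsManifold 𝓘(ℝ, EP) ∞ P] [FiniteDimensional ℝ EG]
  [FiniteDimensional ℝ EM] [IsManifold 𝓘(ℝ, EM) ∞ M] [LieGroup 𝓘(ℝ, EG) ∞ G] hE hρ in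
theorem isTensorial_one : IsTensorial B ρ (fun _ : P ↦ (1 : GForm EP (V →L[𝕜] V))) := by
  intro T p hp
  rw [pullM, _root_.map_one, mul_one, const_mul_const, ← _root_.map_mul, inv_mul_cancel,
    _root_.map_one, const_one]

theorem isDescending_chernP (Y : h) : IsDescending B (chernP aP ρ θ.toConnection Y) := by
  rw [chernP_eq]
  exact isTensorial_one.isDescending_trc (tensorial_eqCurv_gauge hρ hE θ Y) (endTrace_mul_comm 𝕜 V)

/-- In the frame at the base point the Chern form is the trace of the exponential of a horizontally
lifted curvature, whose pullback to `P` is the curvature itself. Uniqueness of the descended form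
concludes. -/
theorem chernForm_eq_descend (Y : h) :
    θ.chernForm ρ aP Y = unmix (descend B (chernP aP ρ θ.toConnection Y)) := by
  funext k m
  have h1 : descend B (chernP aP ρ θ.toConnection Y) (B.proj (basePoint B m).1) =
      trc (endTrace 𝕜 V) (expNeg (frameCurv aP ρ θ.toConnection Y (basePoint B m).1)) := by
    refine descend_unique (isDescending_chernP hρ hE θ Y) ?_
    rw [← trc_pull, pull_expNeg, pull_proj_frameCurv hρ hE]
    rfl
  rw [(basePoint B m).2] at h1
  rw [chernForm_eq hρ, ← h1]
  rfl

variable [FiniteDimensional ℝ h]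

theorem isEquivariantBasic_chernP : IsEquivariantBasic B aP (chernP aP ρ θ.toConnection) := by
  have h1 : chernP aP ρ θ.toConnection = fun Y p ↦ trc (endTrace 𝕜 V)
      ((1 : GForm EP (V →L[𝕜] V)) * expNeg (eqCurv aP (θ.gauge ρ) Y p)) := funext (chernP_eq θ)
  have h2 : (fun _ : P ↦ (1 : GForm EP (V →L[𝕜] V))) = fun _ ↦ const EP 1 := by rw [const_one]
  rw [h1]
  refine (θ.isBasicGauge hρ).isEquivariantBasic_trc hρ hE (endTrace_mul_comm 𝕜 V)
    (γ := fun _ ↦ 1) (fun p ↦ ?_) isTensorial_one (fun p z _ ↦ ι_one _) (fun Y V' _ p ↦ ?_)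
  · rw [h2]
    exact smoothAt_const contMDiffAt_const
  · have h3 : (fun p ↦ ι (V'.vec p) (1 : GForm EP (V →L[𝕜] V))) = fun _ ↦ const EP 0 := by
      funext q
      rw [ι_one]
      ext k v
      cases k <;> rfl
    rw [lieM, h3, h2, gd_const_const, gd_const_const, map_zero, add_zero]

variable (hB : IsFoliatedBundle B F FP)

include hB

theorem chernForm_mem : θ.chernForm ρ aP ∈ EquivForms F aM := by
  have h1 : θ.chernForm ρ aP = fun Y ↦ unmix (descend B (chernP aP ρ θ.toConnection Y)) :=
    funext (chernForm_eq_descend hρ hE θ)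
  rw [h1]
  exact (isEquivariantBasic_chernP hρ hE θ).mem_equivForms hB hE

theorem equivD_chernForm (hC : θ.chernForm ρ aP ∈ EquivForms F aM) :
    equivD F aM ⟨θ.chernForm ρ aP, hC⟩ = 0 := by
  have h0 : IsDescending B (fun _ : P ↦ (0 : GForm EP ℂ)) := fun T p hp ↦ (map_zero _).symm
  have h1 := (isEquivariantBasic_chernP hρ hE θ).equivD_descend hB hE (Ψ' := fun _ _ ↦ 0)
    (fun Y p ↦ (θ.isBasicGauge hρ).gd_sub_ι_trc (endTrace_mul_comm 𝕜 V) Y p) (fun _ ↦ h0)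
  have h2 : (⟨θ.chernForm ρ aP, hC⟩ : EquivForms F aM) =
      ⟨_, (isEquivariantBasic_chernP hρ hE θ).mem_equivForms hB hE⟩ :=
    Subtype.ext (funext (chernForm_eq_descend hρ hE θ))
  rw [h2, h1]
  funext Y k m
  have h3 : descend B (fun _ : P ↦ (0 : GForm EP ℂ)) m = 0 := map_zero _
  change toCont (descend B (fun _ : P ↦ (0 : GForm EP ℂ)) m k) = 0
  rw [h3]
  rfl

/-- The Chern character forms of two connections are cohomologous. -/
theorem exists_equivD_eq_sub (θ' : InvariantBasicConnection B FP aP) :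
    ∃ β : EquivForms F aM, equivD F aM β = θ.chernForm ρ aP - θ'.chernForm ρ aP := by
  have ha := θ.isBasicGauge hρ
  have ha' := θ'.isBasicGauge hρ
  -- The primitive is the form descended from the integral over `[0, 1]` of `Tr(η exp(-α_s))`.
  have h1 := ha.isEquivariantBasic_transgression ha' hρ hE (endTrace_mul_comm 𝕜 V)
  have hd : ∀ Y, IsDescending B
      (fun p ↦ chernP aP ρ θ.toConnection Y p - chernP aP ρ θ'.toConnection Y p) :=
    fun Y T p hp ↦ (congrArg₂ (· - ·) (isDescending_chernP hρ hE θ Y T p hp)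
      (isDescending_chernP hρ hE θ' Y T p hp)).trans (map_sub _ _ _).symm
  refine ⟨_, (h1.equivD_descend hB hE (fun Y p ↦ ha.gd_sub_ι_transgression ha'
    (endTrace_mul_comm 𝕜 V) Y p) hd).trans ?_⟩
  funext Y k m
  refine Eq.trans ?_ (congrArg₂ (fun x y : Mixed EM M ↦ x k m - y k m)
    (chernForm_eq_descend hρ hE θ Y) (chernForm_eq_descend hρ hE θ' Y)).symm
  have h3 : descend B (fun p ↦ chernP aP ρ θ.toConnection Y p - chernP aP ρ θ'.toConnection Y p) m =
      descend B (chernP aP ρ θ.toConnection Y) m - descend B (chernP aP ρ θ'.toConnection Y) m :=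
    map_sub _ _ _
  change toCont (descend B (fun p ↦ chernP aP ρ θ.toConnection Y p -
    chernP aP ρ θ'.toConnection Y p) m k) = _
  rw [h3]
  rfl

end ChernForm

end BasicChern
end

noncomputable section
namespace BasicChern

attribute [local instance] endNormedAlgebra finiteDimensional_end

/-! ### The covariant derivative and its square -/

section CovariantDerivative

open GForm

variable {EM : Type*} [NormedAddCommGroup EM] [NormedSpace ℝ EM] [FiniteDimensional ℝ EM]
  {M : Type*} [TopologicalSpace M] [ChartedSpace EM M] [IsManifold 𝓘(ℝ, EM) ∞ M]
  {EP : Type*} [NormedAddCommGroup EP] [NormedSpace ℝ EP] [FiniteDimensional ℝ EP]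
  {P : Type*} [TopologicalSpace P] [ChartedSpace EP P] [IsManifold 𝓘(ℝ, EP) ∞ P]
  {EG : Type*} [NormedAddCommGroup EG] [NormedSpace ℝ EG] [FiniteDimensional ℝ EG]
  {G : Type*} [TopologicalSpace G] [ChartedSpace EG G] [Group G] [LieGroup 𝓘(ℝ, EG) ∞ G]
  {B : PrincipalBundle EM M EP P EG G}
  {𝕜 V : Type*} [RCLike 𝕜] [NormedAddCommGroup V] [NormedSpace 𝕜 V] [FiniteDimensional 𝕜 V]
  [NormedSpace ℝ V] [IsScalarTower ℝ 𝕜 V] {ρ : G →* (V →L[𝕜] V)}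

/-- The operator `w ↦ ℓ(w)v` as a function of `v`. -/
def rankOne (ℓ : V →L[𝕜] 𝕜) : V →L[ℝ] (V →L[𝕜] V) :=
  haveI : FiniteDimensional ℝ V := FiniteDimensional.trans ℝ 𝕜 V
  LinearMap.toContinuousLinearMap
    { toFun := fun v ↦ ContinuousLinearMap.smulRight ℓ v
      map_add' := fun v w ↦ ContinuousLinearMap.ext fun x ↦ smul_add _ _ _
      map_smul' := fun c v ↦ ContinuousLinearMap.ext fun x ↦ smul_comm _ _ _ }

/-- The embedding `rankOne ℓ` turns the action of endomorphisms on `V` into left multiplication in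
`End(V)`. It brings `V`-valued forms into the algebra of forms already available, without loss when
`ℓ ≠ 0`. -/
theorem mul_rankOne (ℓ : V →L[𝕜] 𝕜) (A : V →L[𝕜] V) (v : V) :
    A * rankOne ℓ v = rankOne ℓ (A v) :=
  ContinuousLinearMap.ext fun x ↦ map_smul A (ℓ x) v

theorem rankOne_injective {ℓ : V →L[𝕜] 𝕜} (hℓ : ℓ ≠ 0) : Function.Injective (rankOne ℓ) := by
  obtain ⟨w, hw⟩ := DFunLike.exists_ne hℓ
  intro v v' hv
  have h1 : ℓ w • v = ℓ w • v' := congrArg (fun f : V →L[𝕜] V ↦ f w) hv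
  exact (smul_right_injective V (by simpa using hw)) h1

/-- The term of degree zero of the covariant derivative. -/
theorem rankOne_wedge (ℓ : V →L[𝕜] 𝕜) {p q n : ℕ} (hn : p + q = n) (α : EP [⋀^Fin p]→ₗ[ℝ] EG)
    (β : EP [⋀^Fin q]→ₗ[ℝ] V) (v : Fin n → EP) :
    rankOne ℓ ((wedge (dRepApply (EG := EG) ρ) α β).domDomCongr (finCongr hn) v) =
      ((p.factorial * q.factorial : ℕ) : ℝ)⁻¹ • antisymm n
        (tens ((dRho ρ : EG →L[ℝ] (V →L[𝕜] V)).toLinearMap.compAlternatingMap α)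
          ((rankOne ℓ).toLinearMap.compAlternatingMap β)) v := by
  subst hn
  have h1 := congrArg (rankOne ℓ) (wedge_apply (dRepApply (EG := EG) ρ) α β v)
  have h2 : rankOne ℓ (antisymm (p + q)
      (fun s ↦ dRepApply (EG := EG) ρ (α fun i ↦ s i) (β fun j ↦ s (p + j))) v) =
      antisymm (p + q) (tens ((dRho ρ : EG →L[ℝ] (V →L[𝕜] V)).toLinearMap.compAlternatingMap α)
          ((rankOne ℓ).toLinearMap.compAlternatingMap β)) v := by
    rw [antisymm, antisymm, map_sum]
    refine Finset.sum_congr rfl fun σ _ ↦ ?_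
    rw [map_zsmul]
    exact congrArg _ (mul_rankOne ℓ _ _).symm
  rw [h2, map_nsmul] at h1
  rw [← h1, ← Nat.cast_smul_eq_nsmul ℝ, smul_smul, inv_mul_cancel₀, one_smul]
  · rfl
  · positivity

/-- Since `dρ(ω)` has degree one and `η` degree `k`, a single term of the graded product survives,
and it is the wedge product in the definition of the covariant derivative. -/
theorem toG_covD (ℓ : V →L[𝕜] 𝕜) (θ : Connection B) {k : ℕ} {η : Form EP P V k} {p : P}
    (hη : DifferentiableAt ℝ (η.inChart p) (extChartAt 𝓘(ℝ, EP) p p)) :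
    toG (rankOne ℓ) (θ.covD ρ η) p =
      gd (toG (rankOne ℓ) η) p + θ.gauge ρ p * toG (rankOne ℓ) η p := by
  rw [gd_toG _ _ hη]
  have key : ∀ j v, (θ.gauge ρ p * toG (rankOne ℓ) η p) j v =
      single (V →L[𝕜] V) (k + 1) ((rankOne ℓ).compContinuousAlternatingMap
        (toCont ((wedge (dRepApply (EG := EG) ρ) (θ.form p).toAlternatingMap
          (η p).toAlternatingMap).domDomCongr (finCongr (add_comm 1 k))))) j v := by
    intro j v
    rw [mul_apply]
    have h0 : ∀ q ∈ Finset.HasAntidiagonal.antidiagonal j, q ≠ (1, k) →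
        ((q.1.factorial * q.2.factorial : ℕ) : ℝ)⁻¹ •
          antisymm j (tens (θ.gauge ρ p q.1) (toG (rankOne ℓ) η p q.2)) v = 0 := by
      intro q _ hne
      have h1 : tens (θ.gauge ρ p q.1) (toG (rankOne ℓ) η p q.2) = fun _ ↦ 0 := by
        funext s
        by_cases h1 : q.1 = 1
        · have h2 : q.2 ≠ k := fun h2 ↦ hne (Prod.ext h1 h2)
          rw [tens, toG, single_ne h2]
          exact mul_zero _
        · exact (congrArg (· * _) (DFunLike.congr_fun (θ.isOneForm_toG (ρ := ρ) p q.1 h1) _)).trans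
            (zero_mul _)
      rw [h1]
      simp [antisymm]
    by_cases hj : j = k + 1
    · subst hj
      rw [Finset.sum_eq_single (1, k) h0 (fun h ↦ absurd
        (Finset.HasAntidiagonal.mem_antidiagonal.2 (add_comm 1 k)) h), single_same]
      refine Eq.trans ?_ (rankOne_wedge ℓ (add_comm 1 k) _ _ v).symm
      simp only [toG, single_same]
      rfl
    · rw [single_ne hj]
      refine Finset.sum_eq_zero fun q hq ↦ h0 q hq ?_
      rintro rfl
      exact hj ((Finset.HasAntidiagonal.mem_antidiagonal.1 hq).symm.trans (add_comm 1 k))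
  have h3 : θ.gauge ρ p * toG (rankOne ℓ) η p =
      single (V →L[𝕜] V) (k + 1) ((rankOne ℓ).compContinuousAlternatingMap
        (toCont ((wedge (dRepApply (EG := EG) ρ) (θ.form p).toAlternatingMap
          (η p).toAlternatingMap).domDomCongr (finCongr (add_comm 1 k))))) :=
    GForm.ext fun j ↦ AlternatingMap.ext fun v ↦ key j v
  rw [h3]
  funext j
  by_cases hj : j = k + 1
  · subst hj
    refine AlternatingMap.ext fun v ↦ ?_
    simp only [toG, single_same, GForm.add_apply, AlternatingMap.add_apply]
    exact map_add (rankOne ℓ) _ _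
  · simp only [toG, GForm.add_apply, single_ne hj]
    exact (add_zero _).symm

/-- For an iterated covariant derivative smoothness is known only after the embedding in the
algebra; a linear left inverse brings it back to the `W`-valued form. -/
theorem differentiableAt_inChart {W R : Type*} [NormedAddCommGroup W] [NormedSpace ℝ W]
    [NormedRing R] [NormedAlgebra ℝ R] [FiniteDimensional ℝ R] {l : W →L[ℝ] R}
    {L : R →L[ℝ] W} (hL : ∀ v, L (l v) = v) {k : ℕ} {η : Form EP P W k} {p : P}
    (hη : SmoothAt (toG l η) p) :
    DifferentiableAt ℝ (η.inChart p) (extChartAt 𝓘(ℝ, EP) p p) := by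
  have h1 := (GSmoothAt.contDiffAt hη k).differentiableAt (by simp)
  have h2 : η.inChart p = fun y ↦ ContinuousLinearMap.compContinuousAlternatingMapCLM ℝ EP R W
      (Fin k) L (toCont (chartRep p (toG l η) y k)) := by
    funext y
    rw [chartRep_toG, single_same]
    ext v
    exact (hL _).symm
  rw [h2]
  exact (ContinuousLinearMap.differentiableAt _).comp _ h1

variable {f : P → V} (hf : ContMDiff 𝓘(ℝ, EP) 𝓘(ℝ, V) ∞ f) (ℓ : V →L[𝕜] 𝕜)

omit [FiniteDimensional ℝ EP] [IsManifold 𝓘(ℝ, EP) ∞ P] in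
theorem toG_ofFun (p : P) : toG (rankOne ℓ) (Form.ofFun (E := EP) f) p = const EP (rankOne ℓ (f p)) := by
  rw [const_eq_single]
  exact congrArg (single _ 0) (ContinuousAlternatingMap.ext fun _ ↦ rfl)

include hf

omit [FiniteDimensional ℝ EP] [IsManifold 𝓘(ℝ, EP) ∞ P] in
theorem contMDiff_rankOne : ContMDiff 𝓘(ℝ, EP) 𝓘(ℝ, V →L[𝕜] V) ∞ (fun p ↦ rankOne ℓ (f p)) :=
  (rankOne ℓ).contMDiff.comp hf

theorem smoothAt_toG_ofFun (p : P) : SmoothAt (toG (rankOne ℓ) (Form.ofFun (E := EP) f)) p := by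
  rw [funext (toG_ofFun ℓ)]
  exact smoothAt_const (contMDiff_rankOne hf ℓ p)

variable {ℓ} (hℓ : ℓ ≠ 0)

include hℓ

theorem toG_covD_ofFun (θ : Connection B) (p : P) :
    toG (rankOne ℓ) (θ.covD ρ (Form.ofFun f)) p = gd (fun p ↦ const EP (rankOne ℓ (f p))) p +
      θ.gauge ρ p * const EP (rankOne ℓ (f p)) := by
  obtain ⟨L, hL⟩ := (rankOne ℓ : V →ₗ[ℝ] (V →L[𝕜] V)).exists_leftInverse_of_injective
    (LinearMap.ker_eq_bot.2 (rankOne_injective hℓ))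
  have h1 := differentiableAt_inChart (L := L.toContinuousLinearMap)
    (fun v ↦ LinearMap.congr_fun hL v) (smoothAt_toG_ofFun hf ℓ p)
  rw [toG_covD ℓ θ h1, toG_ofFun, funext (toG_ofFun ℓ)]

/-- The square of the covariant derivative is the multiplication by the curvature. -/
theorem toG_covD_covD (hρ : ContMDiff 𝓘(ℝ, EG) 𝓘(ℝ, V →L[𝕜] V) ∞ ρ) (θ : Connection B) (p : P) :
    toG (rankOne ℓ) (θ.covD ρ (θ.covD ρ (Form.ofFun f))) p =
      curv (θ.gauge ρ) p * const EP (rankOne ℓ (f p)) := by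
  have ha := θ.isGauge hρ
  have hC : ∀ p, SmoothAt (fun p ↦ const EP (rankOne ℓ (f p))) p := fun p ↦
    smoothAt_const (contMDiff_rankOne hf ℓ p)
  have hdC : SmoothAt (gd (fun p ↦ const EP (rankOne ℓ (f p)))) p :=
    SmoothAt.gd (Filter.Eventually.of_forall hC)
  obtain ⟨L, hL⟩ := (rankOne ℓ : V →ₗ[ℝ] (V →L[𝕜] V)).exists_leftInverse_of_injective
    (LinearMap.ker_eq_bot.2 (rankOne_injective hℓ))
  have h0 := funext (toG_covD_ofFun hf hℓ θ (ρ := ρ))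
  have h1 : SmoothAt (toG (rankOne ℓ) (θ.covD ρ (Form.ofFun f))) p := by
    rw [h0]
    exact hdC.add ((ha.smooth p).mul (hC p))
  have h2 := differentiableAt_inChart (L := L.toContinuousLinearMap)
    (fun v ↦ LinearMap.congr_fun hL v) h1
  -- This is `d(df + af) + a(df + af) = (da + a²)f`: the two terms `a df` cancel because `a` is odd.
  rw [toG_covD ℓ θ h2, h0, gd_add hdC ((ha.smooth p).mul (hC p)),
    gd_gd (Filter.Eventually.of_forall hC), gd_mul (ha.smooth p) (hC p), (ha.oneForm p).ε_eq, curv]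
  noncomm_ring

theorem covD_covD_apply (hρ : ContMDiff 𝓘(ℝ, EG) 𝓘(ℝ, V →L[𝕜] V) ∞ ρ) (θ : Connection B) (p : P)
    (v : Fin 2 → EP) : θ.covD ρ (θ.covD ρ (Form.ofFun f)) p v = curv (θ.gauge ρ) p 2 v (f p) := by
  apply rankOne_injective hℓ
  have h1 := congrArg (fun b : GForm EP (V →L[𝕜] V) ↦ b 2 v) (toG_covD_covD hf hℓ hρ θ p)
  rw [← mul_rankOne]
  refine Eq.trans ?_ (h1.trans (mul_const_apply _ _ _ _))
  simp only [toG, single_same]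
  rfl

theorem covD_apply (θ : Connection B) (p : P) (w : EP) :
    θ.covD ρ (Form.ofFun f) p (fun _ ↦ w) = tmap EP V f p w + dRho ρ (θ.form p fun _ ↦ w) (f p) := by
  apply rankOne_injective hℓ
  have h1 := congrArg (fun b : GForm EP (V →L[𝕜] V) ↦ b 1 fun _ ↦ w)
    (toG_covD_ofFun hf hℓ θ p (ρ := ρ))
  have h2 : toG (rankOne ℓ) (θ.covD ρ (Form.ofFun f)) p 1 (fun _ ↦ w) =
      rankOne ℓ (θ.covD ρ (Form.ofFun f) p (fun _ ↦ w)) := by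
    simp only [toG, single_same]
    rfl
  have h3 := gd_const_apply ((contMDiff_rankOne hf ℓ).mdifferentiable (by simp) p) w
  have h4 := tmap_clm_comp (rankOne ℓ) (hf.mdifferentiable (by simp) p) w
  rw [map_add, ← mul_rankOne, ← θ.toG_apply, ← h2, ← h4, ← h3]
  refine h1.trans ?_
  exact congrArg (gd (fun p ↦ const EP (rankOne ℓ (f p))) p 1 (fun _ ↦ w) + ·)
    (mul_const_apply _ _ _ _)

end CovariantDerivative

/-! ### Identification of the components with `R^E` and `μ^E` -/

section Geometric

open GForm

variable {EM : Type*} [NormedAddCommGroup EM] [NormedSpace ℝ EM] [FiniteDimensional ℝ EM]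
  {M : Type*} [TopologicalSpace M] [ChartedSpace EM M] [IsManifold 𝓘(ℝ, EM) ∞ M]
  {EP : Type*} [NormedAddCommGroup EP] [NormedSpace ℝ EP] [FiniteDimensional ℝ EP]
  {P : Type*} [TopologicalSpace P] [ChartedSpace EP P] [IsManifold 𝓘(ℝ, EP) ∞ P] [T2Space P]
  {EG : Type*} [NormedAddCommGroup EG] [NormedSpace ℝ EG] [FiniteDimensional ℝ EG]
  {G : Type*} [TopologicalSpace G] [ChartedSpace EG G] [Group G] [LieGroup 𝓘(ℝ, EG) ∞ G]
  {B : PrincipalBundle EM M EP P EG G}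
  {F : Foliation EM M} {FP : Foliation EP P} {h : Type*} [LieRing h] [LieAlgebra ℝ h]
  {aM : h →ₗ⁅ℝ⁆ F.BasicField} {aP : h →ₗ⁅ℝ⁆ FP.BasicField}
  {𝕜 V : Type*} [RCLike 𝕜] [NormedAddCommGroup V] [NormedSpace 𝕜 V] [FiniteDimensional 𝕜 V]
  [NormedSpace ℝ V] [IsScalarTower ℝ 𝕜 V] {ρ : G →* (V →L[𝕜] V)}
  (hρ : ContMDiff 𝓘(ℝ, EG) 𝓘(ℝ, V →L[𝕜] V) ∞ ρ)
  (hE : IsEquivariantBundle B F FP aM aP) (θ : InvariantBasicConnection B FP aP)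
  {f : P → V} (hf : ∀ p g, f (B.act p g) = ρ g⁻¹ (f p)) (hs : ContMDiff 𝓘(ℝ, EP) 𝓘(ℝ, V) ∞ f)
  (Y : h) (p : P)

include hρ hE hs

/-- The part of degree two of the equivariant curvature is the curvature of the covariant
derivative. -/
theorem equivCurv_two (u w : EP) : evalAt B ρ ⟨p, rfl⟩ (θ.equivCurv ρ aP Y (B.proj p) 2
      ![tmap EP EM B.proj p u, tmap EP EM B.proj p w] (toSection B ρ f hf (B.proj p))) =
    θ.covD ρ (θ.covD ρ (Form.ofFun f)) p ![u, w] := by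
  -- A nonzero linear form `ℓ` exists only if `V ≠ 0`; otherwise both sides lie in the zero space.
  rcases subsingleton_or_nontrivial V with hV | hV
  · exact Subsingleton.elim _ _
  obtain ⟨v, hv⟩ := exists_ne (0 : V)
  obtain ⟨ℓ, hℓ⟩ := SeparatingDual.exists_ne_zero (R := 𝕜) hv
  have hℓ' : ℓ ≠ 0 := fun h0 ↦ hℓ (by rw [h0]; rfl)
  rw [evalAt_equivCurv hρ hE θ, covD_covD_apply hs hℓ' hρ]
  have h1 : (![tmap EP EM B.proj p u, tmap EP EM B.proj p w] : Fin 2 → EM) =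
      tmap EP EM B.proj p ∘ ![u, w] := by
    funext i
    fin_cases i <;> rfl
  have h2 := DFunLike.congr_fun (congrFun (pull_proj_frameCurv hρ hE θ Y p) 2) ![u, w]
  have h3 : eqCurv aP (θ.gauge ρ) Y p 2 ![u, w] = curv (θ.gauge ρ) p 2 ![u, w] := sub_zero _
  rw [h1]
  exact congrArg (fun A : V →L[𝕜] V ↦ A (f p)) (h2.trans h3)

/-- The part of degree zero of the equivariant curvature is the moment. -/
theorem equivCurv_zero {W : VF EP P} (hW : FP.Represents W (aP Y)) :
    evalAt B ρ ⟨p, rfl⟩ (θ.equivCurv ρ aP Y (B.proj p) 0 ![] (toSection B ρ f hf (B.proj p))) =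
      tmap EP V f p (W.vec p) - θ.covD ρ (Form.ofFun f) p ![W.vec p] := by
  rcases subsingleton_or_nontrivial V with hV | hV
  · exact Subsingleton.elim _ _
  obtain ⟨v, hv⟩ := exists_ne (0 : V)
  obtain ⟨ℓ, hℓ⟩ := SeparatingDual.exists_ne_zero (R := 𝕜) hv
  have hℓ' : ℓ ≠ 0 := fun h0 ↦ hℓ (by rw [h0]; rfl)
  have h1 : (![W.vec p] : Fin 1 → EP) = fun _ ↦ W.vec p := by
    funext i
    fin_cases i
    rfl
  -- The chosen representative may be replaced by `W`: the difference is tangent to the foliation,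
  -- where the connection form vanishes.
  have h2 : (dRho ρ (θ.form p fun _ ↦ W.vec p) : V →L[𝕜] V) =
      dRho ρ (θ.form p fun _ ↦ (FP.rep (aP Y)).vec p) :=
    (θ.toG_apply p _).symm.trans (((θ.isBasicGauge hρ).apply_eq
      (hW.sub_mem (FP.rep_spec (aP Y)) p)).trans (θ.toG_apply p _))
  have h3 : frameCurv aP ρ θ.toConnection Y p 0 ![] =
      -dRho ρ (θ.form p fun _ ↦ (FP.rep (aP Y)).vec p) := eqCurv_gauge_zero hρ θ.toConnection Y p _
  -- The derivative of `f` along `W` occurs in both terms of the moment and cancels, which leaves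
  -- `-dρ(ω(W))f`.
  rw [evalAt_equivCurv hρ hE θ, h1, covD_apply hs hℓ', h3, ← h2, sub_add_cancel_left]
  rfl

end Geometric

end BasicChern
end

/-! ### The equivariant basic Chern character -/

theorem proposition2p3p5
    {EM : Type*} [NormedAddCommGroup EM] [NormedSpace ℝ EM] [FiniteDimensional ℝ EM]
    {M : Type*} [TopologicalSpace M] [ChartedSpace EM M] [IsManifold 𝓘(ℝ, EM) ∞ M]
    [T2Space M] [SigmaCompactSpace M]
    {EP : Type*} [NormedAddCommGroup EP] [NormedSpace ℝ EP] [FiniteDimensional ℝ EP]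
    {P : Type*} [TopologicalSpace P] [ChartedSpace EP P] [IsManifold 𝓘(ℝ, EP) ∞ P]
    [T2Space P] [SigmaCompactSpace P]
    {EG : Type*} [NormedAddCommGroup EG] [NormedSpace ℝ EG] [FiniteDimensional ℝ EG]
    {G : Type*} [TopologicalSpace G] [ChartedSpace EG G] [Group G] [LieGroup 𝓘(ℝ, EG) ∞ G]
    [T2Space G] [CompactSpace G] [ConnectedSpace G]
    (B : BasicChern.PrincipalBundle EM M EP P EG G)
    (F : BasicChern.Foliation EM M) (FP : BasicChern.Foliation EP P)
    (hB : BasicChern.IsFoliatedBundle B F FP)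
    {h : Type*} [LieRing h] [LieAlgebra ℝ h] [FiniteDimensional ℝ h]
    (aM : h →ₗ⁅ℝ⁆ F.BasicField) (aP : h →ₗ⁅ℝ⁆ FP.BasicField)
    (hE : BasicChern.IsEquivariantBundle B F FP aM aP)
    {𝕜 V : Type*} [RCLike 𝕜] [NormedAddCommGroup V] [NormedSpace 𝕜 V] [FiniteDimensional 𝕜 V]
    [NormedSpace ℝ V] [IsScalarTower ℝ 𝕜 V]
    (ρ : G →* (V →L[𝕜] V)) (hρ : ContMDiff 𝓘(ℝ, EG) 𝓘(ℝ, V →L[𝕜] V) ∞ ρ)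
    (hne : Nonempty (BasicChern.InvariantBasicConnection B FP aP)) :
    (∀ (θ : BasicChern.InvariantBasicConnection B FP aP) (f : P → V)
      (hf : ∀ p g, f (B.act p g) = ρ g⁻¹ (f p)), ContMDiff 𝓘(ℝ, EP) 𝓘(ℝ, V) ∞ f →
      ∀ (Y : h) (p : P),
        (∀ u w : EP, BasicChern.evalAt B ρ ⟨p, rfl⟩ (θ.equivCurv ρ aP Y (B.proj p) 2
            ![BasicChern.tmap EP EM B.proj p u, BasicChern.tmap EP EM B.proj p w]
            (BasicChern.toSection B ρ f hf (B.proj p))) =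
          θ.covD ρ (θ.covD ρ (BasicChern.Form.ofFun f)) p ![u, w]) ∧
        ∀ W : BasicChern.VF EP P, FP.Represents W (aP Y) →
          BasicChern.evalAt B ρ ⟨p, rfl⟩ (θ.equivCurv ρ aP Y (B.proj p) 0 ![]
            (BasicChern.toSection B ρ f hf (B.proj p))) =
          BasicChern.tmap EP V f p (W.vec p) -
            θ.covD ρ (BasicChern.Form.ofFun f) p ![W.vec p]) ∧
    ∃ (hC : ∀ θ : BasicChern.InvariantBasicConnection B FP aP,
        θ.chernForm ρ aP ∈ BasicChern.EquivForms F aM)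
      (hd : ∀ θ : BasicChern.InvariantBasicConnection B FP aP,
        BasicChern.equivD F aM ⟨θ.chernForm ρ aP, hC θ⟩ = 0),
      ∃! c : BasicChern.Cohomology F aM, ∀ θ : BasicChern.InvariantBasicConnection B FP aP,
        Submodule.Quotient.mk ⟨⟨θ.chernForm ρ aP, hC θ⟩, LinearMap.mem_ker.2 (hd θ)⟩ = c := by
  refine ⟨fun θ f hf hs Y p ↦ ⟨BasicChern.equivCurv_two hρ hE θ hf hs Y p,
    fun W hW ↦ BasicChern.equivCurv_zero hρ hE θ hf hs Y p hW⟩,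
    fun θ ↦ BasicChern.chernForm_mem hρ hE θ hB,
    fun θ ↦ BasicChern.equivD_chernForm hρ hE θ hB _, ?_⟩
  -- The class of one fixed connection is the witness. Without any connection the condition on `c`
  -- would be vacuous and uniqueness could fail.
  obtain ⟨θ₀⟩ := hne
  refine ⟨_, fun θ ↦ ?_, fun c hc ↦ (hc θ₀).symm⟩
  refine (Submodule.Quotient.eq _).2 ?_
  obtain ⟨β, hβ⟩ := BasicChern.exists_equivD_eq_sub hρ hE θ hB θ₀
  exact ⟨β, hβ⟩
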